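/- Let $D>4$ and let $\mathbb{R}^D$ carry the Minkowski metric $\eta_{\mu\nu}$. Consider the following variables: - the field $T_{[\alpha\beta]\gamma}$, with $T_{[\alpha\beta]\gamma}+T_{[\beta\gamma]\alpha}+T_{[\gamma\alpha]\beta}=0$ (commuting), the ghosts $S_{(\alpha\beta)}$, $A_{[\alpha\beta]}$ (anticommuting) and $C_\alpha$ (commuting), all of antifield number $0$; - the antifields $T^{*[\alpha\beta]\gamma}$ (anticommuting, antifield number $1$, same index symmetries as $T$), $C^{*\alpha\beta}=3S^{*(\alpha\beta)}+A^{*[\alpha\beta]}$ (commuting, antifield number $2$, no index symmetry), and $C^{*\alpha}$ (anticommuting, antifield number $3$). Local forms are polynomials in these variables, in finitely many of their derivatives, and in the anticommuting $dx^\mu$, with coefficients that are smooth functions of $x\in\mathbb{R}^D$. Let $d=dx^\mu\partial_\mu$ with $\partial_\mu$ the total derivative. Let $\delta$ be the Koszul–Tate differential of the free theory: the odd left derivation that commutes with $\partial_\mu$, vanishes on functions of $x$, on $dx^\mu$, on $T$ and on the ghosts, and satisfies $$\delta T^{*[\alpha\beta]\gamma}=3\bigl(E^{[\alpha\beta]\gamma}+\eta^{\gamma[\alpha}E^{\beta]}\bigr),\qquad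 \delta C^{*\alpha\beta}=-6\,\partial_\gamma T^{*[\gamma\alpha]\beta},\qquad \delta C^{*\mu}=2\,\partial_\nu C^{*\nu\mu},$$ where $F_{[\alpha\beta\gamma]\delta}=\partial_\alpha T_{[\beta\gamma]\delta}+\partial_\beta T_{[\gamma\alpha]\delta}+\partial_\gamma T_{[\alpha\beta]\delta}$, $E_{[\alpha\beta\delta][\varepsilon\gamma]}=\frac12(\partial_\varepsilon F_{[\alpha\beta\delta]\gamma}-\partial_\gamma F_{[\alpha\beta\delta]\varepsilon})$, $E_{[\alpha\beta]\gamma}=\eta^{\varepsilon\delta}E_{[\alpha\beta\delta][\varepsilon\gamma]}$, $E_\alpha=\eta^{\beta\gamma}E_{[\alpha\beta]\gamma}$, and antisymmetrization has strength one. Below, $a^p_k$ denotes a local form of form degree $p$ and antifield number $k$. A form $a^D_2$ is called a cocycle if $\delta a^D_2+d a^{D-1}_1=0$ for some $a^{D-1}_1$, and trivial if $a^D_2=\delta m^D_3+d n^{D-1}_2$ for some $m^D_3$, $n^{D-1}_2$. Then: 1. A form $a^D_2$ is a cocycle if and only if $$a^D_2=C^{*\mu\nu}\,t_{\mu\nu\rho}\,x^\rho\,dx^0\wedge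 dx^1\wedge\cdots\wedge dx^{D-1}+\text{(a trivial form)}$$ for some constant, completely antisymmetric tensor $t_{\mu\nu\rho}=t_{[\mu\nu\rho]}$. 2. Every cocycle $a^D_2$ that has no explicit $x$-dependence is trivial, i.e. its class in $H^D_2(\delta|d)$ vanishes (the forms $a^{D-1}_1$, $m^D_3$, $n^{D-1}_2$ may depend explicitly on $x$). -/

import Mathlib

open scoped TensorProduct ContDiff

noncomputable section

namespace DualGravity

/-! ### Space-time, coefficient functions, metric -/

/-- Smooth real functions on `ℝ^D`: the coefficients carrying the explicit `x`-dependence. -/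
def Smooth (D : ℕ) : Subalgebra ℝ ((Fin D → ℝ) → ℝ) where
  carrier := {f | ContDiff ℝ ∞ f}
  mul_mem' {f g} hf hg := by
    rw [Set.mem_ofPred_eq] at hf hg ⊢
    exact hf.mul hg
  add_mem' {f g} hf hg := by
    rw [Set.mem_ofPred_eq] at hf hg ⊢
    exact hf.add hg
  algebraMap_mem' r := by
    rw [Set.mem_ofPred_eq]
    exact contDiff_const

theorem mem_smooth {D : ℕ} {f : (Fin D → ℝ) → ℝ} : f ∈ Smooth D ↔ ContDiff ℝ ∞ f := by
  rw [← SetLike.mem_coe]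
  exact Iff.of_eq Set.mem_ofPred_eq

theorem differentiableAt_smooth {D : ℕ} (f : Smooth D) (x : Fin D → ℝ) :
    DifferentiableAt ℝ f.1 x :=
  (ContDiff.differentiable (mem_smooth.mp f.2) (by simp)) x

/-- The coordinate function `x^μ`. -/
def coord {D : ℕ} (μ : Fin D) : Smooth D :=
  ⟨fun x => x μ, mem_smooth.mpr (contDiff_apply ℝ ℝ μ)⟩

/-- The partial derivative `∂/∂x^μ` of coefficient functions. -/
def partialX {D : ℕ} (μ : Fin D) : Smooth D →ₗ[ℝ] Smooth D where
  toFun f := ⟨fun x => fderiv ℝ f.1 x (Pi.single μ 1), mem_smooth.mpr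
    ((ContDiff.fderiv_right (mem_smooth.mp f.2) (m := ∞) (by simp)).clm_apply contDiff_const)⟩
  map_add' f g := by
    apply Subtype.ext
    funext x
    change fderiv ℝ (f.1 + g.1) x _ = _
    rw [fderiv_add (differentiableAt_smooth f x) (differentiableAt_smooth g x)]
    rfl
  map_smul' c f := by
    apply Subtype.ext
    funext x
    change fderiv ℝ (c • f.1) x _ = _
    rw [fderiv_const_smul (differentiableAt_smooth f x)]
    rfl

/-- The diagonal entries of the Minkowski metric `diag(-1, 1, …, 1)`. -/
def η {D : ℕ} (μ : Fin D) : ℝ := if μ.val = 0 then -1 else 1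

/-- The components `η^{μν} = η_{μν}` of the Minkowski metric. -/
def metric {D : ℕ} (μ ν : Fin D) : ℝ := if μ = ν then η μ else 0

/-! ### Fields, ghosts, antifields and their jets -/

/-- Labels of the independent components of a tensor `T_{[αβ]γ}` with
`T_{[αβ]γ} + T_{[βγ]α} + T_{[γα]β} = 0`: those with `α < β` and `α ≤ γ`. -/
def HookIdx (D : ℕ) : Type :=
  {i : Fin D × Fin D × Fin D // i.1 < i.2.1 ∧ i.1 ≤ i.2.2}

/-- The bosonic variables: the field `T_{[αβ]γ}`, the ghosts of ghosts `C_α` and the antifields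
`C^{*αβ} = 3 S^{*αβ} + A^{*αβ}` (no symmetry in `αβ`; the symmetric part is `3 S^*` and the
antisymmetric part is `A^*`). -/
inductive EvenVar (D : ℕ) : Type
  | T (i : HookIdx D)
  | ghostC (α : Fin D)
  | antiC2 (α β : Fin D)

/-- The fermionic variables: the ghosts `S_{(αβ)}` and `A_{[αβ]}`, the antifields `T^{*[αβ]γ}`
(same index symmetries as `T`) and the antifields `C^{*α}`. -/
inductive OddVar (D : ℕ) : Type
  | ghostS (i : {p : Fin D × Fin D // p.1 ≤ p.2})
  | ghostA (i : {p : Fin D × Fin D // p.1 < p.2})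
  | antiT (i : HookIdx D)
  | antiC (α : Fin D)

/-- A symmetric multi-index of derivatives: `I` stands for `∂_0^{I 0} ⋯ ∂_{D-1}^{I (D-1)}`. -/
abbrev MultiIdx (D : ℕ) : Type := Fin D →₀ ℕ

/-- The even jet coordinates `∂_I z`. -/
abbrev EvenJet (D : ℕ) : Type := MultiIdx D × EvenVar D

/-- The odd generators: the odd jet coordinates `∂_I z`, and the one-forms `dx^μ`. -/
abbrev OddGen (D : ℕ) : Type := (MultiIdx D × OddVar D) ⊕ Fin D

/-- All the generators of the algebra of local forms. -/
abbrev Gen (D : ℕ) : Type := EvenJet D ⊕ OddGen D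

/-! ### The algebra of local forms -/

/-- Local forms without explicit `x`-dependence: the free graded commutative algebra on the jet
coordinates and the `dx^μ`, that is, polynomials in the even generators tensored with the exterior
algebra on the odd ones. -/
abbrev ConstForms (D : ℕ) : Type :=
  MvPolynomial (EvenJet D) ℝ ⊗[ℝ] ExteriorAlgebra ℝ (OddGen D →₀ ℝ)

/-- Local forms: polynomials in the generators with coefficients in the smooth functions of `x`. -/
abbrev Forms (D : ℕ) : Type := Smooth D ⊗[ℝ] ConstForms D

/-- The generators as elements of the algebra. -/
def gen {D : ℕ} : Gen D → ConstForms D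
  | .inl e => MvPolynomial.X e ⊗ₜ[ℝ] 1
  | .inr o => 1 ⊗ₜ[ℝ] ExteriorAlgebra.ι ℝ (Finsupp.single o 1)

/-- The form degree of the generators. -/
def formDeg {D : ℕ} : Gen D → ℕ
  | .inr (.inr _) => 1
  | _ => 0

/-- The antifield number of the generators. -/
def antifieldNumber {D : ℕ} : Gen D → ℕ
  | .inl (_, .antiC2 _ _) => 2
  | .inr (.inl (_, .antiT _)) => 1
  | .inr (.inl (_, .antiC _)) => 3
  | _ => 0

/-- Forms without explicit `x`-dependence, of form degree `p` and antifield number `k`: real linear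
combinations of products of generators with these total degrees. -/
def constCochains (D p k : ℕ) : Submodule ℝ (ConstForms D) :=
  Submodule.span ℝ {a | ∃ l : List (Gen D),
    (l.map formDeg).sum = p ∧ (l.map antifieldNumber).sum = k ∧ a = (l.map gen).prod}

/-- Local forms of form degree `p` and antifield number `k`: combinations of products of generators
with these degrees, with smooth functions of `x` as coefficients. -/
def cochains (D p k : ℕ) : Submodule (Smooth D) (Forms D) :=
  (constCochains D p k).baseChange (Smooth D)

/-! ### Derivations -/

/-- The partial derivative with respect to an even generator. -/
def evenDeriv {D : ℕ} (e : EvenJet D) : ConstForms D →ₗ[ℝ] ConstForms D :=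
  LinearMap.rTensor _ (MvPolynomial.pderiv e).toLinearMap

/-- The left partial derivative with respect to an odd generator. -/
def oddDeriv {D : ℕ} (o : OddGen D) : ConstForms D →ₗ[ℝ] ConstForms D :=
  LinearMap.lTensor _ (CliffordAlgebra.contractLeft (Q := (0 : QuadraticForm ℝ (OddGen D →₀ ℝ)))
    (Finsupp.lapply o))

theorem finite_evenDeriv {D : ℕ} (a : ConstForms D) :
    {e : EvenJet D | evenDeriv e a ≠ 0}.Finite := by
  induction a using TensorProduct.induction_on with
  | zero => simp
  | tmul p w =>
    refine (Finset.finite_toSet p.vars).subset fun e he => ?_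
    by_contra h
    apply he
    have h0 : MvPolynomial.pderiv e p = 0 := MvPolynomial.pderiv_eq_zero_of_notMem_vars (by simpa using h)
    simp [evenDeriv, h0]
  | add a b ha hb =>
    refine (ha.union hb).subset fun e he => ?_
    by_contra h
    simp only [Set.mem_union, Set.mem_ofPred_eq, not_or, not_not] at h
    exact he (by rw [map_add, h.1, h.2, add_zero])

theorem finite_contract {ι : Type*} (w : ExteriorAlgebra ℝ (ι →₀ ℝ)) :
    {o : ι | CliffordAlgebra.contractLeft (Q := (0 : QuadraticForm ℝ (ι →₀ ℝ)))
      (Finsupp.lapply o) w ≠ 0}.Finite := by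
  induction w using CliffordAlgebra.left_induction with
  | algebraMap r => simp
  | add a b ha hb =>
    refine (ha.union hb).subset fun e he => ?_
    by_contra h
    simp only [Set.mem_union, Set.mem_ofPred_eq, not_or, not_not] at h
    exact he (by rw [map_add, h.1, h.2, add_zero])
  | ι_mul x m hx =>
    refine (hx.union (Finset.finite_toSet m.support)).subset fun e he => ?_
    by_contra h
    simp only [Set.mem_union, Set.mem_ofPred_eq, not_or, not_not, Finset.mem_coe,
      Finsupp.mem_support_iff] at h
    apply he
    rw [CliffordAlgebra.contractLeft_ι_mul, h.1]
    simp [h.2]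

theorem finite_oddDeriv {D : ℕ} (a : ConstForms D) :
    {o : OddGen D | oddDeriv o a ≠ 0}.Finite := by
  induction a using TensorProduct.induction_on with
  | zero => simp
  | tmul p w =>
    refine (finite_contract w).subset fun e he h => he ?_
    rw [oddDeriv, LinearMap.lTensor_tmul, h, TensorProduct.tmul_zero]
  | add a b ha hb =>
    refine (ha.union hb).subset fun e he => ?_
    by_contra h
    simp only [Set.mem_union, Set.mem_ofPred_eq, not_or, not_not] at h
    exact he (by rw [map_add, h.1, h.2, add_zero])

theorem finite_mul_support {ι : Type*} {A : Type*} [NonUnitalNonAssocSemiring A] (v f : ι → A)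
    (h : {i | f i ≠ 0}.Finite) : (Function.support fun i => v i * f i).Finite :=
  h.subset fun i hi h0 => hi (by simp [h0])

/-- The graded derivation `∑_z v(z) ∂/∂z` (sum over all generators `z`, left derivatives) sending
each generator `z` to `v z`; only finitely many terms are nonzero on a given form. It is used for
`v` of a definite parity relative to `z`: `v` preserves parity for an even derivation and reverses
it for an odd one. -/
def gradedDer {D : ℕ} (v : Gen D → ConstForms D) : ConstForms D →ₗ[ℝ] ConstForms D where
  toFun a := (∑ᶠ e : EvenJet D, v (.inl e) * evenDeriv e a) +
    ∑ᶠ o : OddGen D, v (.inr o) * oddDeriv o a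
  map_add' a b := by
    simp only [map_add, mul_add]
    rw [finsum_add_distrib (finite_mul_support _ _ (finite_evenDeriv a))
        (finite_mul_support _ _ (finite_evenDeriv b)),
      finsum_add_distrib (finite_mul_support _ _ (finite_oddDeriv a))
        (finite_mul_support _ _ (finite_oddDeriv b))]
    abel
  map_smul' c a := by
    simp only [map_smul, mul_smul_comm, RingHom.id_apply, smul_add, smul_finsum]

/-- On a generator `z` the derivation takes the prescribed value `v z`. -/
theorem gradedDer_gen {D : ℕ} (v : Gen D → ConstForms D) (z : Gen D) :
    gradedDer v (gen z) = v z := by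
  classical
  rcases z with e | o
  · have h1 : ∀ o, v (.inr o) * oddDeriv o (gen (.inl e)) = 0 := by
      intro o
      have h := CliffordAlgebra.contractLeft_one (0 : QuadraticForm ℝ (OddGen D →₀ ℝ))
        (Finsupp.lapply (R := ℝ) o)
      have h' : oddDeriv o (gen (.inl e)) = 0 := by
        rw [oddDeriv, gen, LinearMap.lTensor_tmul]
        erw [h]
        exact TensorProduct.tmul_zero _ _
      rw [h', mul_zero]
    simp only [gradedDer, LinearMap.coe_mk, AddHom.coe_mk, h1, finsum_zero, add_zero]
    rw [finsum_eq_single _ e]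
    · simp [evenDeriv, gen, ← Algebra.TensorProduct.one_def]
    · intro e' he
      simp [evenDeriv, gen, MvPolynomial.pderiv_X, he.symm]
  · have h1 : ∀ e, v (.inl e) * evenDeriv e (gen (.inr o)) = 0 := by
      intro e
      simp [evenDeriv, gen]
    have key : ∀ o', oddDeriv o' (gen (.inr o)) = if o = o' then 1 else 0 := by
      intro o'
      have h := CliffordAlgebra.contractLeft_ι (0 : QuadraticForm ℝ (OddGen D →₀ ℝ))
        (Finsupp.lapply (R := ℝ) o') (Finsupp.single o 1)
      rw [oddDeriv, gen, LinearMap.lTensor_tmul]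
      erw [h]
      rw [Finsupp.lapply_apply, Finsupp.single_apply]
      split_ifs
      · rw [map_one]
        rfl
      · rw [map_zero]
        exact TensorProduct.tmul_zero _ _
    simp only [gradedDer, LinearMap.coe_mk, AddHom.coe_mk, h1, finsum_zero, zero_add]
    rw [finsum_eq_single _ o]
    · simp [key]
    · intro o' h
      simp [key, h.symm]

/-! ### Total derivatives and the exterior differential -/

/-- The action of `∂_μ` on generators: `∂_I z ↦ ∂_μ ∂_I z` and `dx^ν ↦ 0`. -/
def shift {D : ℕ} (μ : Fin D) : Gen D → ConstForms D
  | .inl (I, z) => gen (.inl (I + Finsupp.single μ 1, z))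
  | .inr (.inl (I, z)) => gen (.inr (.inl (I + Finsupp.single μ 1, z)))
  | .inr (.inr _) => 0

/-- The total derivative `∂_μ`. -/
def totalDeriv {D : ℕ} (μ : Fin D) : Forms D →ₗ[ℝ] Forms D :=
  LinearMap.rTensor _ (partialX μ) + LinearMap.lTensor _ (gradedDer (shift μ))

/-- The one-form `dx^μ`. -/
def dx {D : ℕ} (μ : Fin D) : ConstForms D := gen (.inr (.inr μ))

/-- The volume form `dx^0 ∧ dx^1 ∧ … ∧ dx^{D-1}`. -/
def vol (D : ℕ) : ConstForms D := ((List.finRange D).map dx).prod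

/-- The space-time exterior differential `d = dx^μ ∂_μ`. -/
def d {D : ℕ} : Forms D →ₗ[ℝ] Forms D :=
  ∑ μ : Fin D, LinearMap.mulLeft ℝ ((1 : Smooth D) ⊗ₜ[ℝ] dx μ) ∘ₗ totalDeriv μ

/-! ### Tensor components -/

/-- All components of a tensor with the symmetries of `T_{[αβ]γ}`, given the independent ones. -/
def hookComp {D : ℕ} {M : Type*} [AddCommGroup M] (c : HookIdx D → M) (α β γ : Fin D) : M :=
  if hlt : α < β then
    if h : α ≤ γ then c ⟨(α, β, γ), hlt, h⟩
    else c ⟨(γ, β, α), (not_le.mp h).trans hlt, (not_le.mp h).le⟩ -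
      c ⟨(γ, α, β), not_le.mp h, ((not_le.mp h).trans hlt).le⟩
  else if hgt : β < α then
    if h : β ≤ γ then -c ⟨(β, α, γ), hgt, h⟩
    else c ⟨(γ, β, α), not_le.mp h, ((not_le.mp h).trans hgt).le⟩ -
      c ⟨(γ, α, β), (not_le.mp h).trans hgt, (not_le.mp h).le⟩
  else 0

theorem hookComp_antisymm {D : ℕ} {M : Type*} [AddCommGroup M] (c : HookIdx D → M)
    (α β γ : Fin D) : hookComp c β α γ = -hookComp c α β γ := by
  unfold hookComp
  split_ifs <;> first | (exfalso; omega) | simp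

theorem hookComp_cyclic {D : ℕ} {M : Type*} [AddCommGroup M] (c : HookIdx D → M)
    (α β γ : Fin D) : hookComp c α β γ + hookComp c β γ α + hookComp c γ α β = 0 := by
  rcases lt_trichotomy α β with h1 | h1 | h1 <;> rcases lt_trichotomy β γ with h2 | h2 | h2 <;>
    rcases lt_trichotomy α γ with h3 | h3 | h3 <;>
    first
    | (exfalso; omega)
    | (subst_vars; simp [hookComp, *, not_lt_of_gt, not_le_of_gt, le_of_lt]; done)
    | (simp [hookComp, *, not_lt_of_gt, not_le_of_gt, le_of_lt]; try abel)

/-- `∂_I T_{αβγ}`. -/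
def T {D : ℕ} (I : MultiIdx D) (α β γ : Fin D) : ConstForms D :=
  hookComp (fun i => gen (.inl (I, .T i))) α β γ

/-- `∂_I T^{*αβγ}`. -/
def antiT {D : ℕ} (I : MultiIdx D) (α β γ : Fin D) : ConstForms D :=
  hookComp (fun i => gen (.inr (.inl (I, .antiT i)))) α β γ

/-- `∂_I C^{*αβ}`. -/
def antiC2 {D : ℕ} (I : MultiIdx D) (α β : Fin D) : ConstForms D :=
  gen (.inl (I, .antiC2 α β))

/-- `∂_I F_{[αβγ]δ}`, where `F_{[αβγ]δ} = ∂_α T_{[βγ]δ} + ∂_β T_{[γα]δ} + ∂_γ T_{[αβ]δ}`. -/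
def F {D : ℕ} (I : MultiIdx D) (α β γ δ : Fin D) : ConstForms D :=
  T (I + Finsupp.single α 1) β γ δ + T (I + Finsupp.single β 1) γ α δ +
    T (I + Finsupp.single γ 1) α β δ

/-- `∂_I E_{[αβδ][εγ]}`, where `E_{[αβδ][εγ]} = (∂_ε F_{[αβδ]γ} - ∂_γ F_{[αβδ]ε}) / 2`. -/
def E {D : ℕ} (I : MultiIdx D) (α β δ ε γ : Fin D) : ConstForms D :=
  (1 / 2 : ℝ) • (F (I + Finsupp.single ε 1) α β δ γ - F (I + Finsupp.single γ 1) α β δ ε)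

/-- `∂_I E_{[αβ]γ}`, where `E_{[αβ]γ} = η^{εδ} E_{[αβδ][εγ]}`. -/
def Ricci {D : ℕ} (I : MultiIdx D) (α β γ : Fin D) : ConstForms D :=
  ∑ ε : Fin D, ∑ δ : Fin D, metric ε δ • E I α β δ ε γ

/-- `∂_I E_α`, where `E_α = η^{βγ} E_{[αβ]γ}`. -/
def RicciTrace {D : ℕ} (I : MultiIdx D) (α : Fin D) : ConstForms D :=
  ∑ β : Fin D, ∑ γ : Fin D, metric β γ • Ricci I α β γ

/-- `∂_I` of the left-hand side `3 (E^{[αβ]γ} + η^{γ[α} E^{β]})` of the field equations, with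
antisymmetrization of strength one; the indices of `E` are raised with the diagonal metric. -/
def eom {D : ℕ} (I : MultiIdx D) (α β γ : Fin D) : ConstForms D :=
  (3 : ℝ) • ((η α * η β * η γ) • Ricci I α β γ +
    (1 / 2 : ℝ) • (metric γ α • η β • RicciTrace I β - metric γ β • η α • RicciTrace I α))

/-! ### The Koszul-Tate differential -/

/-- The action of `δ` on generators:
`δ T^{*αβγ} = 3 (E^{αβγ} + η^{γ[α} E^{β]})`, `δ C^{*αβ} = -6 ∂_γ T^{*γαβ}`,
`δ C^{*μ} = 2 ∂_ν C^{*νμ}`, and zero on the field, the ghosts and the `dx^μ`; the action on jets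
commutes with derivatives. -/
def deltaGen {D : ℕ} : Gen D → ConstForms D
  | .inr (.inl (I, .antiT i)) => eom I i.1.1 i.1.2.1 i.1.2.2
  | .inl (I, .antiC2 α β) => (-6 : ℝ) • ∑ γ : Fin D, antiT (I + Finsupp.single γ 1) γ α β
  | .inr (.inl (I, .antiC μ)) => (2 : ℝ) • ∑ ν : Fin D, antiC2 (I + Finsupp.single ν 1) ν μ
  | _ => 0

/-- The Koszul-Tate differential `δ`; it does not act on the coefficient functions. -/
def delta {D : ℕ} : Forms D →ₗ[ℝ] Forms D :=
  LinearMap.lTensor _ (gradedDer deltaGen)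

/-- `∂_I S^{*αβ}`, the symmetric part of `C^{*αβ} = 3 S^{*αβ} + A^{*αβ}` divided by `3`. -/
def antiS {D : ℕ} (I : MultiIdx D) (α β : Fin D) : ConstForms D :=
  (1 / 6 : ℝ) • (antiC2 I α β + antiC2 I β α)

/-- `∂_I A^{*αβ}`, the antisymmetric part of `C^{*αβ} = 3 S^{*αβ} + A^{*αβ}`. -/
def antiA {D : ℕ} (I : MultiIdx D) (α β : Fin D) : ConstForms D :=
  (1 / 2 : ℝ) • (antiC2 I α β - antiC2 I β α)

theorem antiC2_eq {D : ℕ} (I : MultiIdx D) (α β : Fin D) :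
    antiC2 I α β = (3 : ℝ) • antiS I α β + antiA I α β := by
  unfold antiS antiA
  module

/-- `δ S^{*αβ} = -∂_γ (T^{*γαβ} + T^{*γβα})`. -/
theorem gradedDer_antiS {D : ℕ} (I : MultiIdx D) (α β : Fin D) :
    gradedDer deltaGen (antiS I α β) = -∑ γ : Fin D,
      (antiT (I + Finsupp.single γ 1) γ α β + antiT (I + Finsupp.single γ 1) γ β α) := by
  simp only [antiS, map_smul, map_add, antiC2, gradedDer_gen, deltaGen, Finset.sum_add_distrib]
  module

/-- `δ A^{*αβ} = -3 ∂_γ (T^{*γαβ} - T^{*γβα})`. -/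
theorem gradedDer_antiA {D : ℕ} (I : MultiIdx D) (α β : Fin D) :
    gradedDer deltaGen (antiA I α β) = (-3 : ℝ) • ∑ γ : Fin D,
      (antiT (I + Finsupp.single γ 1) γ α β - antiT (I + Finsupp.single γ 1) γ β α) := by
  simp only [antiA, map_smul, map_sub, antiC2, gradedDer_gen, deltaGen, Finset.sum_sub_distrib]
  module

/-- `δ C^{*μ} = 6 ∂_ν S^{*νμ} + 2 ∂_ν A^{*νμ}`. -/
theorem gradedDer_antiC {D : ℕ} (I : MultiIdx D) (μ : Fin D) :
    gradedDer deltaGen (gen (.inr (.inl (I, .antiC μ)))) =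
      (6 : ℝ) • ∑ ν : Fin D, antiS (I + Finsupp.single ν 1) ν μ +
        (2 : ℝ) • ∑ ν : Fin D, antiA (I + Finsupp.single ν 1) ν μ := by
  simp only [gradedDer_gen, deltaGen, antiC2_eq, Finset.sum_add_distrib, ← Finset.smul_sum]
  module

/-! ### The cohomology of `δ` modulo `d` in top form degree and antifield number two -/

/-- The solutions `a` of `δ a + d b = 0` in form degree `D` and antifield number `2`, with `b` of
form degree `D - 1` and antifield number `1`. -/
def IsCocycle (D : ℕ) (a : Forms D) : Prop :=
  a ∈ cochains D D 2 ∧ ∃ b ∈ cochains D (D - 1) 1, delta a + d b = 0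

/-- The trivial solutions `δ m + d n` in form degree `D` and antifield number `2`, with `m` of form
degree `D` and antifield number `3` and `n` of form degree `D - 1` and antifield number `2`. -/
def IsTrivial (D : ℕ) (a : Forms D) : Prop :=
  ∃ m ∈ cochains D D 3, ∃ n ∈ cochains D (D - 1) 2, a = delta m + d n

/-- Complete antisymmetry of a tensor with three indices. -/
def TotallyAntisymmetric {D : ℕ} (t : Fin D → Fin D → Fin D → ℝ) : Prop :=
  ∀ μ ν ρ, t ν μ ρ = -t μ ν ρ ∧ t μ ρ ν = -t μ ν ρ

/-- The form `C^{*μν} t_{μνρ} x^ρ dx^0 ∧ dx^1 ∧ … ∧ dx^{D-1}`. -/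
def representative {D : ℕ} (t : Fin D → Fin D → Fin D → ℝ) : Forms D :=
  ∑ μ : Fin D, ∑ ν : Fin D, ∑ ρ : Fin D,
    (t μ ν ρ • coord ρ) ⊗ₜ[ℝ] (antiC2 0 μ ν * vol D)

end DualGravity

end

noncomputable section

namespace DualGravity

variable {D : ℕ}

/-! ### The algebra of local forms as a graded commutative algebra -/

/-! Write a top form as the volume form times a coefficient `f` of antifield number 2 without `dx`.
Up to a sign the cocycle condition says that `δ f` is a total divergence, and triviality says that
`f` is `δ`-exact up to a divergence.

Euler-Lagrange derivatives annihilate divergences. Hence the family `a κ = euler κ f`, with `κ`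
ranging over fields, ghosts and antifields, solves the system `eulerD a = 0`, which combines `δ`
with the formal adjoint of its linear action on the variables. Since `a κ` has antifield number 2
minus that of `κ`, the component `Z α β` along `C^{*αβ}` depends only on `x`, fields and ghosts, and
the equation along `T^*` says that the gauge transformation with parameter `Z` vanishes on shell.

The crux is to solve this for `Z` (`exists_gauge_parameter`). The hook part of `∂_γ Z_{αβ}` vanishes
on shell, so the curl of `Z` in its first index is totally antisymmetric on shell. Being also
closed, it has vanishing derivatives (`map_curl_eq_zero`), hence is a numerical antisymmetric tensor
up to `δ`-exact terms. After subtraction of a term linear in `x`, the Poincaré lemma modulo the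
field equations (`exists_primitive`) yields `Z_{αβ} = t_{αβρ} x^ρ + ∂_α ξ_β + δ W_{αβ}`. The other
components of `a` are then matched one at a time by acyclicity of `δ` in positive antifield number
(`exists_dK_eq`), so that `a = reprE t + eulerD b` (`exists_eq_eulerD`). The first variational
formula (`mdv_cnt`) and inversion of the operator counting generators turn this into `f = repr t + δ
M + ∂_μ n^μ`. If `f` has no explicit `x`, the values of `Z` at vanishing generators are constants,
so the numerical curl, and with it `t`, is zero. Conversely `repr t` is a cocycle because `reprE t`
solves the system (`exists_dvg_repr`).

The input is linear algebra in momentum space. With derivatives replaced by commuting variables, the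
complex of field equations, gauge transformations and their reducibility is exact (`exists_gauge`,
`exists_gauge_gauge`): on shell the traces vanish, the curvature is annihilated by the nonzero
polynomial `momSq`, hence vanishes, and Koszul exactness integrates it to a gauge transformation.
This is used twice. It gives a homotopy for `δ` (`exists_homotopy`). And since it still holds when
some momenta are set to zero, as long as three survive, multiplication by `X_μ`, and by `X_ν` modulo
`X_μ`, is injective modulo the field equations (`exists_eomMat_of_X_smul`,
`exists_eomMat_of_X_smul_sub`). The second of these removes two momenta and so uses `D > 4` in full.
Linearization (`symb`, `lsymb`) and the filtration by degree in the momenta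
(`GradedBy.mem_of_filtered`, `GradedBy.exists_of_filtered`) carry these facts over to total
derivatives of nonlinear functions. -/

theorem gen_induction {p : ConstForms D → Prop} (hr : ∀ r, p (algebraMap ℝ _ r))
    (hg : ∀ z, p (gen z)) (ha : ∀ a b, p a → p b → p (a + b))
    (hm : ∀ a b, p a → p b → p (a * b)) (a : ConstForms D) : p a := by
  have h0 : p 0 := by simpa using hr 0
  have hs : ∀ (r : ℝ) a, p a → p (r • a) := fun r a h => by
    have e : r • a = algebraMap ℝ (ConstForms D) r * a := Algebra.smul_def r a
    rw [e]
    exact hm _ _ (hr r) h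
  have he : ∀ q : MvPolynomial (EvenJet D) ℝ, p (q ⊗ₜ[ℝ] 1) := by
    intro q
    induction q using MvPolynomial.induction_on with
    | C r => exact hr r
    | add q q' h h' => rw [TensorProduct.add_tmul]; exact ha _ _ h h'
    | mul_X q e h =>
      have : (q * MvPolynomial.X e) ⊗ₜ[ℝ] (1 : ExteriorAlgebra ℝ (OddGen D →₀ ℝ)) =
          q ⊗ₜ[ℝ] 1 * gen (.inl e) := by simp [gen]
      rw [this]
      exact hm _ _ h (hg _)
  have ho : ∀ w : ExteriorAlgebra ℝ (OddGen D →₀ ℝ),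
      p ((1 : MvPolynomial (EvenJet D) ℝ) ⊗ₜ[ℝ] w) := by
    intro w
    induction w using ExteriorAlgebra.induction with
    | algebraMap r =>
      rw [Algebra.algebraMap_eq_smul_one, TensorProduct.tmul_smul]
      exact hs _ _ (he 1)
    | ι m =>
      induction m using Finsupp.induction_linear with
      | zero => rw [map_zero, TensorProduct.tmul_zero]; exact h0
      | add m m' h h' => rw [map_add, TensorProduct.tmul_add]; exact ha _ _ h h'
      | single o r =>
        rw [← mul_one r, ← smul_eq_mul, ← Finsupp.smul_single, map_smul, TensorProduct.tmul_smul]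
        exact hs _ _ (hg (.inr o))
    | mul v w h h' =>
      have := hm _ _ h h'
      rwa [Algebra.TensorProduct.tmul_mul_tmul, one_mul] at this
    | add v w h h' => rw [TensorProduct.tmul_add]; exact ha _ _ h h'
  induction a using TensorProduct.induction_on with
  | zero => exact h0
  | tmul q w =>
    have := hm _ _ (he q) (ho w)
    rwa [Algebra.TensorProduct.tmul_mul_tmul, one_mul, mul_one] at this
  | add a b h h' => exact ha _ _ h h'

/-- The grade involution: the identity on even generators, the sign change on odd ones. -/
def gradeInvConst : ConstForms D →ₐ[ℝ] ConstForms D :=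
  Algebra.TensorProduct.map (AlgHom.id ℝ _)
    (CliffordAlgebra.involute (Q := (0 : QuadraticForm ℝ (OddGen D →₀ ℝ))))

theorem gradeInvConst_tmul (p : MvPolynomial (EvenJet D) ℝ)
    (w : ExteriorAlgebra ℝ (OddGen D →₀ ℝ)) :
    gradeInvConst (p ⊗ₜ[ℝ] w) = p ⊗ₜ[ℝ]
      (CliffordAlgebra.involute (Q := (0 : QuadraticForm ℝ (OddGen D →₀ ℝ))) w) := rfl

theorem gradeInvConst_gen_inl (e : EvenJet D) :
    gradeInvConst (gen (.inl e)) = gen (.inl e) := by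
  rw [gen, gradeInvConst_tmul]
  erw [map_one]

theorem gradeInvConst_gen_inr (o : OddGen D) :
    gradeInvConst (gen (.inr o)) = -gen (.inr o) := by
  rw [gen, gradeInvConst_tmul]
  erw [CliffordAlgebra.involute_ι]
  exact TensorProduct.tmul_neg _ _

theorem gen_inl_mul (e : EvenJet D) (a : ConstForms D) : gen (.inl e) * a = a * gen (.inl e) := by
  induction a using TensorProduct.induction_on with
  | zero => simp
  | tmul p w => simp [gen, mul_comm]
  | add a b h h' => rw [add_mul, mul_add, h, h']

theorem ι_mul_ι_swap {ι : Type*} (x y : ι →₀ ℝ) :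
    ExteriorAlgebra.ι ℝ x * ExteriorAlgebra.ι ℝ y =
      -(ExteriorAlgebra.ι ℝ y * ExteriorAlgebra.ι ℝ x) :=
  eq_neg_of_add_eq_zero_left (ExteriorAlgebra.ι_add_mul_swap x y)

theorem gen_inr_mul_gen_inr (o o' : OddGen D) :
    gen (.inr o) * gen (.inr o') = -(gen (.inr o') * gen (.inr o)) := by
  simp only [gen, Algebra.TensorProduct.tmul_mul_tmul, mul_one]
  rw [ι_mul_ι_swap, TensorProduct.tmul_neg]

theorem evenDeriv_mul (e : EvenJet D) (a b : ConstForms D) :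
    evenDeriv e (a * b) = evenDeriv e a * b + a * evenDeriv e b := by
  induction a using TensorProduct.induction_on with
  | zero => simp
  | add a a' h h' => 
    rw [add_mul, map_add, h, h', map_add, add_mul, add_mul]; abel
  | tmul p w =>
    induction b using TensorProduct.induction_on with
    | zero => simp
    | add b b' h h' =>
        rw [mul_add, map_add, h, h', map_add, mul_add, mul_add]; abel
    | tmul q v =>
      simp only [evenDeriv, Algebra.TensorProduct.tmul_mul_tmul, LinearMap.rTensor_tmul,
        Derivation.coeFn_coe, Derivation.leibniz, smul_eq_mul,
        TensorProduct.add_tmul]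
      rw [add_comm, mul_comm q]

/-- Left induction on the first factor: each generator that the contraction passes contributes a
sign, and `involute` collects these signs. -/
theorem contractLeft_mul' {ι : Type*} (φ : Module.Dual ℝ (ι →₀ ℝ))
    (w v : CliffordAlgebra (0 : QuadraticForm ℝ (ι →₀ ℝ))) :
    CliffordAlgebra.contractLeft φ (w * v) =
      CliffordAlgebra.contractLeft φ w * v +
        CliffordAlgebra.involute w * CliffordAlgebra.contractLeft φ v := by
  induction w using CliffordAlgebra.left_induction with
  | algebraMap r => simp [CliffordAlgebra.contractLeft_algebraMap_mul]
  | add a b ha hb => simp only [add_mul, map_add, ha, hb]; abel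
  | ι_mul x m hx =>
    rw [mul_assoc, CliffordAlgebra.contractLeft_ι_mul, hx, CliffordAlgebra.contractLeft_ι_mul,
      map_mul, CliffordAlgebra.involute_ι]
    simp only [mul_add, sub_mul, smul_mul_assoc, neg_mul, mul_assoc]
    abel

theorem oddDeriv_mul (o : OddGen D) (a b : ConstForms D) :
    oddDeriv o (a * b) = oddDeriv o a * b + gradeInvConst a * oddDeriv o b := by
  induction a using TensorProduct.induction_on with
  | zero => simp
  | add a a' h h' =>
    simp only [add_mul, map_add, h, h']; abel
  | tmul p w =>
    induction b using TensorProduct.induction_on with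
    | zero => simp
    | add b b' h h' =>
        simp only [mul_add, map_add, h, h']; abel
    | tmul q v =>
      rw [gradeInvConst_tmul]
      simp only [oddDeriv, Algebra.TensorProduct.tmul_mul_tmul, LinearMap.lTensor_tmul]
      rw [← TensorProduct.tmul_add]
      congr 1
      exact contractLeft_mul' _ _ _

/-! ### An opaque copy of the algebra

The instances on `ConstForms D` unfold to large terms; `CForm D` is the same algebra with sealed
instances. -/

/-- The algebra `ConstForms D` with sealed instances. -/
def CForm (D : ℕ) : Type := ConstForms D

instance : Ring (CForm D) := inferInstanceAs (Ring (ConstForms D))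

instance : Algebra ℝ (CForm D) := inferInstanceAs (Algebra ℝ (ConstForms D))

/-- The generators in `CForm D`. -/
def cgen (z : Gen D) : CForm D := gen z

theorem cgen_induction {p : CForm D → Prop} (hr : ∀ r, p (algebraMap ℝ _ r))
    (hg : ∀ z, p (cgen z)) (ha : ∀ a b, p a → p b → p (a + b))
    (hm : ∀ a b, p a → p b → p (a * b)) (a : CForm D) : p a :=
  gen_induction (p := p) hr hg ha hm a

/-- The grade involution: the identity on even generators, the sign change on odd ones. -/
def gradeInv : CForm D →ₐ[ℝ] CForm D := gradeInvConst

theorem gradeInv_inl (e : EvenJet D) : gradeInv (cgen (.inl e)) = cgen (.inl e) :=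
  gradeInvConst_gen_inl e

theorem gradeInv_inr (o : OddGen D) : gradeInv (cgen (.inr o)) = -cgen (.inr o) :=
  gradeInvConst_gen_inr o

/-- The partial derivatives with respect to the generators, from the left. -/
def pd : Gen D → CForm D →ₗ[ℝ] CForm D
  | .inl e => evenDeriv e
  | .inr o => oddDeriv o

theorem pd_inl_mul (e : EvenJet D) (a b : CForm D) :
    pd (.inl e) (a * b) = pd (.inl e) a * b + a * pd (.inl e) b := evenDeriv_mul e a b

theorem pd_inr_mul (o : OddGen D) (a b : CForm D) :
    pd (.inr o) (a * b) = pd (.inr o) a * b + gradeInv a * pd (.inr o) b := oddDeriv_mul o a b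

theorem finite_pd_inl (a : CForm D) : {e | pd (.inl e) a ≠ 0}.Finite := finite_evenDeriv a

theorem finite_pd_inr (a : CForm D) : {e | pd (.inr e) a ≠ 0}.Finite := finite_oddDeriv a

/-- The graded derivation with prescribed values on the generators. -/
def der (v : Gen D → CForm D) : CForm D →ₗ[ℝ] CForm D := gradedDer v

theorem der_apply (v : Gen D → CForm D) (a : CForm D) : der v a =
    (∑ᶠ e, v (.inl e) * pd (.inl e) a) + ∑ᶠ o, v (.inr o) * pd (.inr o) a := rfl

theorem der_cgen (v : Gen D → CForm D) (z : Gen D) : der v (cgen z) = v z := gradedDer_gen v z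

/-- The products of generators span the algebra. -/
theorem span_cgen_prod :
    Submodule.span ℝ (Set.range fun l : List (Gen D) => (l.map cgen).prod) = ⊤ := by
  rw [eq_top_iff]
  rintro a -
  induction a using cgen_induction with
  | hr r =>
    rw [Algebra.algebraMap_eq_smul_one]
    exact Submodule.smul_mem _ _ (Submodule.subset_span ⟨[], by simp⟩)
  | hg z => exact Submodule.subset_span ⟨[z], by simp⟩
  | ha a b h h' => exact add_mem h h'
  | hm a b h h' =>
    induction h using Submodule.span_induction with
    | mem a ha =>
      obtain ⟨l, rfl⟩ := ha
      induction h' using Submodule.span_induction with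
      | mem b hb =>
        obtain ⟨l', rfl⟩ := hb
        exact Submodule.subset_span ⟨l ++ l', by simp⟩
      | zero => simp
      | add x y _ _ hx hy => rw [mul_add]; exact add_mem hx hy
      | smul r x _ hx => rw [mul_smul_comm]; exact Submodule.smul_mem _ _ hx
    | zero => simp
    | add x y _ _ hx hy => rw [add_mul]; exact add_mem hx hy
    | smul r x _ hx => rw [smul_mul_assoc]; exact Submodule.smul_mem _ _ hx

/-- Even elements: invariant under the grade involution and central. -/
def evenPart (D : ℕ) : Submodule ℝ (CForm D) where
  carrier := {w | gradeInv w = w ∧ ∀ a, w * a = a * w}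
  add_mem' h h' := ⟨by rw [map_add, h.1, h'.1], fun a => by rw [add_mul, mul_add, h.2, h'.2]⟩
  zero_mem' := ⟨map_zero _, by simp⟩
  smul_mem' r w h := ⟨by rw [map_smul, h.1], fun a => by
    rw [smul_mul_assoc, mul_smul_comm, h.2]⟩

/-- Odd elements: they change sign under the grade involution and anticommute in the graded
sense with everything. -/
def oddPart (D : ℕ) : Submodule ℝ (CForm D) where
  carrier := {w | gradeInv w = -w ∧ ∀ a, w * a = gradeInv a * w}
  add_mem' h h' := ⟨by rw [map_add, h.1, h'.1, neg_add],
    fun a => by rw [add_mul, mul_add, h.2, h'.2]⟩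
  zero_mem' := ⟨by simp, by simp⟩
  smul_mem' r w h := ⟨by rw [map_smul, h.1, smul_neg], fun a => by
    rw [smul_mul_assoc, mul_smul_comm, h.2]⟩

theorem mem_evenPart {w : CForm D} :
    w ∈ evenPart D ↔ gradeInv w = w ∧ ∀ a, w * a = a * w := Iff.rfl

theorem mem_oddPart {w : CForm D} :
    w ∈ oddPart D ↔ gradeInv w = -w ∧ ∀ a, w * a = gradeInv a * w := Iff.rfl

theorem cgen_inl_mem (e : EvenJet D) : cgen (.inl e) ∈ evenPart D :=
  mem_evenPart.2 ⟨gradeInv_inl e, fun a => gen_inl_mul e a⟩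

theorem one_mem_evenPart : (1 : CForm D) ∈ evenPart D :=
  mem_evenPart.2 ⟨map_one _, by simp⟩

theorem cgen_inr_mul_cgen_inr (o o' : OddGen D) :
    cgen (.inr o) * cgen (.inr o') = -(cgen (.inr o') * cgen (.inr o)) :=
  gen_inr_mul_gen_inr o o'

/-- Both sides of the graded commutation rule are multiplicative in `a`, so it only has to be
checked against generators. -/
theorem cgen_inr_mem (o : OddGen D) : cgen (.inr o) ∈ oddPart D := by
  refine mem_oddPart.2 ⟨gradeInv_inr o, fun a => ?_⟩
  induction a using cgen_induction with
  | hr r => rw [AlgHom.commutes, Algebra.commutes]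
  | hg z =>
    rcases z with e | o'
    · rw [gradeInv_inl, (mem_evenPart.1 (cgen_inl_mem e)).2]
    · rw [gradeInv_inr, cgen_inr_mul_cgen_inr, neg_mul]
  | ha a b h h' => rw [mul_add, map_add, add_mul, h, h']
  | hm a b h h' => rw [← mul_assoc, h, mul_assoc, h', map_mul, mul_assoc]

theorem gradeInv_gradeInv (a : CForm D) : gradeInv (gradeInv a) = a := by
  induction a using cgen_induction with
  | hr r => rw [AlgHom.commutes, AlgHom.commutes]
  | hg z =>
    rcases z with e | o
    · rw [gradeInv_inl, gradeInv_inl]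
    · rw [gradeInv_inr, map_neg, gradeInv_inr, neg_neg]
  | ha a b h h' => rw [map_add, map_add, h, h']
  | hm a b h h' => rw [map_mul, map_mul, h, h']

/-! ### Twisted derivations -/

section Derivations

variable {B : Type*} [Ring B] [Algebra ℝ B]

/-- Derivations twisted by a left and a right algebra homomorphism. -/
def IsDer (l r : CForm D →ₐ[ℝ] B) (L : CForm D →ₗ[ℝ] B) : Prop :=
  ∀ a b, L (a * b) = L a * r b + l a * L b

/-- A twisted derivation kills 1, so its values on generators determine it. Most commutation
relations between operators are reduced to generators through this lemma, with the twists chosen so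
that both sides are derivations of the same kind. -/
theorem IsDer.ext {l r : CForm D →ₐ[ℝ] B} {L L' : CForm D →ₗ[ℝ] B}
    (h : IsDer l r L) (h' : IsDer l r L') (hg : ∀ z, L (cgen z) = L' (cgen z)) : L = L' := by
  have one : ∀ {L : CForm D →ₗ[ℝ] B}, IsDer l r L → L 1 = 0 := fun {L} h => by
    have := h 1 1
    simpa using this
  refine LinearMap.ext fun a => ?_
  induction a using cgen_induction with
  | hr c => rw [Algebra.algebraMap_eq_smul_one, map_smul, map_smul, one h, one h']
  | hg z => exact hg z
  | ha a b ha hb => rw [map_add, map_add, ha, hb]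
  | hm a b ha hb => rw [h, h', ha, hb]

theorem IsDer.add {l r : CForm D →ₐ[ℝ] B} {L L' : CForm D →ₗ[ℝ] B}
    (h : IsDer l r L) (h' : IsDer l r L') : IsDer l r (L + L') := fun a b => by
  simp only [LinearMap.add_apply, h a b, h' a b, add_mul, mul_add]
  abel

theorem IsDer.smul {l r : CForm D →ₐ[ℝ] B} {L : CForm D →ₗ[ℝ] B}
    (c : ℝ) (h : IsDer l r L) : IsDer l r (c • L) := fun a b => by
  simp only [LinearMap.smul_apply, h a b, smul_add, smul_mul_assoc, mul_smul_comm]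

theorem IsDer.zero {l r : CForm D →ₐ[ℝ] B} : IsDer l r (0 : CForm D →ₗ[ℝ] B) :=
  fun a b => by simp

theorem IsDer.sum {l r : CForm D →ₐ[ℝ] B} {ι : Type*} (s : Finset ι)
    {L : ι → CForm D →ₗ[ℝ] B} (h : ∀ i ∈ s, IsDer l r (L i)) :
    IsDer l r (∑ i ∈ s, L i) := by
  classical
  induction s using Finset.induction_on with
  | empty => simpa using IsDer.zero
  | insert i s hi ih =>
    rw [Finset.sum_insert hi]
    exact (h i (Finset.mem_insert_self _ _)).add
      (ih fun j hj => h j (Finset.mem_insert_of_mem hj))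

end Derivations

/-- Even derivations of the algebra of local forms. -/
abbrev EvenDer (L : CForm D →ₗ[ℝ] CForm D) : Prop :=
  IsDer (AlgHom.id ℝ _) (AlgHom.id ℝ _) L

/-- Odd left derivations of the algebra of local forms. -/
abbrev OddDer (L : CForm D →ₗ[ℝ] CForm D) : Prop :=
  IsDer gradeInv (AlgHom.id ℝ _) L

theorem EvenDer.comm {L L' : CForm D →ₗ[ℝ] CForm D} (h : EvenDer L) (h' : EvenDer L') :
    EvenDer (L ∘ₗ L' - L' ∘ₗ L) := fun a b => by
  have := h a b
  simp only [LinearMap.sub_apply, LinearMap.comp_apply, h _ _, h' _ _, map_add, AlgHom.id_apply,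
    sub_mul, mul_sub]
  abel

theorem EvenDer.comm_odd {L L' : CForm D →ₗ[ℝ] CForm D} (h : EvenDer L) (h' : OddDer L')
    (hL : ∀ a, L (gradeInv a) = gradeInv (L a)) :
    OddDer (L ∘ₗ L' - L' ∘ₗ L) := fun a b => by
  simp only [LinearMap.sub_apply, LinearMap.comp_apply, h _ _, h' _ _, map_add, AlgHom.id_apply,
    sub_mul, mul_sub, hL]
  abel

theorem OddDer.anticomm {L L' : CForm D →ₗ[ℝ] CForm D} (h : OddDer L) (h' : OddDer L')
    (hL : ∀ a, L (gradeInv a) = -gradeInv (L a)) (hL' : ∀ a, L' (gradeInv a) = -gradeInv (L' a)) :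
    EvenDer (L ∘ₗ L' + L' ∘ₗ L) := fun a b => by
  simp only [LinearMap.add_apply, LinearMap.comp_apply, h _ _, h' _ _, map_add, AlgHom.id_apply,
    add_mul, mul_add, hL, hL', gradeInv_gradeInv, neg_mul]
  abel

/-- The hypotheses say how the prescribed values pass a form. Combined with the left Leibniz rules
of `pd` they leave the single twist `ε`, so even and odd derivations are treated at once. -/
theorem der_mul (v : Gen D → CForm D) (ε : CForm D →ₐ[ℝ] CForm D)
    (he : ∀ e a, v (.inl e) * a = ε a * v (.inl e))
    (ho : ∀ o a, v (.inr o) * gradeInv a = ε a * v (.inr o)) :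
    IsDer ε (AlgHom.id ℝ _) (der v) := fun a b => by
  have h1 : ∀ e, v (.inl e) * pd (.inl e) (a * b) =
      v (.inl e) * pd (.inl e) a * b + ε a * (v (.inl e) * pd (.inl e) b) := fun e => by
    rw [pd_inl_mul, mul_add, ← mul_assoc, ← mul_assoc, he e a, mul_assoc (ε a)]
  have h2 : ∀ o, v (.inr o) * pd (.inr o) (a * b) =
      v (.inr o) * pd (.inr o) a * b + ε a * (v (.inr o) * pd (.inr o) b) := fun o => by
    rw [pd_inr_mul, mul_add, ← mul_assoc, ← mul_assoc, ho o a, mul_assoc (ε a)]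
  have f1 := fun c => finite_mul_support (fun e => v (.inl e)) _ (finite_pd_inl (D := D) c)
  have f2 := fun c => finite_mul_support (fun e => v (.inr e)) _ (finite_pd_inr (D := D) c)
  simp only [der_apply, h1, h2, AlgHom.id_apply]
  rw [finsum_add_distrib, finsum_add_distrib, add_mul, mul_add, mul_finsum' _ _ (f1 b),
    mul_finsum' _ _ (f2 b), finsum_mul' _ _ (f1 a), finsum_mul' _ _ (f2 a)]
  · abel
  · exact (f2 a).subset fun i hi h => hi (by simp only [h, zero_mul])
  · exact (f2 b).subset fun i hi h => hi (by simp only [h, mul_zero])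
  · exact (f1 a).subset fun i hi h => hi (by simp only [h, zero_mul])
  · exact (f1 b).subset fun i hi h => hi (by simp only [h, mul_zero])

/-- Prescribed values that preserve parity. -/
def ParityPreserving (v : Gen D → CForm D) : Prop :=
  (∀ e, v (.inl e) ∈ evenPart D) ∧ ∀ o, v (.inr o) ∈ oddPart D

/-- Prescribed values that reverse parity. -/
def ParityReversing (v : Gen D → CForm D) : Prop :=
  (∀ e, v (.inl e) ∈ oddPart D) ∧ ∀ o, v (.inr o) ∈ evenPart D

theorem ParityPreserving.evenDer {v : Gen D → CForm D} (h : ParityPreserving v) :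
    EvenDer (der v) :=
  der_mul v _ (fun e a => (mem_evenPart.1 (h.1 e)).2 a) fun o a => by
    rw [(mem_oddPart.1 (h.2 o)).2, gradeInv_gradeInv, AlgHom.id_apply]

theorem ParityReversing.oddDer {v : Gen D → CForm D} (h : ParityReversing v) :
    OddDer (der v) :=
  der_mul v _ (fun e a => (mem_oddPart.1 (h.1 e)).2 a) fun o _ => (mem_evenPart.1 (h.2 o)).2 _

/-- Conjugating a derivation by the grade involution gives a derivation with the same twist; parity
statements about `der v` therefore reduce to generators. -/
theorem gradeInv_conj_isDer {ε : CForm D →ₐ[ℝ] CForm D} (hε : ∀ a, gradeInv (ε (gradeInv a)) = ε a)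
    {L : CForm D →ₗ[ℝ] CForm D} (h : IsDer ε (AlgHom.id ℝ _) L) :
    IsDer ε (AlgHom.id ℝ _) (gradeInv.toLinearMap ∘ₗ L ∘ₗ gradeInv.toLinearMap) := fun a b => by
  simp only [LinearMap.comp_apply, AlgHom.toLinearMap_apply, map_mul, h _ _, map_add,
    AlgHom.id_apply, gradeInv_gradeInv, hε]

theorem ParityPreserving.der_gradeInv {v : Gen D → CForm D} (h : ParityPreserving v) (a : CForm D) :
    der v (gradeInv a) = gradeInv (der v a) := by
  have key : gradeInv.toLinearMap ∘ₗ der v ∘ₗ gradeInv.toLinearMap = der v := by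
    refine (gradeInv_conj_isDer (fun a => ?_) h.evenDer).ext h.evenDer fun z => ?_
    · simp [gradeInv_gradeInv]
    · rcases z with e | o
      · simp [gradeInv_inl, der_cgen, (mem_evenPart.1 (h.1 e)).1]
      · simp [gradeInv_inr, der_cgen, (mem_oddPart.1 (h.2 o)).1]
  conv_rhs => rw [← key]
  simp [gradeInv_gradeInv]

theorem ParityReversing.der_gradeInv {v : Gen D → CForm D} (h : ParityReversing v) (a : CForm D) :
    der v (gradeInv a) = -gradeInv (der v a) := by
  have key : gradeInv.toLinearMap ∘ₗ der v ∘ₗ gradeInv.toLinearMap = (-1 : ℝ) • der v := by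
    refine (gradeInv_conj_isDer (fun a => ?_) h.oddDer).ext (h.oddDer.smul _) fun z => ?_
    · simp [gradeInv_gradeInv]
    · rcases z with e | o
      · simp [gradeInv_inl, der_cgen, (mem_oddPart.1 (h.1 e)).1]
      · simp [gradeInv_inr, der_cgen, (mem_evenPart.1 (h.2 o)).1]
  have := congrArg gradeInv (LinearMap.congr_fun key a)
  simpa [gradeInv_gradeInv] using this

theorem pd_eq_der [DecidableEq (Gen D)] (z : Gen D) : pd z = der (Pi.single z 1) := by
  ext1 a
  rw [der_apply]
  rcases z with e | o
  · rw [finsum_eq_single _ e, finsum_eq_zero_of_forall_eq_zero]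
    · simp
    · intro o; simp
    · intro e' h; simp [h]
  · rw [finsum_eq_single _ o, finsum_eq_zero_of_forall_eq_zero]
    · simp
    · intro o; simp
    · intro e' h; simp [h]

theorem pd_cgen [DecidableEq (Gen D)] (z z' : Gen D) :
    pd z (cgen z') = if z' = z then 1 else 0 := by
  rw [pd_eq_der, der_cgen, Pi.single_apply]

/-! ### Hook tensors -/

instance : Fintype (HookIdx D) :=
  inferInstanceAs (Fintype {i : Fin D × Fin D × Fin D // i.1 < i.2.1 ∧ i.1 ≤ i.2.2})

instance : DecidableEq (HookIdx D) :=
  inferInstanceAs (DecidableEq {i : Fin D × Fin D × Fin D // i.1 < i.2.1 ∧ i.1 ≤ i.2.2})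

/-- Tensors with the symmetries of `T_{[αβ]γ}`. -/
def IsHook {M : Type*} [AddCommGroup M] (t : Fin D → Fin D → Fin D → M) : Prop :=
  (∀ α β γ, t β α γ = -t α β γ) ∧ ∀ α β γ, t α β γ + t β γ α + t γ α β = 0

theorem map_hookComp {M M' : Type*} [AddCommGroup M] [AddCommGroup M'] (f : M →+ M')
    (c : HookIdx D → M) (α β γ : Fin D) :
    f (hookComp c α β γ) = hookComp (fun i => f (c i)) α β γ := by
  unfold hookComp
  split_ifs <;> simp

theorem IsHook.hookComp_eq {M : Type*} [AddCommGroup M] [Module ℝ M]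
    {t : Fin D → Fin D → Fin D → M}
    (h : IsHook t) (α β γ : Fin D) :
    hookComp (fun i => t i.1.1 i.1.2.1 i.1.2.2) α β γ = t α β γ := by
  have h0 : ∀ α γ, t α α γ = 0 := fun α γ => by
    have := h.1 α α γ
    have h2 : (2 : ℝ) • t α α γ = 0 := by rw [two_smul]; nth_rw 1 [this]; simp
    simpa using h2
  unfold hookComp
  split_ifs with h1 h2 h3 h4
  · rfl
  · have e1 := h.1 γ α β
    have e2 := h.2 α β γ
    have e3 := h.1 β γ α
    dsimp only
    rw [e3]
    rw [← sub_eq_zero, ← neg_eq_zero, ← e2]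
    abel
  · exact (h.1 _ _ _).symm
  · have e2 := h.2 α β γ
    have e3 := h.1 β γ α
    dsimp only
    rw [e3]
    rw [← sub_eq_zero, ← neg_eq_zero, ← e2]
    abel
  · have : α = β := le_antisymm (not_lt.1 h3) (not_lt.1 h1)
    rw [this, h0]

/-- The components of the basis of hook tensors dual to the independent components. -/
def hookBasis (i : HookIdx D) (α β γ : Fin D) : ℝ :=
  hookComp (fun j => (Pi.single j 1 : HookIdx D → ℝ)) α β γ i

/-- `hookComp` is natural in the target group, so the general case is the image of the universal
family `Pi.single` under a linear combination map. -/
theorem hookComp_eq_sum {M : Type*} [AddCommGroup M] [Module ℝ M] (c : HookIdx D → M)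
    (α β γ : Fin D) : hookComp c α β γ = ∑ i, hookBasis i α β γ • c i := by
  have := map_hookComp (Fintype.linearCombination ℝ c).toAddMonoidHom
    (fun j => (Pi.single j 1 : HookIdx D → ℝ)) α β γ
  simp only [LinearMap.toAddMonoidHom_coe, Fintype.linearCombination_apply] at this
  rw [show (∑ i, hookBasis i α β γ • c i) = _ from this]
  congr 1
  funext i
  simp [Pi.single_apply]

theorem isHook_hookBasis (i : HookIdx D) : IsHook (hookBasis i) :=
  ⟨fun α β γ => congrFun (hookComp_antisymm _ α β γ) i,
    fun α β γ => congrFun (hookComp_cyclic (fun j => (Pi.single j 1 : HookIdx D → ℝ)) α β γ) i⟩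

/-! ### Relabelling of triple sums -/

section Sums

variable {M : Type*} [AddCommMonoid M]

theorem sum_swap (g : Fin D → Fin D → Fin D → M) :
    ∑ α, ∑ β, ∑ γ, g β α γ = ∑ α, ∑ β, ∑ γ, g α β γ := Finset.sum_comm

theorem sum_swap' (g : Fin D → Fin D → Fin D → M) :
    ∑ α, ∑ β, ∑ γ, g α γ β = ∑ α, ∑ β, ∑ γ, g α β γ :=
  Finset.sum_congr rfl fun _ _ => Finset.sum_comm

theorem sum_rotate (g : Fin D → Fin D → Fin D → M) :
    ∑ α, ∑ β, ∑ γ, g β γ α = ∑ α, ∑ β, ∑ γ, g α β γ := by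
  rw [sum_swap fun α β γ => g α γ β, sum_swap']

theorem sum_rotate' (g : Fin D → Fin D → Fin D → M) :
    ∑ α, ∑ β, ∑ γ, g γ α β = ∑ α, ∑ β, ∑ γ, g α β γ :=
  (sum_rotate fun α β γ => g γ α β).symm

end Sums

/-! ### The hook projection and pairings with hook tensors -/

section HookProj

variable {M : Type*} [AddCommGroup M] [Module ℝ M]

/-- The projection of a tensor with three indices on the hook tensors. -/
def hookProj (Y : Fin D → Fin D → Fin D → M) (α β γ : Fin D) : M :=
  (1 / 6 : ℝ) • ((2 : ℝ) • (Y α β γ - Y β α γ) - (Y β γ α - Y γ β α) - (Y γ α β - Y α γ β))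

theorem isHook_hookProj (Y : Fin D → Fin D → Fin D → M) : IsHook (hookProj Y) :=
  ⟨fun α β γ => by unfold hookProj; module, fun α β γ => by unfold hookProj; module⟩

theorem IsHook.hookProj_eq {Y : Fin D → Fin D → Fin D → M} (h : IsHook Y) (α β γ : Fin D) :
    hookProj Y α β γ = Y α β γ := by
  unfold hookProj
  rw [h.1 α β γ, h.1 β γ α, h.1 γ α β]
  linear_combination (norm := module) (-1 / 3 : ℝ) • h.2 α β γ

/-- The projection is a combination of index permutations that is self-adjoint for full contraction:
relabelling the summation indices moves each permutation from `t` to `Y`. -/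
theorem sum_hookProj_smul (t : Fin D → Fin D → Fin D → ℝ) (Y : Fin D → Fin D → Fin D → M) :
    ∑ α, ∑ β, ∑ γ, hookProj t α β γ • Y α β γ = ∑ α, ∑ β, ∑ γ, t α β γ • hookProj Y α β γ := by
  have e : ∀ α β γ, hookProj t α β γ • Y α β γ = (1 / 6 : ℝ) • ((2 : ℝ) • (t α β γ • Y α β γ -
      t β α γ • Y α β γ) - (t β γ α • Y α β γ - t γ β α • Y α β γ) -
      (t γ α β • Y α β γ - t α γ β • Y α β γ)) := fun α β γ => by
    unfold hookProj; module
  have e' : ∀ α β γ, t α β γ • hookProj Y α β γ = (1 / 6 : ℝ) • ((2 : ℝ) • (t α β γ • Y α β γ -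
      t α β γ • Y β α γ) - (t α β γ • Y β γ α - t α β γ • Y γ β α) -
      (t α β γ • Y γ α β - t α β γ • Y α γ β)) := fun α β γ => by
    unfold hookProj; module
  have e5 : ∑ α, ∑ β, ∑ γ, t α β γ • Y γ β α = ∑ α, ∑ β, ∑ γ, t γ β α • Y α β γ := by
    rw [← sum_rotate fun α β γ => t γ β α • Y α β γ,
      sum_swap' fun α β γ => t α β γ • Y γ β α]
  simp only [e, e', ← Finset.smul_sum, Finset.sum_sub_distrib]
  rw [sum_swap fun α β γ => t α β γ • Y β α γ, sum_rotate fun α β γ => t γ α β • Y α β γ,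
    sum_rotate' fun α β γ => t β γ α • Y α β γ, sum_swap' fun α β γ => t α β γ • Y α γ β, e5]
  module

theorem IsHook.sum_smul_hookProj {t : Fin D → Fin D → Fin D → ℝ} (ht : IsHook t)
    (Y : Fin D → Fin D → Fin D → M) :
    ∑ α, ∑ β, ∑ γ, t α β γ • hookProj Y α β γ = ∑ α, ∑ β, ∑ γ, t α β γ • Y α β γ := by
  have h : hookProj t = t := funext fun α => funext fun β => funext fun γ => ht.hookProj_eq α β γ
  rw [← sum_hookProj_smul, h]

/-- The pairings of a tensor with the basis of hook tensors. -/
def hookCoef (Y : Fin D → Fin D → Fin D → M) (i : HookIdx D) : M :=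
  ∑ α, ∑ β, ∑ γ, hookBasis i α β γ • Y α β γ

/-- A contraction with a hook tensor sees `Y` only through `hookCoef Y`. This is what lets tensors
be traded for families indexed by independent components. -/
theorem IsHook.sum_smul {t : Fin D → Fin D → Fin D → ℝ} (ht : IsHook t)
    (Y : Fin D → Fin D → Fin D → M) :
    ∑ α, ∑ β, ∑ γ, t α β γ • Y α β γ = ∑ i, t i.1.1 i.1.2.1 i.1.2.2 • hookCoef Y i := by
  simp only [hookCoef, Finset.smul_sum]
  symm
  rw [Finset.sum_comm]
  refine Finset.sum_congr rfl fun α _ => ?_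
  rw [Finset.sum_comm]
  refine Finset.sum_congr rfl fun β _ => ?_
  rw [Finset.sum_comm]
  refine Finset.sum_congr rfl fun γ _ => ?_
  rw [← ht.hookComp_eq α β γ, hookComp_eq_sum, Finset.sum_smul]
  refine Finset.sum_congr rfl fun i _ => ?_
  rw [smul_smul, smul_eq_mul, mul_comm]

/-- Test against the hook projection of an elementary tensor and move the projection onto `Y`; the
contraction then reads off a single component. -/
theorem hookProj_eq_zero {Y : Fin D → Fin D → Fin D → M} (h : ∀ i, hookCoef Y i = 0)
    (a b c : Fin D) : hookProj Y a b c = 0 := by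
  classical
  let e : Fin D → Fin D → Fin D → ℝ := fun α β γ =>
    if α = a then if β = b then if γ = c then 1 else 0 else 0 else 0
  have h1 : ∑ α, ∑ β, ∑ γ, hookProj e α β γ • Y α β γ = 0 := by
    rw [(isHook_hookProj e).sum_smul]
    simp [h]
  rw [← h1, sum_hookProj_smul]
  simp only [e, ite_smul, one_smul, zero_smul, Finset.sum_ite_eq', Finset.mem_univ, if_true,
    Finset.sum_ite_irrel, Finset.sum_const_zero]

theorem hookCoef_hookProj (Y : Fin D → Fin D → Fin D → M) (i : HookIdx D) :
    hookCoef (hookProj Y) i = hookCoef Y i :=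
  (isHook_hookBasis i).sum_smul_hookProj Y

end HookProj

/-! ### The linear field equations in momentum space -/

/-- Polynomials in the derivatives. -/
abbrev Poly (D : ℕ) : Type := MvPolynomial (Fin D) ℝ

section Momentum

variable {M : Type*} [AddCommGroup M] [Module ℝ M] [Module (Poly D) M] [IsScalarTower ℝ (Poly D) M]
variable (v : Fin D → Poly D) (t : Fin D → Fin D → Fin D → M)

/-- The field strength `F_{αβγδ}` with the derivatives replaced by `v`. -/
def momF (α β γ δ : Fin D) : M := v α • t β γ δ + v β • t γ α δ + v γ • t α β δ

/-- The curvature `E_{αβδεγ}` with the derivatives replaced by `v`. -/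
def momE (α β δ ε γ : Fin D) : M :=
  (1 / 2 : ℝ) • (v ε • momF v t α β δ γ - v γ • momF v t α β δ ε)

/-- The Ricci tensor with the derivatives replaced by `v`. -/
def momRicci (α β γ : Fin D) : M := ∑ ε : Fin D, ∑ δ : Fin D, metric ε δ • momE v t α β δ ε γ

/-- The trace of the Ricci tensor with the derivatives replaced by `v`. -/
def momTrace (α : Fin D) : M := ∑ β : Fin D, ∑ γ : Fin D, metric β γ • momRicci v t α β γ

/-- The field equations with the derivatives replaced by `v`. -/
def momEom (α β γ : Fin D) : M :=
  (3 : ℝ) • ((η α * η β * η γ) • momRicci v t α β γ +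
    (1 / 2 : ℝ) • (metric γ α • η β • momTrace v t β - metric γ β • η α • momTrace v t α))

/-- The square of `v`. -/
def momSq : Poly D := ∑ μ : Fin D, η μ • (v μ * v μ)

/-- The divergence in the first index. -/
def divFirst (β γ : Fin D) : M := ∑ α : Fin D, η α • v α • t α β γ

/-- The divergence in the last index. -/
def divLast (α β : Fin D) : M := ∑ γ : Fin D, η γ • v γ • t α β γ

end Momentum

theorem sum_metric {M : Type*} [AddCommGroup M] [Module ℝ M] (f : Fin D → Fin D → M) :
    ∑ ε : Fin D, ∑ δ : Fin D, metric ε δ • f ε δ = ∑ δ : Fin D, η δ • f δ δ := by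
  simp [metric, ite_smul]

theorem η_mul_self (μ : Fin D) : η μ * η μ = 1 := by
  unfold η; split_ifs <;> norm_num

/-- The trace over the last two indices. -/
def hookTrace {M : Type*} [AddCommGroup M] [Module ℝ M] (t : Fin D → Fin D → Fin D → M)
    (α : Fin D) : M := ∑ γ : Fin D, η γ • t α γ γ

section Momentum

variable {M : Type*} [AddCommGroup M] [Module ℝ M] [Module (Poly D) M] [IsScalarTower ℝ (Poly D) M]
variable (v : Fin D → Poly D) {t : Fin D → Fin D → Fin D → M}

theorem momSq_smul (m : M) : momSq v • m = ∑ μ : Fin D, η μ • v μ • v μ • m := by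
  rw [momSq, Finset.sum_smul]
  simp only [smul_assoc, mul_smul]

/-- Expansion into the square of the momentum, the two divergences and the trace. The Noether
identity and self-adjointness are proved on these blocks, never on the curvature itself. -/
theorem momRicci_eq (ht : IsHook t) (α β γ : Fin D) : momRicci v t α β γ =
    (1 / 2 : ℝ) • (momSq v • t α β γ - v α • divFirst v t β γ + v β • divFirst v t α γ -
      v γ • (v α • hookTrace t β - v β • hookTrace t α + divLast v t α β)) := by
  rw [momRicci, sum_metric]
  simp only [momE, smul_comm (η _) (1 / 2 : ℝ), ← Finset.smul_sum]
  congr 1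
  simp only [momSq_smul, divFirst, divLast, hookTrace, Finset.smul_sum,
    ← Finset.sum_add_distrib, ← Finset.sum_sub_distrib]
  refine Finset.sum_congr rfl fun δ _ => ?_
  rw [momF, momF, ht.1 δ β γ, ht.1 α δ δ]
  module

/-- The divergence of the trace. -/
def divTrace (t : Fin D → Fin D → Fin D → M) : M := ∑ γ : Fin D, η γ • v γ • hookTrace t γ

/-- The double divergence. -/
def divDiv (t : Fin D → Fin D → Fin D → M) (α : Fin D) : M :=
  ∑ γ : Fin D, η γ • v γ • divLast v t α γ

theorem sum_divFirst_self : ∑ γ : Fin D, η γ • divFirst v t γ γ = divTrace v t := by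
  simp only [divFirst, divTrace, hookTrace, Finset.smul_sum]
  rw [Finset.sum_comm]
  refine Finset.sum_congr rfl fun α _ => Finset.sum_congr rfl fun γ _ => ?_
  module

theorem sum_smul_divFirst (ht : IsHook t) (α : Fin D) :
    ∑ γ : Fin D, η γ • v γ • divFirst v t α γ = -divDiv v t α := by
  simp only [divFirst, divDiv, divLast, Finset.smul_sum, ← Finset.sum_neg_distrib]
  rw [Finset.sum_comm]
  refine Finset.sum_congr rfl fun β _ => Finset.sum_congr rfl fun γ _ => ?_
  rw [ht.1 α β γ]
  module

theorem momTrace_eq (ht : IsHook t) (α : Fin D) : momTrace v t α =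
    momSq v • hookTrace t α - v α • divTrace v t - divDiv v t α := by
  have h : momTrace v t α = (1 / 2 : ℝ) • ((momSq v • hookTrace t α -
      v α • ∑ γ : Fin D, η γ • divFirst v t γ γ) + ∑ γ : Fin D, η γ • v γ • divFirst v t α γ -
      (v α • divTrace v t - momSq v • hookTrace t α + divDiv v t α)) := by
    rw [momTrace, sum_metric]
    simp only [momRicci_eq v ht, smul_comm (η _) (1 / 2 : ℝ), ← Finset.smul_sum]
    congr 1
    have e : ∀ x, η x • (momSq v • t α x x - v α • divFirst v t x x + v x • divFirst v t α x -
        v x • (v α • hookTrace t x - v x • hookTrace t α + divLast v t α x)) =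
        momSq v • η x • t α x x - v α • η x • divFirst v t x x + η x • v x • divFirst v t α x -
        (v α • η x • v x • hookTrace t x - η x • v x • v x • hookTrace t α +
          η x • v x • divLast v t α x) := fun x => by module
    simp only [e, Finset.sum_add_distrib, Finset.sum_sub_distrib, ← Finset.smul_sum,
      ← momSq_smul]
    rfl
  rw [h, sum_divFirst_self, sum_smul_divFirst v ht]
  have e : ∀ a b c : M, (1 / 2 : ℝ) • (a - b + -c - (b - a + c)) = a - b - c := fun a b c => by
    module
  exact e _ _ _

/-- The Noether identity: the divergence of the field equations vanishes. -/
theorem sum_smul_momEom (ht : IsHook t) (β γ : Fin D) :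
    ∑ α : Fin D, v α • momEom v t α β γ = 0 := by
  have h1 : ∀ α, v α • momEom v t α β γ = (3 : ℝ) • (1 / 2 : ℝ) • (
      (η β * η γ) • (momSq v • η α • v α • t α β γ - (η α • v α • v α • divFirst v t β γ) +
        v β • η α • v α • divFirst v t α γ - v γ • (η α • v α • v α • hookTrace t β -
          v β • η α • v α • hookTrace t α + η α • v α • divLast v t α β)) +
      (metric γ α • η β • v α • momTrace v t β - metric γ β • η α • v α • momTrace v t α)) :=
    fun α => by
      rw [momEom, momRicci_eq v ht]
      module
  -- A double divergence over the antisymmetric pair of indices: the two momenta commute, so the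
  -- summand is antisymmetric.
  have h2 : ∑ α : Fin D, η α • v α • divFirst v t α γ = 0 := by
    have : ∀ f : Fin D → Fin D → M, (∀ a b, f a b = - f b a) → ∑ a, ∑ b, f a b = 0 := by
      intro f hf
      have h : ∑ a, ∑ b, f a b = - ∑ a, ∑ b, f a b := by
        conv_rhs => rw [Finset.sum_comm]
        simp only [← Finset.sum_neg_distrib]
        exact Finset.sum_congr rfl fun a _ => Finset.sum_congr rfl fun b _ => hf a b
      have h' : (2 : ℝ) • ∑ a, ∑ b, f a b = 0 := by
        rw [two_smul]; nth_rw 1 [h]; exact neg_add_cancel _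
      simpa using h'
    simp only [divFirst, Finset.smul_sum]
    refine this _ fun a b => ?_
    rw [ht.1 b a]
    module
  have h3 : ∑ α : Fin D, η α • v α • divLast v t α β = -divDiv v t β := by
    simp only [divDiv, divLast, Finset.smul_sum, ← Finset.sum_neg_distrib]
    refine Finset.sum_congr rfl fun α _ => Finset.sum_congr rfl fun δ _ => ?_
    rw [ht.1 β α]
    module
  have h4 : ∑ α : Fin D, η α • v α • momTrace v t α = 0 := by
    have : ∀ α, η α • v α • momTrace v t α = momSq v • η α • v α • hookTrace t α -
        η α • v α • v α • divTrace v t - η α • v α • divDiv v t α := fun α => by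
      rw [momTrace_eq v ht]; module
    simp only [this, Finset.sum_sub_distrib, ← Finset.smul_sum, ← momSq_smul]
    have h5 : ∑ α : Fin D, η α • v α • divDiv v t α = 0 := by
      have : ∑ α : Fin D, η α • v α • divDiv v t α =
          ∑ γ : Fin D, η γ • v γ • ∑ α : Fin D, η α • v α • divLast v t α γ := by
        simp only [divDiv, Finset.smul_sum]
        rw [Finset.sum_comm]
        refine Finset.sum_congr rfl fun α _ => Finset.sum_congr rfl fun δ _ => ?_
        module
      have h6 : ∑ γ : Fin D, η γ • v γ • ∑ α : Fin D, η α • v α • divLast v t α γ =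
          -∑ γ : Fin D, η γ • v γ • divDiv v t γ := by
        have h3' : ∀ γ, ∑ α : Fin D, η α • v α • divLast v t α γ = -divDiv v t γ := by
          intro γ
          simp only [divDiv, divLast, Finset.smul_sum, ← Finset.sum_neg_distrib]
          refine Finset.sum_congr rfl fun α _ => Finset.sum_congr rfl fun δ _ => ?_
          rw [ht.1 γ α]
          module
        simp only [h3', smul_neg, Finset.sum_neg_distrib]
      have h7 := this.trans h6
      have h' : (2 : ℝ) • ∑ α : Fin D, η α • v α • divDiv v t α = 0 := by
        rw [two_smul]; nth_rw 1 [h7]; exact neg_add_cancel _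
      simpa using h'
    rw [h5, sub_zero]
    exact sub_self _
  have h5 : ∑ α : Fin D, metric γ α • η β • v α • momTrace v t β =
      (η β * η γ) • v γ • momTrace v t β := by
    simp only [metric, ite_smul, zero_smul, Finset.sum_ite_eq, Finset.mem_univ, if_true]
    module
  have h6 : ∑ α : Fin D, metric γ β • η α • v α • momTrace v t α = 0 := by
    rw [← Finset.smul_sum, h4, smul_zero]
  simp only [h1, ← Finset.smul_sum, Finset.sum_add_distrib, Finset.sum_sub_distrib, h2, h3,
    ← momSq_smul, h5, h6]
  rw [momTrace_eq v ht, divTrace, divFirst]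
  module

theorem metric_comm (μ ν : Fin D) : metric μ ν = metric ν μ := by
  unfold metric
  split_ifs with h1 h2 h2
  · rw [h1]
  · exact absurd h1.symm h2
  · exact absurd h2.symm h1
  · rfl

theorem divLast_eq (ht : IsHook t) (α β : Fin D) :
    divLast v t α β = divFirst v t β α - divFirst v t α β := by
  simp only [divLast, divFirst, ← Finset.sum_sub_distrib]
  refine Finset.sum_congr rfl fun γ _ => ?_
  have h := ht.2 α β γ
  rw [ht.1 γ β α] at h
  linear_combination (norm := module) η γ • v γ • h

theorem isHook_momEom (ht : IsHook t) : IsHook (momEom v t) := by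
  have h1 : ∀ α β, divLast v t β α = -divLast v t α β := fun α β => by
    rw [divLast_eq v ht, divLast_eq v ht]; abel
  constructor
  · intro α β γ
    simp only [momEom, momRicci_eq v ht, ht.1 α β, h1 α β]
    module
  · intro α β γ
    have h2 := ht.2 α β γ
    simp only [momEom, momRicci_eq v ht, divLast_eq v ht, metric_comm γ α, metric_comm β α,
      metric_comm γ β]
    linear_combination (norm := module)
      (3 : ℝ) • (1 / 2 : ℝ) • (η α * η β * η γ) • momSq v • h2

/-! ### Self-adjointness of the field equations -/

section Pairing

variable {M' M'' : Type*} [AddCommGroup M'] [Module ℝ M'] [Module (Poly D) M']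
  [IsScalarTower ℝ (Poly D) M'] [AddCommGroup M''] [Module ℝ M''] [Module (Poly D) M'']
  [IsScalarTower ℝ (Poly D) M'']
variable (f : M →ₗ[Poly D] M' →ₗ[Poly D] M'')

set_option linter.unusedSectionVars false in
theorem pair_smul_left (r : ℝ) (m : M) (m' : M') : f (r • m) m' = r • f m m' := by
  rw [LinearMap.map_smul_of_tower, LinearMap.smul_apply]

set_option linter.unusedSectionVars false in
theorem pair_smul_right (r : ℝ) (m : M) (m' : M') : f m (r • m') = r • f m m' :=
  LinearMap.map_smul_of_tower _ _ _

/-- A manifestly symmetric form of the pairing of the field equations with a tensor. -/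
def eomForm (t : Fin D → Fin D → Fin D → M) (h : Fin D → Fin D → Fin D → M') : M'' :=
  (3 : ℝ) • (1 / 2 : ℝ) • (momSq v • ∑ α, ∑ β, ∑ γ, (η α * η β * η γ) • f (t α β γ) (h α β γ) -
    (2 : ℝ) • ∑ β, ∑ γ, (η β * η γ) • f (divFirst v t β γ) (divFirst v h β γ) -
    ∑ α, ∑ β, (η α * η β) • f (divLast v t α β) (divLast v h α β) +
    (2 : ℝ) • (∑ β, η β • f (hookTrace t β) (divDiv v h β) +
      ∑ β, η β • f (divDiv v t β) (hookTrace h β)) -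
    (2 : ℝ) • (momSq v • ∑ β, η β • f (hookTrace t β) (hookTrace h β) -
      f (divTrace v t) (divTrace v h)))

variable {h : Fin D → Fin D → Fin D → M'}

/-- Momenta are moved across the bilinear pairing onto `h`, where they assemble into its
divergences. The antisymmetry of `h` merges the two halves of every antisymmetrized term, and the
result is visibly symmetric. -/
theorem sum_momEom_pair (ht : IsHook t) (hh : IsHook h) :
    ∑ α, ∑ β, ∑ γ, f (momEom v t α β γ) (h α β γ) = eomForm v f t h := by
  have e : ∀ α β γ, f (momEom v t α β γ) (h α β γ) = (3 : ℝ) • (1 / 2 : ℝ) • (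
      momSq v • (η α * η β * η γ) • f (t α β γ) (h α β γ) -
      (η β * η γ) • η α • v α • f (divFirst v t β γ) (h α β γ) -
      (η α * η γ) • η β • v β • f (divFirst v t α γ) (h β α γ) -
      (η α * η β) • η γ • v γ • f (divLast v t α β) (h α β γ) +
      η β • η γ • v γ • η α • v α • f (hookTrace t β) (h β α γ) +
      η α • η γ • v γ • η β • v β • f (hookTrace t α) (h α β γ) -
      metric γ α • η β • f (momTrace v t β) (h β α γ) -
      metric γ β • η α • f (momTrace v t α) (h α β γ)) := fun α β γ => by
    rw [hh.1 α β γ, momEom, momRicci_eq v ht]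
    simp only [map_add, map_sub, map_neg, LinearMap.add_apply, LinearMap.sub_apply,
      LinearMap.neg_apply, map_smul, LinearMap.smul_apply, pair_smul_left]
    module
  have c1 : ∀ g : Fin D → Fin D → Fin D → M'', ∑ α, ∑ β, ∑ γ, (3 : ℝ) • (1 / 2 : ℝ) • g α β γ =
      (3 : ℝ) • (1 / 2 : ℝ) • ∑ α, ∑ β, ∑ γ, g α β γ := fun g => by
    simp only [Finset.smul_sum]
  have c2 : ∀ g : Fin D → Fin D → Fin D → M'', ∑ α, ∑ β, ∑ γ, momSq v • g α β γ =
      momSq v • ∑ α, ∑ β, ∑ γ, g α β γ := fun g => by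
    simp only [Finset.smul_sum]
  simp only [e]
  rw [c1]
  simp only [Finset.sum_add_distrib, Finset.sum_sub_distrib]
  rw [c2]
  have e2 : ∑ α, ∑ β, ∑ γ, (η β * η γ) • η α • v α • f (divFirst v t β γ) (h α β γ) =
      ∑ β, ∑ γ, (η β * η γ) • f (divFirst v t β γ) (divFirst v h β γ) := by
    rw [← sum_rotate']
    refine Finset.sum_congr rfl fun β _ => Finset.sum_congr rfl fun γ _ => ?_
    rw [divFirst.eq_def v h]
    simp only [map_sum, Finset.smul_sum, pair_smul_right, map_smul]
  have e3 : ∑ α, ∑ β, ∑ γ, (η α * η γ) • η β • v β • f (divFirst v t α γ) (h β α γ) =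
      ∑ α, ∑ β, ∑ γ, (η β * η γ) • η α • v α • f (divFirst v t β γ) (h α β γ) :=
    sum_swap fun α β γ => (η β * η γ) • η α • v α • f (divFirst v t β γ) (h α β γ)
  have e4 : ∑ α, ∑ β, ∑ γ, (η α * η β) • η γ • v γ • f (divLast v t α β) (h α β γ) =
      ∑ α, ∑ β, (η α * η β) • f (divLast v t α β) (divLast v h α β) := by
    refine Finset.sum_congr rfl fun β _ => Finset.sum_congr rfl fun γ _ => ?_
    rw [divLast.eq_def v h]
    simp only [map_sum, Finset.smul_sum, pair_smul_right, map_smul]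
  have e6 : ∑ α, ∑ β, ∑ γ, η α • η γ • v γ • η β • v β • f (hookTrace t α) (h α β γ) =
      ∑ β, η β • f (hookTrace t β) (divDiv v h β) := by
    refine Finset.sum_congr rfl fun α _ => ?_
    rw [Finset.sum_comm]
    simp only [divDiv, divLast, map_sum, Finset.smul_sum, pair_smul_right, map_smul]
    rw [Finset.sum_comm]
    refine Finset.sum_congr rfl fun β _ => Finset.sum_congr rfl fun γ _ => ?_
    module
  have e5 : ∑ α, ∑ β, ∑ γ, η β • η γ • v γ • η α • v α • f (hookTrace t β) (h β α γ) =
      ∑ α, ∑ β, ∑ γ, η α • η γ • v γ • η β • v β • f (hookTrace t α) (h α β γ) :=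
    sum_swap fun α β γ => η α • η γ • v γ • η β • v β • f (hookTrace t α) (h α β γ)
  have e8 : ∑ α, ∑ β, ∑ γ, metric γ β • η α • f (momTrace v t α) (h α β γ) =
      ∑ α, η α • f (momTrace v t α) (hookTrace h α) := by
    refine Finset.sum_congr rfl fun α _ => ?_
    simp only [metric, ite_smul, zero_smul, Finset.sum_ite_eq', Finset.mem_univ, if_true,
      hookTrace, map_sum, Finset.smul_sum, pair_smul_right]
    refine Finset.sum_congr rfl fun β _ => ?_
    module
  have e7 : ∑ α, ∑ β, ∑ γ, metric γ α • η β • f (momTrace v t β) (h β α γ) =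
      ∑ α, ∑ β, ∑ γ, metric γ β • η α • f (momTrace v t α) (h α β γ) :=
    sum_swap fun α β γ => metric γ β • η α • f (momTrace v t α) (h α β γ)
  have e9 : ∑ α, η α • f (momTrace v t α) (hookTrace h α) =
      momSq v • ∑ β, η β • f (hookTrace t β) (hookTrace h β) -
      f (divTrace v t) (divTrace v h) - ∑ β, η β • f (divDiv v t β) (hookTrace h β) := by
    have : f (divTrace v t) (divTrace v h) =
        ∑ α, η α • v α • f (divTrace v t) (hookTrace h α) := by
      conv_lhs => rw [divTrace.eq_def v h]
      simp only [map_sum, pair_smul_right, map_smul]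
    rw [this, Finset.smul_sum, ← Finset.sum_sub_distrib, ← Finset.sum_sub_distrib]
    refine Finset.sum_congr rfl fun α _ => ?_
    rw [momTrace_eq v ht]
    simp only [map_sub, LinearMap.sub_apply, map_smul, LinearMap.smul_apply]
    module
  rw [e3, e2, e4, e5, e6, e7, e8, e9, eomForm]
  simp only [two_smul ℝ]
  module

/-- Only the two mixed terms, trace against double divergence, change places. -/
theorem eomForm_flip : eomForm v f.flip h t = eomForm v f t h := by
  simp only [eomForm, LinearMap.flip_apply]
  rw [add_comm (∑ β, η β • f (divDiv v t β) (hookTrace h β))]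

/-- The linear field equations are self-adjoint. -/
theorem sum_momEom_pair_symm (ht : IsHook t) (hh : IsHook h) :
    ∑ α, ∑ β, ∑ γ, f (momEom v t α β γ) (h α β γ) =
      ∑ α, ∑ β, ∑ γ, f (t α β γ) (momEom v h α β γ) := by
  rw [sum_momEom_pair v f ht hh, ← eomForm_flip, ← sum_momEom_pair v f.flip hh ht]
  rfl

end Pairing

end Momentum

/-! ### Koszul exactness for polynomials with values in a vector space -/

section Koszul

variable {H : Type*} [AddCommGroup H] [Module ℝ H]

theorem poly_tensor_ext {B : Type*} [AddCommMonoid B] [Module ℝ B] {f g : Poly D ⊗[ℝ] H →ₗ[ℝ] B}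
    (h : ∀ I x, f (MvPolynomial.monomial I 1 ⊗ₜ x) = g (MvPolynomial.monomial I 1 ⊗ₜ x)) :
    f = g := by
  refine TensorProduct.ext' fun p x => ?_
  induction p using MvPolynomial.induction_on' with
  | monomial I r =>
    have : MvPolynomial.monomial I r = r • (MvPolynomial.monomial I 1 : Poly D) := by
      rw [MvPolynomial.smul_monomial, smul_eq_mul, mul_one]
    rw [this, TensorProduct.smul_tmul, TensorProduct.tmul_smul, map_smul, map_smul, h]
  | add p q hp hq => rw [TensorProduct.add_tmul, map_add, map_add, hp, hq]

/-- Multiplication of the monomials by a function of the exponent. -/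
def diag (g : MultiIdx D → ℝ) : Poly D →ₗ[ℝ] Poly D :=
  (MvPolynomial.basisMonomials (Fin D) ℝ).constr ℝ fun I => MvPolynomial.monomial I (g I)

theorem diag_monomial (g : MultiIdx D → ℝ) (I : MultiIdx D) (r : ℝ) :
    diag g (MvPolynomial.monomial I r) = MvPolynomial.monomial I (g I * r) := by
  have : MvPolynomial.monomial I r = r • (MvPolynomial.basisMonomials (Fin D) ℝ) I := by
    rw [MvPolynomial.coe_basisMonomials, MvPolynomial.smul_monomial, smul_eq_mul, mul_one]
  rw [diag, this, map_smul, Module.Basis.constr_basis, MvPolynomial.smul_monomial, smul_eq_mul,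
    mul_comm]

/-- Multiplication of the monomials by a function of the exponent, with values in `H`. -/
def diagT (g : MultiIdx D → ℝ) : Poly D ⊗[ℝ] H →ₗ[ℝ] Poly D ⊗[ℝ] H :=
  LinearMap.rTensor H (diag g)

theorem diagT_monomial (g : MultiIdx D → ℝ) (I : MultiIdx D) (x : H) :
    diagT g (MvPolynomial.monomial I 1 ⊗ₜ[ℝ] x) = g I • (MvPolynomial.monomial I 1 ⊗ₜ[ℝ] x) := by
  rw [diagT, LinearMap.rTensor_tmul, diag_monomial, TensorProduct.smul_tmul',
    MvPolynomial.smul_monomial, smul_eq_mul]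

theorem diagT_diagT (g g' : MultiIdx D → ℝ) (u : Poly D ⊗[ℝ] H) :
    diagT g (diagT g' u) = diagT (fun I => g I * g' I) u := by
  have : diagT g ∘ₗ diagT g' = (diagT (fun I => g I * g' I) : Poly D ⊗[ℝ] H →ₗ[ℝ] _) :=
    poly_tensor_ext fun I x => by
      simp only [LinearMap.comp_apply, diagT_monomial, map_smul, smul_smul, mul_comm]
  exact LinearMap.congr_fun this u

theorem diagT_add (g g' : MultiIdx D → ℝ) (u : Poly D ⊗[ℝ] H) :
    diagT (fun I => g I + g' I) u = diagT g u + diagT g' u := by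
  have : (diagT (fun I => g I + g' I) : Poly D ⊗[ℝ] H →ₗ[ℝ] _) = diagT g + diagT g' :=
    poly_tensor_ext fun I x => by
      simp only [LinearMap.add_apply, diagT_monomial, add_smul]
  exact LinearMap.congr_fun this u

theorem diagT_const (c : ℝ) (u : Poly D ⊗[ℝ] H) : diagT (fun _ => c) u = c • u := by
  have : (diagT (fun _ => c) : Poly D ⊗[ℝ] H →ₗ[ℝ] _) = c • LinearMap.id :=
    poly_tensor_ext fun I x => by
      simp only [LinearMap.smul_apply, diagT_monomial, LinearMap.id_apply]
  exact LinearMap.congr_fun this u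

theorem diagT_X_smul (g : MultiIdx D → ℝ) (ν : Fin D) (u : Poly D ⊗[ℝ] H) :
    diagT g ((MvPolynomial.X ν : Poly D) • u) =
      (MvPolynomial.X ν : Poly D) • diagT (fun I => g (I + Finsupp.single ν 1)) u := by
  have : diagT g ∘ₗ Algebra.lsmul ℝ ℝ (Poly D ⊗[ℝ] H) (MvPolynomial.X ν : Poly D) =
      Algebra.lsmul ℝ ℝ (Poly D ⊗[ℝ] H) (MvPolynomial.X ν : Poly D) ∘ₗ
        diagT (fun I => g (I + Finsupp.single ν 1)) :=
    poly_tensor_ext fun I x => by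
      have e : (MvPolynomial.X ν : Poly D) • ((MvPolynomial.monomial I 1 : Poly D) ⊗ₜ[ℝ] x) =
          MvPolynomial.monomial (I + Finsupp.single ν 1) 1 ⊗ₜ[ℝ] x := by
        rw [TensorProduct.smul_tmul', smul_eq_mul, mul_comm, MvPolynomial.X,
          MvPolynomial.monomial_mul, mul_one]
      simp only [LinearMap.comp_apply, Algebra.lsmul_coe, diagT_monomial]
      rw [smul_comm, e, diagT_monomial]
  exact LinearMap.congr_fun this u

/-- The partial derivatives with respect to the momenta. -/
def dmom (μ : Fin D) : Poly D ⊗[ℝ] H →ₗ[ℝ] Poly D ⊗[ℝ] H :=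
  LinearMap.rTensor H (MvPolynomial.pderiv μ).toLinearMap

theorem dmom_smul (μ : Fin D) (x : Poly D) (u : Poly D ⊗[ℝ] H) :
    dmom μ (x • u) = MvPolynomial.pderiv μ x • u + x • dmom μ u := by
  induction u using TensorProduct.induction_on with
  | zero => simp
  | add u w hu hw => rw [smul_add, map_add, hu, hw, map_add, smul_add, smul_add]; abel
  | tmul y h =>
    simp only [dmom, TensorProduct.smul_tmul', LinearMap.rTensor_tmul, Derivation.coeFn_coe,
      smul_eq_mul, Derivation.leibniz, ← TensorProduct.add_tmul]
    rw [add_comm, mul_comm y]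

variable (J : Finset (Fin D))

/-- The degree in the variables `J`. -/
def degIn (I : MultiIdx D) : ℝ := ∑ μ ∈ J, (I μ : ℝ)

theorem degIn_nonneg (I : MultiIdx D) : 0 ≤ degIn J I := Finset.sum_nonneg fun _ _ => by positivity

/-- The momenta with only the components in `J` nonzero. -/
def momVec (μ : Fin D) : Poly D := if μ ∈ J then MvPolynomial.X μ else 0

/-- Membership in `J` as a real number. -/
def indic (μ : Fin D) : ℝ := if μ ∈ J then 1 else 0

theorem indic_le (μ : Fin D) : indic J μ ≤ 1 := by unfold indic; split_ifs <;> norm_num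

/-- `c` plus the degree in the variables `J`. -/
def shiftDeg (c : ℝ) : Poly D ⊗[ℝ] H →ₗ[ℝ] Poly D ⊗[ℝ] H := diagT fun I => c + degIn J I

theorem shiftDeg_add (c c' : ℝ) (u : Poly D ⊗[ℝ] H) :
    shiftDeg J (c + c') u = c • u + shiftDeg J c' u := by
  rw [shiftDeg, shiftDeg, ← diagT_const, ← diagT_add]
  simp only [add_assoc]

theorem shiftDeg_momVec (c : ℝ) (ν : Fin D) (u : Poly D ⊗[ℝ] H) :
    shiftDeg J c (momVec J ν • u) = momVec J ν • shiftDeg J (c + indic J ν) u := by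
  unfold momVec indic
  split_ifs with h
  · rw [shiftDeg, diagT_X_smul]
    congr 3
    funext I
    simp only [degIn, Finsupp.add_apply, Nat.cast_add, Finset.sum_add_distrib]
    have : ∑ μ ∈ J, ((Finsupp.single ν 1 μ : ℕ) : ℝ) = 1 := by
      simp [Finsupp.single_apply, h]
    rw [this]; ring
  · simp

/-- For positive `c` the eigenvalue `c + degIn J I` never vanishes, so the operator has an inverse
that is again diagonal on monomials. -/
theorem shiftDeg_injective {c : ℝ} (hc : 0 < c) :
    Function.Injective (shiftDeg (H := H) J c) := by
  refine Function.LeftInverse.injective (g := diagT fun I => (c + degIn J I)⁻¹) fun u => ?_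
  rw [shiftDeg, diagT_diagT]
  have : ∀ I : MultiIdx D, (c + degIn J I)⁻¹ * (c + degIn J I) = 1 := fun I =>
    inv_mul_cancel₀ (add_pos_of_pos_of_nonneg hc (degIn_nonneg J I)).ne'
  simp only [this, diagT_const, one_smul]

theorem exists_shiftDeg {c : ℝ} (hc : 0 < c) (u : Poly D ⊗[ℝ] H) : ∃ w, shiftDeg J c w = u := by
  refine ⟨diagT (fun I => (c + degIn J I)⁻¹) u, ?_⟩
  rw [shiftDeg, diagT_diagT]
  have : ∀ I : MultiIdx D, (c + degIn J I) * (c + degIn J I)⁻¹ = 1 := fun I =>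
    mul_inv_cancel₀ (add_pos_of_pos_of_nonneg hc (degIn_nonneg J I)).ne'
  simp only [this, diagT_const, one_smul]

/-- The Leibniz rule; the derivative of `momVec J ν` picks out `w ν`, and only if `ν` belongs to
`J`. -/
theorem sum_dmom_momVec (ν : Fin D) (w : Fin D → Poly D ⊗[ℝ] H) :
    ∑ μ ∈ J, dmom μ (momVec J ν • w μ) =
      indic J ν • w ν + momVec J ν • ∑ μ ∈ J, dmom μ (w μ) := by
  unfold momVec indic
  split_ifs with h
  · simp only [dmom_smul, MvPolynomial.pderiv_X, Finset.sum_add_distrib, ← Finset.smul_sum]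
    congr 1
    rw [Finset.sum_eq_single ν]
    · simp
    · intro μ _ hμ; simp [hμ.symm]
    · intro h'; exact absurd h h'
  · simp

/-- Euler's identity: differentiating after multiplying by `X_μ` scales a monomial by one plus its
exponent, and summing over `J` gives the cardinality plus the degree. It is the source of all the
Koszul homotopies below. -/
theorem sum_dmom_self (u : Poly D ⊗[ℝ] H) :
    ∑ μ ∈ J, dmom μ (momVec J μ • u) = shiftDeg J J.card u := by
  have : (∑ μ ∈ J, dmom μ ∘ₗ Algebra.lsmul ℝ ℝ (Poly D ⊗[ℝ] H) (momVec J μ)) =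
      shiftDeg J J.card := poly_tensor_ext fun I x => by
    simp only [LinearMap.sum_apply, LinearMap.comp_apply, Algebra.lsmul_coe, shiftDeg,
      diagT_monomial, dmom_smul]
    have e : ∀ μ ∈ J, MvPolynomial.pderiv μ (momVec J μ) • ((MvPolynomial.monomial I 1 : Poly D) ⊗ₜ[ℝ] x) +
        momVec J μ • dmom μ ((MvPolynomial.monomial I 1 : Poly D) ⊗ₜ[ℝ] x) =
        (1 + (I μ : ℝ)) • ((MvPolynomial.monomial I 1 : Poly D) ⊗ₜ[ℝ] x) := fun μ hμ => by
      simp only [momVec, if_pos hμ, dmom, LinearMap.rTensor_tmul, Derivation.coeFn_coe,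
        TensorProduct.smul_tmul', smul_eq_mul, MvPolynomial.X_mul_pderiv_monomial,
        MvPolynomial.pderiv_X_self, add_smul, one_smul]
      rw [← Nat.cast_smul_eq_nsmul ℝ]
    rw [Finset.sum_congr rfl e, ← Finset.sum_smul, Finset.sum_add_distrib]
    simp [degIn]
  have := LinearMap.congr_fun this u
  simpa only [LinearMap.sum_apply, LinearMap.comp_apply, Algebra.lsmul_coe] using this

/-- Insert the hypothesis in Euler's identity for `w γ`: the terms regroup into `momVec J γ` times a
divergence, and what is left on the other side is invertible since the cardinality exceeds `indic J
γ`. Directions outside `J` are included: there the conclusion says `w γ = 0`. -/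
theorem koszul_one (hJ : 2 ≤ J.card) {w : Fin D → Poly D ⊗[ℝ] H}
    (hw : ∀ ε γ, momVec J ε • w γ = momVec J γ • w ε) : ∃ g, ∀ γ, w γ = momVec J γ • g := by
  have hr : (2 : ℝ) ≤ J.card := by exact_mod_cast hJ
  obtain ⟨g, hg⟩ := exists_shiftDeg J (c := J.card) (by linarith) (∑ μ ∈ J, dmom μ (w μ))
  refine ⟨g, fun γ => shiftDeg_injective J (c := J.card - indic J γ)
    (by linarith [indic_le J γ]) ?_⟩
  have h1 := sum_dmom_self J (w γ)
  simp only [hw _ γ] at h1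
  rw [sum_dmom_momVec, ← hg] at h1
  rw [shiftDeg_momVec, sub_add_cancel]
  have h2 := shiftDeg_add J (indic J γ) (J.card - indic J γ) (w γ)
  rw [add_sub_cancel, ← h1] at h2
  exact (add_left_cancel h2).symm

/-- The same homotopy one degree higher. The operator to invert now starts at the cardinality minus
at most 2, which is why three momenta are required. -/
theorem koszul_two (hJ : 3 ≤ J.card) {q : Fin D → Fin D → Poly D ⊗[ℝ] H}
    (ha : ∀ α β, q β α = -q α β)
    (hw : ∀ α β γ, momVec J γ • q α β + momVec J α • q β γ + momVec J β • q γ α = 0) :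
    ∃ s : Fin D → Poly D ⊗[ℝ] H, ∀ α β, q α β = momVec J α • s β - momVec J β • s α := by
  have hr : (3 : ℝ) ≤ J.card := by exact_mod_cast hJ
  have hs := fun β => exists_shiftDeg J (c := J.card - indic J β)
    (by linarith [indic_le J β]) (∑ μ ∈ J, dmom μ (q μ β))
  choose s hs using hs
  refine ⟨s, fun α β => shiftDeg_injective J (c := J.card - indic J α - indic J β)
    (by linarith [indic_le J β, indic_le J α]) ?_⟩
  have h1 := sum_dmom_self J (q α β)
  have e : ∀ μ, momVec J μ • q α β = momVec J α • q μ β - momVec J β • q μ α := fun μ => by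
    have := hw α β μ
    rw [ha μ β] at this
    linear_combination (norm := module) this
  simp only [e, map_sub, Finset.sum_sub_distrib] at h1
  rw [sum_dmom_momVec, sum_dmom_momVec, ← hs, ← hs, ha α β] at h1
  rw [map_sub, shiftDeg_momVec, shiftDeg_momVec]
  have h2 := shiftDeg_add J (indic J α + indic J β) (J.card - indic J α - indic J β) (q α β)
  rw [show indic J α + indic J β + (J.card - indic J α - indic J β) = (J.card : ℝ) by ring,
    ← h1] at h2
  rw [show J.card - indic J α - indic J β + indic J α = J.card - indic J β by ring,
    sub_add_cancel]
  linear_combination (norm := module) -h2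

end Koszul

/-! ### Solutions of the field equations in momentum space are pure gauge -/

section Curvature

set_option linter.unusedSectionVars false

variable {M : Type*} [AddCommGroup M] [Module ℝ M] [Module (Poly D) M] [IsScalarTower ℝ (Poly D) M]
variable (v : Fin D → Poly D) {t : Fin D → Fin D → Fin D → M}

/-- Contracting the last two indices of the equations returns the trace itself, multiplied by `(3 -
D) / 2` up to invertible factors. -/
theorem momTrace_eq_zero (hD : 4 < D) (h : ∀ α β γ, momEom v t α β γ = 0) (α : Fin D) :
    momTrace v t α = 0 := by
  have h1 : ∀ β, η β • momRicci v t α β β +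
      (1 / 2 : ℝ) • ((if β = α then (1 : ℝ) else 0) • momTrace v t α - momTrace v t α) = 0 :=
    fun β => by
    have h2 := h α β β
    rw [momEom, smul_eq_zero_iff_right (by norm_num), mul_assoc (η α), η_mul_self, mul_one] at h2
    have h3 : (η α * η β) • (η α • momRicci v t α β β + (1 / 2 : ℝ) •
        (metric β α • η β • momTrace v t β - metric β β • η α • momTrace v t α)) = 0 := by
      rw [h2, smul_zero]
    rw [← h3, metric, metric, if_pos rfl]
    have hα := η_mul_self α
    have hβ := η_mul_self β
    split_ifs with e
    · subst e
      simp [smul_smul, hα]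
    · simp only [zero_smul, zero_sub, smul_add, smul_neg, smul_smul, zero_mul]
      congr 1
      · rw [mul_right_comm, hα, one_mul]
      · rw [show η α * η β * (1 / 2 * (η β * η α)) = 1 / 2 * ((η α * η α) * (η β * η β)) by ring,
          hα, hβ, mul_one, mul_one]
  have h4 : ∑ β, (η β • momRicci v t α β β +
      (1 / 2 : ℝ) • ((if β = α then (1 : ℝ) else 0) • momTrace v t α - momTrace v t α)) = 0 :=
    Finset.sum_eq_zero fun β _ => h1 β
  have h5 : ∑ β, η β • momRicci v t α β β = momTrace v t α := by rw [momTrace, sum_metric]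
  rw [Finset.sum_add_distrib, h5, ← Finset.smul_sum, Finset.sum_sub_distrib, ← Finset.sum_smul,
    Finset.sum_ite_eq', if_pos (Finset.mem_univ _), Finset.sum_const, Finset.card_univ,
    Fintype.card_fin, ← Nat.cast_smul_eq_nsmul ℝ] at h4
  have h6 : ((3 - D : ℝ) / 2) • momTrace v t α = 0 := by
    rw [← h4]; module
  have h7 : (4 : ℝ) < D := by exact_mod_cast hD
  exact (smul_eq_zero.1 h6).resolve_left (by linarith)

theorem momRicci_eq_zero (hD : 4 < D) (h : ∀ α β γ, momEom v t α β γ = 0) (α β γ : Fin D) :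
    momRicci v t α β γ = 0 := by
  have h2 := h α β γ
  simp only [momEom, momTrace_eq_zero v hD h, smul_zero, sub_self, add_zero] at h2
  have h3 : ∀ μ : Fin D, η μ ≠ 0 := fun μ => by unfold η; split_ifs <;> norm_num
  simpa [h3] using h2

/-- The curvature, without the factor one half. -/
def momK (v : Fin D → Poly D) (t : Fin D → Fin D → Fin D → M) (α β δ ε γ : Fin D) : M :=
  v ε • momF v t α β δ γ - v γ • momF v t α β δ ε

theorem momF_rotate (α β γ δ : Fin D) : momF v t β γ α δ = momF v t α β γ δ := by
  unfold momF; abel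

theorem momF_swap (ht : IsHook t) (α β γ δ : Fin D) : momF v t β α γ δ = -momF v t α β γ δ := by
  unfold momF
  rw [ht.1 γ α, ht.1 β γ, ht.1 α β]
  module

/-- The Bianchi identity: in its first three indices the field strength is a curl, hence closed. -/
theorem momF_bianchi (ht : IsHook t) (α β δ ζ γ : Fin D) : v ζ • momF v t α β δ γ =
    v α • momF v t β δ ζ γ + v β • momF v t δ α ζ γ + v δ • momF v t α β ζ γ := by
  unfold momF
  rw [ht.1 ζ β, ht.1 ζ δ, ht.1 ζ α, ht.1 β α, ht.1 δ β, ht.1 α δ]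
  module

theorem sum_momK (h : ∀ α β γ, momRicci v t α β γ = 0) (α β γ : Fin D) :
    ∑ δ, η δ • momK v t α β δ δ γ = 0 := by
  have h1 := h α β γ
  rw [momRicci, sum_metric] at h1
  simp only [momE, smul_comm (η _) (1 / 2 : ℝ), ← Finset.smul_sum] at h1
  exact (smul_eq_zero.1 h1).resolve_left (by norm_num)

/-- The Bianchi identity turns the divergence of the curvature into momenta times contractions, and
these vanish with the Ricci tensor. -/
theorem sum_smul_momK (ht : IsHook t) (h : ∀ α β γ, momRicci v t α β γ = 0) (α β δ γ : Fin D) :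
    ∑ ζ, η ζ • v ζ • momK v t α β δ ζ γ = 0 := by
  have e : ∀ ζ, η ζ • v ζ • momK v t α β δ ζ γ = v α • η ζ • momK v t β δ ζ ζ γ +
      v β • η ζ • momK v t δ α ζ ζ γ + v δ • η ζ • momK v t α β ζ ζ γ := fun ζ => by
    unfold momK
    have h1 := momF_bianchi v ht α β δ ζ γ
    have h2 := momF_bianchi v ht α β δ ζ ζ
    linear_combination (norm := module) η ζ • v ζ • h1 - η ζ • v γ • h2
  simp only [e, Finset.sum_add_distrib, ← Finset.smul_sum, sum_momK v h, smul_zero, add_zero]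

/-- In its last two indices the curvature is also a curl, so the square of the momentum times it is
the curl of its divergence, which is zero. -/
theorem momSq_smul_momK (ht : IsHook t) (h : ∀ α β γ, momRicci v t α β γ = 0)
    (α β δ ε γ : Fin D) : momSq v • momK v t α β δ ε γ = 0 := by
  have e : ∀ ζ, η ζ • v ζ • v ζ • momK v t α β δ ε γ =
      v ε • η ζ • v ζ • momK v t α β δ ζ γ - v γ • η ζ • v ζ • momK v t α β δ ζ ε := fun ζ => by
    unfold momK
    module
  simp only [momSq_smul, e, Finset.sum_sub_distrib, ← Finset.smul_sum, sum_smul_momK v ht h,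
    smul_zero, sub_zero]

end Curvature

/-! ### Integrating a field strength of pure gauge type -/

section Gauge

variable {H : Type*} [AddCommGroup H] [Module ℝ H] (J : Finset (Fin D))

/-- Evaluation at one unit vector along `J` suffices; the signature of the metric is irrelevant for
being nonzero as a polynomial. -/
theorem momSq_momVec_ne_zero (hJ : 1 ≤ J.card) : momSq (momVec J) ≠ 0 := by
  obtain ⟨μ, hμ⟩ := Finset.card_pos.1 hJ
  intro h
  have h1 := congrArg (MvPolynomial.eval (Pi.single μ 1)) h
  rw [momSq, map_sum, map_zero] at h1
  have h3 : ∀ μ : Fin D, η μ ≠ 0 := fun μ => by unfold η; split_ifs <;> norm_num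
  rw [Finset.sum_eq_single μ] at h1
  · simp [momVec, hμ, h3] at h1
  · intro ν _ hν
    simp only [momVec, MvPolynomial.smul_eval, map_mul]
    split_ifs <;> simp [hν]
  · simp

variable {h : Fin D → Fin D → Fin D → Poly D ⊗[ℝ] H}

/-- The killing of the variables in `J`. -/
def lowDeg : Poly D ⊗[ℝ] H →ₗ[ℝ] Poly D ⊗[ℝ] H := diagT fun I => if degIn J I = 0 then 1 else 0

theorem lowDeg_momVec (ν : Fin D) (u : Poly D ⊗[ℝ] H) : lowDeg J (momVec J ν • u) = 0 := by
  unfold momVec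
  split_ifs with hν
  · rw [lowDeg, diagT_X_smul]
    have : ∀ I : MultiIdx D, ¬ degIn J (I + Finsupp.single ν 1) = 0 := fun I => by
      refine (Finset.sum_pos' (fun _ _ => by positivity) ⟨ν, hν, ?_⟩).ne'
      simp only [Finsupp.add_apply, Finsupp.single_eq_same]
      positivity
    simp only [this, if_false, diagT_const, zero_smul, smul_zero]
  · simp

theorem lowDeg_eq_self {u : Poly D ⊗[ℝ] H} (hu : shiftDeg J 0 u = 0) : lowDeg J u = u := by
  have h1 : diagT (fun I => (degIn J I)⁻¹) (shiftDeg J 0 u) = u - lowDeg J u := by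
    rw [shiftDeg, diagT_diagT, lowDeg]
    have h2 := diagT_add (fun I => (degIn J I)⁻¹ * (0 + degIn J I))
      (fun I => if degIn J I = 0 then 1 else 0) u
    have h3 : ∀ I : MultiIdx D, (degIn J I)⁻¹ * (0 + degIn J I) +
        (if degIn J I = 0 then 1 else 0) = 1 := fun I => by
      by_cases h : degIn J I = 0 <;> simp [h]
    simp only [h3, diagT_const, one_smul] at h2
    rw [eq_sub_iff_add_eq, ← h2]
  rw [hu, map_zero] at h1
  exact (sub_eq_zero.1 h1.symm).symm

/-- `G` inherits total antisymmetry and closedness from the field strength, so it should be a curl.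
With exactly three momenta Koszul exactness fails in this degree on the part of degree zero; the
cyclic identity of `h` shows that `G` has no such part. -/
theorem koszul_three (hJ : 3 ≤ J.card) (hh : IsHook h)
    {G : Fin D → Fin D → Fin D → Poly D ⊗[ℝ] H}
    (hG : ∀ α β δ γ, momF (momVec J) h α β δ γ = momVec J γ • G α β δ) :
    ∃ a : Fin D → Fin D → Poly D ⊗[ℝ] H, (∀ α β, a β α = -a α β) ∧
      ∀ α β δ, G α β δ = momVec J α • a β δ + momVec J β • a δ α + momVec J δ • a α β := by
  have hr : (3 : ℝ) ≤ J.card := by exact_mod_cast hJ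
  -- Multiplication by the momentum along `κ` is injective; identities of the field strength with
  -- last index `κ` can thus be divided to give identities of `G`.
  obtain ⟨κ, hκ⟩ := Finset.card_pos.1 (by omega : 0 < J.card)
  have cancel : ∀ {x y : Poly D ⊗[ℝ] H}, momVec J κ • x = momVec J κ • y → x = y := by
    intro x y hxy
    have h0 : momVec J κ ≠ 0 := by rw [momVec, if_pos hκ]; exact MvPolynomial.X_ne_zero _
    exact smul_right_injective (Poly D ⊗[ℝ] H) h0 hxy
  have Grot : ∀ α β δ, G β δ α = G α β δ := fun α β δ => cancel (by
    rw [← hG, ← hG, momF_rotate])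
  have Gswap : ∀ α β δ, G β α δ = -G α β δ := fun α β δ => cancel (by
    rw [smul_neg, ← hG, ← hG, momF_swap _ hh])
  have Gcl : ∀ α β δ ζ, momVec J ζ • G α β δ =
      momVec J α • G ζ β δ + momVec J β • G ζ δ α + momVec J δ • G ζ α β := fun α β δ ζ =>
    cancel (by
      have := momF_bianchi (momVec J) hh α β δ ζ κ
      rw [hG, hG, hG, hG, Grot ζ β δ, Grot ζ δ α, Grot ζ α β] at this
      linear_combination (norm := module) this)
  choose a ha using fun β δ => exists_shiftDeg J (c := J.card - indic J β - indic J δ)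
    (by linarith [indic_le J β, indic_le J δ]) (∑ μ ∈ J, dmom μ (G μ β δ))
  refine ⟨a, fun α β => ?_, fun α β δ => ?_⟩
  · refine shiftDeg_injective J (c := J.card - indic J α - indic J β)
      (by linarith [indic_le J α, indic_le J β]) ?_
    have := ha β α
    rw [show (J.card - indic J β - indic J α : ℝ) = J.card - indic J α - indic J β by ring] at this
    rw [this, map_neg, ha α β, ← Finset.sum_neg_distrib]
    refine Finset.sum_congr rfl fun μ _ => ?_
    rw [← map_neg, ← Grot, Gswap, Grot]
  set c : ℝ := J.card - indic J α - indic J β - indic J δ with hc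
  have key : shiftDeg J c (G α β δ) =
      shiftDeg J c (momVec J α • a β δ + momVec J β • a δ α + momVec J δ • a α β) := by
    have h1 := sum_dmom_self J (G α β δ)
    simp only [Gcl α β δ, map_add, Finset.sum_add_distrib, sum_dmom_momVec] at h1
    rw [← ha, ← ha, ← ha] at h1
    simp only [map_add, shiftDeg_momVec]
    rw [show c + indic J α = J.card - indic J β - indic J δ by rw [hc]; ring,
      show c + indic J β = J.card - indic J δ - indic J α by rw [hc]; ring,
      show c + indic J δ = J.card - indic J α - indic J β by rw [hc]; ring]
    have h2 := shiftDeg_add J (indic J α + indic J β + indic J δ) c (G α β δ)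
    rw [show indic J α + indic J β + indic J δ + c = J.card by rw [hc]; ring, ← h1,
      Grot α β δ, ← Grot δ α β] at h2
    linear_combination (norm := module) -h2
  -- The remaining case is `c = 0`: exactly three momenta, with `α`, `β`, `δ` all in `J`. There
  -- `key` determines `G α β δ` only up to a term of degree zero in `J`.
  by_cases hpos : 0 < c
  · exact shiftDeg_injective J hpos key
  have hα := indic_le J α
  have hβ := indic_le J β
  have hδ := indic_le J δ
  have hc0 : c = 0 := by linarith
  have hα1 : indic J α = 1 := by linarith
  have hβ1 : indic J β = 1 := by linarith
  have hδ1 : indic J δ = 1 := by linarith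
  rw [hc0] at key
  set y := momVec J α • a β δ + momVec J β • a δ α + momVec J δ • a α β with hy
  have h0 : shiftDeg J 0 (G α β δ - y) = 0 := by rw [map_sub, key, sub_self]
  have h1 : shiftDeg J J.card (G α β δ - y) = (J.card : ℝ) • (G α β δ - y) := by
    have := shiftDeg_add J J.card 0 (G α β δ - y)
    rwa [add_zero, h0, add_zero] at this
  -- Euler's identity for `G` is rewritten through the field strength. Its terms without a momentum
  -- in front add up to the cyclic sum of `h`, so the part of degree zero vanishes.
  have h2 := sum_dmom_self J (G α β δ)
  simp only [← hG, momF, map_add, Finset.sum_add_distrib, sum_dmom_momVec, hα1, hβ1, hδ1,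
    one_smul] at h2
  have h3 : lowDeg J (shiftDeg J J.card (G α β δ)) = 0 := by
    rw [← h2]
    have h4 := hh.2 α β δ
    have : ∀ x y z a b c : Poly D ⊗[ℝ] H, x + y + z = 0 → y + a + (z + b) + (x + c) = a + b + c :=
      fun x y z a b c e => by linear_combination (norm := module) e
    rw [this _ _ _ _ _ _ h4]
    simp only [map_add, lowDeg_momVec, add_zero]
  have h5 : lowDeg J (shiftDeg J J.card y) = 0 := by
    simp only [hy, map_add, shiftDeg_momVec, lowDeg_momVec, add_zero]
  rw [map_sub] at h1
  have h6 := congrArg (lowDeg J) h1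
  rw [map_sub, h3, h5, map_smul, lowDeg_eq_self J h0, sub_zero] at h6
  exact sub_eq_zero.1 ((smul_eq_zero.1 h6.symm).resolve_left (by linarith))

end Gauge

/-! ### Exactness of the gauge complex in momentum space -/

section Exactness

/-- The basis of hook tensors with constant polynomials as components. -/
def basisPoly (j : HookIdx D) (α β γ : Fin D) : Poly D := algebraMap ℝ (Poly D) (hookBasis j α β γ)

theorem isHook_basisPoly (j : HookIdx D) : IsHook (basisPoly j) :=
  ⟨fun α β γ => by simp only [basisPoly, (isHook_hookBasis j).1 α β γ, map_neg],
    fun α β γ => by simp only [basisPoly, ← map_add, (isHook_hookBasis j).2 α β γ, map_zero]⟩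

theorem IsHook.sum_poly_smul {M : Type*} [AddCommGroup M] [Module ℝ M] [Module (Poly D) M]
    [IsScalarTower ℝ (Poly D) M] {t : Fin D → Fin D → Fin D → Poly D} (ht : IsHook t)
    (Y : Fin D → Fin D → Fin D → M) :
    ∑ α, ∑ β, ∑ γ, t α β γ • Y α β γ = ∑ i, t i.1.1 i.1.2.1 i.1.2.2 • hookCoef Y i := by
  simp only [hookCoef, Finset.smul_sum]
  symm
  rw [Finset.sum_comm]
  refine Finset.sum_congr rfl fun α _ => ?_
  rw [Finset.sum_comm]
  refine Finset.sum_congr rfl fun β _ => ?_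
  rw [Finset.sum_comm]
  refine Finset.sum_congr rfl fun γ _ => ?_
  rw [← ht.hookComp_eq α β γ, hookComp_eq_sum, Finset.sum_smul]
  refine Finset.sum_congr rfl fun i _ => ?_
  rw [smul_assoc, smul_comm]

/-- The matrix of the field equations. -/
def eomMat (v : Fin D → Poly D) (i j : HookIdx D) : Poly D :=
  momEom v (basisPoly j) i.1.1 i.1.2.1 i.1.2.2

/-- The matrix of the gauge transformations. -/
def gaugeMat (v : Fin D → Poly D) (i : HookIdx D) (α β : Fin D) : Poly D :=
  (-6 : ℝ) • ∑ γ, hookBasis i γ α β • v γ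

section Module

variable {M : Type*} [AddCommGroup M] [Module ℝ M] [Module (Poly D) M] [IsScalarTower ℝ (Poly D) M]
variable (v : Fin D → Poly D)

theorem sum_gaugeMat (i : HookIdx D) (l : Fin D → Fin D → M) :
    ∑ α, ∑ β, gaugeMat v i α β • l α β = (-6 : ℝ) • hookCoef (fun γ α β => v γ • l α β) i := by
  simp only [gaugeMat, hookCoef, smul_assoc, Finset.sum_smul, ← Finset.smul_sum]
  congr 1
  exact sum_rotate' fun γ α β => hookBasis i γ α β • v γ • l α β

/-- The field equations are gauge invariant. -/
theorem sum_eomMat_gaugeMat (j : HookIdx D) (α β : Fin D) :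
    ∑ i, eomMat v i j * gaugeMat v i α β = 0 := by
  have ht := isHook_basisPoly j
  have h1 := fun i => sum_gaugeMat (M := Poly D) v i
    (fun a b => if a = α then if b = β then 1 else 0 else 0)
  simp only [smul_eq_mul, mul_ite, mul_one, mul_zero, Finset.sum_ite_eq', Finset.mem_univ, if_true,
    Finset.sum_ite_irrel, Finset.sum_const_zero] at h1
  simp only [h1, mul_smul_comm, ← Finset.smul_sum]
  have h2 := (isHook_momEom v ht).sum_poly_smul (M := Poly D)
    (fun γ a b => if a = α then if b = β then v γ else 0 else 0)
  have h3 := sum_smul_momEom v ht α β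
  simp only [smul_eq_mul] at h2 h3
  simp only [eomMat]
  rw [← h2]
  simp only [mul_ite, mul_zero, Finset.sum_ite_eq', Finset.mem_univ, if_true,
    Finset.sum_ite_irrel, Finset.sum_const_zero]
  simp only [mul_comm _ (v _), h3, smul_zero]

/-- Self-adjointness: the pairing of a basis tensor with the equations of `h` equals the pairing of
the equations of the basis tensor, that is a column of `eomMat`, with `h`. -/
theorem hookCoef_momEom {h : Fin D → Fin D → Fin D → M} (hh : IsHook h) (j : HookIdx D) :
    hookCoef (momEom v h) j = ∑ i, eomMat v i j • hookCoef h i := by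
  have h1 := sum_momEom_pair_symm v (LinearMap.lsmul (Poly D) M) (isHook_basisPoly j) hh
  simp only [LinearMap.lsmul_apply] at h1
  rw [(isHook_momEom v (isHook_basisPoly j)).sum_poly_smul h] at h1
  simp only [eomMat]
  rw [h1, hookCoef]
  simp only [basisPoly, algebraMap_smul]

-- Put `c` on the independent components, zero elsewhere, and project. Projection does not change
-- the pairings, and `hookBasis` is dual to the independent components.
set_option linter.unusedSectionVars false in
theorem exists_isHook_hookCoef (c : HookIdx D → M) : ∃ h, IsHook h ∧ ∀ i, hookCoef h i = c i := by
  let Y : Fin D → Fin D → Fin D → M := fun α β γ =>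
    ∑ k : HookIdx D, if k.1.1 = α then if k.1.2.1 = β then if k.1.2.2 = γ then c k else 0 else 0 else 0
  refine ⟨hookProj Y, isHook_hookProj Y, fun i => ?_⟩
  rw [hookCoef_hookProj, hookCoef]
  simp only [Y, Finset.smul_sum]
  have h1 : ∀ k : HookIdx D, ∑ α, ∑ β, ∑ γ, hookBasis i α β γ •
      (if k.1.1 = α then if k.1.2.1 = β then if k.1.2.2 = γ then c k else 0 else 0 else 0) =
      hookBasis i k.1.1 k.1.2.1 k.1.2.2 • c k := fun k => by
    simp only [smul_ite, smul_zero, Finset.sum_ite_eq, Finset.mem_univ, if_true,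
      Finset.sum_ite_irrel, Finset.sum_const_zero]
  have h2 : ∀ k : HookIdx D, hookBasis i k.1.1 k.1.2.1 k.1.2.2 = if k = i then 1 else 0 := fun k => by
    rw [hookBasis, hookComp, dif_pos k.2.1, dif_pos k.2.2]
    rw [show (⟨(k.1.1, k.1.2.1, k.1.2.2), _⟩ : HookIdx D) = k from rfl, Pi.single_apply]
    simp only [eq_comm]
  have h3 : ∑ α, ∑ β, ∑ γ, ∑ k : HookIdx D, hookBasis i α β γ •
      (if k.1.1 = α then if k.1.2.1 = β then if k.1.2.2 = γ then c k else 0 else 0 else 0) =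
      ∑ k : HookIdx D, ∑ α, ∑ β, ∑ γ, hookBasis i α β γ •
      (if k.1.1 = α then if k.1.2.1 = β then if k.1.2.2 = γ then c k else 0 else 0 else 0) := by
    exact (Finset.sum_congr rfl fun α _ => (Finset.sum_congr rfl fun β _ =>
      Finset.sum_comm).trans Finset.sum_comm).trans Finset.sum_comm
  rw [h3]
  simp only [h1, h2, ite_smul, one_smul, zero_smul, Finset.sum_ite_eq', Finset.mem_univ, if_true]

end Module

/-- The hook projection identifies the different index placements of a gauge transformation; the
numerical factors are those that the `-6` in `gaugeMat` imposes on the parameter. -/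
theorem hookProj_gauge {M : Type*} [AddCommGroup M] [Module ℝ M]
    (A S : Fin D → Fin D → Fin D → M) (hA : ∀ p q r, A p r q = -A p q r) (x y z : Fin D) :
    hookProj (fun α β γ => A γ α β + S α γ β - S β γ α) x y z =
      (-6 : ℝ) • hookProj (fun γ α β => (-1 / 3 : ℝ) • (S γ β α - A γ α β)) x y z := by
  simp only [hookProj, hA x y z, hA y z x, hA z x y]
  module

variable {H : Type*} [AddCommGroup H] [Module ℝ H] (J : Finset (Fin D))

/-- Solutions of the field equations in momentum space are pure gauge. -/
theorem exists_gauge (hD : 4 < D) (hJ : 3 ≤ J.card) (c : HookIdx D → Poly D ⊗[ℝ] H)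
    (hc : ∀ j, ∑ i, eomMat (momVec J) i j • c i = 0) :
    ∃ l : Fin D → Fin D → Poly D ⊗[ℝ] H,
      ∀ i, c i = ∑ α, ∑ β, gaugeMat (momVec J) i α β • l α β := by
  obtain ⟨h, hh, hci⟩ := exists_isHook_hookCoef c
  set v := momVec J with hv
  have h1 : ∀ α β γ, momEom v h α β γ = 0 := fun α β γ => by
    rw [← (isHook_momEom v hh).hookProj_eq]
    refine hookProj_eq_zero (fun j => ?_) α β γ
    rw [hookCoef_momEom v hh]
    simp only [hci, hc]
  have h2 := momRicci_eq_zero v hD h1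
  -- The curvature is annihilated by the nonzero polynomial `momSq v`, and the module of polynomials
  -- with coefficients has no torsion.
  have h3 : ∀ α β δ ε γ, v ε • momF v h α β δ γ = v γ • momF v h α β δ ε := fun α β δ ε γ =>
    sub_eq_zero.1 ((smul_eq_zero.1 (momSq_smul_momK v hh h2 α β δ ε γ)).resolve_left
      (momSq_momVec_ne_zero J (by omega)))
  choose G hG using fun α β δ => koszul_one J (by omega) (h3 α β δ)
  obtain ⟨a, ha, hGa⟩ := koszul_three J hJ hh hG
  -- Once the field strength is the momentum times a curl, `h` minus the momentum times the
  -- potential is closed in its first two indices.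
  have h4 : ∀ γ, ∃ s : Fin D → Poly D ⊗[ℝ] H, ∀ α β,
      h α β γ - v γ • a α β = v α • s β - v β • s α := fun γ => by
    refine koszul_two J hJ (fun α β => ?_) fun α β δ => ?_
    · rw [hh.1 α β, ha α β]; module
    · have h5 := hG α β δ γ
      rw [hGa, momF] at h5
      linear_combination (norm := module) h5
  choose s hs using h4
  refine ⟨fun α β => (-1 / 3 : ℝ) • (s β α - a α β), fun i => ?_⟩
  refine Eq.trans ?_ (sum_gaugeMat v i _).symm
  rw [← hci, ← hookCoef_hookProj h, 
    ← hookCoef_hookProj fun γ α β => v γ • (-1 / 3 : ℝ) • (s β α - a α β)]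
  have e : (-6 : ℝ) • hookCoef (hookProj fun γ α β => v γ • (-1 / 3 : ℝ) • (s β α - a α β)) i =
      hookCoef (fun x y z => (-6 : ℝ) •
        hookProj (fun γ α β => v γ • (-1 / 3 : ℝ) • (s β α - a α β)) x y z) i := by
    simp only [hookCoef, Finset.smul_sum, smul_comm (-6 : ℝ)]
  rw [e]
  congr 1
  funext x y z
  have e2 : h = fun α β γ => v γ • a α β + v α • s γ β - v β • s γ α := by
    funext α β γ
    rw [add_sub_assoc, ← hs]; abel
  rw [e2]
  simp only [smul_comm (v _) (-1 / 3 : ℝ), smul_sub (v _)]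
  exact hookProj_gauge (fun p q r => v p • a q r) (fun p q r => v p • s q r)
    (fun p q r => by rw [ha q r, smul_neg]) x y z

end Exactness

/-! ### Totally antisymmetric curls -/

section Antisymmetric

/-- If the curl of `Z` in its first index is totally antisymmetric, then it is constant. -/
theorem map_curl_eq_zero {V : Type*} [AddCommGroup V] [Module ℝ V] {p : Fin D → V →ₗ[ℝ] V}
    (hp : ∀ α β x, p α (p β x) = p β (p α x)) {Z : Fin D → Fin D → V}
    (hZ : ∀ α β γ, p γ (Z α β) - p α (Z γ β) = p α (Z β γ) - p β (Z α γ)) (α β γ δ : Fin D) :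
    p δ (p γ (Z α β) - p α (Z γ β)) = 0 := by
  obtain ⟨U, hU⟩ : ∃ U : Fin D → Fin D → Fin D → Fin D → V,
      ∀ ε x y z, U ε x y z = p ε (p x (Z y z) - p y (Z x z)) := ⟨_, fun _ _ _ _ => rfl⟩
  have closed : ∀ α β γ δ, U δ γ α β + U γ α δ β + U α δ γ β = 0 := fun α β γ δ => by
    simp only [hU, map_sub, hp δ, hp γ α]; abel
  have cyc : ∀ ε x y z, U ε x y z = U ε y z x := fun ε x y z => by rw [hU, hU, hZ]
  have anti : ∀ ε x y z, U ε y x z = -U ε x y z := fun ε x y z => by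
    rw [hU, hU, ← map_neg, neg_sub]
  -- `U` is antisymmetric in its last three indices, and its sum over cyclic permutations of the
  -- first three vanishes. Up to sign only four components occur; the four relations express
  -- closedness in terms of them and force each to vanish.
  have i1 := closed α β γ δ
  have i2 : U β γ α δ - U γ α δ β - U α δ γ β = 0 := by
    have := closed α δ γ β
    rw [anti γ β α, cyc γ β α, anti α γ β, ← cyc α δ γ] at this
    rw [← this]; abel
  have i3 : -U δ γ α β + U β γ α δ - U α δ γ β = 0 := by
    have := closed α γ β δ
    rw [anti δ α β, ← cyc δ γ α, ← cyc β γ α, anti α β δ, cyc α β δ, cyc α δ γ, cyc α γ β,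
      ← cyc α γ β, ← cyc α δ γ] at this
    rw [← this]; abel
  have i4 : -U δ γ α β - U γ α δ β + U β γ α δ = 0 := by
    have := closed β α γ δ
    rw [anti δ β γ, anti γ δ β] at this
    rw [cyc δ γ α β, cyc δ α β γ, cyc γ α δ β, cyc β γ α δ, cyc β α δ γ, ← this]
    abel
  have h3 : (3 : ℝ) • U δ γ α β = 0 := by
    linear_combination (norm := module) i1 + (2 : ℝ) • i2 - i3 - i4
  rw [← hU]
  exact (smul_eq_zero.1 h3).resolve_left (by norm_num)

end Antisymmetric

/-! ### Reducibility, and setting momenta to zero -/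

section Kill

variable {H : Type*} [AddCommGroup H] [Module ℝ H]

theorem momVec_univ : momVec (Finset.univ : Finset (Fin D)) = MvPolynomial.X :=
  funext fun μ => by simp [momVec]

theorem X_smul_injective (μ : Fin D) :
    Function.Injective fun u : Poly D ⊗[ℝ] H => (MvPolynomial.X μ : Poly D) • u :=
  smul_right_injective _ (MvPolynomial.X_ne_zero _)

-- The hypotheses are the vanishing of a hook projection at two cyclically related index triples;
-- their difference shows that the curl is invariant under cyclic permutations.
set_option linter.unusedSectionVars false in
theorem curl_aux (a b c d e f : H)
    (h : (1 / 6 : ℝ) • ((2 : ℝ) • (a - b) - (c - d) - (e - f)) = 0)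
    (h' : (1 / 6 : ℝ) • ((2 : ℝ) • (c - d) - (e - f) - (a - b)) = 0) : a - b = c - d := by
  linear_combination (norm := module) (2 : ℝ) • h - (2 : ℝ) • h'

/-- Gauge parameters with vanishing gauge transformation. -/
theorem exists_gauge_gauge (hD : 4 < D) (l : Fin D → Fin D → Poly D ⊗[ℝ] H)
    (hl : ∀ i, ∑ α, ∑ β, gaugeMat MvPolynomial.X i α β • l α β = 0) :
    ∃ c : Fin D → Poly D ⊗[ℝ] H, ∀ α β, l α β = (MvPolynomial.X α : Poly D) • c β := by
  have h1 : ∀ γ α β, hookProj (fun γ α β => (MvPolynomial.X γ : Poly D) • l α β) γ α β = 0 :=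
    hookProj_eq_zero fun i => by
      have := hl i
      have := (sum_gaugeMat (M := Poly D ⊗[ℝ] H) MvPolynomial.X i l).symm.trans this
      exact (smul_eq_zero.1 this).resolve_left (by norm_num)
  let p : Fin D → Poly D ⊗[ℝ] H →ₗ[ℝ] Poly D ⊗[ℝ] H := fun μ =>
    Algebra.lsmul ℝ ℝ (Poly D ⊗[ℝ] H) (MvPolynomial.X μ : Poly D)
  have h2 : ∀ α β γ δ, p δ (p γ (l α β) - p α (l γ β)) = 0 := by
    refine map_curl_eq_zero (fun α β x => ?_) fun α β γ => ?_
    · exact smul_comm _ _ _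
    · have e1 := h1 γ α β
      have e2 := h1 α β γ
      simp only [hookProj] at e1 e2
      simp only [p, Algebra.lsmul_coe]
      exact curl_aux _ _ _ _ _ _ e1 e2
  have h3 : ∀ β, ∃ c : Poly D ⊗[ℝ] H, ∀ α, l α β = momVec Finset.univ α • c := fun β => by
    refine koszul_one _ (by rw [Finset.card_univ, Fintype.card_fin]; omega) fun γ α => ?_
    rw [momVec_univ]
    exact sub_eq_zero.1 (X_smul_injective (⟨0, by omega⟩ : Fin D)
      ((h2 α β γ ⟨0, by omega⟩).trans (smul_zero _).symm))
  choose c hc using h3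
  exact ⟨c, fun α β => by rw [hc, momVec_univ]⟩

/-- Setting one momentum to zero. -/
def killVar (μ : Fin D) : Poly D →ₐ[ℝ] Poly D :=
  MvPolynomial.aeval fun ν => if ν = μ then 0 else MvPolynomial.X ν

/-- Setting one momentum to zero, on a tensor product. -/
def kill (μ : Fin D) : Poly D ⊗[ℝ] H →ₗ[ℝ] Poly D ⊗[ℝ] H :=
  LinearMap.rTensor H (killVar μ).toLinearMap

theorem kill_smul (μ : Fin D) (p : Poly D) (u : Poly D ⊗[ℝ] H) :
    kill μ (p • u) = killVar μ p • kill μ u := by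
  induction u using TensorProduct.induction_on with
  | zero => simp
  | add u w hu hw => simp only [smul_add, map_add, hu, hw]
  | tmul q h => simp [kill, TensorProduct.smul_tmul']

theorem killVar_X_self (μ : Fin D) : killVar μ (MvPolynomial.X μ) = 0 := by
  simp [killVar]

theorem kill_X_smul (μ : Fin D) (u : Poly D ⊗[ℝ] H) :
    kill μ ((MvPolynomial.X μ : Poly D) • u) = 0 := by
  rw [kill_smul, killVar_X_self, zero_smul]

theorem killVar_killVar (μ : Fin D) (p : Poly D) : killVar μ (killVar μ p) = killVar μ p := by
  have : (killVar μ).comp (killVar μ) = killVar μ := MvPolynomial.algHom_ext fun ν => by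
    by_cases h : ν = μ <;> simp [killVar, h]
  exact AlgHom.congr_fun this p

theorem kill_kill (μ : Fin D) (u : Poly D ⊗[ℝ] H) : kill μ (kill μ u) = kill μ u := by
  induction u using TensorProduct.induction_on with
  | zero => simp
  | add u w hu hw => simp only [map_add, hu, hw]
  | tmul q h => simp [kill, killVar_killVar]

theorem exists_sub_killVar (μ : Fin D) (p : Poly D) :
    ∃ q, p - killVar μ p = MvPolynomial.X μ * q := by
  induction p using MvPolynomial.induction_on with
  | C a => exact ⟨0, by simp [killVar]⟩
  | add p q hp hq =>
    obtain ⟨a, ha⟩ := hp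
    obtain ⟨b, hb⟩ := hq
    exact ⟨a + b, by rw [map_add]; linear_combination ha + hb⟩
  | mul_X p ν hp =>
    obtain ⟨a, ha⟩ := hp
    by_cases h : ν = μ
    · subst h
      exact ⟨p, by rw [map_mul, killVar_X_self]; ring⟩
    · refine ⟨a * MvPolynomial.X ν, ?_⟩
      have : killVar μ (MvPolynomial.X ν) = MvPolynomial.X ν := by simp [killVar, h]
      rw [map_mul, this]
      linear_combination MvPolynomial.X ν * ha

/-- Division with remainder by a variable. It turns vanishing at zero momentum into divisibility. -/
theorem exists_sub_kill (μ : Fin D) (u : Poly D ⊗[ℝ] H) :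
    ∃ w, u - kill μ u = (MvPolynomial.X μ : Poly D) • w := by
  induction u using TensorProduct.induction_on with
  | zero => exact ⟨0, by simp⟩
  | add u w hu hw =>
    obtain ⟨a, ha⟩ := hu
    obtain ⟨b, hb⟩ := hw
    exact ⟨a + b, by rw [map_add, smul_add, ← ha, ← hb]; abel⟩
  | tmul q h =>
    obtain ⟨a, ha⟩ := exists_sub_killVar μ q
    refine ⟨a ⊗ₜ h, ?_⟩
    rw [TensorProduct.smul_tmul', smul_eq_mul, ← ha, TensorProduct.sub_tmul]
    rfl

theorem killVar_momVec (J : Finset (Fin D)) (μ ν : Fin D) :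
    killVar μ (momVec J ν) = momVec (J.erase μ) ν := by
  unfold momVec
  by_cases h : ν = μ
  · subst h
    by_cases h' : ν ∈ J <;> simp [h', killVar]
  · by_cases h' : ν ∈ J <;> simp [h, h', killVar]

theorem map_momEom (f : Poly D →ₐ[ℝ] Poly D) (v : Fin D → Poly D)
    (t : Fin D → Fin D → Fin D → Poly D) (α β γ : Fin D) : f (momEom v t α β γ) =
      momEom (fun μ => f (v μ)) (fun α β γ => f (t α β γ)) α β γ := by
  simp only [momEom, momTrace, momRicci, momE, momF, map_add, map_sub, map_smul, map_sum,
    smul_eq_mul, map_mul]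

theorem killVar_eomMat (J : Finset (Fin D)) (μ : Fin D) (i j : HookIdx D) :
    killVar μ (eomMat (momVec J) i j) = eomMat (momVec (J.erase μ)) i j := by
  simp only [eomMat, map_momEom, killVar_momVec, basisPoly, AlgHom.commutes]
  rfl

theorem killVar_gaugeMat (J : Finset (Fin D)) (μ : Fin D) (i : HookIdx D) (α β : Fin D) :
    killVar μ (gaugeMat (momVec J) i α β) = gaugeMat (momVec (J.erase μ)) i α β := by
  simp only [gaugeMat, map_smul, map_sum, killVar_momVec]

variable (J : Finset (Fin D))

/-- At `X_μ = 0` the hypothesis says that `h` solves the field equations in the remaining momenta,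
so it is pure gauge there. Lift the gauge transformation to all of `J` and subtract it: the
equations do not notice, and what is left of `h` is divisible by `X_μ`. -/
theorem exists_eomMat_of_X_smul (hD : 4 < D) {μ : Fin D} (hJ : 3 ≤ (J.erase μ).card)
    {l h : HookIdx D → Poly D ⊗[ℝ] H}
    (hl : ∀ j, (MvPolynomial.X μ : Poly D) • l j = ∑ i, eomMat (momVec J) i j • h i) :
    ∃ k : HookIdx D → Poly D ⊗[ℝ] H, ∀ j, l j = ∑ i, eomMat (momVec J) i j • k i := by
  have h1 : ∀ j, ∑ i, eomMat (momVec (J.erase μ)) i j • kill μ (h i) = 0 := fun j => by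
    have := congrArg (kill μ) (hl j)
    rw [kill_X_smul, map_sum] at this
    simpa only [kill_smul, killVar_eomMat] using this.symm
  obtain ⟨c, hc⟩ := exists_gauge (J.erase μ) hD hJ _ h1
  have h2 : ∀ i, ∃ k, h i - ∑ α, ∑ β, gaugeMat (momVec J) i α β • kill μ (c α β) =
      (MvPolynomial.X μ : Poly D) • k := fun i => by
    obtain ⟨k, hk⟩ := exists_sub_kill μ
      (h i - ∑ α, ∑ β, gaugeMat (momVec J) i α β • kill μ (c α β))
    refine ⟨k, ?_⟩
    rw [← hk, eq_comm, sub_eq_self, map_sub, ← kill_kill, hc]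
    simp only [map_sum, kill_smul, kill_kill, killVar_gaugeMat, Finset.erase_idem, sub_self]
  choose k hk using h2
  refine ⟨k, fun j => X_smul_injective μ ?_⟩
  simp only [hl, Finset.smul_sum, smul_comm (MvPolynomial.X μ : Poly D), ← hk, smul_sub,
    Finset.sum_sub_distrib]
  rw [eq_comm, sub_eq_self, Finset.sum_comm]
  refine Finset.sum_eq_zero fun α _ => ?_
  rw [Finset.sum_comm]
  refine Finset.sum_eq_zero fun β _ => ?_
  simp only [smul_smul, ← Finset.sum_smul, sum_eomMat_gaugeMat, zero_smul]

/-- Setting `X_μ` to zero removes `l'` and reduces to `exists_eomMat_of_X_smul` for `X_ν` with `μ`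
already erased. Two momenta are lost in total, so three must remain out of `D`. -/
theorem exists_eomMat_of_X_smul_sub (hD : 4 < D) {μ ν : Fin D} (hμν : ν ≠ μ)
    {l l' h : HookIdx D → Poly D ⊗[ℝ] H}
    (hl : ∀ j, (MvPolynomial.X ν : Poly D) • l j - (MvPolynomial.X μ : Poly D) • l' j =
      ∑ i, eomMat MvPolynomial.X i j • h i) :
    ∃ k w : HookIdx D → Poly D ⊗[ℝ] H, ∀ j, l j = ∑ i, eomMat MvPolynomial.X i j • k i +
      (MvPolynomial.X μ : Poly D) • w j := by
  have hX : killVar μ (MvPolynomial.X ν) = MvPolynomial.X ν := by simp [killVar, hμν]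
  have h1 : ∀ j, (MvPolynomial.X ν : Poly D) • kill μ (l j) =
      ∑ i, eomMat (momVec (Finset.univ.erase μ)) i j • kill μ (h i) := fun j => by
    have := congrArg (kill μ) (hl j)
    rw [map_sub, kill_X_smul, sub_zero, kill_smul, hX, map_sum] at this
    simpa only [kill_smul, ← momVec_univ, killVar_eomMat] using this
  obtain ⟨k, hk⟩ := exists_eomMat_of_X_smul (Finset.univ.erase μ) hD
    (by
      rw [Finset.card_erase_of_mem (by simp [hμν]), Finset.card_erase_of_mem (by simp),
        Finset.card_univ, Fintype.card_fin]
      omega) h1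
  have h2 : ∀ j, ∃ w, l j - ∑ i, eomMat MvPolynomial.X i j • k i =
      (MvPolynomial.X μ : Poly D) • w := fun j => by
    obtain ⟨w, hw⟩ := exists_sub_kill μ (l j - ∑ i, eomMat MvPolynomial.X i j • k i)
    refine ⟨w, ?_⟩
    rw [← hw, eq_comm, sub_eq_self, map_sub, ← kill_kill, hk]
    simp only [map_sum, kill_smul, killVar_eomMat, ← momVec_univ, Finset.erase_idem, sub_self]
  choose w hw using h2
  exact ⟨k, w, fun j => by rw [← hw]; abel⟩

/-- The counterpart for variables without field equations. -/
theorem exists_X_smul {μ ν : Fin D} (hμν : ν ≠ μ) {l l' : Poly D ⊗[ℝ] H}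
    (hl : (MvPolynomial.X ν : Poly D) • l = (MvPolynomial.X μ : Poly D) • l') :
    ∃ w, l = (MvPolynomial.X μ : Poly D) • w := by
  have hX : killVar μ (MvPolynomial.X ν) = MvPolynomial.X ν := by simp [killVar, hμν]
  have := congrArg (kill μ) hl
  rw [kill_X_smul, kill_smul, hX] at this
  obtain ⟨w, hw⟩ := exists_sub_kill μ l
  refine ⟨w, ?_⟩
  rw [← hw, X_smul_injective ν (this.trans (smul_zero _).symm), sub_zero]

end Kill

/-! ### From leading terms to filtered operators -/

section Filtered

/-- A grading by projections, with operators raising the degree by one. -/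
structure GradedBy {V : Type*} [AddCommGroup V] [Module ℝ V] (hp : ℕ → V →ₗ[ℝ] V)
    (U : Submodule ℝ V) : Prop where
  proj : ∀ m n v, hp m (hp n v) = if m = n then hp n v else 0
  ext : ∀ v, (∀ n, hp n v = 0) → v = 0
  bounded : ∀ v, ∃ m, ∀ n, m ≤ n → hp n v = 0
  mem : ∀ n, ∀ v ∈ U, hp n v ∈ U

variable {V : Type*} [AddCommGroup V] [Module ℝ V] {hp : ℕ → V →ₗ[ℝ] V} {U : Submodule ℝ V}

/-- The component of `X v + d v` one degree above the top of `v` involves `X` alone. So the top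
component of `v` lies in `U`; remove it and descend. -/
theorem GradedBy.mem_of_filtered (hg : GradedBy hp U) {X d : V →ₗ[ℝ] V}
    (hX : ∀ n v, hp (n + 1) (X v) = X (hp n v)) (hd : ∀ n v, hp n (d v) = d (hp n v))
    (hXU : ∀ v ∈ U, X v ∈ U) (hdU : ∀ v ∈ U, d v ∈ U) (h : ∀ v, X v ∈ U → v ∈ U) (v : V)
    (hv : X v + d v ∈ U) : v ∈ U := by
  obtain ⟨m, hm⟩ := hg.bounded v
  induction m generalizing v with
  | zero => rw [hg.ext v fun n => hm n (Nat.zero_le n)]; exact U.zero_mem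
  | succ m ih =>
    have h1 : hp m v ∈ U := h _ (by
      have := hg.mem (m + 1) _ hv
      rwa [map_add, hX, hd, hm _ le_rfl, map_zero, add_zero] at this)
    have h2 := ih (v - hp m v) (by
      rw [map_sub, map_sub, sub_add_sub_comm]
      exact U.sub_mem hv (U.add_mem (hXU _ h1) (hdU _ h1))) fun n hn => by
        rw [map_sub, hg.proj]
        split_ifs with e
        · rw [e, sub_self]
        · rw [hm n (by omega), sub_zero]
    have := U.add_mem h2 h1
    rwa [sub_add_cancel] at this

/-- Divisibility by `X + d` modulo `U` is again settled on the top components, where only `X` and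
`X'` contribute. After subtracting `X w + d w` and `X' w + d' w` the bound on the degree drops by
one. -/
theorem GradedBy.exists_of_filtered (hg : GradedBy hp U) {X d X' d' : V →ₗ[ℝ] V}
    (hX : ∀ n v, hp (n + 1) (X v) = X (hp n v)) (hd : ∀ n v, hp n (d v) = d (hp n v))
    (hX' : ∀ n v, hp (n + 1) (X' v) = X' (hp n v)) (hd' : ∀ n v, hp n (d' v) = d' (hp n v))
    (hX0 : ∀ v, hp 0 (X v) = 0)
    (hXU : ∀ v ∈ U, X v ∈ U) (hdU : ∀ v ∈ U, d v ∈ U)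
    (hXU' : ∀ v ∈ U, X' v ∈ U) (hdU' : ∀ v ∈ U, d' v ∈ U)
    (hXX : ∀ v, X (X' v) = X' (X v)) (hdd : ∀ v, d (d' v) = d' (d v))
    (hXd : ∀ v, X (d' v) = d' (X v)) (hdX : ∀ v, d (X' v) = X' (d v))
    (h : ∀ v, X v ∈ U → v ∈ U) (h' : ∀ v v', X' v - X v' ∈ U → ∃ w, v - X w ∈ U) (v v' : V)
    (hv : X' v + d' v - (X v' + d v') ∈ U) : ∃ w, v - (X w + d w) ∈ U := by
  obtain ⟨m, hm, hm'⟩ : ∃ m, (∀ n, m ≤ n → hp n v = 0) ∧ ∀ n, m ≤ n → hp n v' = 0 := by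
    obtain ⟨m, hm⟩ := hg.bounded v
    obtain ⟨m', hm'⟩ := hg.bounded v'
    exact ⟨max m m', fun n hn => hm n ((le_max_left _ _).trans hn),
      fun n hn => hm' n ((le_max_right _ _).trans hn)⟩
  induction m generalizing v v' with
  | zero => exact ⟨0, by rw [hg.ext v fun n => hm n (Nat.zero_le n)]; simp⟩
  | succ m ih =>
    have h0 : X' (hp m v) - X (hp m v') ∈ U := by
      have := hg.mem (m + 1) _ hv
      rwa [map_sub, map_add, map_add, hX, hX', hd, hd', hm _ le_rfl, hm' _ le_rfl, map_zero,
        map_zero, add_zero, add_zero] at this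
    -- Only the part of `w` one degree below `m` matters for the leading term; keeping just that
    -- part preserves the bound. For `m = 0` nothing in the image of `X` has this degree, and `w =
    -- 0` works.
    obtain ⟨w, hw, hwn⟩ : ∃ w, hp m v - X w ∈ U ∧ ∀ n, m ≤ n → hp n w = 0 := by
      obtain ⟨w, hw⟩ := h' _ _ h0
      have hw2 := hg.mem m _ hw
      rw [map_sub, hg.proj, if_pos rfl] at hw2
      cases m with
      | zero => exact ⟨0, by rwa [hX0, ← map_zero X] at hw2, fun n _ => map_zero _⟩
      | succ m =>
        refine ⟨hp m w, by rwa [hX] at hw2, fun n hn => ?_⟩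
        rw [hg.proj, if_neg (by omega)]
    -- The same `w` divides the top component of `v'`, because `X` is injective modulo `U`.
    have hw' : hp m v' - X' w ∈ U := h _ (by
      have := U.sub_mem (hXU' _ hw) h0
      rw [map_sub] at this ⊢
      rw [hXX]
      convert this using 1
      abel)
    set a := hp m v - X w with ha
    set b := hp m v' - X' w with hb
    have van : ∀ {Y e : V →ₗ[ℝ] V} {u : V} (hY : ∀ n v, hp (n + 1) (Y v) = Y (hp n v))
        (he : ∀ n v, hp n (e v) = e (hp n v)) (hu : ∀ n, m + 1 ≤ n → hp n u = 0)
        (hU : hp m u - Y w ∈ U) (n : ℕ) (hn : m ≤ n),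
        hp n (u - (Y w + e w) - (hp m u - Y w)) = 0 := by
      intro Y e u hY he hu hU n hn
      have e1 : hp n (e w) = 0 := by rw [he, hwn n hn, map_zero]
      cases n with
      | zero =>
        obtain rfl : m = 0 := by omega
        simp only [map_sub, map_add, hg.proj, if_true, e1]
        abel
      | succ n =>
        simp only [map_sub, map_add, hg.proj, e1, add_zero]
        split_ifs with e2
        · rw [← e2]; abel
        · rw [hu _ (by omega), hY, hwn n (by omega)]; simp
    obtain ⟨w', hw''⟩ := ih (v - (X w + d w) - a) (v' - (X' w + d' w) - b) (by
      have e := U.sub_mem hv (U.sub_mem (U.add_mem (hXU' _ hw) (hdU' _ hw))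
        (U.add_mem (hXU _ hw') (hdU _ hw')))
      convert e using 1
      simp only [map_sub, map_add, hXX, hdd, hXd, hdX]
      abel) (van hX hd hm hw) (van hX' hd' hm' hw')
    refine ⟨w + w', ?_⟩
    have e := U.add_mem hw'' hw
    convert e using 1
    simp only [map_add]
    abel

end Filtered

/-! ### Variables and linear forms in their jets -/

/-- The bosonic variables as a sum of the index types. -/
def evenVarEquiv : HookIdx D ⊕ Fin D ⊕ (Fin D × Fin D) ≃ EvenVar D where
  toFun := Sum.elim .T (Sum.elim .ghostC fun p => .antiC2 p.1 p.2)
  invFun z := match z with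
    | .T i => .inl i
    | .ghostC α => .inr (.inl α)
    | .antiC2 α β => .inr (.inr (α, β))
  left_inv := by rintro (i | α | p) <;> rfl
  right_inv := by rintro (i | α | ⟨α, β⟩) <;> rfl

/-- The fermionic variables as a sum of the index types. -/
def oddVarEquiv : {p : Fin D × Fin D // p.1 ≤ p.2} ⊕ {p : Fin D × Fin D // p.1 < p.2} ⊕
    HookIdx D ⊕ Fin D ≃ OddVar D where
  toFun := Sum.elim .ghostS (Sum.elim .ghostA (Sum.elim .antiT .antiC))
  invFun z := match z with
    | .ghostS i => .inl i
    | .ghostA i => .inr (.inl i)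
    | .antiT i => .inr (.inr (.inl i))
    | .antiC α => .inr (.inr (.inr α))
  left_inv := by rintro (i | i | i | α) <;> rfl
  right_inv := by rintro (i | i | i | α) <;> rfl

instance : Fintype (EvenVar D) := Fintype.ofEquiv _ evenVarEquiv

instance : Fintype (OddVar D) := Fintype.ofEquiv _ oddVarEquiv

theorem sum_evenVar {M : Type*} [AddCommMonoid M] (f : EvenVar D → M) :
    ∑ z, f z = ∑ i, f (.T i) + (∑ α, f (.ghostC α) + ∑ α, ∑ β, f (.antiC2 α β)) := by
  rw [← Equiv.sum_comp evenVarEquiv f, Fintype.sum_sum_type, Fintype.sum_sum_type,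
    Fintype.sum_prod_type]
  rfl

theorem sum_oddVar {M : Type*} [AddCommMonoid M] (f : OddVar D → M) :
    ∑ z, f z = ∑ i, f (.ghostS i) + (∑ i, f (.ghostA i) + (∑ i, f (.antiT i) +
      ∑ α, f (.antiC α))) := by
  rw [← Equiv.sum_comp oddVarEquiv f, Fintype.sum_sum_type, Fintype.sum_sum_type,
    Fintype.sum_sum_type]
  rfl

/-- The passage to the sealed copy of the algebra. -/
def toC : ConstForms D →ₗ[ℝ] CForm D where
  toFun a := a
  map_add' _ _ := rfl
  map_smul' _ _ := rfl

theorem toC_gen (z : Gen D) : toC (gen z) = cgen z := rfl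

/-- The variables without their derivatives. -/
abbrev Lab (D : ℕ) : Type := EvenVar D ⊕ OddVar D

/-- The generator `∂_I κ`. -/
def jet (I : MultiIdx D) : Lab D → Gen D
  | .inl z => .inl (I, z)
  | .inr z => .inr (.inl (I, z))

theorem gen_cases {p : Gen D → Prop} (hj : ∀ I κ, p (jet I κ)) (hx : ∀ μ, p (.inr (.inr μ)))
    (z : Gen D) : p z := by
  rcases z with ⟨I, z⟩ | ⟨I, z⟩ | μ
  · exact hj I (.inl z)
  · exact hj I (.inr z)
  · exact hx μ

theorem poly_ext {M : Type*} [AddCommGroup M] [Module ℝ M] {f g : Poly D →ₗ[ℝ] M}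
    (h : ∀ I : MultiIdx D, f (MvPolynomial.monomial I 1) = g (MvPolynomial.monomial I 1)) :
    f = g :=
  (MvPolynomial.basisMonomials (Fin D) ℝ).ext fun I => by
    simpa only [MvPolynomial.coe_basisMonomials] using h I

/-- The linear form `p(∂) κ` in the jets of a variable. -/
def lin (κ : Lab D) : Poly D →ₗ[ℝ] CForm D :=
  (MvPolynomial.basisMonomials (Fin D) ℝ).constr ℝ fun I => cgen (jet I κ)

theorem lin_monomial (κ : Lab D) (I : MultiIdx D) :
    lin κ (MvPolynomial.monomial I 1) = cgen (jet I κ) := by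
  rw [lin]
  have := (MvPolynomial.basisMonomials (Fin D) ℝ).constr_basis ℝ (fun I => cgen (jet I κ)) I
  simpa only [MvPolynomial.coe_basisMonomials] using this

theorem lin_mem {κ : Lab D} {U : Submodule ℝ (CForm D)} (h : ∀ I, cgen (jet I κ) ∈ U)
    (p : Poly D) : lin κ p ∈ U := by
  induction p using MvPolynomial.induction_on' with
  | add p q hp hq => rw [map_add]; exact U.add_mem hp hq
  | monomial I r =>
    rw [← mul_one r, ← smul_eq_mul, ← MvPolynomial.smul_monomial, map_smul, lin_monomial]
    exact U.smul_mem _ (h I)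

theorem lin_inl_mem (z : EvenVar D) (p : Poly D) : lin (.inl z) p ∈ evenPart D :=
  lin_mem (fun I => cgen_inl_mem (I, z)) p

theorem lin_inr_mem (z : OddVar D) (p : Poly D) : lin (.inr z) p ∈ oddPart D :=
  lin_mem (fun I => cgen_inr_mem (.inl (I, z))) p

theorem X_mul_monomial (μ : Fin D) (I : MultiIdx D) :
    (MvPolynomial.X μ : Poly D) * MvPolynomial.monomial I 1 =
      MvPolynomial.monomial (I + Finsupp.single μ 1) 1 := by
  rw [mul_comm, MvPolynomial.X, MvPolynomial.monomial_mul, mul_one]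

/-! ### Total derivatives -/

/-- The total derivative on forms without explicit dependence on the coordinates. -/
def tot (μ : Fin D) : CForm D →ₗ[ℝ] CForm D := der fun z => toC (shift μ z)

theorem tot_jet (μ : Fin D) (I : MultiIdx D) (κ : Lab D) :
    tot μ (cgen (jet I κ)) = cgen (jet (I + Finsupp.single μ 1) κ) := by
  rw [tot, der_cgen]
  cases κ <;> rfl

theorem tot_dx (μ ν : Fin D) : tot μ (cgen (.inr (.inr ν))) = 0 := by
  rw [tot, der_cgen]
  rfl

theorem tot_lin (μ : Fin D) (κ : Lab D) (p : Poly D) :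
    tot μ (lin κ p) = lin κ (MvPolynomial.X μ * p) := by
  have : tot μ ∘ₗ lin κ = lin κ ∘ₗ LinearMap.mulLeft ℝ (MvPolynomial.X μ) := poly_ext fun I => by
    simp only [LinearMap.comp_apply, LinearMap.mulLeft_apply, X_mul_monomial, lin_monomial,
      tot_jet]
  exact LinearMap.congr_fun this p

theorem parity_shift (μ : Fin D) :
    ParityPreserving (fun z => toC (shift μ z)) := by
  refine ⟨fun e => cgen_inl_mem _, fun o => ?_⟩
  rcases o with o | ν
  · exact cgen_inr_mem _
  · exact (oddPart D).zero_mem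

theorem tot_evenDer (μ : Fin D) : EvenDer (tot μ) := (parity_shift μ).evenDer

theorem tot_gradeInv (μ : Fin D) (a : CForm D) : tot μ (gradeInv a) = gradeInv (tot μ a) :=
  (parity_shift μ).der_gradeInv a

theorem tot_comm (μ ν : Fin D) (a : CForm D) : tot μ (tot ν a) = tot ν (tot μ a) := by
  have := ((tot_evenDer μ).comm (tot_evenDer ν)).ext IsDer.zero (gen_cases (fun I κ => by
    simp only [LinearMap.sub_apply, LinearMap.comp_apply, tot_jet, LinearMap.zero_apply,
      add_right_comm, sub_self]) fun ρ => by
    simp only [LinearMap.sub_apply, LinearMap.comp_apply, tot_dx, map_zero, LinearMap.zero_apply,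
      sub_self])
  exact sub_eq_zero.1 (LinearMap.congr_fun this a)

/-! ### The Koszul-Tate differential -/

/-- The matrix of the Koszul-Tate differential on the variables. -/
def ktMat : Lab D → Lab D → Poly D
  | .inl (.T j), .inr (.antiT i) => eomMat MvPolynomial.X i j
  | .inr (.antiT i), .inl (.antiC2 α β) => gaugeMat MvPolynomial.X i α β
  | .inl (.antiC2 α β), .inr (.antiC μ) => if β = μ then (2 : ℝ) • MvPolynomial.X α else 0
  | _, _ => 0

/-- The Koszul-Tate differential on forms without explicit dependence on the coordinates. -/
def kos : CForm D →ₗ[ℝ] CForm D := der fun z => toC (deltaGen z)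

/-! ### The field equations as linear forms in the jets -/

section Eom

/-- The linear forms in the jets of the field. -/
def linT (I : MultiIdx D) : (HookIdx D → Poly D) →ₗ[ℝ] CForm D :=
  ∑ j, lin (.inl (.T j)) ∘ₗ LinearMap.mulLeft ℝ (MvPolynomial.monomial I 1) ∘ₗ LinearMap.proj j

theorem linT_apply (I : MultiIdx D) (q : HookIdx D → Poly D) :
    linT I q = ∑ j, lin (.inl (.T j)) (MvPolynomial.monomial I 1 * q j) := by
  simp [linT]

theorem linT_shift (I : MultiIdx D) (μ : Fin D) (q : HookIdx D → Poly D) :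
    linT (I + Finsupp.single μ 1) q = linT I fun j => MvPolynomial.X μ * q j := by
  simp only [linT_apply, ← X_mul_monomial]
  refine Finset.sum_congr rfl fun j _ => ?_
  ring_nf

theorem hookComp_jet (I : MultiIdx D) (f : HookIdx D → Lab D) (α β γ : Fin D) :
    (hookComp (fun i => cgen (jet I (f i))) α β γ : CForm D) =
      ∑ i, lin (f i) (basisPoly i α β γ * MvPolynomial.monomial I 1) := by
  rw [hookComp_eq_sum]
  refine Finset.sum_congr rfl fun i _ => ?_
  rw [basisPoly, ← Algebra.smul_def, map_smul, lin_monomial]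

theorem toC_hookComp (c : HookIdx D → ConstForms D) (α β γ : Fin D) :
    toC (hookComp c α β γ) = hookComp (fun i => toC (c i)) α β γ :=
  map_hookComp toC.toAddMonoidHom c α β γ

theorem toC_T (I : MultiIdx D) (α β γ : Fin D) :
    toC (T I α β γ) = linT I fun j => basisPoly j α β γ := by
  rw [linT_apply, T, toC_hookComp]
  refine (hookComp_jet I (fun i => .inl (.T i)) α β γ).trans ?_
  simp only [mul_comm]

theorem toC_F (I : MultiIdx D) (α β γ δ : Fin D) :
    toC (F I α β γ δ) = linT I fun j => momF MvPolynomial.X (basisPoly j) α β γ δ := by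
  rw [F, map_add, map_add, toC_T, toC_T, toC_T, linT_shift, linT_shift, linT_shift, ← map_add,
    ← map_add]
  rfl

theorem toC_E (I : MultiIdx D) (α β δ ε γ : Fin D) :
    toC (E I α β δ ε γ) = linT I fun j => momE MvPolynomial.X (basisPoly j) α β δ ε γ := by
  rw [E, map_smul, map_sub, toC_F, toC_F, linT_shift, linT_shift, ← map_sub, ← map_smul]
  rfl

theorem toC_Ricci (I : MultiIdx D) (α β γ : Fin D) :
    toC (Ricci I α β γ) = linT I fun j => momRicci MvPolynomial.X (basisPoly j) α β γ := by
  simp only [Ricci, map_sum, map_smul, toC_E]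
  simp only [← map_smul, ← map_sum]
  congr 1
  funext j
  simp only [momRicci, Finset.sum_apply, Pi.smul_apply]

theorem toC_RicciTrace (I : MultiIdx D) (α : Fin D) :
    toC (RicciTrace I α) = linT I fun j => momTrace MvPolynomial.X (basisPoly j) α := by
  simp only [RicciTrace, map_sum, map_smul, toC_Ricci]
  simp only [← map_smul, ← map_sum]
  congr 1
  funext j
  simp only [momTrace, Finset.sum_apply, Pi.smul_apply]

theorem toC_eom (I : MultiIdx D) (α β γ : Fin D) :
    toC (eom I α β γ) = linT I fun j => momEom MvPolynomial.X (basisPoly j) α β γ := by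
  simp only [eom, map_smul, map_add, map_sub, toC_Ricci, toC_RicciTrace]
  simp only [← map_smul, ← map_sub, ← map_add]
  rfl

theorem toC_antiT (I : MultiIdx D) (α β γ : Fin D) :
    toC (antiT I α β γ) =
      ∑ i, lin (.inr (.antiT i)) (basisPoly i α β γ * MvPolynomial.monomial I 1) := by
  rw [antiT, toC_hookComp]
  exact hookComp_jet I (fun i => .inr (.antiT i)) α β γ

end Eom

theorem kos_dx (μ : Fin D) : kos (cgen (.inr (.inr μ))) = 0 := by
  rw [kos, der_cgen]
  exact map_zero toC

/-- The bridge from the tensorial definition of `deltaGen` to a matrix of polynomials in the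
derivatives. Parity, nilpotency and compatibility with total derivatives are read off the matrix. -/
theorem kos_jet (I : MultiIdx D) (κ : Lab D) :
    kos (cgen (jet I κ)) = ∑ κ', lin κ' (ktMat κ' κ * MvPolynomial.monomial I 1) := by
  rw [kos, der_cgen, Fintype.sum_sum_type, sum_evenVar, sum_oddVar]
  rcases κ with (i | α | ⟨α, β⟩) | (i | i | i | μ)
  · simp [jet, deltaGen, ktMat]
  · simp [jet, deltaGen, ktMat]
  · simp only [jet, deltaGen, ktMat, map_smul, map_sum, toC_antiT, zero_mul, map_zero,
      Finset.sum_const_zero, add_zero, zero_add, gaugeMat, smul_mul_assoc, Finset.sum_mul]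
    rw [← Finset.smul_sum, Finset.sum_comm]
    congr 1
    refine Finset.sum_congr rfl fun i _ => Finset.sum_congr rfl fun γ _ => ?_
    rw [basisPoly, ← Algebra.smul_def, map_smul, X_mul_monomial]
  · simp [jet, deltaGen, ktMat]
  · simp [jet, deltaGen, ktMat]
  · simp only [jet, deltaGen, ktMat, toC_eom, linT_apply, zero_mul, map_zero,
      Finset.sum_const_zero, add_zero, eomMat, mul_comm]
  · simp only [jet, deltaGen, ktMat, map_smul, map_sum, zero_mul, map_zero, ite_mul,
      Finset.sum_const_zero, add_zero, zero_add, smul_mul_assoc, apply_ite (lin _),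
      Finset.sum_ite_eq', Finset.mem_univ, if_true, ← Finset.smul_sum, X_mul_monomial,
      lin_monomial, antiC2, toC_gen]

theorem kos_lin (κ : Lab D) (p : Poly D) : kos (lin κ p) = ∑ κ', lin κ' (ktMat κ' κ * p) := by
  have : kos ∘ₗ lin κ = ∑ κ', lin κ' ∘ₗ LinearMap.mulLeft ℝ (ktMat κ' κ) := poly_ext fun I => by
    simp only [LinearMap.comp_apply, LinearMap.sum_apply, LinearMap.mulLeft_apply, lin_monomial,
      kos_jet]
  simpa only [LinearMap.comp_apply, LinearMap.sum_apply, LinearMap.mulLeft_apply] using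
    LinearMap.congr_fun this p

theorem ktMat_inl_inl (z z' : EvenVar D) : ktMat (.inl z) (.inl z') = 0 := by
  cases z <;> cases z' <;> rfl

theorem ktMat_inr_inr (z z' : OddVar D) : ktMat (.inr z) (.inr z') = 0 := by
  cases z <;> cases z' <;> rfl

theorem parity_deltaGen : ParityReversing (fun z : Gen D => toC (deltaGen z)) := by
  have h : ∀ I κ, toC (deltaGen (jet I κ)) =
      ∑ κ' : Lab D, lin κ' (ktMat κ' κ * MvPolynomial.monomial I 1) := fun I κ => by
    rw [← kos_jet, kos, der_cgen]
  constructor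
  · rintro ⟨I, z⟩
    change toC (deltaGen (jet I (.inl z))) ∈ _
    rw [h, Fintype.sum_sum_type]
    refine add_mem (sum_mem fun z' _ => ?_) (sum_mem fun z' _ => lin_inr_mem _ _)
    rw [ktMat_inl_inl, zero_mul, map_zero]
    exact zero_mem _
  · rintro (⟨I, z⟩ | μ)
    · change toC (deltaGen (jet I (.inr z))) ∈ _
      rw [h, Fintype.sum_sum_type]
      refine add_mem (sum_mem fun z' _ => lin_inl_mem _ _) (sum_mem fun z' _ => ?_)
      rw [ktMat_inr_inr, zero_mul, map_zero]
      exact zero_mem _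
    · change toC 0 ∈ _
      rw [map_zero]
      exact zero_mem _

theorem kos_oddDer : OddDer (kos : CForm D →ₗ[ℝ] CForm D) := parity_deltaGen.oddDer

theorem kos_gradeInv (a : CForm D) : kos (gradeInv a) = -gradeInv (kos a) :=
  parity_deltaGen.der_gradeInv a

theorem kos_tot (μ : Fin D) (a : CForm D) : kos (tot μ a) = tot μ (kos a) := by
  have := ((tot_evenDer μ).comm_odd kos_oddDer (tot_gradeInv μ)).ext IsDer.zero
    (gen_cases (fun I κ => by
      simp only [LinearMap.sub_apply, LinearMap.comp_apply, tot_jet, LinearMap.zero_apply, kos_jet,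
        map_sum, tot_lin, mul_left_comm (MvPolynomial.X _), X_mul_monomial, sub_self]) fun ρ => by
      simp only [LinearMap.sub_apply, LinearMap.comp_apply, tot_dx, kos_dx, map_zero,
        LinearMap.zero_apply, sub_self])
  exact (sub_eq_zero.1 (LinearMap.congr_fun this a)).symm

theorem sum_eq_zero_of_swap {M : Type*} [AddCommGroup M] [Module ℝ M] {f : Fin D → Fin D → M}
    (h : ∀ α β, f β α = -f α β) : ∑ α, ∑ β, f α β = 0 := by
  have h1 : ∑ α, ∑ β, f α β = -∑ α, ∑ β, f α β := by
    rw [← Finset.sum_neg_distrib, Finset.sum_comm]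
    refine Finset.sum_congr rfl fun α _ => ?_
    rw [← Finset.sum_neg_distrib]
    exact Finset.sum_congr rfl fun β _ => h α β
  have h2 : (2 : ℝ) • ∑ α, ∑ β, f α β = 0 := by
    rw [two_smul]; nth_rw 1 [h1]; exact neg_add_cancel _
  exact (smul_eq_zero.1 h2).resolve_left (by norm_num)

/-- The reducibility of the gauge transformations. -/
theorem sum_gaugeMat_X (i : HookIdx D) (μ : Fin D) :
    ∑ α, gaugeMat MvPolynomial.X i α μ * (MvPolynomial.X α : Poly D) = 0 := by
  simp only [gaugeMat, smul_mul_assoc, Finset.sum_mul, ← Finset.smul_sum]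
  rw [sum_eq_zero_of_swap fun α γ => ?_, smul_zero]
  rw [(isHook_hookBasis i).1 γ α, neg_smul, mul_comm]

/-- Only two compositions are not zero for trivial reasons: gauge invariance of the field equations
and reducibility of the gauge transformations. -/
theorem sum_ktMat (κ κ'' : Lab D) : ∑ κ', ktMat κ'' κ' * ktMat κ' κ = 0 := by
  rw [Fintype.sum_sum_type, sum_evenVar, sum_oddVar]
  rcases κ with (i | α | ⟨α, β⟩) | (i | i | i | μ) <;>
    rcases κ'' with (j | α' | ⟨α', β'⟩) | (j | j | j | μ')
  all_goals simp only [ktMat, mul_zero, zero_mul, Finset.sum_const_zero, add_zero, zero_add]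
  · exact sum_eomMat_gaugeMat _ _ _ _
  · simp only [mul_ite, mul_zero, Finset.sum_ite_eq', Finset.mem_univ, if_true, mul_smul_comm,
      ← Finset.smul_sum, sum_gaugeMat_X, smul_zero]

/-- The square is half the anticommutator of an odd derivation with itself, hence an even
derivation, which vanishes on generators by `sum_ktMat`. -/
theorem kos_kos (a : CForm D) : kos (kos a) = 0 := by
  have := ((kos_oddDer (D := D)).anticomm kos_oddDer kos_gradeInv kos_gradeInv).ext IsDer.zero
    (gen_cases (fun I κ => by
      have : kos (kos (cgen (jet I κ))) = 0 := by
        simp only [kos_jet, map_sum, kos_lin, ← mul_assoc]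
        rw [Finset.sum_comm]
        refine Finset.sum_eq_zero fun κ'' _ => ?_
        rw [← map_sum, ← Finset.sum_mul, sum_ktMat, zero_mul, map_zero]
      simp only [LinearMap.add_apply, LinearMap.comp_apply, this, add_zero, LinearMap.zero_apply])
      fun ρ => by
      simp only [LinearMap.add_apply, LinearMap.comp_apply, kos_dx, map_zero, add_zero,
        LinearMap.zero_apply])
  have h2 : (2 : ℝ) • kos (kos a) = 0 := by
    rw [two_smul]; exact LinearMap.congr_fun this a
  exact (smul_eq_zero.1 h2).resolve_left (by norm_num)

/-! ### Diagonalizable operators with natural eigenvalues -/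

section Diag

variable {V W : Type*} [AddCommGroup V] [Module ℝ V] [AddCommGroup W] [Module ℝ W]

/-- The eigenvectors with natural eigenvalues span. -/
def Diag (L : V →ₗ[ℝ] V) : Prop := ∀ v, v ∈ Submodule.span ℝ {x | ∃ n : ℕ, L x = (n : ℝ) • x}

theorem Diag.ext {L : V →ₗ[ℝ] V} (h : Diag L) {f f' : V →ₗ[ℝ] W}
    (hf : ∀ (n : ℕ) x, L x = (n : ℝ) • x → f x = f' x) (v : V) : f v = f' v := by
  have : Submodule.span ℝ {x | ∃ n : ℕ, L x = (n : ℝ) • x} ≤ LinearMap.eqLocus f f' :=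
    Submodule.span_le.2 fun x ⟨n, hx⟩ => hf n x hx
  exact this (h v)

theorem Diag.exists_calculus {L : V →ₗ[ℝ] V} (h : Diag L) (g : ℕ → ℝ) :
    ∃ P : V →ₗ[ℝ] V, ∀ (n : ℕ) x, L x = (n : ℝ) • x → P x = g n • x := by
  have hi : iSupIndep fun n : ℕ => Module.End.eigenspace L (n : ℝ) :=
    (Module.End.eigenspaces_iSupIndep L).comp Nat.cast_injective
  have ht : ⨆ n : ℕ, Module.End.eigenspace L (n : ℝ) = ⊤ := by
    rw [eq_top_iff]
    rintro v -
    refine Submodule.span_le.2 ?_ (h v)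
    rintro x ⟨n, hx⟩
    exact Submodule.mem_iSup_of_mem n (Module.End.mem_eigenspace_iff.2 hx)
  have hI := DirectSum.isInternal_submodule_of_iSupIndep_of_iSup_eq_top hi ht
  let e := LinearEquiv.ofBijective
    (DirectSum.coeLinearMap fun n : ℕ => Module.End.eigenspace L (n : ℝ)) hI
  refine ⟨DirectSum.toModule ℝ ℕ V (fun n => g n • (Module.End.eigenspace L (n : ℝ)).subtype) ∘ₗ
    e.symm.toLinearMap, fun n x hx => ?_⟩
  have : e.symm x = DirectSum.lof ℝ ℕ (fun n : ℕ => Module.End.eigenspace L (n : ℝ)) n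
      ⟨x, Module.End.mem_eigenspace_iff.2 hx⟩ := by
    rw [LinearEquiv.symm_apply_eq]
    exact (DirectSum.coeLinearMap_lof (fun n : ℕ => Module.End.eigenspace L (n : ℝ)) n
      ⟨x, Module.End.mem_eigenspace_iff.2 hx⟩).symm
  rw [LinearMap.comp_apply, LinearEquiv.coe_coe, this, DirectSum.toModule_lof]
  rfl

open Classical in
/-- The operator with the same eigenvectors as `L` and the eigenvalues `g n`. -/
def calc' (L : V →ₗ[ℝ] V) (g : ℕ → ℝ) : V →ₗ[ℝ] V :=
  if h : Diag L then (h.exists_calculus g).choose else 0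

theorem Diag.calc'_apply {L : V →ₗ[ℝ] V} (h : Diag L) (g : ℕ → ℝ) {n : ℕ} {x : V}
    (hx : L x = (n : ℝ) • x) : calc' L g x = g n • x := by
  rw [calc', dif_pos h]
  exact (h.exists_calculus g).choose_spec n x hx

/-- The map may shift eigenvalues, provided `g` and `g'` are matched along the shift. The
alternative `T x = 0` covers eigenvectors whose shifted eigenvalue would be negative. -/
theorem Diag.calc'_comm {L : V →ₗ[ℝ] V} (h : Diag L) {L' : W →ₗ[ℝ] W} (h' : Diag L')
    (g g' : ℕ → ℝ) (T : V →ₗ[ℝ] W) (hT : ∀ (n : ℕ) x, L x = (n : ℝ) • x →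
      T x = 0 ∨ ∃ m : ℕ, L' (T x) = (m : ℝ) • T x ∧ g' m = g n) (v : V) :
    calc' L' g' (T v) = T (calc' L g v) := by
  refine h.ext (f := calc' L' g' ∘ₗ T) (f' := T ∘ₗ calc' L g) (fun n x hx => ?_) v
  rw [LinearMap.comp_apply, LinearMap.comp_apply, h.calc'_apply g hx, map_smul]
  rcases hT n x hx with h0 | ⟨m, hm, hg⟩
  · rw [h0, map_zero, smul_zero]
  · rw [h'.calc'_apply g' hm, hg]

theorem Diag.calc'_comm_of_comm {L : V →ₗ[ℝ] V} (h : Diag L) (g : ℕ → ℝ) (T : V →ₗ[ℝ] V)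
    (hT : ∀ x, L (T x) = T (L x)) (v : V) : calc' L g (T v) = T (calc' L g v) :=
  h.calc'_comm h g g T (fun n x hx => .inr ⟨n, by rw [hT, hx, map_smul], rfl⟩) v

/-- Inversion of `L` outside of its kernel. -/
theorem Diag.apply_calc'_inv {L : V →ₗ[ℝ] V} (h : Diag L) (v : V) :
    L (calc' L (fun n => (n : ℝ)⁻¹) v) = v - calc' L (fun n => if n = 0 then 1 else 0) v := by
  refine h.ext (f := L ∘ₗ calc' L fun n => (n : ℝ)⁻¹)
    (f' := LinearMap.id - calc' L fun n => if n = 0 then 1 else 0) (fun n x hx => ?_) v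
  rw [LinearMap.comp_apply, LinearMap.sub_apply, LinearMap.id_apply, h.calc'_apply _ hx,
    h.calc'_apply _ hx, map_smul, hx, smul_smul]
  by_cases hn : n = 0
  · simp [hn]
  · rw [if_neg hn, zero_smul, sub_zero, inv_mul_cancel₀ (by exact_mod_cast hn), one_smul]

end Diag

/-- Eigenvalues of a derivation add under products. A product has eigenvalue zero only if both
factors do, and then the Leibniz rule lets `M` kill it. -/
theorem EvenDer.mem_span {L M : CForm D →ₗ[ℝ] CForm D} (hL : EvenDer L) (hM : EvenDer M)
    (hg : ∀ z, cgen z ∈ Submodule.span ℝ {x | ∃ n : ℕ, L x = (n : ℝ) • x ∧ (n = 0 → M x = 0)})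
    (a : CForm D) :
    a ∈ Submodule.span ℝ {x | ∃ n : ℕ, L x = (n : ℝ) • x ∧ (n = 0 → M x = 0)} := by
  have one : ∀ {L : CForm D →ₗ[ℝ] CForm D}, EvenDer L → L 1 = 0 := fun {L} h => by
    simpa using h 1 1
  induction a using cgen_induction with
  | hr r =>
    rw [Algebra.algebraMap_eq_smul_one]
    exact Submodule.smul_mem _ _ (Submodule.subset_span ⟨0, by simp [one hL], fun _ => one hM⟩)
  | hg z => exact hg z
  | ha a b ha hb => exact add_mem ha hb
  | hm a b ha hb =>
    have := Submodule.mul_mem_mul ha hb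
    rw [Submodule.span_mul_span] at this
    refine Submodule.span_mono ?_ this
    rintro _ ⟨x, ⟨n, hx, hx0⟩, y, ⟨m, hy, hy0⟩, rfl⟩
    refine ⟨n + m, ?_, fun h => ?_⟩
    · dsimp only
      rw [hL x y, hx, hy, AlgHom.id_apply, AlgHom.id_apply, smul_mul_assoc, mul_smul_comm,
        Nat.cast_add, add_smul]
    · dsimp only
      rw [hM x y, hx0 (by omega), hy0 (by omega), mul_zero, zero_mul, add_zero]

/-! ### Counting operators -/

/-- The weights of the generators, given those of the variables and of the one-forms. -/
def wt (w : Lab D → ℕ) (e : ℕ) : Gen D → ℕ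
  | .inl (_, z) => w (.inl z)
  | .inr (.inl (_, z)) => w (.inr z)
  | .inr (.inr _) => e

theorem wt_jet (w : Lab D → ℕ) (e : ℕ) (I : MultiIdx D) (κ : Lab D) : wt w e (jet I κ) = w κ := by
  cases κ <;> rfl

/-- The operator counting the generators with weights. -/
def cnt (w : Lab D → ℕ) (e : ℕ) : CForm D →ₗ[ℝ] CForm D := der fun z => (wt w e z : ℝ) • cgen z

theorem cnt_cgen (w : Lab D → ℕ) (e : ℕ) (z : Gen D) :
    cnt w e (cgen z) = (wt w e z : ℝ) • cgen z := by
  rw [cnt, der_cgen]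

theorem cnt_evenDer (w : Lab D → ℕ) (e : ℕ) : EvenDer (cnt w e) :=
  ParityPreserving.evenDer ⟨fun e => (evenPart D).smul_mem _ (cgen_inl_mem e),
    fun o => (oddPart D).smul_mem _ (cgen_inr_mem o)⟩

theorem cnt_lin (w : Lab D → ℕ) (e : ℕ) (κ : Lab D) (p : Poly D) :
    cnt w e (lin κ p) = (w κ : ℝ) • lin κ p := by
  have : cnt w e ∘ₗ lin κ = (w κ : ℝ) • lin κ := poly_ext fun I => by
    rw [LinearMap.comp_apply, LinearMap.smul_apply, lin_monomial, cnt_cgen, wt_jet]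
  exact LinearMap.congr_fun this p

theorem cnt_diag (w : Lab D → ℕ) (e : ℕ) : Diag (cnt w e) := fun a => by
  refine Submodule.span_mono ?_ ((cnt_evenDer w e).mem_span (M := 0) IsDer.zero (fun z => ?_) a)
  · rintro x ⟨n, hx, -⟩
    exact ⟨n, hx⟩
  · exact Submodule.subset_span ⟨_, cnt_cgen w e z, fun _ => rfl⟩

theorem cnt_tot (w : Lab D → ℕ) (e : ℕ) (μ : Fin D) (a : CForm D) :
    cnt w e (tot μ a) = tot μ (cnt w e a) := by
  have := ((cnt_evenDer w e).comm (tot_evenDer μ)).ext IsDer.zero (gen_cases (fun I κ => by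
    simp only [LinearMap.sub_apply, LinearMap.comp_apply, tot_jet, cnt_cgen, map_smul, wt_jet,
      sub_self, LinearMap.zero_apply]) fun ρ => by
    simp only [LinearMap.sub_apply, LinearMap.comp_apply, tot_dx, cnt_cgen, map_smul, map_zero,
      smul_zero, sub_self, LinearMap.zero_apply])
  exact sub_eq_zero.1 (LinearMap.congr_fun this a)

theorem cnt_gradeInv (w : Lab D → ℕ) (e : ℕ) (a : CForm D) :
    cnt w e (gradeInv a) = gradeInv (cnt w e a) :=
  ParityPreserving.der_gradeInv ⟨fun e => (evenPart D).smul_mem _ (cgen_inl_mem e),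
    fun o => (oddPart D).smul_mem _ (cgen_inr_mem o)⟩ a

/-- The Koszul-Tate differential lowers the weight by `c`. -/
theorem cnt_kos (w : Lab D → ℕ) (e : ℕ) (c : ℝ)
    (hw : ∀ κ κ' : Lab D, ktMat κ' κ = 0 ∨ (w κ' : ℝ) = w κ - c) (a : CForm D) :
    cnt w e (kos a) = kos (cnt w e a) - c • kos a := by
  have := ((cnt_evenDer w e).comm_odd kos_oddDer (cnt_gradeInv w e)).ext
    (kos_oddDer.smul (-c)) (gen_cases (fun I κ => by
    simp only [LinearMap.sub_apply, LinearMap.comp_apply, cnt_cgen, map_smul, wt_jet,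
      LinearMap.smul_apply, kos_jet, map_sum, cnt_lin, Finset.smul_sum]
    rw [← Finset.sum_sub_distrib]
    refine Finset.sum_congr rfl fun κ' _ => ?_
    rcases hw κ κ' with h | h
    · rw [h, zero_mul, map_zero]; simp
    · rw [h]; module) fun ρ => by
    simp only [LinearMap.sub_apply, LinearMap.comp_apply, kos_dx, cnt_cgen, map_smul, map_zero,
      smul_zero, sub_self, LinearMap.smul_apply])
  have h2 := LinearMap.congr_fun this a
  simp only [LinearMap.sub_apply, LinearMap.comp_apply, LinearMap.smul_apply] at h2
  rw [eq_sub_iff_add_eq, ← sub_eq_zero] 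
  linear_combination (norm := module) h2

/-- The antifield numbers of the variables. -/
def af : Lab D → ℕ
  | .inl (.antiC2 _ _) => 2
  | .inr (.antiT _) => 1
  | .inr (.antiC _) => 3
  | _ => 0

theorem wt_af (z : Gen D) : wt af 0 z = antifieldNumber z := by
  rcases z with ⟨I, z⟩ | ⟨I, z⟩ | μ
  · cases z <;> rfl
  · cases z <;> rfl
  · rfl

theorem wt_formDeg (z : Gen D) : wt (fun _ => 0) 1 z = formDeg z := by
  rcases z with ⟨I, z⟩ | ⟨I, z⟩ | μ <;> rfl

theorem cnt_af_kos (e : ℕ) (a : CForm D) : cnt af e (kos a) = kos (cnt af e a) - kos a := by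
  have := cnt_kos af e 1 (fun κ κ' => ?_) a
  · rwa [one_smul] at this
  rcases κ with (i | α | ⟨α, β⟩) | (i | i | i | μ) <;>
    rcases κ' with (j | α' | ⟨α', β'⟩) | (j | j | j | μ') <;>
    first
    | exact .inl rfl
    | (right; norm_num [af])

theorem cnt_const_kos (n e : ℕ) (a : CForm D) :
    cnt (fun _ => n) e (kos a) = kos (cnt (fun _ => n) e a) := by
  have := cnt_kos (fun _ => n) e 0 (fun κ κ' => .inr (sub_zero _).symm) a
  rwa [zero_smul, sub_zero] at this

/-! ### The homotopy for the Koszul-Tate differential -/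

section Homotopy

/-- Linear forms in the jets of a family of variables. -/
def linv {ι : Type*} [Fintype ι] (f : ι → Lab D) : (ι → Poly D) →ₗ[ℝ] CForm D :=
  ∑ i, lin (f i) ∘ₗ LinearMap.proj i

theorem linv_apply {ι : Type*} [Fintype ι] (f : ι → Lab D) (c : ι → Poly D) :
    linv f c = ∑ i, lin (f i) (c i) := by
  simp [linv]

theorem linv_single {ι : Type*} [Fintype ι] [DecidableEq ι] (f : ι → Lab D) (i : ι) (p : Poly D) :
    linv f (Pi.single i p) = lin (f i) p := by
  rw [linv_apply, Finset.sum_eq_single i]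
  · simp
  · intro j _ hj; simp [hj]
  · simp

theorem pi_poly_ext {ι M : Type*} [Fintype ι] [DecidableEq ι] [AddCommGroup M] [Module ℝ M]
    {f g : (ι → Poly D) →ₗ[ℝ] M} (h : ∀ i (I : MultiIdx D),
      f (Pi.single i (MvPolynomial.monomial I 1)) = g (Pi.single i (MvPolynomial.monomial I 1))) :
    f = g :=
  LinearMap.pi_ext' fun i => poly_ext fun I => h i I

/-- The field equations as an operator on polynomials. -/
def eomOp : (HookIdx D → Poly D) →ₗ[ℝ] (HookIdx D → Poly D) where
  toFun c j := ∑ i, eomMat MvPolynomial.X i j * c i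
  map_add' c c' := by ext1 j; simp [mul_add, Finset.sum_add_distrib]
  map_smul' r c := by ext1 j; simp [Finset.smul_sum]

/-- The gauge transformations as an operator on polynomials. -/
def gaugeOp : (Fin D × Fin D → Poly D) →ₗ[ℝ] (HookIdx D → Poly D) where
  toFun l i := ∑ α, ∑ β, gaugeMat MvPolynomial.X i α β * l (α, β)
  map_add' c c' := by ext1 j; simp [mul_add, Finset.sum_add_distrib]
  map_smul' r c := by ext1 j; simp [Finset.smul_sum]

/-- The reducibility of the gauge transformations as an operator on polynomials. -/
def redOp : (Fin D → Poly D) →ₗ[ℝ] (Fin D × Fin D → Poly D) where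
  toFun c p := (2 : ℝ) • (MvPolynomial.X p.1 * c p.2)
  map_add' c c' := by ext1 j; simp [mul_add]
  map_smul' r c := by
    ext1 p
    change (2 : ℝ) • (MvPolynomial.X p.1 * (r • c p.2)) = r • (2 : ℝ) • (MvPolynomial.X p.1 * c p.2)
    rw [mul_smul_comm, smul_comm]

theorem kos_linv_antiT (c : HookIdx D → Poly D) :
    kos (linv (fun i => .inr (.antiT i)) c) = linv (fun j => .inl (.T j)) (eomOp c) := by
  simp only [linv_apply, map_sum, kos_lin, Fintype.sum_sum_type, sum_evenVar, ktMat,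
    zero_mul, map_zero, Finset.sum_const_zero, add_zero, eomOp, LinearMap.coe_mk, AddHom.coe_mk]
  exact Finset.sum_comm

theorem kos_linv_antiC2 (c : Fin D × Fin D → Poly D) :
    kos (linv (fun p => .inl (.antiC2 p.1 p.2)) c) =
      linv (fun j => .inr (.antiT j)) (gaugeOp c) := by
  simp only [linv_apply, map_sum, kos_lin, Fintype.sum_sum_type, sum_oddVar, ktMat,
    zero_mul, map_zero, Finset.sum_const_zero, add_zero, zero_add, gaugeOp, LinearMap.coe_mk,
    AddHom.coe_mk]
  rw [Finset.sum_comm]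
  simp only [Fintype.sum_prod_type]

theorem kos_linv_antiC (c : Fin D → Poly D) :
    kos (linv (fun α => .inr (.antiC α)) c) =
      linv (fun p => .inl (.antiC2 p.1 p.2)) (redOp c) := by
  simp only [linv_apply, map_sum, kos_lin, Fintype.sum_sum_type, sum_evenVar, ktMat,
    zero_mul, map_zero, Finset.sum_const_zero, add_zero, zero_add, redOp, LinearMap.coe_mk,
    AddHom.coe_mk, ite_mul, apply_ite (lin _), Fintype.sum_prod_type, smul_mul_assoc]
  rw [Finset.sum_comm]
  simp

theorem eomOp_gaugeOp (l : Fin D × Fin D → Poly D) : eomOp (gaugeOp l) = 0 := by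
  funext j
  simp only [eomOp, gaugeOp, LinearMap.coe_mk, AddHom.coe_mk, Finset.mul_sum, Pi.zero_apply]
  rw [Finset.sum_comm]
  refine Finset.sum_eq_zero fun α _ => ?_
  rw [Finset.sum_comm]
  refine Finset.sum_eq_zero fun β _ => ?_
  simp only [← mul_assoc, ← Finset.sum_mul, sum_eomMat_gaugeMat, zero_mul]

theorem gaugeOp_redOp (c : Fin D → Poly D) : gaugeOp (redOp c) = 0 := by
  funext i
  simp only [redOp, gaugeOp, LinearMap.coe_mk, AddHom.coe_mk, Pi.zero_apply, mul_smul_comm,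
    ← mul_assoc]
  rw [Finset.sum_comm]
  refine Finset.sum_eq_zero fun β _ => ?_
  simp only [← Finset.smul_sum, ← Finset.sum_mul, sum_gaugeMat_X, zero_mul, smul_zero]

/-- `exists_gauge` with all momenta and coefficients in `ℝ`, transported along `M ⊗ ℝ ≃ M`. -/
theorem exists_gaugeOp (hD : 4 < D) {c : HookIdx D → Poly D} (hc : eomOp c = 0) :
    ∃ l, gaugeOp l = c := by
  let r := TensorProduct.AlgebraTensorModule.rid ℝ (Poly D) (Poly D)
  obtain ⟨l, hl⟩ := exists_gauge Finset.univ hD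
    (by rw [Finset.card_univ, Fintype.card_fin]; omega) (fun i => r.symm (c i)) fun j => by
      rw [momVec_univ]
      simp only [← map_smul, ← map_sum]
      rw [show ∑ i, eomMat MvPolynomial.X i j • c i = 0 from congrFun hc j, map_zero]
  refine ⟨fun p => r (l p.1 p.2), funext fun i => ?_⟩
  have := congrArg r (hl i)
  rw [LinearEquiv.apply_symm_apply, momVec_univ] at this
  simp only [map_sum, map_smul] at this
  exact this.symm

theorem exists_redOp (hD : 4 < D) {l : Fin D × Fin D → Poly D} (hl : gaugeOp l = 0) :
    ∃ c, redOp c = l := by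
  let r := TensorProduct.AlgebraTensorModule.rid ℝ (Poly D) (Poly D)
  obtain ⟨c, hc⟩ := exists_gauge_gauge hD (fun α β => r.symm (l (α, β))) fun i => by
      simp only [← map_smul, ← map_sum]
      rw [show ∑ α, ∑ β, gaugeMat MvPolynomial.X i α β • l (α, β) = 0 from congrFun hl i, map_zero]
  refine ⟨fun β => (1 / 2 : ℝ) • r (c β), funext fun p => ?_⟩
  have := congrArg r (hc p.1 p.2)
  rw [LinearEquiv.apply_symm_apply, map_smul, smul_eq_mul] at this
  simp only [redOp, LinearMap.coe_mk, AddHom.coe_mk, mul_smul_comm, smul_smul]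
  rw [this]
  norm_num

theorem redOp_injective (hD : 0 < D) : Function.Injective (redOp (D := D)) := by
  intro c c' h
  funext β
  have := congrFun h (⟨0, hD⟩, β)
  simp only [redOp, LinearMap.coe_mk, AddHom.coe_mk] at this
  exact mul_left_cancel₀ (MvPolynomial.X_ne_zero _) (smul_right_injective _ two_ne_zero this)

theorem exists_lift {V W W' : Type*} [AddCommGroup V] [Module ℝ V] [AddCommGroup W] [Module ℝ W]
    [AddCommGroup W'] [Module ℝ W'] (f : V →ₗ[ℝ] W) (g : W' →ₗ[ℝ] W)
    (h : ∀ x, ∃ y, f y = g x) : ∃ q : W' →ₗ[ℝ] V, ∀ x, f (q x) = g x := by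
  obtain ⟨s, hs⟩ := f.rangeRestrict.exists_rightInverse_of_surjective f.range_rangeRestrict
  refine ⟨s ∘ₗ g.codRestrict (LinearMap.range f) fun x => h x, fun x => ?_⟩
  exact congrArg Subtype.val (LinearMap.congr_fun hs (g.codRestrict (LinearMap.range f) h x))

/-- Split the map onto its range and extend the splitting; both exist over a field. -/
theorem exists_pseudoinverse {V W : Type*} [AddCommGroup V] [Module ℝ V] [AddCommGroup W]
    [Module ℝ W] (f : V →ₗ[ℝ] W) : ∃ q : W →ₗ[ℝ] V, ∀ x, f (q (f x)) = f x := by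
  obtain ⟨s, hs⟩ := f.rangeRestrict.exists_rightInverse_of_surjective f.range_rangeRestrict
  obtain ⟨q, hq⟩ := s.exists_extend
  refine ⟨q, fun x => ?_⟩
  have h1 : q (f x) = s (f.rangeRestrict x) := LinearMap.congr_fun hq (f.rangeRestrict x)
  rw [h1]
  exact congrArg Subtype.val (LinearMap.congr_fun hs (f.rangeRestrict x))

/-- A contracting homotopy of the exact complex of polynomial operators, built from the left by
lifting. The maps are only linear over `ℝ`, so the homotopy need not commute with total derivatives;
acyclicity of `δ` alone does not need this. -/
theorem exists_op_homotopy (hD : 4 < D) :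
    ∃ (h0 : (HookIdx D → Poly D) →ₗ[ℝ] (HookIdx D → Poly D))
      (h1 : (HookIdx D → Poly D) →ₗ[ℝ] (Fin D × Fin D → Poly D))
      (h2 : (Fin D × Fin D → Poly D) →ₗ[ℝ] (Fin D → Poly D)),
      (∀ c, eomOp (h0 (eomOp c)) = eomOp c) ∧ (∀ c, gaugeOp (h1 c) = c - h0 (eomOp c)) ∧
      (∀ c, redOp (h2 c) = c - h1 (gaugeOp c)) ∧ ∀ c, h2 (redOp c) = c := by
  obtain ⟨h0, hh0⟩ := exists_pseudoinverse (eomOp (D := D))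
  obtain ⟨h1, hh1⟩ := exists_lift (gaugeOp (D := D)) (LinearMap.id - h0 ∘ₗ eomOp) fun x =>
    exists_gaugeOp hD (by
      simp only [LinearMap.sub_apply, LinearMap.comp_apply, map_sub, hh0, LinearMap.id_apply,
        sub_self])
  simp only [LinearMap.sub_apply, LinearMap.comp_apply, LinearMap.id_apply] at hh1
  obtain ⟨h2, hh2⟩ := exists_lift (redOp (D := D)) (LinearMap.id - h1 ∘ₗ gaugeOp) fun x =>
    exists_redOp hD (by
      simp only [LinearMap.sub_apply, LinearMap.comp_apply, map_sub, hh1, LinearMap.id_apply,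
        eomOp_gaugeOp, map_zero, sub_zero, sub_self])
  simp only [LinearMap.sub_apply, LinearMap.comp_apply, LinearMap.id_apply] at hh2
  exact ⟨h0, h1, h2, hh0, hh1, hh2, fun c => redOp_injective (by omega) (by
    rw [hh2, gaugeOp_redOp, map_zero, sub_zero])⟩

/-! ### The homotopy as a derivation of the algebra of forms -/

section Values

variable (h0 : (HookIdx D → Poly D) →ₗ[ℝ] (HookIdx D → Poly D))
  (h1 : (HookIdx D → Poly D) →ₗ[ℝ] (Fin D × Fin D → Poly D))
  (h2 : (Fin D × Fin D → Poly D) →ₗ[ℝ] (Fin D → Poly D))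

/-- The values of the homotopy on the generators. -/
def homVal : Gen D → CForm D
  | .inl (I, .T j) => linv (fun i => .inr (.antiT i)) (h0 (Pi.single j (MvPolynomial.monomial I 1)))
  | .inr (.inl (I, .antiT i)) => linv (fun p : Fin D × Fin D => .inl (.antiC2 p.1 p.2))
      (h1 (Pi.single i (MvPolynomial.monomial I 1)))
  | .inl (I, .antiC2 α β) => linv (fun α => .inr (.antiC α))
      (h2 (Pi.single (α, β) (MvPolynomial.monomial I 1)))
  | _ => 0

theorem linv_even {ι : Type*} [Fintype ι] (f : ι → EvenVar D) (c : ι → Poly D) :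
    linv (fun i => .inl (f i)) c ∈ evenPart D := by
  rw [linv_apply]; exact sum_mem fun i _ => lin_inl_mem _ _

theorem linv_odd {ι : Type*} [Fintype ι] (f : ι → OddVar D) (c : ι → Poly D) :
    linv (fun i => .inr (f i)) c ∈ oddPart D := by
  rw [linv_apply]; exact sum_mem fun i _ => lin_inr_mem _ _

theorem parity_homVal : ParityReversing (homVal h0 h1 h2) := by
  constructor
  · rintro ⟨I, (i | α | ⟨α, β⟩)⟩
    · exact linv_odd _ _
    · exact zero_mem _
    · exact linv_odd _ _
  · rintro (⟨I, (i | α | i | α)⟩ | μ)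
    · exact zero_mem _
    · exact zero_mem _
    · exact linv_even (fun p : Fin D × Fin D => .antiC2 p.1 p.2) _
    · exact zero_mem _
    · exact zero_mem _

theorem der_linv {ι ι' : Type*} [Fintype ι] [DecidableEq ι] [Fintype ι'] (f : ι → Lab D)
    (f' : ι' → Lab D) (q : (ι → Poly D) →ₗ[ℝ] (ι' → Poly D)) (v : Gen D → CForm D)
    (h : ∀ i I, v (jet I (f i)) = linv f' (q (Pi.single i (MvPolynomial.monomial I 1))))
    (c : ι → Poly D) : der v (linv f c) = linv f' (q c) :=
  LinearMap.congr_fun (f := der v ∘ₗ linv f) (g := linv f' ∘ₗ q) (pi_poly_ext fun i I => by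
    rw [LinearMap.comp_apply, linv_single, lin_monomial, der_cgen, h, LinearMap.comp_apply]) c

/-- The homotopy. -/
def homOp : CForm D →ₗ[ℝ] CForm D := der (homVal h0 h1 h2)

theorem homOp_T (c : HookIdx D → Poly D) : homOp h0 h1 h2 (linv (fun j => .inl (.T j)) c) =
    linv (fun i => .inr (.antiT i)) (h0 c) :=
  der_linv _ _ h0 _ (fun _ _ => rfl) c

theorem homOp_antiT (c : HookIdx D → Poly D) :
    homOp h0 h1 h2 (linv (fun i => .inr (.antiT i)) c) =
      linv (fun p : Fin D × Fin D => .inl (.antiC2 p.1 p.2)) (h1 c) :=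
  der_linv _ _ h1 _ (fun _ _ => rfl) c

theorem homOp_antiC2 (c : Fin D × Fin D → Poly D) :
    homOp h0 h1 h2 (linv (fun p => .inl (.antiC2 p.1 p.2)) c) =
      linv (fun α => .inr (.antiC α)) (h2 c) :=
  der_linv _ _ h2 _ (fun _ _ => rfl) c

theorem homOp_antiC (c : Fin D → Poly D) :
    homOp h0 h1 h2 (linv (fun α => .inr (.antiC α)) c) = 0 := by
  refine (der_linv (fun α => .inr (.antiC α)) (fun α : Fin D => .inr (.antiC α))
    0 _ (fun _ _ => ?_) c).trans (map_zero _)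
  rw [LinearMap.zero_apply, map_zero]
  rfl

/-- The anticommutator of the homotopy with the Koszul-Tate differential. -/
def homK : CForm D →ₗ[ℝ] CForm D := kos ∘ₗ homOp h0 h1 h2 + homOp h0 h1 h2 ∘ₗ kos

theorem homK_apply (a : CForm D) :
    homK h0 h1 h2 a = kos (homOp h0 h1 h2 a) + homOp h0 h1 h2 (kos a) := rfl

theorem homK_evenDer : EvenDer (homK h0 h1 h2) :=
  kos_oddDer.anticomm (parity_homVal h0 h1 h2).oddDer kos_gradeInv
    (parity_homVal h0 h1 h2).der_gradeInv

theorem homK_kos (a : CForm D) : homK h0 h1 h2 (kos a) = kos (homK h0 h1 h2 a) := by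
  rw [homK_apply, homK_apply, kos_kos, map_zero, add_zero, map_add, kos_kos, zero_add]

theorem homK_T (c : HookIdx D → Poly D) : homK h0 h1 h2 (linv (fun j => .inl (.T j)) c) =
    linv (fun j => .inl (.T j)) (eomOp (h0 c)) := by
  have : kos (linv (fun j => .inl (.T j)) c) = 0 := by
    simp [linv_apply, kos_lin, ktMat]
  rw [homK_apply, homOp_T, kos_linv_antiT, this, map_zero, add_zero]

variable {h0 h1 h2}

theorem homK_antiT (hh1 : ∀ c, gaugeOp (h1 c) = c - h0 (eomOp c)) (c : HookIdx D → Poly D) :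
    homK h0 h1 h2 (linv (fun i => .inr (.antiT i)) c) = linv (fun i => .inr (.antiT i)) c := by
  rw [homK_apply, homOp_antiT, kos_linv_antiC2, kos_linv_antiT, homOp_T, ← map_add, hh1,
    sub_add_cancel]

theorem homK_antiC2 (hh2 : ∀ c, redOp (h2 c) = c - h1 (gaugeOp c)) (c : Fin D × Fin D → Poly D) :
    homK h0 h1 h2 (linv (fun p => .inl (.antiC2 p.1 p.2)) c) =
      linv (fun p => .inl (.antiC2 p.1 p.2)) c := by
  rw [homK_apply, homOp_antiC2, kos_linv_antiC, kos_linv_antiC2, homOp_antiT, ← map_add, hh2,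
    sub_add_cancel]

theorem homK_antiC (hh3 : ∀ c, h2 (redOp c) = c) (c : Fin D → Poly D) :
    homK h0 h1 h2 (linv (fun α => .inr (.antiC α)) c) = linv (fun α => .inr (.antiC α)) c := by
  rw [homK_apply, homOp_antiC, kos_linv_antiC, homOp_antiC2, map_zero, zero_add, hh3]

/-- Eigenvectors of `homK`, those with eigenvalue zero being of antifield number zero. -/
def homEigen (h0 : (HookIdx D → Poly D) →ₗ[ℝ] (HookIdx D → Poly D))
    (h1 : (HookIdx D → Poly D) →ₗ[ℝ] (Fin D × Fin D → Poly D))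
    (h2 : (Fin D × Fin D → Poly D) →ₗ[ℝ] (Fin D → Poly D)) : Set (CForm D) :=
  {x | ∃ n : ℕ, homK h0 h1 h2 x = (n : ℝ) • x ∧ (n = 0 → cnt af 0 x = 0)}

theorem mem_homEigen_of_eq {x : CForm D} (h : homK h0 h1 h2 x = x) : x ∈ homEigen h0 h1 h2 :=
  ⟨1, by rw [h, Nat.cast_one, one_smul], fun h => absurd h one_ne_zero⟩

theorem mem_homEigen_of_zero {x : CForm D} (h : homK h0 h1 h2 x = 0) (h' : cnt af 0 x = 0) :
    x ∈ homEigen h0 h1 h2 :=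
  ⟨0, by rw [h, Nat.cast_zero, zero_smul], fun _ => h'⟩

theorem mem_homEigen_of_trivial {z : Gen D} (h : kos (cgen z) = 0) (h' : homVal h0 h1 h2 z = 0)
    (hz : wt af 0 z = 0) : cgen z ∈ homEigen h0 h1 h2 :=
  mem_homEigen_of_zero (by rw [homK_apply, h, homOp, der_cgen, h', map_zero, map_zero, add_zero])
    (by rw [cnt_cgen, hz, Nat.cast_zero, zero_smul])

theorem kos_jet_eq_zero (I : MultiIdx D) {κ : Lab D} (h : ∀ κ', ktMat κ' κ = 0) :
    kos (cgen (jet I κ)) = 0 := by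
  rw [kos_jet]
  exact Finset.sum_eq_zero fun κ' _ => by rw [h, zero_mul, map_zero]

/-- The anticommutator acts as 1 on the antifields, as the projection `eomOp ∘ h0` on the range of
the equations among the jets of `T`, and as 0 on the other generators. Eigenvalue zero thus excludes
antifields. -/
theorem span_homEigen (hh0 : ∀ c, eomOp (h0 (eomOp c)) = eomOp c)
    (hh1 : ∀ c, gaugeOp (h1 c) = c - h0 (eomOp c)) (hh2 : ∀ c, redOp (h2 c) = c - h1 (gaugeOp c))
    (hh3 : ∀ c, h2 (redOp c) = c) (a : CForm D) :
    a ∈ Submodule.span ℝ (homEigen h0 h1 h2) := by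
  refine (homK_evenDer h0 h1 h2).mem_span (cnt_evenDer af 0) (gen_cases (fun I κ => ?_)
    fun μ => ?_) a
  · rcases κ with (i | α | ⟨α, β⟩) | (i | i | i | μ)
    · set c : HookIdx D → Poly D := Pi.single i (MvPolynomial.monomial I 1) with hc
      -- A jet of `T` need not be an eigenvector; it is split by the projection into parts of
      -- eigenvalue one and zero.
      have e : cgen (jet I (.inl (.T i))) = linv (fun j => .inl (.T j)) (eomOp (h0 c)) +
          linv (fun j => .inl (.T j)) (c - eomOp (h0 c)) := by
        rw [map_sub, add_sub_cancel, hc, linv_single, lin_monomial]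
      rw [e]
      refine add_mem (Submodule.subset_span (mem_homEigen_of_eq ?_))
        (Submodule.subset_span (mem_homEigen_of_zero ?_ ?_))
      · rw [homK_T, hh0]
      · rw [homK_T, map_sub, map_sub, hh0, sub_self, map_zero]
      · simp [linv_apply, cnt_lin, af]
    · exact Submodule.subset_span (mem_homEigen_of_trivial (kos_jet_eq_zero I fun κ' => by
        rcases κ' with (_ | _ | _) | (_ | _ | _ | _) <;> rfl) rfl rfl)
    · have := homK_antiC2 (h0 := h0) hh2 (Pi.single (α, β) (MvPolynomial.monomial I 1))
      rw [linv_single, lin_monomial] at this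
      exact Submodule.subset_span (mem_homEigen_of_eq this)
    · exact Submodule.subset_span (mem_homEigen_of_trivial (kos_jet_eq_zero I fun κ' => by
        rcases κ' with (_ | _ | _) | (_ | _ | _ | _) <;> rfl) rfl rfl)
    · exact Submodule.subset_span (mem_homEigen_of_trivial (kos_jet_eq_zero I fun κ' => by
        rcases κ' with (_ | _ | _) | (_ | _ | _ | _) <;> rfl) rfl rfl)
    · have := homK_antiT (h2 := h2) hh1 (Pi.single i (MvPolynomial.monomial I 1))
      rw [linv_single, lin_monomial] at this
      exact Submodule.subset_span (mem_homEigen_of_eq this)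
    · have := homK_antiC (h0 := h0) (h1 := h1) hh3 (Pi.single μ (MvPolynomial.monomial I 1))
      rw [linv_single, lin_monomial] at this
      exact Submodule.subset_span (mem_homEigen_of_eq this)
  · exact Submodule.subset_span (mem_homEigen_of_trivial (kos_dx μ) rfl rfl)

end Values

/-- A homotopy for the Koszul-Tate differential, up to an operator with values in antifield
number zero. -/
theorem exists_homotopy (hD : 4 < D) : ∃ p h : CForm D →ₗ[ℝ] CForm D,
    (∀ a, cnt af 0 (p a) = 0) ∧ ∀ a, a = p a + (kos (h a) + h (kos a)) := by
  obtain ⟨h0, h1, h2, hh0, hh1, hh2, hh3⟩ := exists_op_homotopy hD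
  have span := span_homEigen hh0 hh1 hh2 hh3
  have hKd : Diag (homK h0 h1 h2) := fun a => by
    refine Submodule.span_mono ?_ (span a)
    rintro x ⟨n, hx, -⟩
    exact ⟨n, hx⟩
  -- Divide by the anticommutator where it is invertible; the leftover is its kernel, in antifield
  -- number zero.
  refine ⟨calc' (homK h0 h1 h2) fun n => if n = 0 then 1 else 0,
    homOp h0 h1 h2 ∘ₗ calc' (homK h0 h1 h2) fun n => (n : ℝ)⁻¹, fun a => ?_, fun a => ?_⟩
  · have : Submodule.span ℝ (homEigen h0 h1 h2) ≤
        LinearMap.ker (cnt af 0 ∘ₗ calc' (homK h0 h1 h2) fun n => if n = 0 then 1 else 0) := by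
      refine Submodule.span_le.2 ?_
      rintro x ⟨n, hx, hx0⟩
      change cnt af 0 (calc' (homK h0 h1 h2) _ x) = 0
      rw [hKd.calc'_apply _ hx, map_smul]
      by_cases hn : n = 0
      · rw [hx0 hn, smul_zero]
      · rw [if_neg hn, zero_smul]
    exact this (span a)
  · rw [LinearMap.comp_apply, LinearMap.comp_apply,
      hKd.calc'_comm_of_comm _ kos (homK_kos h0 h1 h2), ← homK_apply,
      hKd.apply_calc'_inv, add_sub_cancel]

end Homotopy

/-! ### Linearization -/

/-- The sign of a variable under the grade involution. -/
def par : Lab D → ℝ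
  | .inl _ => 1
  | .inr _ => -1

/-- The grade involution for odd variables, the identity for even ones. -/
def twist : Lab D → CForm D →ₐ[ℝ] CForm D
  | .inl _ => AlgHom.id ℝ _
  | .inr _ => gradeInv

theorem par_mul_par (κ : Lab D) : par κ * par κ = 1 := by
  cases κ <;> norm_num [par]

theorem twist_gradeInv (κ : Lab D) (a : CForm D) :
    twist κ (gradeInv a) = gradeInv (twist κ a) := by
  cases κ <;> rfl

theorem lin_mul_twist (κ : Lab D) (p : Poly D) (a : CForm D) :
    lin κ p * twist κ a = a * lin κ p := by
  cases κ with
  | inl z => exact (mem_evenPart.1 (lin_inl_mem z p)).2 a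
  | inr z => rw [(mem_oddPart.1 (lin_inr_mem z p)).2, twist, gradeInv_gradeInv]

theorem gradeInv_lin (κ : Lab D) (p : Poly D) : gradeInv (lin κ p) = par κ • lin κ p := by
  cases κ with
  | inl z => rw [(mem_evenPart.1 (lin_inl_mem z p)).1, par, one_smul]
  | inr z => rw [(mem_oddPart.1 (lin_inr_mem z p)).1, par, neg_one_smul]

theorem pd_jet_mul (I : MultiIdx D) (κ : Lab D) (a b : CForm D) :
    pd (jet I κ) (a * b) = pd (jet I κ) a * b + twist κ a * pd (jet I κ) b := by
  cases κ with
  | inl z => exact pd_inl_mul _ a b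
  | inr z => exact pd_inr_mul _ a b

theorem pd_jet_gradeInv (I : MultiIdx D) (κ : Lab D) (a : CForm D) :
    pd (jet I κ) (gradeInv a) = par κ • gradeInv (pd (jet I κ) a) := by
  classical
  rw [pd_eq_der]
  cases κ with
  | inl z =>
    rw [par, one_smul]
    refine ParityPreserving.der_gradeInv ⟨fun e => ?_, fun o => ?_⟩ a
    · rw [Pi.single_apply]
      split_ifs
      · exact one_mem_evenPart
      · exact zero_mem _
    · rw [Pi.single_apply, if_neg (by simp [jet])]
      exact zero_mem _
  | inr z =>
    rw [par, neg_one_smul]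
    refine ParityReversing.der_gradeInv ⟨fun e => ?_, fun o => ?_⟩ a
    · rw [Pi.single_apply, if_neg (by simp [jet])]
      exact zero_mem _
    · rw [Pi.single_apply]
      split_ifs
      · exact one_mem_evenPart
      · exact zero_mem _

theorem finite_pd_jet (κ : Lab D) (a : CForm D) : {I | pd (jet I κ) a ≠ 0}.Finite := by
  cases κ with
  | inl z =>
    exact (finite_pd_inl a).preimage fun I _ J _ h => congrArg Prod.fst h
  | inr z =>
    exact (finite_pd_inr a).preimage fun I _ J _ h => congrArg Prod.fst (Sum.inl_injective h)

theorem jet_injective {I J : MultiIdx D} {κ κ' : Lab D} (h : jet I κ = jet J κ') :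
    I = J ∧ κ = κ' := by
  cases κ <;> cases κ' <;> simp_all [jet]

/-- Polynomials with coefficients in the forms. -/
abbrev PForm (D : ℕ) : Type := Poly D ⊗[ℝ] CForm D

theorem finite_symb (κ : Lab D) (a : CForm D) : (Function.support fun I : MultiIdx D =>
    ((MvPolynomial.monomial I 1 : Poly D) ⊗ₜ[ℝ] pd (jet I κ) a : PForm D)).Finite :=
  (finite_pd_jet κ a).subset fun I hI h => hI (by
    dsimp only
    rw [show pd (jet I κ) a = 0 from h, TensorProduct.tmul_zero])

/-- The linearization with respect to a variable, the derivatives of which are replaced by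
momenta. -/
def symb (κ : Lab D) : CForm D →ₗ[ℝ] PForm D where
  toFun a := ∑ᶠ I : MultiIdx D, (MvPolynomial.monomial I 1 : Poly D) ⊗ₜ[ℝ] pd (jet I κ) a
  map_add' a b := by
    simp only [map_add, TensorProduct.tmul_add]
    exact finsum_add_distrib (finite_symb κ a) (finite_symb κ b)
  map_smul' c a := by
    simp only [map_smul, TensorProduct.tmul_smul, RingHom.id_apply]
    exact (smul_finsum' c (finite_symb κ a)).symm

theorem symb_apply (κ : Lab D) (a : CForm D) : symb κ a =
    ∑ᶠ I : MultiIdx D, (MvPolynomial.monomial I 1 : Poly D) ⊗ₜ[ℝ] pd (jet I κ) a := rfl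

/-- The inclusion of the forms in the polynomials with coefficients in the forms. -/
def cst : CForm D →ₐ[ℝ] PForm D := Algebra.TensorProduct.includeRight

theorem cst_apply (a : CForm D) : cst a = (1 : Poly D) ⊗ₜ[ℝ] a := rfl

theorem symb_isDer (κ : Lab D) : IsDer (cst.comp (twist κ)) cst (symb κ) := fun a b => by
  have e : ∀ I : MultiIdx D, ((MvPolynomial.monomial I 1 : Poly D) ⊗ₜ[ℝ] pd (jet I κ) (a * b) : PForm D)
      = ((MvPolynomial.monomial I 1 : Poly D) ⊗ₜ[ℝ] pd (jet I κ) a : PForm D) * cst b +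
        cst (twist κ a) * ((MvPolynomial.monomial I 1 : Poly D) ⊗ₜ[ℝ] pd (jet I κ) b : PForm D) := fun I => by
    rw [cst_apply, cst_apply, Algebra.TensorProduct.tmul_mul_tmul,
      Algebra.TensorProduct.tmul_mul_tmul, mul_one, one_mul, pd_jet_mul, TensorProduct.tmul_add]
  simp only [symb_apply, e]
  rw [finsum_add_distrib, finsum_mul' _ _ (finite_symb κ a), mul_finsum' _ _ (finite_symb κ b)]
  · rfl
  · exact (finite_symb κ a).subset fun I hI h => hI (by
      dsimp only at h ⊢; rw [h, zero_mul])
  · exact (finite_symb κ b).subset fun I hI h => hI (by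
      dsimp only at h ⊢; rw [h, mul_zero])

open Classical in
theorem symb_jet (κ κ' : Lab D) (J : MultiIdx D) : symb κ (cgen (jet J κ')) =
    if κ = κ' then (MvPolynomial.monomial J 1 : Poly D) ⊗ₜ[ℝ] 1 else 0 := by
  simp only [symb_apply, pd_cgen]
  split_ifs with h
  · subst h
    rw [finsum_eq_single _ J]
    · rw [if_pos rfl]
    · intro I hI
      rw [if_neg fun h => hI (jet_injective h).1.symm, TensorProduct.tmul_zero]
  · refine finsum_eq_zero_of_forall_eq_zero fun I => ?_
    rw [if_neg fun h' => h (jet_injective h').2.symm, TensorProduct.tmul_zero]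

theorem symb_dx (κ : Lab D) (μ : Fin D) : symb κ (cgen (.inr (.inr μ))) = 0 := by
  classical
  simp only [symb_apply, pd_cgen]
  refine finsum_eq_zero_of_forall_eq_zero fun I => ?_
  rw [if_neg, TensorProduct.tmul_zero]
  cases κ <;> simp [jet]

open Classical in
theorem symb_lin (κ κ' : Lab D) (p : Poly D) : symb κ (lin κ' p) =
    if κ = κ' then p ⊗ₜ[ℝ] 1 else 0 := by
  have : symb κ ∘ₗ lin κ' =
      if κ = κ' then (TensorProduct.mk ℝ (Poly D) (CForm D)).flip 1 else 0 := poly_ext fun I => by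
    rw [LinearMap.comp_apply, lin_monomial, symb_jet]
    split_ifs <;> rfl
  have h2 := LinearMap.congr_fun this p
  rw [LinearMap.comp_apply] at h2
  rw [h2]
  split_ifs <;> rfl

/-- The grade involution of the coefficients. -/
def barP : PForm D →ₐ[ℝ] PForm D := Algebra.TensorProduct.map (AlgHom.id ℝ _) gradeInv

theorem barP_tmul (p : Poly D) (a : CForm D) : barP (p ⊗ₜ a) = p ⊗ₜ[ℝ] gradeInv a := rfl

theorem barP_cst (a : CForm D) : barP (cst a) = cst (gradeInv a) := rfl

/-- The action of an operator on the coefficients. -/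
def coefP (L : CForm D →ₗ[ℝ] CForm D) : PForm D →ₗ[ℝ] PForm D := LinearMap.lTensor (Poly D) L

theorem coefP_tmul (L : CForm D →ₗ[ℝ] CForm D) (p : Poly D) (a : CForm D) :
    coefP L (p ⊗ₜ a) = p ⊗ₜ[ℝ] L a := rfl

theorem coefP_cst (L : CForm D →ₗ[ℝ] CForm D) (a : CForm D) : coefP L (cst a) = cst (L a) := rfl

theorem coefP_mul_even {L : CForm D →ₗ[ℝ] CForm D} (h : EvenDer L) (x y : PForm D) :
    coefP L (x * y) = coefP L x * y + x * coefP L y := by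
  induction x using TensorProduct.induction_on with
  | zero => simp
  | add x x' hx hx' => simp only [add_mul, map_add, hx, hx']; abel
  | tmul p a =>
    induction y using TensorProduct.induction_on with
    | zero => simp
    | add y y' hy hy' => simp only [mul_add, map_add, hy, hy']; abel
    | tmul q b =>
      simp only [Algebra.TensorProduct.tmul_mul_tmul, coefP_tmul]
      rw [h a b, TensorProduct.tmul_add]
      rfl

theorem coefP_mul_odd {L : CForm D →ₗ[ℝ] CForm D} (h : OddDer L) (x y : PForm D) :
    coefP L (x * y) = coefP L x * y + barP x * coefP L y := by
  induction x using TensorProduct.induction_on with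
  | zero => simp
  | add x x' hx hx' => simp only [add_mul, map_add, hx, hx']; abel
  | tmul p a =>
    induction y using TensorProduct.induction_on with
    | zero => simp
    | add y y' hy hy' => simp only [mul_add, map_add, hy, hy']; abel
    | tmul q b =>
      simp only [Algebra.TensorProduct.tmul_mul_tmul, coefP_tmul, barP_tmul]
      rw [h a b, TensorProduct.tmul_add]
      rfl

theorem poly_smul_mul (p : Poly D) (x y : PForm D) : (p • x) * y = p • (x * y) :=
  smul_mul_assoc p x y

theorem mul_poly_smul (p : Poly D) (x y : PForm D) : x * (p • y) = p • (x * y) :=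
  mul_smul_comm p x y

/-- Multiplication by a polynomial. -/
def polyMul (p : Poly D) : PForm D →ₗ[ℝ] PForm D := Algebra.lsmul ℝ ℝ (PForm D) p

theorem polyMul_apply (p : Poly D) (x : PForm D) : polyMul p x = p • x := rfl

theorem polyMul_isDer {l r : CForm D →ₐ[ℝ] PForm D} {L : CForm D →ₗ[ℝ] PForm D}
    (h : IsDer l r L) (p : Poly D) : IsDer l r (polyMul p ∘ₗ L) := fun a b => by
  simp only [LinearMap.comp_apply, polyMul_apply]
  rw [h a b, smul_add, poly_smul_mul, mul_poly_smul]

/-- Linearization and even derivations. -/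
theorem symb_even {L : CForm D →ₗ[ℝ] CForm D} (h : EvenDer L)
    (hL : ∀ a, L (gradeInv a) = gradeInv (L a)) (m : Lab D → Poly D)
    (hj : ∀ I κ, L (cgen (jet I κ)) = lin κ (m κ * MvPolynomial.monomial I 1))
    (hx : ∀ κ μ, symb κ (L (cgen (.inr (.inr μ)))) = 0) (κ : Lab D) (a : CForm D) :
    symb κ (L a) = m κ • symb κ a + coefP L (symb κ a) := by
  have hS := symb_isDer κ
  have hLt : ∀ a, L (twist κ a) = twist κ (L a) := by
    cases κ with
    | inl z => exact fun a => rfl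
    | inr z => exact hL
  have key : IsDer (cst.comp (twist κ)) cst (symb κ ∘ₗ L - coefP L ∘ₗ symb κ) := fun a b => by
    simp only [LinearMap.sub_apply, LinearMap.comp_apply]
    rw [h a b, map_add, hS _ _, hS _ _, hS a b, map_add, coefP_mul_even h, coefP_mul_even h]
    simp only [AlgHom.id_apply, AlgHom.comp_apply, coefP_cst, hLt, sub_mul, mul_sub]
    abel
  have := key.ext (polyMul_isDer hS (m κ)) (gen_cases (fun I κ' => by
    simp only [LinearMap.sub_apply, LinearMap.comp_apply, hj, symb_lin, symb_jet]
    have one : L 1 = 0 := by simpa using h 1 1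
    split_ifs with e
    · rw [coefP_tmul, one, TensorProduct.tmul_zero, sub_zero, polyMul_apply,
        TensorProduct.smul_tmul', smul_eq_mul, e]
    · rw [map_zero, map_zero, sub_zero]) fun μ => by
    simp only [LinearMap.sub_apply, LinearMap.comp_apply, hx, symb_dx, map_zero, sub_zero])
  have h2 := LinearMap.congr_fun this a
  simp only [LinearMap.sub_apply, LinearMap.comp_apply, polyMul_apply] at h2
  rw [← h2, sub_add_cancel]

theorem symb_tot (μ : Fin D) (κ : Lab D) (a : CForm D) :
    symb κ (tot μ a) = (MvPolynomial.X μ : Poly D) • symb κ a + coefP (tot μ) (symb κ a) :=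
  symb_even (tot_evenDer μ) (tot_gradeInv μ) (fun _ => MvPolynomial.X μ)
    (fun I κ => by rw [tot_jet, X_mul_monomial, lin_monomial])
    (fun κ ν => by rw [tot_dx, map_zero]) κ a

theorem symb_cnt (w : Lab D → ℕ) (e : ℕ) (κ : Lab D) (a : CForm D) :
    symb κ (cnt w e a) = (w κ : ℝ) • symb κ a + coefP (cnt w e) (symb κ a) := by
  have := symb_even (cnt_evenDer w e) (cnt_gradeInv w e)
    (fun κ => algebraMap ℝ (Poly D) (w κ))
    (fun I κ => by rw [cnt_cgen, wt_jet, ← Algebra.smul_def, map_smul, lin_monomial])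
    (fun κ ν => by rw [cnt_cgen, map_smul, symb_dx, smul_zero]) κ a
  rwa [algebraMap_smul] at this

theorem symb_gradeInv (κ : Lab D) (a : CForm D) :
    symb κ (gradeInv a) = par κ • barP (symb κ a) := by
  have e : barP (symb κ a) =
      ∑ᶠ I : MultiIdx D, barP ((MvPolynomial.monomial I 1 : Poly D) ⊗ₜ[ℝ] pd (jet I κ) a) :=
    AddMonoidHom.map_finsum barP.toLinearMap.toAddMonoidHom (finite_symb κ a)
  rw [e, smul_finsum, symb_apply]
  refine finsum_congr fun I => ?_
  rw [pd_jet_gradeInv, barP_tmul, TensorProduct.tmul_smul]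

/-- Linearization and the Koszul-Tate differential. -/
theorem symb_kos (κ : Lab D) (a : CForm D) : symb κ (kos a) =
    ∑ κ', ktMat κ κ' • symb κ' a + par κ • coefP kos (symb κ a) := by
  have hS := symb_isDer κ
  have hkt : ∀ a, par κ • kos (twist κ a) = twist κ (kos a) := by
    cases κ with
    | inl z => exact fun a => one_smul _ _
    | inr z => intro a; rw [par, twist, kos_gradeInv, neg_one_smul, neg_neg]
  have key : IsDer (cst.comp ((twist κ).comp gradeInv)) cst
      (symb κ ∘ₗ kos - par κ • coefP kos ∘ₗ symb κ) := fun a b => by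
    simp only [LinearMap.sub_apply, LinearMap.smul_apply, LinearMap.comp_apply]
    rw [kos_oddDer a b, map_add, hS _ _, hS _ _, hS a b, map_add, coefP_mul_odd kos_oddDer,
      coefP_mul_odd kos_oddDer]
    simp only [AlgHom.id_apply, AlgHom.comp_apply, coefP_cst, ← hkt, symb_gradeInv, sub_mul,
      mul_sub, smul_add, barP_cst, twist_gradeInv, map_smul, smul_mul_assoc, mul_smul_comm]
    abel
  have hs : IsDer (cst.comp ((twist κ).comp gradeInv)) cst
      (∑ κ', polyMul (ktMat κ κ') ∘ₗ symb κ') := IsDer.sum _ fun κ' _ => by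
    by_cases h0 : ktMat κ κ' = 0
    · have : polyMul (ktMat κ κ') ∘ₗ symb κ' = 0 := LinearMap.ext fun a => by
        rw [LinearMap.comp_apply, polyMul_apply, h0, zero_smul, LinearMap.zero_apply]
      rw [this]
      exact IsDer.zero
    · have : (twist κ).comp gradeInv = twist κ' := by
        rcases κ with z | z <;> rcases κ' with z' | z'
        · exact absurd (ktMat_inl_inl z z') h0
        · rfl
        · exact AlgHom.ext fun a => gradeInv_gradeInv a
        · exact absurd (ktMat_inr_inr z z') h0
      rw [this]
      exact polyMul_isDer (symb_isDer κ') _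
  have := key.ext hs (gen_cases (fun I κ' => by
    classical
    simp only [LinearMap.sub_apply, LinearMap.smul_apply, LinearMap.comp_apply, kos_jet,
      LinearMap.sum_apply, map_sum, symb_lin, symb_jet, polyMul_apply]
    have one : kos (1 : CForm D) = 0 := by simpa using kos_oddDer (1 : CForm D) 1
    have e : coefP kos (if κ = κ' then (MvPolynomial.monomial I 1 : Poly D) ⊗ₜ[ℝ] (1 : CForm D)
        else 0) = 0 := by
      split_ifs
      · rw [coefP_tmul, one, TensorProduct.tmul_zero]
      · exact map_zero _
    rw [e, smul_zero, sub_zero]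
    simp only [smul_ite, smul_zero, Finset.sum_ite_eq, Finset.sum_ite_eq', Finset.mem_univ,
      if_true, TensorProduct.smul_tmul', smul_eq_mul]) fun μ => by
    simp only [LinearMap.sub_apply, LinearMap.smul_apply, LinearMap.comp_apply, kos_dx, symb_dx,
      LinearMap.sum_apply, map_zero, smul_zero, sub_zero, Finset.sum_const_zero])
  have h2 := LinearMap.congr_fun this a
  simp only [LinearMap.sub_apply, LinearMap.smul_apply, LinearMap.comp_apply, LinearMap.sum_apply,
    polyMul_apply] at h2
  rw [← h2, sub_add_cancel]

/-- The substitution of a variable for the momenta. -/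
def subst (κ : Lab D) : PForm D →ₗ[ℝ] CForm D :=
  TensorProduct.lift (LinearMap.mul ℝ (CForm D) ∘ₗ lin κ)

theorem subst_tmul (κ : Lab D) (p : Poly D) (a : CForm D) : subst κ (p ⊗ₜ a) = lin κ p * a := rfl

theorem subst_mul_cst (κ : Lab D) (x : PForm D) (b : CForm D) :
    subst κ (x * cst b) = subst κ x * b := by
  induction x using TensorProduct.induction_on with
  | zero => simp
  | add x x' hx hx' => simp only [add_mul, map_add, hx, hx']
  | tmul p a =>
    rw [cst_apply, Algebra.TensorProduct.tmul_mul_tmul, mul_one, subst_tmul, subst_tmul, mul_assoc]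

theorem subst_cst_mul (κ : Lab D) (x : PForm D) (b : CForm D) :
    subst κ (cst (twist κ b) * x) = b * subst κ x := by
  induction x using TensorProduct.induction_on with
  | zero => simp
  | add x x' hx hx' => simp only [mul_add, map_add, hx, hx']
  | tmul p a =>
    rw [cst_apply, Algebra.TensorProduct.tmul_mul_tmul, one_mul, subst_tmul, subst_tmul,
      ← mul_assoc, ← mul_assoc, lin_mul_twist]

/-- Euler's formula. -/
theorem sum_subst_symb (a : CForm D) : ∑ κ, subst κ (symb κ a) = cnt (fun _ => 1) 0 a := by
  classical
  have h : EvenDer (∑ κ, subst κ ∘ₗ symb κ : CForm D →ₗ[ℝ] CForm D) :=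
    IsDer.sum _ fun κ _ a b => by
      simp only [LinearMap.comp_apply]
      rw [symb_isDer κ a b, map_add, subst_mul_cst, AlgHom.comp_apply, subst_cst_mul]
      rfl
  have := h.ext (cnt_evenDer (fun _ => 1) 0) (gen_cases (fun I κ => by
    simp only [LinearMap.sum_apply, LinearMap.comp_apply, symb_jet, cnt_cgen, wt_jet, Nat.cast_one,
      one_smul, apply_ite (subst _), subst_tmul, lin_monomial, mul_one, map_zero,
      Finset.sum_ite_eq', Finset.mem_univ, if_true]) fun μ => by
    simp only [LinearMap.sum_apply, LinearMap.comp_apply, symb_dx, map_zero, cnt_cgen, wt,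
      Finset.sum_const_zero, Nat.cast_zero, zero_smul])
  have h2 := LinearMap.congr_fun this a
  simpa only [LinearMap.sum_apply, LinearMap.comp_apply] using h2

/-! ### Forms with explicit dependence on the coordinates -/

/-- Local forms, with sealed instances. -/
def LForm (D : ℕ) : Type := Smooth D ⊗[ℝ] CForm D

instance : AddCommGroup (LForm D) := inferInstanceAs (AddCommGroup (Smooth D ⊗[ℝ] CForm D))

instance : Module ℝ (LForm D) := inferInstanceAs (Module ℝ (Smooth D ⊗[ℝ] CForm D))

/-- The product of a function and a form. -/
def pur : Smooth D →ₗ[ℝ] CForm D →ₗ[ℝ] LForm D := TensorProduct.mk ℝ (Smooth D) (CForm D)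

theorem LForm.induction {p : LForm D → Prop} (h0 : p 0) (hp : ∀ f c, p (pur f c))
    (ha : ∀ a b, p a → p b → p (a + b)) (a : LForm D) : p a :=
  TensorProduct.induction_on (motive := p) a h0 hp ha

/-- The linear map determined by a bilinear one. -/
def lliftB {M : Type*} [AddCommGroup M] [Module ℝ M] (B : Smooth D →ₗ[ℝ] CForm D →ₗ[ℝ] M) :
    LForm D →ₗ[ℝ] M := TensorProduct.lift B

theorem lliftB_pur {M : Type*} [AddCommGroup M] [Module ℝ M]
    (B : Smooth D →ₗ[ℝ] CForm D →ₗ[ℝ] M) (f : Smooth D) (c : CForm D) :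
    lliftB B (pur f c) = B f c := TensorProduct.lift.tmul f c

theorem lform_ext {M : Type*} [AddCommGroup M] [Module ℝ M] {F G : LForm D →ₗ[ℝ] M}
    (h : ∀ f c, F (pur f c) = G (pur f c)) : F = G := by
  refine LinearMap.ext fun a => ?_
  induction a using LForm.induction with
  | h0 => rw [map_zero, map_zero]
  | hp f c => exact h f c
  | ha a b ha hb => rw [map_add, map_add, ha, hb]

/-- The action of an operator that does not see the coordinates. -/
def hat (L : CForm D →ₗ[ℝ] CForm D) : LForm D →ₗ[ℝ] LForm D := lliftB (pur.compl₂ L)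

theorem hat_pur (L : CForm D →ₗ[ℝ] CForm D) (f : Smooth D) (c : CForm D) :
    hat L (pur f c) = pur f (L c) := lliftB_pur _ f c

theorem hat_add (L L' : CForm D →ₗ[ℝ] CForm D) : hat (L + L') = hat L + hat L' :=
  lform_ext fun f c => by
    rw [LinearMap.add_apply, hat_pur, hat_pur, hat_pur, LinearMap.add_apply, map_add]

theorem hat_smul (r : ℝ) (L : CForm D →ₗ[ℝ] CForm D) : hat (r • L) = r • hat L :=
  lform_ext fun f c => by
    rw [LinearMap.smul_apply, hat_pur, hat_pur, LinearMap.smul_apply, map_smul]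

theorem hat_comp (L L' : CForm D →ₗ[ℝ] CForm D) : hat (L ∘ₗ L') = hat L ∘ₗ hat L' :=
  lform_ext fun f c => by
    rw [LinearMap.comp_apply, hat_pur, hat_pur, hat_pur, LinearMap.comp_apply]

theorem hat_id : hat (LinearMap.id : CForm D →ₗ[ℝ] CForm D) = LinearMap.id :=
  lform_ext fun f c => by rw [hat_pur]; rfl

theorem hat_zero : hat (0 : CForm D →ₗ[ℝ] CForm D) = 0 :=
  lform_ext fun f c => by
    rw [hat_pur, LinearMap.zero_apply, LinearMap.zero_apply, map_zero]

theorem hat_comm {L L' : CForm D →ₗ[ℝ] CForm D} (h : ∀ a, L (L' a) = L' (L a)) (a : LForm D) :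
    hat L (hat L' a) = hat L' (hat L a) := by
  have : L ∘ₗ L' = L' ∘ₗ L := LinearMap.ext h
  rw [← LinearMap.comp_apply, ← hat_comp, this, hat_comp, LinearMap.comp_apply]

theorem Diag.hat {L : CForm D →ₗ[ℝ] CForm D} (h : Diag L) : Diag (hat L) := fun a => by
  induction a using LForm.induction with
  | h0 => exact zero_mem _
  | ha a b ha hb => exact add_mem ha hb
  | hp f c =>
    have : Submodule.span ℝ {x | ∃ n : ℕ, L x = (n : ℝ) • x} ≤ (Submodule.span ℝ
        {x | ∃ n : ℕ, DualGravity.hat L x = (n : ℝ) • x}).comap (pur f) := by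
      refine Submodule.span_le.2 ?_
      rintro x ⟨n, hx⟩
      exact Submodule.subset_span ⟨n, by rw [hat_pur, hx, map_smul]⟩
    exact this (h c)

/-- The explicit partial derivative. -/
def expl (μ : Fin D) : LForm D →ₗ[ℝ] LForm D := lliftB (pur ∘ₗ partialX μ)

theorem expl_pur (μ : Fin D) (f : Smooth D) (c : CForm D) :
    expl μ (pur f c) = pur (partialX μ f) c := lliftB_pur _ f c

/-- The total derivative. -/
def tD (μ : Fin D) : LForm D →ₗ[ℝ] LForm D := expl μ + hat (tot μ)

theorem tD_pur (μ : Fin D) (f : Smooth D) (c : CForm D) :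
    tD μ (pur f c) = pur (partialX μ f) c + pur f (tot μ c) := by
  rw [tD, LinearMap.add_apply, expl_pur, hat_pur]

theorem hat_tD {L : CForm D →ₗ[ℝ] CForm D} {μ : Fin D} (h : ∀ a, L (tot μ a) = tot μ (L a))
    (a : LForm D) : hat L (tD μ a) = tD μ (hat L a) := by
  have : hat L ∘ₗ tD μ = tD μ ∘ₗ hat L := lform_ext fun f c => by
    simp only [LinearMap.comp_apply, tD_pur, hat_pur, map_add, h]
  exact LinearMap.congr_fun this a

theorem partialX_comm (μ ν : Fin D) (f : Smooth D) :
    partialX μ (partialX ν f) = partialX ν (partialX μ f) := by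
  apply Subtype.ext
  funext x
  have hf : ContDiff ℝ ∞ f.1 := mem_smooth.1 f.2
  have h1 : ∀ (α β : Fin D), (partialX α (partialX β f)).1 x =
      fderiv ℝ (fderiv ℝ f.1) x (Pi.single α 1) (Pi.single β 1) := fun α β => by
    change fderiv ℝ (fun y => fderiv ℝ f.1 y (Pi.single β 1)) x (Pi.single α 1) = _
    have hd : DifferentiableAt ℝ (fderiv ℝ f.1) x :=
      ((hf.fderiv_right (m := ∞) (by simp)).differentiable (by simp)) x
    rw [fderiv_clm_apply hd (differentiableAt_const _)]
    simp
  rw [h1, h1]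
  exact (hf.contDiffAt.isSymmSndFDerivAt (by
    rw [minSmoothness_of_isRCLikeNormedField]; exact WithTop.coe_le_coe.2 (le_top : (2 : ℕ∞) ≤ ⊤))).eq _ _

theorem tD_comm (μ ν : Fin D) (a : LForm D) : tD μ (tD ν a) = tD ν (tD μ a) := by
  have : tD μ ∘ₗ tD ν = tD ν ∘ₗ tD μ := lform_ext fun f c => by
    simp only [LinearMap.comp_apply, tD_pur, map_add, partialX_comm μ ν, tot_comm μ ν]
    abel
  exact LinearMap.congr_fun this a

/-- The Koszul-Tate differential. -/
def dK : LForm D →ₗ[ℝ] LForm D := hat kos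

theorem dK_pur (f : Smooth D) (c : CForm D) : dK (pur f c) = pur f (kos c) := hat_pur _ _ _

theorem dK_tD (μ : Fin D) (a : LForm D) : dK (tD μ a) = tD μ (dK a) := hat_tD (kos_tot μ) a

theorem dK_dK (a : LForm D) : dK (dK a) = 0 := by
  have : (kos : CForm D →ₗ[ℝ] CForm D) ∘ₗ kos = 0 := LinearMap.ext kos_kos
  rw [dK, ← LinearMap.comp_apply, ← hat_comp, this, hat_zero, LinearMap.zero_apply]

/-- Multiplication from the left. -/
def cmul (c : CForm D) : LForm D →ₗ[ℝ] LForm D := hat (LinearMap.mulLeft ℝ c)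

theorem cmul_pur (c : CForm D) (f : Smooth D) (b : CForm D) : cmul c (pur f b) = pur f (c * b) :=
  hat_pur _ _ _

theorem cmul_add (c c' : CForm D) (a : LForm D) : cmul (c + c') a = cmul c a + cmul c' a := by
  have : LinearMap.mulLeft ℝ (c + c') = LinearMap.mulLeft ℝ c + LinearMap.mulLeft ℝ c' :=
    LinearMap.ext fun x => add_mul c c' x
  rw [cmul, this, hat_add, LinearMap.add_apply]
  rfl

theorem cmul_smul (r : ℝ) (c : CForm D) (a : LForm D) : cmul (r • c) a = r • cmul c a := by
  have : LinearMap.mulLeft ℝ (r • c) = r • LinearMap.mulLeft ℝ c :=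
    LinearMap.ext fun x => smul_mul_assoc r c x
  rw [cmul, this, hat_smul, LinearMap.smul_apply]
  rfl

theorem cmul_mul (c c' : CForm D) (a : LForm D) : cmul (c * c') a = cmul c (cmul c' a) := by
  have : LinearMap.mulLeft ℝ (c * c') = LinearMap.mulLeft ℝ c ∘ₗ LinearMap.mulLeft ℝ c' :=
    LinearMap.ext fun x => mul_assoc c c' x
  rw [cmul, this, hat_comp, LinearMap.comp_apply]
  rfl

theorem cmul_one (a : LForm D) : cmul 1 a = a := by
  have : LinearMap.mulLeft ℝ (1 : CForm D) = LinearMap.id := LinearMap.ext fun x => one_mul x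
  rw [cmul, this, hat_id, LinearMap.id_apply]

/-- Multiplication as a bilinear map. -/
def cmulB : CForm D →ₗ[ℝ] LForm D →ₗ[ℝ] LForm D where
  toFun := cmul
  map_add' c c' := LinearMap.ext (cmul_add c c')
  map_smul' r c := LinearMap.ext (cmul_smul r c)

theorem cmul_zero (a : LForm D) : cmul 0 a = 0 :=
  LinearMap.congr_fun (map_zero (cmulB (D := D))) a

theorem cmul_sum {ι : Type*} (s : Finset ι) (c : ι → CForm D) (a : LForm D) :
    cmul (∑ i ∈ s, c i) a = ∑ i ∈ s, cmul (c i) a := by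
  have := LinearMap.congr_fun (map_sum cmulB c s) a
  rwa [LinearMap.sum_apply] at this

theorem tD_cmul (μ : Fin D) (c : CForm D) (a : LForm D) :
    tD μ (cmul c a) = cmul (tot μ c) a + cmul c (tD μ a) := by
  have : tD μ ∘ₗ cmul c = cmul (tot μ c) + cmul c ∘ₗ tD μ := lform_ext fun f b => by
    simp only [LinearMap.comp_apply, LinearMap.add_apply, tD_pur, cmul_pur, map_add]
    rw [tot_evenDer μ c b, map_add]
    simp only [AlgHom.id_apply]
    abel
  exact LinearMap.congr_fun this a

theorem dK_cmul (c : CForm D) (a : LForm D) :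
    dK (cmul c a) = cmul (kos c) a + cmul (gradeInv c) (dK a) := by
  have : dK ∘ₗ cmul c = cmul (kos c) + cmul (gradeInv c) ∘ₗ dK := lform_ext fun f b => by
    simp only [LinearMap.comp_apply, LinearMap.add_apply, dK_pur, cmul_pur]
    rw [kos_oddDer c b, map_add]
    rfl
  exact LinearMap.congr_fun this a

theorem hat_cnt_cmul (w : Lab D → ℕ) (e : ℕ) (c : CForm D) (a : LForm D) :
    hat (cnt w e) (cmul c a) = cmul (cnt w e c) a + cmul c (hat (cnt w e) a) := by
  have : hat (cnt w e) ∘ₗ cmul c = cmul (cnt w e c) + cmul c ∘ₗ hat (cnt w e) :=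
    lform_ext fun f b => by
    simp only [LinearMap.comp_apply, LinearMap.add_apply, hat_pur, cmul_pur]
    rw [cnt_evenDer w e c b, map_add]
    rfl
  exact LinearMap.congr_fun this a

/-! ### Linearization of forms with explicit dependence on the coordinates -/

/-- Polynomials with coefficients in the local forms. -/
abbrev PLForm (D : ℕ) : Type := Poly D ⊗[ℝ] LForm D

/-- The action of an operator on the coefficients. -/
def coefL {M : Type*} [AddCommGroup M] [Module ℝ M] (L : LForm D →ₗ[ℝ] M) :
    PLForm D →ₗ[ℝ] Poly D ⊗[ℝ] M := LinearMap.lTensor (Poly D) L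

theorem coefL_tmul {M : Type*} [AddCommGroup M] [Module ℝ M] (L : LForm D →ₗ[ℝ] M) (p : Poly D)
    (a : LForm D) : coefL L (p ⊗ₜ a) = p ⊗ₜ[ℝ] L a := rfl

theorem coefL_smul {M : Type*} [AddCommGroup M] [Module ℝ M] (L : LForm D →ₗ[ℝ] M) (p : Poly D)
    (u : PLForm D) : coefL L (p • u) = p • coefL L u := by
  induction u using TensorProduct.induction_on with
  | zero => simp
  | add u w hu hw => simp only [smul_add, map_add, hu, hw]
  | tmul q h => simp [coefL_tmul, TensorProduct.smul_tmul']

theorem coefL_comp {M : Type*} [AddCommGroup M] [Module ℝ M] (L : LForm D →ₗ[ℝ] M)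
    (L' : LForm D →ₗ[ℝ] LForm D) (u : PLForm D) : coefL (L ∘ₗ L') u = coefL L (coefL L' u) := by
  rw [coefL, LinearMap.lTensor_comp, LinearMap.comp_apply]
  rfl

theorem coefL_comm {L L' : LForm D →ₗ[ℝ] LForm D} (h : ∀ a, L (L' a) = L' (L a)) (u : PLForm D) :
    coefL L (coefL L' u) = coefL L' (coefL L u) := by
  have : L ∘ₗ L' = L' ∘ₗ L := LinearMap.ext h
  rw [← coefL_comp, this, coefL_comp]

theorem coefL_zero (u : PLForm D) : coefL (0 : LForm D →ₗ[ℝ] LForm D) u = 0 := by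
  rw [coefL, LinearMap.lTensor_zero, LinearMap.zero_apply]

/-- Multiplication of the coefficients by a function. -/
def purP (f : Smooth D) : PForm D →ₗ[ℝ] PLForm D := LinearMap.lTensor (Poly D) (pur f)

theorem purP_tmul (f : Smooth D) (p : Poly D) (c : CForm D) :
    purP f (p ⊗ₜ c) = p ⊗ₜ[ℝ] pur f c := rfl

theorem purP_smul (f : Smooth D) (p : Poly D) (u : PForm D) : purP f (p • u) = p • purP f u := by
  induction u using TensorProduct.induction_on with
  | zero => simp
  | add u w hu hw => simp only [smul_add, map_add, hu, hw]
  | tmul q h => simp [purP_tmul, TensorProduct.smul_tmul']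

theorem coefL_hat_purP (L : CForm D →ₗ[ℝ] CForm D) (f : Smooth D) (u : PForm D) :
    coefL (hat L) (purP f u) = purP f (coefP L u) := by
  induction u using TensorProduct.induction_on with
  | zero => simp
  | add u w hu hw => simp only [map_add, hu, hw]
  | tmul q h => rw [purP_tmul, coefL_tmul, coefP_tmul, purP_tmul, hat_pur]

theorem coefL_tD_purP (μ : Fin D) (f : Smooth D) (u : PForm D) :
    coefL (tD μ) (purP f u) = purP (partialX μ f) u + purP f (coefP (tot μ) u) := by
  induction u using TensorProduct.induction_on with
  | zero => simp
  | add u w hu hw => simp only [map_add, hu, hw]; abel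
  | tmul q h =>
    rw [purP_tmul, coefL_tmul, coefP_tmul, purP_tmul, tD_pur, TensorProduct.tmul_add]
    rfl

/-- The linearization with respect to a variable. -/
def lsymb (κ : Lab D) : LForm D →ₗ[ℝ] PLForm D :=
  lliftB (LinearMap.lcomp ℝ (PLForm D) (symb κ) ∘ₗ LinearMap.lTensorHom (Poly D) ∘ₗ pur)

theorem lsymb_pur (κ : Lab D) (f : Smooth D) (c : CForm D) :
    lsymb κ (pur f c) = purP f (symb κ c) := lliftB_pur _ f c

theorem lsymb_tD (μ : Fin D) (κ : Lab D) (a : LForm D) : lsymb κ (tD μ a) =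
    (MvPolynomial.X μ : Poly D) • lsymb κ a + coefL (tD μ) (lsymb κ a) := by
  induction a using LForm.induction with
  | h0 => simp
  | ha a b ha hb => simp only [map_add, ha, hb, smul_add]; abel
  | hp f c =>
    rw [tD_pur, map_add, lsymb_pur, lsymb_pur, lsymb_pur, symb_tot, map_add, purP_smul,
      coefL_tD_purP]
    abel

theorem lsymb_dK (κ : Lab D) (a : LForm D) : lsymb κ (dK a) =
    ∑ κ', ktMat κ κ' • lsymb κ' a + par κ • coefL dK (lsymb κ a) := by
  induction a using LForm.induction with
  | h0 => simp
  | ha a b ha hb =>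
    simp only [map_add, ha, hb, smul_add, Finset.sum_add_distrib]; abel
  | hp f c =>
    simp only [dK, hat_pur, lsymb_pur, symb_kos, map_add, map_sum, map_smul, purP_smul,
      coefL_hat_purP]

theorem lsymb_cnt (w : Lab D → ℕ) (e : ℕ) (κ : Lab D) (a : LForm D) : lsymb κ (hat (cnt w e) a) =
    (w κ : ℝ) • lsymb κ a + coefL (hat (cnt w e)) (lsymb κ a) := by
  induction a using LForm.induction with
  | h0 => simp
  | ha a b ha hb => simp only [map_add, ha, hb, smul_add]; abel
  | hp f c =>
    rw [hat_pur, lsymb_pur, lsymb_pur, symb_cnt, map_add, map_smul, coefL_hat_purP]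

/-- The substitution of a variable for the momenta. -/
def lsubst (κ : Lab D) : PLForm D →ₗ[ℝ] LForm D := TensorProduct.lift (cmulB ∘ₗ lin κ)

theorem lsubst_tmul (κ : Lab D) (p : Poly D) (a : LForm D) :
    lsubst κ (p ⊗ₜ a) = cmul (lin κ p) a := rfl

theorem lsubst_purP (κ : Lab D) (f : Smooth D) (u : PForm D) :
    lsubst κ (purP f u) = pur f (subst κ u) := by
  induction u using TensorProduct.induction_on with
  | zero => simp
  | add u w hu hw => simp only [map_add, hu, hw]
  | tmul p c => rw [purP_tmul, lsubst_tmul, subst_tmul, cmul_pur]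

/-- Euler's formula. -/
theorem sum_lsubst_lsymb (a : LForm D) :
    ∑ κ, lsubst κ (lsymb κ a) = hat (cnt (fun _ => 1) 0) a := by
  induction a using LForm.induction with
  | h0 => simp
  | ha a b ha hb => simp only [map_add, Finset.sum_add_distrib, ha, hb]
  | hp f c => simp only [lsymb_pur, lsubst_purP, ← map_sum, sum_subst_symb, hat_pur]

theorem tD_lsubst (μ : Fin D) (κ : Lab D) (u : PLForm D) : tD μ (lsubst κ u) =
    lsubst κ ((MvPolynomial.X μ : Poly D) • u + coefL (tD μ) u) := by
  induction u using TensorProduct.induction_on with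
  | zero => simp
  | add u w hu hw => simp only [smul_add, map_add, hu, hw]; abel
  | tmul p a =>
    rw [lsubst_tmul, tD_cmul, tot_lin, coefL_tmul, map_add, lsubst_tmul, TensorProduct.smul_tmul',
      smul_eq_mul, lsubst_tmul]

theorem dK_lsubst (κ : Lab D) (u : PLForm D) : dK (lsubst κ u) =
    ∑ κ', lsubst κ' (ktMat κ' κ • u) + par κ • lsubst κ (coefL dK u) := by
  induction u using TensorProduct.induction_on with
  | zero => simp
  | add u w hu hw => simp only [smul_add, map_add, hu, hw, Finset.sum_add_distrib]; abel
  | tmul p a =>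
    rw [lsubst_tmul, dK_cmul, kos_lin, cmul_sum, gradeInv_lin, cmul_smul, coefL_tmul, lsubst_tmul]
    rfl

/-! ### The augmentation -/

/-- The value of a form at vanishing generators. -/
def aug : CForm D →ₐ[ℝ] ℝ :=
  Algebra.TensorProduct.productMap (MvPolynomial.aeval fun _ : EvenJet D => (0 : ℝ))
    (ExteriorAlgebra.algebraMapInv (R := ℝ) (M := OddGen D →₀ ℝ))

theorem aug_cgen (z : Gen D) : aug (cgen z) = 0 := by
  rcases z with e | o
  · change Algebra.TensorProduct.productMap _ _ (MvPolynomial.X e ⊗ₜ[ℝ] 1) = 0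
    rw [Algebra.TensorProduct.productMap_apply_tmul, MvPolynomial.aeval_X, zero_mul]
  · change Algebra.TensorProduct.productMap _ _ (1 ⊗ₜ[ℝ] ExteriorAlgebra.ι ℝ (Finsupp.single o 1)) = 0
    rw [Algebra.TensorProduct.productMap_apply_tmul]
    simp [ExteriorAlgebra.algebraMapInv]

theorem aug_lin (κ : Lab D) (p : Poly D) : aug (lin κ p) = 0 := by
  have := lin_mem (κ := κ) (U := LinearMap.ker aug.toLinearMap)
    (fun I => aug_cgen (jet I κ)) p
  exact this

theorem aug_tot (μ : Fin D) (a : CForm D) : aug (tot μ a) = 0 := by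
  have h : IsDer aug aug (aug.toLinearMap ∘ₗ tot μ) := fun a b => by
    simp only [LinearMap.comp_apply, AlgHom.toLinearMap_apply]
    rw [tot_evenDer μ a b, map_add, map_mul, map_mul]
    rfl
  have := h.ext IsDer.zero (gen_cases (fun I κ => by
    rw [LinearMap.comp_apply, tot_jet]; exact aug_cgen _) fun ν => by
    rw [LinearMap.comp_apply, tot_dx, map_zero, LinearMap.zero_apply])
  exact LinearMap.congr_fun this a

theorem aug_kos (a : CForm D) : aug (kos a) = 0 := by
  have h : IsDer ((aug : CForm D →ₐ[ℝ] ℝ).comp gradeInv) aug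
      (aug.toLinearMap ∘ₗ (kos : CForm D →ₗ[ℝ] CForm D)) := fun a b => by
    simp only [LinearMap.comp_apply, AlgHom.toLinearMap_apply]
    rw [kos_oddDer a b, map_add, map_mul, map_mul]
    rfl
  have := h.ext IsDer.zero (gen_cases (fun I κ => by
    rw [LinearMap.comp_apply, kos_jet, AlgHom.toLinearMap_apply, map_sum]
    exact Finset.sum_eq_zero fun κ' _ => aug_lin _ _) fun ν => by
    rw [LinearMap.comp_apply, kos_dx, map_zero, LinearMap.zero_apply])
  exact LinearMap.congr_fun this a

theorem aug_cnt (w : Lab D → ℕ) (e : ℕ) (a : CForm D) : aug (cnt w e a) = 0 := by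
  have h : IsDer aug aug (aug.toLinearMap ∘ₗ cnt w e) := fun a b => by
    simp only [LinearMap.comp_apply, AlgHom.toLinearMap_apply]
    rw [cnt_evenDer w e a b, map_add, map_mul, map_mul]
    rfl
  have := h.ext IsDer.zero fun z => by
    rw [LinearMap.comp_apply, cnt_cgen, AlgHom.toLinearMap_apply, map_smul, aug_cgen, smul_zero]
    rfl
  exact LinearMap.congr_fun this a

theorem cnt_prod (w : Lab D → ℕ) (e : ℕ) (l : List (Gen D)) :
    cnt w e (l.map cgen).prod = (((l.map (wt w e)).sum : ℕ) : ℝ) • (l.map cgen).prod := by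
  induction l with
  | nil =>
    have : cnt w e (1 : CForm D) = 0 := by simpa using cnt_evenDer w e (1 : CForm D) 1
    simp [this]
  | cons z l ih =>
    rw [List.map_cons, List.prod_cons, cnt_evenDer w e _ _, ih, cnt_cgen, List.map_cons,
      List.sum_cons, Nat.cast_add, add_smul, AlgHom.id_apply, AlgHom.id_apply, smul_mul_assoc,
      mul_smul_comm]

/-- The operator counting all the generators. -/
abbrev cntAll : CForm D →ₗ[ℝ] CForm D := cnt (fun _ => 1) 1

/-- A product of generators has counting eigenvalue zero only if it is empty, and `aug` kills all
the others. -/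
theorem calc'_cntAll (a : CForm D) :
    calc' cntAll (fun n => if n = 0 then 1 else 0) a = aug a • (1 : CForm D) := by
  have key : Submodule.span ℝ (Set.range fun l : List (Gen D) => (l.map cgen).prod) ≤
      LinearMap.eqLocus (calc' cntAll fun n => if n = 0 then 1 else 0)
        (LinearMap.smulRight aug.toLinearMap (1 : CForm D)) := by
    refine Submodule.span_le.2 ?_
    rintro _ ⟨l, rfl⟩
    change calc' cntAll _ _ = aug _ • 1
    rw [(cnt_diag _ _).calc'_apply _ (cnt_prod _ _ l)]
    cases l with
    | nil => simp
    | cons z l =>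
      have : wt (fun _ => 1) 1 z = 1 := by rcases z with z | z | z <;> rfl
      have h0 : aug ((z :: l).map cgen).prod = 0 := by
        rw [List.map_cons, List.prod_cons, map_mul, aug_cgen, zero_mul]
      rw [List.map_cons, List.sum_cons, if_neg (by omega), zero_smul]
      exact (by rw [h0, zero_smul] : (0 : CForm D) = aug ((z :: l).map cgen).prod • 1)
  exact key (span_cgen_prod (D := D) ▸ Submodule.mem_top)

/-- The inverse of the total counting operator on forms with generators. -/
def invAll : CForm D →ₗ[ℝ] CForm D := calc' cntAll fun n => (n : ℝ)⁻¹

theorem cntAll_invAll (a : CForm D) : cntAll (invAll a) = a - aug a • (1 : CForm D) := by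
  rw [invAll, (cnt_diag _ _).apply_calc'_inv, calc'_cntAll]

theorem invAll_comm (T : CForm D →ₗ[ℝ] CForm D) (hT : ∀ x, cntAll (T x) = T (cntAll x))
    (a : CForm D) : invAll (T a) = T (invAll a) := (cnt_diag _ _).calc'_comm_of_comm _ T hT a

/-- The value at vanishing generators, a function of the coordinates. -/
def augL : LForm D →ₗ[ℝ] Smooth D :=
  lliftB ((LinearMap.lsmul ℝ (Smooth D)).flip.compl₂ aug.toLinearMap)

theorem augL_pur (f : Smooth D) (c : CForm D) : augL (pur f c) = aug c • f := lliftB_pur _ f c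

theorem augL_tD (μ : Fin D) (a : LForm D) : augL (tD μ a) = partialX μ (augL a) := by
  induction a using LForm.induction with
  | h0 => simp
  | ha a b ha hb => simp only [map_add, ha, hb]
  | hp f c =>
    rw [tD_pur, map_add, augL_pur, augL_pur, augL_pur, aug_tot, zero_smul, add_zero, map_smul]

theorem augL_dK (a : LForm D) : augL (dK a) = 0 := by
  induction a using LForm.induction with
  | h0 => simp
  | ha a b ha hb => simp only [map_add, ha, hb, add_zero]
  | hp f c => rw [dK_pur, augL_pur, aug_kos, zero_smul]

theorem augL_cnt (w : Lab D → ℕ) (e : ℕ) (a : LForm D) : augL (hat (cnt w e) a) = 0 := by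
  induction a using LForm.induction with
  | h0 => simp
  | ha a b ha hb => simp only [map_add, ha, hb, add_zero]
  | hp f c => rw [hat_pur, augL_pur, aug_cnt, zero_smul]

theorem tD_pur_one (μ : Fin D) (f : Smooth D) : tD μ (pur f 1) = pur (partialX μ f) 1 := by
  have : tot μ (1 : CForm D) = 0 := by simpa using tot_evenDer μ (1 : CForm D) 1
  rw [tD_pur, this, map_zero, add_zero]

theorem hat_cntAll_invAll (a : LForm D) :
    hat cntAll (hat invAll a) = a - pur (augL a) 1 := by
  induction a using LForm.induction with
  | h0 => simp
  | ha a b ha hb => simp only [map_add, ha, hb, LinearMap.add_apply]; abel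
  | hp f c =>
    rw [hat_pur, hat_pur, cntAll_invAll, map_sub, map_smul, augL_pur, map_smul,
      LinearMap.smul_apply]

/-! ### The grading by the degree in the momenta -/

section Degree

variable {H : Type*} [AddCommGroup H] [Module ℝ H]

theorem diagT_monomial_smul (g : MultiIdx D → ℝ) (d : MultiIdx D) (r : ℝ) (u : Poly D ⊗[ℝ] H) :
    diagT g ((MvPolynomial.monomial d r : Poly D) • u) =
      (MvPolynomial.monomial d r : Poly D) • diagT (fun I => g (I + d)) u := by
  have : diagT g ∘ₗ Algebra.lsmul ℝ ℝ (Poly D ⊗[ℝ] H) (MvPolynomial.monomial d r : Poly D) =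
      Algebra.lsmul ℝ ℝ (Poly D ⊗[ℝ] H) (MvPolynomial.monomial d r : Poly D) ∘ₗ
        diagT (fun I => g (I + d)) :=
    poly_tensor_ext fun I x => by
      have e : (MvPolynomial.monomial d r : Poly D) • ((MvPolynomial.monomial I 1 : Poly D) ⊗ₜ[ℝ] x) =
          r • MvPolynomial.monomial (I + d) 1 ⊗ₜ[ℝ] x := by
        rw [TensorProduct.smul_tmul', smul_eq_mul, MvPolynomial.monomial_mul, mul_one, add_comm,
          TensorProduct.smul_tmul', MvPolynomial.smul_monomial, smul_eq_mul, mul_one]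
      simp only [LinearMap.comp_apply, Algebra.lsmul_coe, diagT_monomial]
      rw [smul_comm, e, map_smul, diagT_monomial, smul_comm]
  exact LinearMap.congr_fun this u

theorem diagT_homogeneous_smul (g : ℕ → ℝ) {k : ℕ} {q : Poly D}
    (hq : q ∈ MvPolynomial.homogeneousSubmodule (Fin D) ℝ k) (u : Poly D ⊗[ℝ] H) :
    diagT (fun I => g I.degree) (q • u) = q • diagT (fun I => g (I.degree + k)) u := by
  rw [MvPolynomial.mem_homogeneousSubmodule] at hq
  have h : ∀ d ∈ q.support, diagT (fun I => g I.degree)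
      ((MvPolynomial.monomial d (q.coeff d) : Poly D) • u) =
      (MvPolynomial.monomial d (q.coeff d) : Poly D) • diagT (fun I => g (I.degree + k)) u :=
    fun d hd => by
      have : d.degree = k := by
        rw [Finsupp.degree_eq_weight_one (R := ℕ)]
        exact hq (MvPolynomial.mem_support_iff.1 hd)
      rw [diagT_monomial_smul]
      simp only [map_add, this]
  conv_lhs => rw [q.as_sum]
  conv_rhs => rw [q.as_sum]
  rw [Finset.sum_smul, map_sum, Finset.sum_smul]
  exact Finset.sum_congr rfl h

/-- The component of a given degree in the momenta. -/
def homP (n : ℕ) : Poly D ⊗[ℝ] H →ₗ[ℝ] Poly D ⊗[ℝ] H :=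
  diagT fun I => if I.degree = n then 1 else 0

theorem homP_homP (m n : ℕ) (u : Poly D ⊗[ℝ] H) :
    homP m (homP n u) = if m = n then homP n u else 0 := by
  rw [homP, homP, diagT_diagT]
  split_ifs with h
  · subst h
    congr 2
    funext I
    split_ifs <;> simp
  · rw [← zero_smul ℝ u, ← diagT_const]
    congr 2
    funext I
    split_ifs <;> first | omega | simp

theorem sum_homP (u : Poly D ⊗[ℝ] H) : ∃ m, ∀ n, m ≤ n → ∑ i ∈ Finset.range n, homP i u = u := by
  induction u using TensorProduct.induction_on with
  | zero => exact ⟨0, fun n _ => by simp⟩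
  | add u w hu hw =>
    obtain ⟨m, hm⟩ := hu
    obtain ⟨m', hm'⟩ := hw
    refine ⟨max m m', fun n hn => ?_⟩
    simp only [map_add, Finset.sum_add_distrib]
    rw [hm n ((le_max_left _ _).trans hn), hm' n ((le_max_right _ _).trans hn)]
  | tmul p x =>
    induction p using MvPolynomial.induction_on' with
    | monomial I r =>
      have h0 : MvPolynomial.monomial I r ⊗ₜ[ℝ] x =
          r • ((MvPolynomial.monomial I 1 : Poly D) ⊗ₜ[ℝ] x) := by
        rw [TensorProduct.smul_tmul', MvPolynomial.smul_monomial, smul_eq_mul, mul_one]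
      refine ⟨I.degree + 1, fun n hn => ?_⟩
      rw [h0]
      simp only [homP, map_smul, diagT_monomial, ← Finset.smul_sum, ← Finset.sum_smul]
      rw [Finset.sum_ite_eq (Finset.range n), if_pos (Finset.mem_range.2 (by omega)), one_smul]
    | add p q hp hq =>
      obtain ⟨m, hm⟩ := hp
      obtain ⟨m', hm'⟩ := hq
      refine ⟨max m m', fun n hn => ?_⟩
      simp only [TensorProduct.add_tmul, map_add, Finset.sum_add_distrib]
      rw [hm n ((le_max_left _ _).trans hn), hm' n ((le_max_right _ _).trans hn)]

theorem homP_bounded (u : Poly D ⊗[ℝ] H) : ∃ m, ∀ n, m ≤ n → homP n u = 0 := by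
  obtain ⟨m, hm⟩ := sum_homP u
  refine ⟨m, fun n hn => ?_⟩
  have := hm (n + 1) (by omega)
  rwa [Finset.sum_range_succ, hm n hn, add_eq_left] at this

theorem homP_ext {u : Poly D ⊗[ℝ] H} (h : ∀ n, homP n u = 0) : u = 0 := by
  obtain ⟨m, hm⟩ := sum_homP u
  rw [← hm m le_rfl]
  exact Finset.sum_eq_zero fun i _ => h i

theorem X_mem_homogeneous (μ : Fin D) :
    (MvPolynomial.X μ : Poly D) ∈ MvPolynomial.homogeneousSubmodule (Fin D) ℝ 1 :=
  MvPolynomial.isHomogeneous_X ℝ μ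

theorem homP_X_smul (n : ℕ) (μ : Fin D) (u : Poly D ⊗[ℝ] H) :
    homP (n + 1) ((MvPolynomial.X μ : Poly D) • u) = (MvPolynomial.X μ : Poly D) • homP n u := by
  rw [homP, diagT_homogeneous_smul (fun d => if d = n + 1 then 1 else 0) (X_mem_homogeneous μ)]
  simp only [Nat.add_right_cancel_iff]
  rfl

theorem homP_zero_X_smul (μ : Fin D) (u : Poly D ⊗[ℝ] H) :
    homP 0 ((MvPolynomial.X μ : Poly D) • u) = 0 := by
  rw [homP, diagT_homogeneous_smul (fun d => if d = 0 then 1 else 0) (X_mem_homogeneous μ)]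
  simp only [Nat.add_eq_zero_iff, one_ne_zero, and_false, if_false]
  rw [diagT_const, zero_smul, smul_zero]

theorem diagT_lTensor {H' : Type*} [AddCommGroup H'] [Module ℝ H'] (g : MultiIdx D → ℝ)
    (f : H →ₗ[ℝ] H') (u : Poly D ⊗[ℝ] H) :
    diagT g (LinearMap.lTensor (Poly D) f u) = LinearMap.lTensor (Poly D) f (diagT g u) := by
  have : diagT g ∘ₗ LinearMap.lTensor (Poly D) f = LinearMap.lTensor (Poly D) f ∘ₗ diagT g :=
    poly_tensor_ext fun I x => by
      simp only [LinearMap.comp_apply, LinearMap.lTensor_tmul, diagT_monomial, map_smul]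
  exact LinearMap.congr_fun this u

theorem lTensor_smul_poly {H' : Type*} [AddCommGroup H'] [Module ℝ H'] (f : H →ₗ[ℝ] H') (q : Poly D)
    (u : Poly D ⊗[ℝ] H) :
    LinearMap.lTensor (Poly D) f (q • u) = q • LinearMap.lTensor (Poly D) f u := by
  induction u using TensorProduct.induction_on with
  | zero => simp
  | add u w hu hw => simp only [smul_add, map_add, hu, hw]
  | tmul p h => simp [TensorProduct.smul_tmul']

theorem eomMat_mem_homogeneous (i j : HookIdx D) : eomMat (MvPolynomial.X : Fin D → Poly D) i j ∈
    MvPolynomial.homogeneousSubmodule (Fin D) ℝ 2 := by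
  have hF : ∀ α β γ δ, momF (MvPolynomial.X : Fin D → Poly D) (basisPoly j) α β γ δ ∈
      MvPolynomial.homogeneousSubmodule (Fin D) ℝ 1 := by
    have h : ∀ μ α β γ, (MvPolynomial.X μ : Poly D) • basisPoly j α β γ ∈
        MvPolynomial.homogeneousSubmodule (Fin D) ℝ 1 := fun μ α β γ => by
      rw [basisPoly, smul_eq_mul, ← Algebra.commutes, ← Algebra.smul_def]
      exact Submodule.smul_mem _ _ (X_mem_homogeneous μ)
    intro α β γ δ
    exact add_mem (add_mem (h _ _ _ _) (h _ _ _ _)) (h _ _ _ _)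
  have hE : ∀ α β δ ε γ, momE (MvPolynomial.X : Fin D → Poly D) (basisPoly j) α β δ ε γ ∈
      MvPolynomial.homogeneousSubmodule (Fin D) ℝ 2 := fun α β δ ε γ =>
    Submodule.smul_mem _ _ (sub_mem ((X_mem_homogeneous _).mul (hF _ _ _ _))
      ((X_mem_homogeneous _).mul (hF _ _ _ _)))
  have hR : ∀ α β γ, momRicci (MvPolynomial.X : Fin D → Poly D) (basisPoly j) α β γ ∈
      MvPolynomial.homogeneousSubmodule (Fin D) ℝ 2 := fun α β γ =>
    sum_mem fun ε _ => sum_mem fun δ _ => Submodule.smul_mem _ _ (hE _ _ _ _ _)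
  have hT : ∀ α, momTrace (MvPolynomial.X : Fin D → Poly D) (basisPoly j) α ∈
      MvPolynomial.homogeneousSubmodule (Fin D) ℝ 2 := fun α =>
    sum_mem fun ε _ => sum_mem fun δ _ => Submodule.smul_mem _ _ (hR _ _ _)
  exact Submodule.smul_mem _ _ (add_mem (Submodule.smul_mem _ _ (hR _ _ _))
    (Submodule.smul_mem _ _ (sub_mem (Submodule.smul_mem _ _ (Submodule.smul_mem _ _ (hT _)))
      (Submodule.smul_mem _ _ (Submodule.smul_mem _ _ (hT _))))))

end Degree

/-! ### Linearized fields and ghosts modulo the field equations -/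

section OnShell

variable {H : Type*} [AddCommGroup H] [Module ℝ H]

/-- The variables of antifield number zero. -/
abbrev Fld (D : ℕ) : Type := {κ : Lab D // af κ = 0}

/-- The linearized field equations. -/
def onShell (H : Type*) [AddCommGroup H] [Module ℝ H] :
    Submodule ℝ (Fld D → Poly D ⊗[ℝ] H) where
  carrier := {v | ∃ k : HookIdx D → Poly D ⊗[ℝ] H, ∀ κ, v κ = ∑ i, ktMat κ (.inr (.antiT i)) • k i}
  zero_mem' := ⟨0, fun κ => by simp⟩
  add_mem' := by
    rintro v w ⟨k, hk⟩ ⟨l, hl⟩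
    exact ⟨k + l, fun κ => by
      simp only [Pi.add_apply, smul_add, Finset.sum_add_distrib, hk, hl]⟩
  smul_mem' := by
    rintro r v ⟨k, hk⟩
    exact ⟨r • k, fun κ => by
      simp only [Pi.smul_apply, smul_comm _ r, hk, Finset.smul_sum]⟩

/-- A variable of antifield number zero is the field or is not subject to field equations. -/
theorem fld_cases (κ : Fld D) : (∃ j, κ.1 = .inl (.T j)) ∨ ∀ κ', ktMat κ.1 κ' = 0 := by
  obtain ⟨(z | z), h⟩ := κ
  · cases z with
    | T j => exact .inl ⟨j, rfl⟩
    | ghostC α => exact .inr fun κ' => rfl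
    | antiC2 α β => simp [af] at h
  · cases z with
    | ghostS i => exact .inr fun κ' => rfl
    | ghostA i => exact .inr fun κ' => rfl
    | antiT i => simp [af] at h
    | antiC μ => simp [af] at h

theorem ktMat_mem_homogeneous (κ : Fld D) (i : HookIdx D) : ktMat κ.1 (.inr (.antiT i)) ∈
    MvPolynomial.homogeneousSubmodule (Fin D) ℝ 2 := by
  rcases fld_cases κ with ⟨j, hj⟩ | h
  · rw [hj]
    exact eomMat_mem_homogeneous i j
  · rw [h]
    exact zero_mem _

/-- An operator acting componentwise. -/
def compw (f : Poly D ⊗[ℝ] H →ₗ[ℝ] Poly D ⊗[ℝ] H) :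
    (Fld D → Poly D ⊗[ℝ] H) →ₗ[ℝ] (Fld D → Poly D ⊗[ℝ] H) :=
  LinearMap.pi fun κ => f ∘ₗ LinearMap.proj κ

theorem compw_apply (f : Poly D ⊗[ℝ] H →ₗ[ℝ] Poly D ⊗[ℝ] H) (v : Fld D → Poly D ⊗[ℝ] H)
    (κ : Fld D) : compw f v κ = f (v κ) := rfl

/-- All field equations are homogeneous of degree two in the momenta, so homogeneous components of
an equation are equations. -/
theorem gradedBy_onShell : GradedBy (fun n => compw (homP n)) (onShell (D := D) H) where
  proj m n v := by
    split_ifs with h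
    · funext κ; rw [compw_apply, compw_apply, homP_homP, if_pos h]
    · funext κ; rw [compw_apply, compw_apply, homP_homP, if_neg h]; rfl
  ext v h := funext fun κ => homP_ext fun n => congrFun (h n) κ
  bounded v := by
    have : Fintype (Fld D) := Fintype.ofFinite _
    choose m hm using fun κ => homP_bounded (v κ)
    refine ⟨Finset.univ.sup m, fun n hn => funext fun κ => ?_⟩
    exact hm κ n ((Finset.le_sup (Finset.mem_univ κ)).trans hn)
  mem n := by
    rintro v ⟨k, hk⟩
    -- The shift by 2 is the degree of the equations; below degree 2 the multiplier vanishes.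
    refine ⟨fun i => diagT (fun I => if I.degree + 2 = n then 1 else 0) (k i), fun κ => ?_⟩
    rw [compw_apply, hk, map_sum]
    exact Finset.sum_congr rfl fun i _ =>
      diagT_homogeneous_smul (fun d => if d = n then 1 else 0) (ktMat_mem_homogeneous κ i) _

/-- Multiplication by a momentum. -/
def mulX (H : Type*) [AddCommGroup H] [Module ℝ H] (μ : Fin D) :
    Poly D ⊗[ℝ] H →ₗ[ℝ] Poly D ⊗[ℝ] H :=
  Algebra.lsmul ℝ ℝ (Poly D ⊗[ℝ] H) (MvPolynomial.X μ : Poly D)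

theorem mulX_apply (μ : Fin D) (u : Poly D ⊗[ℝ] H) :
    mulX H μ u = (MvPolynomial.X μ : Poly D) • u := rfl

theorem compw_mem_onShell {f : Poly D ⊗[ℝ] H →ₗ[ℝ] Poly D ⊗[ℝ] H}
    (hf : ∀ (q : Poly D) u, f (q • u) = q • f u) {v : Fld D → Poly D ⊗[ℝ] H} (hv : v ∈ onShell H) :
    compw f v ∈ onShell H := by
  obtain ⟨k, hk⟩ := hv
  exact ⟨fun i => f (k i), fun κ => by rw [compw_apply, hk, map_sum]; simp only [hf]⟩

theorem mulX_smul (μ : Fin D) (q : Poly D) (u : Poly D ⊗[ℝ] H) :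
    mulX H μ (q • u) = q • mulX H μ u := smul_comm _ _ _

theorem mem_onShell_of_fields {v : Fld D → Poly D ⊗[ℝ] H} {k : HookIdx D → Poly D ⊗[ℝ] H}
    (hT : ∀ j, v ⟨.inl (.T j), rfl⟩ = ∑ i, eomMat MvPolynomial.X i j • k i)
    (hg : ∀ κ : Fld D, (∀ κ', ktMat κ.1 κ' = 0) → v κ = 0) : v ∈ onShell H := by
  refine ⟨k, fun κ => ?_⟩
  rcases fld_cases κ with ⟨j, hj⟩ | h
  · obtain ⟨κ, hκ⟩ := κ
    obtain rfl : κ = .inl (.T j) := hj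
    exact hT j
  · rw [hg κ h]
    simp only [h, zero_smul, Finset.sum_const_zero]

/-- For components along the field this is `exists_eomMat_of_X_smul`; the ghosts satisfy no
equations, and there injectivity of multiplication by a variable is enough. -/
theorem mem_onShell_of_mulX (hD : 4 < D) (μ : Fin D) (v : Fld D → Poly D ⊗[ℝ] H)
    (hv : compw (mulX H μ) v ∈ onShell H) : v ∈ onShell H := by
  obtain ⟨k, hk⟩ := hv
  obtain ⟨l, hl⟩ := exists_eomMat_of_X_smul Finset.univ hD (μ := μ)
    (l := fun j => v ⟨.inl (.T j), rfl⟩) (h := k)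
    (by rw [Finset.card_erase_of_mem (by simp), Finset.card_univ, Fintype.card_fin]; omega)
    fun j => by rw [momVec_univ]; exact hk ⟨.inl (.T j), rfl⟩
  rw [momVec_univ] at hl
  refine mem_onShell_of_fields hl fun κ h => X_smul_injective μ ?_
  refine Eq.trans ?_ (smul_zero _).symm
  refine (hk κ).trans (Finset.sum_eq_zero fun i _ => ?_)
  rw [h, zero_smul]

theorem exists_mulX_of_sub (hD : 4 < D) {μ ν : Fin D} (hμν : ν ≠ μ) (v v' : Fld D → Poly D ⊗[ℝ] H)
    (hv : compw (mulX H ν) v - compw (mulX H μ) v' ∈ onShell H) :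
    ∃ w, v - compw (mulX H μ) w ∈ onShell H := by
  obtain ⟨k, hk⟩ := hv
  obtain ⟨l, w, hl⟩ := exists_eomMat_of_X_smul_sub hD hμν (l := fun j => v ⟨.inl (.T j), rfl⟩)
    (l' := fun j => v' ⟨.inl (.T j), rfl⟩) (h := k) fun j => hk ⟨.inl (.T j), rfl⟩
  have hg : ∀ κ : Fld D, (∀ κ', ktMat κ.1 κ' = 0) → ∃ w, v κ = (MvPolynomial.X μ : Poly D) • w :=
    fun κ h => exists_X_smul hμν (l' := v' κ) (sub_eq_zero.1 ((hk κ).trans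
      (Finset.sum_eq_zero fun i _ => by rw [h, zero_smul])))
  have : ∀ κ : Fld D, ∃ w', (∀ j, κ.1 = .inl (.T j) → w' = w j) ∧
      ((∀ κ', ktMat κ.1 κ' = 0) → v κ = (MvPolynomial.X μ : Poly D) • w') := fun κ => by
    rcases κ with ⟨(z | z), h⟩
    · cases z with
      | T j =>
        by_cases h0 : ∀ κ', ktMat (.inl (.T j) : Lab D) κ' = 0
        · refine ⟨w j, fun j' hj => ?_, fun _ => ?_⟩
          · cases hj; rfl
          · refine (hl j).trans ?_
            rw [add_eq_right]
            exact Finset.sum_eq_zero fun i _ => by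
              rw [show eomMat MvPolynomial.X i j = 0 from h0 (.inr (.antiT i)), zero_smul]
        · exact ⟨w j, fun j' hj => by cases hj; rfl, fun h => (h0 h).elim⟩
      | ghostC α =>
        obtain ⟨w', hw'⟩ := hg ⟨.inl (.ghostC α), h⟩ fun κ' => rfl
        exact ⟨w', fun j hj => by simp at hj, fun _ => hw'⟩
      | antiC2 α β => simp [af] at h
    · by_cases h0 : ∀ κ', ktMat (.inr z : Lab D) κ' = 0
      · obtain ⟨w', hw'⟩ := hg ⟨.inr z, h⟩ h0
        exact ⟨w', fun j hj => by simp at hj, fun _ => hw'⟩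
      · exact ⟨0, fun j hj => by simp at hj, fun h => (h0 h).elim⟩
  choose w' hw1 hw2 using this
  refine ⟨w', mem_onShell_of_fields (k := l) (fun j => ?_) fun κ h => ?_⟩
  · rw [Pi.sub_apply, compw_apply, mulX_apply, hl, hw1 _ j rfl, add_sub_cancel_right]
  · rw [Pi.sub_apply, compw_apply, mulX_apply, hw2 _ h, sub_self]

variable {dH : Fin D → H →ₗ[ℝ] H}

theorem compw_lTensor_comm (dH' : H →ₗ[ℝ] H) (μ : Fin D) (v : Fld D → Poly D ⊗[ℝ] H) :
    compw (mulX H μ) (compw (LinearMap.lTensor (Poly D) dH') v) =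
      compw (LinearMap.lTensor (Poly D) dH') (compw (mulX H μ) v) :=
  funext fun _ => (lTensor_smul_poly _ _ _).symm

/-- A linearized total derivative is a momentum plus a derivative acting on coefficients. The
momentum is the leading term, so the filtration argument applies. -/
theorem mem_onShell_of_shifted (hD : 4 < D) (μ : Fin D) (v : Fld D → Poly D ⊗[ℝ] H)
    (hv : compw (mulX H μ) v + compw (LinearMap.lTensor (Poly D) (dH μ)) v ∈ onShell H) :
    v ∈ onShell H :=
  gradedBy_onShell.mem_of_filtered (fun n _ => funext fun _ => homP_X_smul n μ _)
    (fun _ _ => funext fun _ => diagT_lTensor _ _ _)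
    (fun _ hv => compw_mem_onShell (mulX_smul μ) hv)
    (fun _ hv => compw_mem_onShell (lTensor_smul_poly _) hv)
    (mem_onShell_of_mulX hD μ) v hv

theorem exists_shifted (hD : 4 < D) (hd : ∀ α β x, dH α (dH β x) = dH β (dH α x)) {μ ν : Fin D}
    (hμν : ν ≠ μ) (v v' : Fld D → Poly D ⊗[ℝ] H)
    (hv : compw (mulX H ν) v + compw (LinearMap.lTensor (Poly D) (dH ν)) v -
      (compw (mulX H μ) v' + compw (LinearMap.lTensor (Poly D) (dH μ)) v') ∈ onShell H) :
    ∃ w, v - (compw (mulX H μ) w + compw (LinearMap.lTensor (Poly D) (dH μ)) w) ∈ onShell H :=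
  gradedBy_onShell.exists_of_filtered (fun n _ => funext fun _ => homP_X_smul n μ _)
    (fun _ _ => funext fun _ => diagT_lTensor _ _ _) (fun n _ => funext fun _ => homP_X_smul n ν _)
    (fun _ _ => funext fun _ => diagT_lTensor _ _ _) (fun _ => funext fun _ => homP_zero_X_smul μ _)
    (fun _ hv => compw_mem_onShell (mulX_smul μ) hv)
    (fun _ hv => compw_mem_onShell (lTensor_smul_poly _) hv)
    (fun _ hv => compw_mem_onShell (mulX_smul ν) hv)
    (fun _ hv => compw_mem_onShell (lTensor_smul_poly _) hv)
    (fun v => funext fun κ => by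
      simp only [compw_apply, mulX_apply]
      exact smul_comm _ _ _)
    (fun v => funext fun κ => by
      have h : dH μ ∘ₗ dH ν = dH ν ∘ₗ dH μ := LinearMap.ext (hd μ ν)
      simp only [compw_apply]
      rw [← LinearMap.comp_apply, ← LinearMap.lTensor_comp, h, LinearMap.lTensor_comp]
      rfl)
    (fun _ => compw_lTensor_comm _ _ _) (fun _ => (compw_lTensor_comm _ _ _).symm)
    (mem_onShell_of_mulX hD μ) (exists_mulX_of_sub hD hμν) v v' hv

end OnShell

/-! ### Closed one-forms on the space of coordinates -/

theorem fderiv_smooth_apply (f : Smooth D) (x y : Fin D → ℝ) :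
    fderiv ℝ f.1 x y = ∑ μ, y μ * (partialX μ f).1 x := by
  conv_lhs => rw [← Finset.univ_sum_single y]
  rw [map_sum]
  refine Finset.sum_congr rfl fun μ _ => ?_
  have : (Pi.single μ (y μ) : Fin D → ℝ) = y μ • Pi.single μ 1 := by
    rw [← Pi.single_smul, smul_eq_mul, mul_one]
  rw [this, map_smul]
  rfl

theorem exists_eq_const (f : Smooth D) (h : ∀ μ, partialX μ f = 0) :
    ∃ r : ℝ, f = r • (1 : Smooth D) := by
  refine ⟨f.1 0, Subtype.ext (funext fun x => ?_)⟩
  have := is_const_of_fderiv_eq_zero (𝕜 := ℝ) (fun x => differentiableAt_smooth f x)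
    (fun x => by
      ext1 y
      rw [fderiv_smooth_apply]
      simp [h]) x 0
  rw [this]
  change f.1 0 = f.1 0 * 1
  rw [mul_one]

/-- The classical Poincaré lemma on the whole space for the one-form with components `f`; the
potential is smooth because its derivative is. -/
theorem exists_potential (f : Fin D → Smooth D)
    (h : ∀ μ ν, partialX μ (f ν) = partialX ν (f μ)) :
    ∃ g : Smooth D, ∀ μ, f μ = partialX μ g := by
  have hd : ∀ x, HasFDerivAt
      (fun x => ∑ μ, (f μ).1 x • (ContinuousLinearMap.proj μ : (Fin D → ℝ) →L[ℝ] ℝ))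
      (∑ μ, (fderiv ℝ (f μ).1 x).smulRight (ContinuousLinearMap.proj μ : (Fin D → ℝ) →L[ℝ] ℝ)) x :=
    fun x => HasFDerivAt.fun_sum fun μ _ =>
      (differentiableAt_smooth (f μ) x).hasFDerivAt.smul_const
        (ContinuousLinearMap.proj μ : (Fin D → ℝ) →L[ℝ] ℝ)
  obtain ⟨g, hg⟩ := convex_univ.exists_forall_hasFDerivAt_of_fderiv_symmetric isOpen_univ
    (fun x _ => (hd x).differentiableAt.differentiableWithinAt) fun x _ y z => by
      rw [(hd x).fderiv]
      simp only [_root_.sum_apply, ContinuousLinearMap.smulRight_apply,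
        _root_.smul_apply, ContinuousLinearMap.proj_apply, smul_eq_mul,
        fderiv_smooth_apply, Finset.sum_mul]
      rw [Finset.sum_comm]
      refine Finset.sum_congr rfl fun μ _ => Finset.sum_congr rfl fun ν _ => ?_
      rw [h]
      ring
  have hg' : ∀ x, HasFDerivAt g
      (∑ μ, (f μ).1 x • (ContinuousLinearMap.proj μ : (Fin D → ℝ) →L[ℝ] ℝ)) x :=
    fun x => hg x (Set.mem_univ x)
  have hs : ContDiff ℝ ∞ g := by
    rw [contDiff_infty_iff_fderiv]
    refine ⟨fun x => (hg' x).differentiableAt, ?_⟩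
    rw [show fderiv ℝ g = _ from funext fun x => (hg' x).fderiv]
    exact ContDiff.sum fun μ _ => (mem_smooth.1 (f μ).2).smul contDiff_const
  refine ⟨⟨g, mem_smooth.2 hs⟩, fun μ => Subtype.ext (funext fun x => ?_)⟩
  change _ = fderiv ℝ g x (Pi.single μ 1)
  rw [(hg' x).fderiv]
  simp [Pi.single_apply]

/-! ### Forms modulo the field equations -/

/-- Forms modulo the image of the Koszul-Tate differential. -/
abbrev Shell (D : ℕ) : Type := LForm D ⧸ LinearMap.range (dK (D := D))

/-- The class of a form modulo the field equations. -/
def cls : LForm D →ₗ[ℝ] Shell D := Submodule.mkQ _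

theorem cls_eq_zero {a : LForm D} : cls a = 0 ↔ ∃ b, dK b = a := by
  rw [cls, Submodule.mkQ_apply, Submodule.Quotient.mk_eq_zero, LinearMap.mem_range]

theorem cls_dK (a : LForm D) : cls (dK a) = 0 := cls_eq_zero.2 ⟨a, rfl⟩

theorem cls_surjective : Function.Surjective (cls (D := D)) := Submodule.mkQ_surjective _

/-- The total derivative modulo the field equations. -/
def tS (μ : Fin D) : Shell D →ₗ[ℝ] Shell D :=
  Submodule.mapQ _ _ (tD μ) (by
    rintro _ ⟨a, rfl⟩
    exact ⟨tD μ a, dK_tD μ a⟩)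

theorem tS_cls (μ : Fin D) (a : LForm D) : tS μ (cls a) = cls (tD μ a) := rfl

theorem tS_comm (μ ν : Fin D) (x : Shell D) : tS μ (tS ν x) = tS ν (tS μ x) := by
  obtain ⟨a, rfl⟩ := cls_surjective x
  simp only [tS_cls, tD_comm μ ν]

theorem coefL_cls_surjective : Function.Surjective (coefL (cls (D := D))) :=
  LinearMap.lTensor_surjective _ cls_surjective

theorem coefL_cls_eq_zero {u : PLForm D} (h : coefL cls u = 0) : ∃ r, u = coefL dK r := by
  have hex : Function.Exact (dK (D := D)) cls := fun a => cls_eq_zero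
  obtain ⟨r, hr⟩ := (lTensor_exact (Poly D) hex cls_surjective u).1 h
  exact ⟨r, hr.symm⟩

theorem coefL_cls_dK (u : PLForm D) : coefL cls (coefL dK u) = 0 := by
  rw [← coefL_comp, show cls ∘ₗ dK = (0 : LForm D →ₗ[ℝ] Shell D) from LinearMap.ext cls_dK, coefL,
    LinearMap.lTensor_zero, LinearMap.zero_apply]

theorem coefL_cls_tD (μ : Fin D) (u : PLForm D) :
    coefL cls (coefL (tD μ) u) = LinearMap.lTensor (Poly D) (tS μ) (coefL cls u) := by
  rw [← coefL_comp, show cls ∘ₗ tD μ = tS μ ∘ₗ cls from LinearMap.ext fun a => (tS_cls μ a).symm,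
    coefL, LinearMap.lTensor_comp]
  rfl

/-! ### Functions of the fields and ghosts -/

/-- Forms of form degree and antifield number zero. -/
def IsField (u : LForm D) : Prop := hat (cnt af 1) u = 0

theorem IsField.sub {u w : LForm D} (hu : IsField u) (hw : IsField w) : IsField (u - w) := by
  rw [IsField, map_sub, hu, hw, sub_zero]

theorem IsField.map_tD {u : LForm D} (hu : IsField u) (μ : Fin D) : IsField (tD μ u) := by
  rw [IsField, hat_tD (cnt_tot af 1 μ), hu, map_zero]

theorem isField_pur_one (f : Smooth D) : IsField (pur f 1) := by
  have : cnt af 1 (1 : CForm D) = 0 := by simpa using cnt_evenDer af 1 (1 : CForm D) 1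
  rw [IsField, hat_pur, this, map_zero]

/-- The component of form degree and antifield number zero. -/
def fieldPart : CForm D →ₗ[ℝ] CForm D := calc' (cnt af 1) fun n => if n = 0 then 1 else 0

/-- `δ` would lower the weight to -1, and the weights occurring are natural numbers. -/
theorem kos_eq_zero {a : CForm D} (h : cnt af 1 a = 0) : kos a = 0 := by
  have h1 : cnt af 1 (kos a) = -kos a := by rw [cnt_af_kos, h, map_zero, zero_sub]
  have h2 := (cnt_diag af 1).ext (f := calc' (cnt af 1) (fun n => ((n : ℝ) + 1)⁻¹) ∘ₗ
    (cnt af 1 + LinearMap.id)) (f' := LinearMap.id) (fun n x hx => by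
      rw [LinearMap.comp_apply, LinearMap.add_apply, hx, LinearMap.id_apply, map_add, map_smul,
        (cnt_diag af 1).calc'_apply _ hx, smul_smul, ← add_smul, ← add_one_mul,
        mul_inv_cancel₀ (by positivity), one_smul]) (kos a)
  rw [LinearMap.comp_apply, LinearMap.add_apply, h1, LinearMap.id_apply, neg_add_cancel, map_zero]
    at h2
  exact h2.symm

theorem fieldPart_eq (a : CForm D) :
    fieldPart a = a - calc' (cnt af 1) (fun n => (n : ℝ)⁻¹) (cnt af 1 a) := by
  rw [(cnt_diag af 1).calc'_comm_of_comm _ (cnt af 1) fun _ => rfl, (cnt_diag af 1).apply_calc'_inv]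
  exact (sub_sub_cancel _ _).symm

theorem cnt_fieldPart (a : CForm D) : cnt af 1 (fieldPart a) = 0 := by
  refine (cnt_diag af 1).ext (f := cnt af 1 ∘ₗ fieldPart) (f' := 0) (fun n x hx => ?_) a
  rw [LinearMap.comp_apply, fieldPart, (cnt_diag af 1).calc'_apply _ hx, map_smul, hx, smul_smul,
    LinearMap.zero_apply]
  split_ifs with h
  · rw [h, Nat.cast_zero, mul_zero, zero_smul]
  · rw [zero_mul, zero_smul]

theorem kos_fieldPart (a : CForm D) : kos (fieldPart a) = 0 := kos_eq_zero (cnt_fieldPart a)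

theorem fieldPart_kos (a : CForm D) :
    fieldPart (kos a) = kos (calc' (cnt af 1) (fun n => if n = 1 then 1 else 0) a) := by
  refine (cnt_diag af 1).calc'_comm (cnt_diag af 1) _ _ kos (fun n x hx => ?_) a
  cases n with
  | zero => exact .inl (kos_eq_zero (by rw [hx, Nat.cast_zero, zero_smul]))
  | succ n =>
    refine .inr ⟨n, ?_, by simp⟩
    rw [cnt_af_kos, hx, map_smul, Nat.cast_add, Nat.cast_one]
    module

theorem fieldPart_tot (μ : Fin D) (a : CForm D) : fieldPart (tot μ a) = tot μ (fieldPart a) :=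
  (cnt_diag af 1).calc'_comm_of_comm _ _ (cnt_tot af 1 μ) a

/-- Antifield number and form degree are nonnegative, so vanishing of their sum makes both vanish.
-/
theorem cnt_fieldPart_formDeg (a : CForm D) : cnt (fun _ => 0) 1 (fieldPart a) = 0 := by
  have h := (cnt_evenDer af 1).mem_span (M := cnt (fun _ => 0) 1) (cnt_evenDer _ _) (fun z =>
    Submodule.subset_span ⟨wt af 1 z, cnt_cgen _ _ z, fun h => by
      rw [cnt_cgen]
      rcases z with z | z | z
      · exact (congrArg (· • _) Nat.cast_zero).trans (zero_smul _ _)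
      · exact (congrArg (· • _) Nat.cast_zero).trans (zero_smul _ _)
      · simp [wt] at h⟩) a
  have key : Submodule.span ℝ {x : CForm D | ∃ n : ℕ, cnt af 1 x = (n : ℝ) • x ∧
      (n = 0 → cnt (fun _ => 0) 1 x = 0)} ≤ LinearMap.ker (cnt (fun _ => 0) 1 ∘ₗ fieldPart) := by
    refine Submodule.span_le.2 ?_
    rintro x ⟨n, hx, hx0⟩
    change cnt _ _ (fieldPart x) = 0
    rw [fieldPart, (cnt_diag af 1).calc'_apply _ hx, map_smul]
    split_ifs with hn
    · rw [hx0 hn, smul_zero]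
    · rw [zero_smul]
  exact key h

theorem IsField.fieldPart_eq {u : LForm D} (hu : IsField u) : hat fieldPart u = u := by
  have : (fieldPart : CForm D →ₗ[ℝ] CForm D) = LinearMap.id +
      (-1 : ℝ) • (calc' (cnt af 1) (fun n => (n : ℝ)⁻¹) ∘ₗ cnt af 1) :=
    LinearMap.ext fun a => by
      rw [DualGravity.fieldPart_eq, LinearMap.add_apply, LinearMap.smul_apply, neg_one_smul,
        ← sub_eq_add_neg]
      rfl
  rw [this, hat_add, hat_smul, hat_id, hat_comp, LinearMap.add_apply, LinearMap.smul_apply,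
    LinearMap.comp_apply, hu, map_zero, smul_zero, add_zero, LinearMap.id_apply]

theorem IsField.hat_formDeg {u : LForm D} (hu : IsField u) : hat (cnt (fun _ => 0) 1) u = 0 := by
  have h : cnt (fun _ => 0) 1 ∘ₗ (fieldPart : CForm D →ₗ[ℝ] CForm D) = 0 :=
    LinearMap.ext cnt_fieldPart_formDeg
  rw [← hu.fieldPart_eq, ← LinearMap.comp_apply, ← hat_comp, h, hat_zero, LinearMap.zero_apply]

theorem isField_fieldPart (u : LForm D) : IsField (hat fieldPart u) := by
  have h : cnt af 1 ∘ₗ (fieldPart : CForm D →ₗ[ℝ] CForm D) = 0 := LinearMap.ext cnt_fieldPart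
  rw [IsField, ← LinearMap.comp_apply, ← hat_comp, h, hat_zero, LinearMap.zero_apply]

theorem coefL_dK_fieldPart (u : PLForm D) : coefL dK (coefL (hat fieldPart) u) = 0 := by
  have h : (kos : CForm D →ₗ[ℝ] CForm D) ∘ₗ fieldPart = 0 := LinearMap.ext kos_fieldPart
  rw [← coefL_comp, dK, ← hat_comp, h, hat_zero, coefL_zero]

theorem coefL_fieldPart_dK (u : PLForm D) : ∃ w, coefL (hat fieldPart) (coefL dK u) = coefL dK w := by
  have h : fieldPart ∘ₗ (kos : CForm D →ₗ[ℝ] CForm D) =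
    kos ∘ₗ calc' (cnt af 1) fun n => if n = 1 then 1 else 0 := LinearMap.ext fieldPart_kos
  exact ⟨coefL (hat (calc' (cnt af 1) fun n => if n = 1 then 1 else 0)) u, by
    rw [← coefL_comp, ← coefL_comp, dK, ← hat_comp, ← hat_comp, h]⟩

theorem coefL_fieldPart_tD (μ : Fin D) (u : PLForm D) :
    coefL (hat fieldPart) (coefL (tD μ) u) = coefL (tD μ) (coefL (hat fieldPart) u) :=
  coefL_comm (hat_tD (fieldPart_tot μ)) u

theorem IsField.coefL_fieldPart_lsymb {u : LForm D} (hu : IsField u) (κ : Fld D) :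
    coefL (hat fieldPart) (lsymb κ u) = lsymb κ u := by
  have h := lsymb_cnt af 1 κ u
  rw [hu, map_zero, κ.2, Nat.cast_zero, zero_smul, zero_add] at h
  have h2 : hat (fieldPart : CForm D →ₗ[ℝ] CForm D) = LinearMap.id -
      (hat (calc' (cnt af 1) (fun n => (n : ℝ)⁻¹)) ∘ₗ hat (cnt af 1)) := by
    rw [← hat_comp, ← hat_id, eq_sub_iff_add_eq, ← hat_add]
    congr 1
    refine LinearMap.ext fun a => ?_
    rw [LinearMap.add_apply, DualGravity.fieldPart_eq]
    exact sub_add_cancel _ _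
  rw [h2, coefL, LinearMap.lTensor_sub, LinearMap.sub_apply, LinearMap.lTensor_id,
    LinearMap.id_apply]
  change _ - coefL _ _ = _
  rw [coefL_comp, ← h, map_zero, sub_zero]

/-- A derivative with respect to a variable of positive antifield number would have negative weight.
-/
theorem IsField.lsymb_eq_zero {u : LForm D} (hu : IsField u) {κ : Lab D} (hκ : af κ ≠ 0) :
    lsymb κ u = 0 := by
  have h := lsymb_cnt af 1 κ u
  rw [hu, map_zero] at h
  have hd : Diag (hat (cnt (D := D) af 1)) := (cnt_diag af 1).hat
  have h2 : calc' (hat (cnt (D := D) af 1)) (fun n => ((af κ : ℝ) + n)⁻¹) ∘ₗ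
      ((af κ : ℝ) • LinearMap.id + hat (cnt af 1)) = LinearMap.id :=
    LinearMap.ext (hd.ext fun n x hx => by
      rw [LinearMap.comp_apply, LinearMap.add_apply, LinearMap.smul_apply, hx, LinearMap.id_apply,
        ← add_smul, map_smul, hd.calc'_apply _ hx, smul_smul, mul_inv_cancel₀, one_smul]
      have : 0 < af κ := Nat.pos_of_ne_zero hκ
      positivity)
  have h3 : coefL ((af κ : ℝ) • LinearMap.id + hat (cnt af 1)) (lsymb κ u) = 0 := by
    rw [coefL, LinearMap.lTensor_add, LinearMap.lTensor_smul, LinearMap.lTensor_id]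
    exact h.symm
  have h4 := coefL_comp (calc' (hat (cnt (D := D) af 1)) fun n => ((af κ : ℝ) + n)⁻¹)
    ((af κ : ℝ) • LinearMap.id + hat (cnt af 1)) (lsymb κ u)
  rwa [h2, h3, map_zero, coefL, LinearMap.lTensor_id, LinearMap.id_apply] at h4

theorem isField_lsubst (κ : Fld D) (u : PLForm D) : IsField (lsubst κ (coefL (hat fieldPart) u)) := by
  induction u using TensorProduct.induction_on with
  | zero => rw [IsField, map_zero, map_zero, map_zero]
  | add u w hu hw => rw [IsField, map_add, map_add, map_add, hu, hw, add_zero]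
  | tmul p a =>
    rw [IsField, coefL_tmul, lsubst_tmul, hat_cnt_cmul, isField_fieldPart, cnt_lin, κ.2,
      Nat.cast_zero, zero_smul, cmul_zero, map_zero, add_zero]

/-! ### The Poincaré lemma modulo the field equations -/

theorem sum_lab_eq_sum_fld {M : Type*} [AddCommMonoid M] (f : Lab D → M)
    (h : ∀ κ, af κ ≠ 0 → f κ = 0) [Fintype (Fld D)] : ∑ κ, f κ = ∑ κ : Fld D, f κ := by
  classical
  rw [← Finset.sum_subset (s₁ := Finset.univ.filter fun κ : Lab D => af κ = 0)
    (Finset.subset_univ _) fun κ _ hκ => h κ (by simpa using hκ)]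
  exact Finset.sum_subtype _ (by simp) f

theorem ktMat_fld (κ' : Lab D) (κ : Fld D) : ktMat κ' κ.1 = 0 := by
  obtain ⟨(z | z), h⟩ := κ
  · cases z with
    | T j => rcases κ' with (_ | _) | (_ | _) <;> rfl
    | ghostC α => rcases κ' with (_ | _) | (_ | _) <;> rfl
    | antiC2 α β => simp [af] at h
  · cases z with
    | ghostS i => rcases κ' with (_ | _) | (_ | _) <;> rfl
    | ghostA i => rcases κ' with (_ | _) | (_ | _) <;> rfl
    | antiT i => simp [af] at h
    | antiC μ => simp [af] at h

/-- `δ` annihilates the substituted variable, so substitution commutes with `δ` up to the sign `par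
κ`. -/
theorem lsubst_fld_dK (κ : Fld D) (u : PLForm D) :
    ∃ m, lsubst κ (coefL dK u) = dK m := by
  refine ⟨par κ.1 • lsubst κ u, ?_⟩
  rw [map_smul, dK_lsubst]
  simp only [ktMat_fld, zero_smul, map_zero, Finset.sum_const_zero, zero_add]
  rw [smul_smul, par_mul_par, one_smul]

theorem ktMat_antiT_of_af {κ : Lab D} (h : af κ ≠ 0) (i : HookIdx D) :
    ktMat κ (.inr (.antiT i)) = 0 := by
  rcases κ with z | z
  · cases z with
    | T j => simp [af] at h
    | ghostC α => rfl
    | antiC2 α β => rfl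
  · exact ktMat_inr_inr _ _

/-- A function of the fields and ghosts whose linearization vanishes on shell up to `t`. -/
theorem IsField.exists_of_onShell [Fintype (Fld D)] {u : LForm D} (hu : IsField u)
    (t : Fld D → PLForm D)
    (h : (fun κ : Fld D => coefL cls (lsymb κ u - t κ)) ∈ onShell (Shell D)) :
    ∃ m, hat (cnt (fun _ => 1) 0) u = dK m + ∑ κ : Fld D, lsubst κ (coefL (hat fieldPart) (t κ)) := by
  obtain ⟨k, hk⟩ := h
  dsimp only at hk
  choose s hs using fun i => coefL_cls_surjective (k i)
  have h1 : ∀ κ : Fld D, ∃ r, lsymb κ u - t κ - ∑ i, ktMat κ (.inr (.antiT i)) • s i = coefL dK r :=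
    fun κ => coefL_cls_eq_zero (by
      rw [map_sub, hk, map_sum]
      simp only [coefL_smul, hs, sub_self])
  -- Projecting coefficients to the field part leaves the linearization of `u` unchanged and keeps
  -- `δ`-exact terms `δ`-exact.
  have h2 : ∀ κ : Fld D, ∃ m, lsubst κ (lsymb κ u) = lsubst κ (coefL (hat fieldPart) (t κ)) +
      ∑ i, lsubst κ (ktMat κ (.inr (.antiT i)) • coefL (hat fieldPart) (s i)) + dK m := fun κ => by
    obtain ⟨r, hr⟩ := h1 κ
    obtain ⟨w, hw⟩ := coefL_fieldPart_dK r
    obtain ⟨m, hm⟩ := lsubst_fld_dK κ w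
    refine ⟨m, ?_⟩
    rw [← hm, ← hw, ← hr]
    simp only [map_sub, hu.coefL_fieldPart_lsymb, map_sum, coefL_smul]
    abel
  choose m hm using h2
  -- The multiples of the field equations are themselves `δ` of something, with `T^*` substituted
  -- for the equations.
  have h3 : dK (∑ i, lsubst (.inr (.antiT i)) (coefL (hat fieldPart) (s i))) =
      ∑ κ : Fld D, ∑ i, lsubst κ (ktMat κ (.inr (.antiT i)) • coefL (hat fieldPart) (s i)) := by
    rw [map_sum, Finset.sum_comm]
    refine Finset.sum_congr rfl fun i _ => ?_
    rw [dK_lsubst, coefL_dK_fieldPart, map_zero, smul_zero, add_zero]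
    refine sum_lab_eq_sum_fld _ fun κ hκ => ?_
    rw [ktMat_antiT_of_af hκ, zero_smul, map_zero]
  refine ⟨∑ i, lsubst (.inr (.antiT i)) (coefL (hat fieldPart) (s i)) + ∑ κ, m κ, ?_⟩
  rw [← sum_lsubst_lsymb, sum_lab_eq_sum_fld _ fun κ hκ => by rw [hu.lsymb_eq_zero hκ, map_zero]]
  simp only [hm, Finset.sum_add_distrib, map_add, h3, map_sum]
  abel

theorem coefL_cls_lsymb_tD (μ : Fin D) (κ : Lab D) (u : LForm D) : coefL cls (lsymb κ (tD μ u)) =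
    mulX (Shell D) μ (coefL cls (lsymb κ u)) +
      LinearMap.lTensor (Poly D) (tS μ) (coefL cls (lsymb κ u)) := by
  rw [lsymb_tD, map_add, coefL_smul, coefL_cls_tD]
  rfl

theorem coefL_cls_lsymb_dK (κ : Fld D) (b : LForm D) : coefL cls (lsymb κ (dK b)) =
    ∑ i, ktMat κ (.inr (.antiT i)) • coefL cls (lsymb (.inr (.antiT i)) b) := by
  rw [lsymb_dK, map_add, map_smul, coefL_cls_dK, smul_zero, add_zero, map_sum]
  simp only [coefL_smul]
  rcases fld_cases κ with ⟨j, hj⟩ | h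
  · rw [hj]
    simp only [Fintype.sum_sum_type, sum_oddVar, ktMat, zero_smul, Finset.sum_const_zero, zero_add,
      add_zero]
  · simp only [h, zero_smul, Finset.sum_const_zero]

/-- Linearize modulo `δ`-exact coefficients: the hypothesis places a momentum plus derivative times
the linearization of `u` on shell, so the linearization itself is on shell. Euler's formula
reassembles `u`, up to the counting operator. -/
theorem exists_of_tD_eq (hD : 4 < D) (μ : Fin D) {u : LForm D} (hu : IsField u) {b : LForm D}
    (h : tD μ u = dK b) : ∃ m, hat (cnt (fun _ => 1) 0) u = dK m := by
  have : Fintype (Fld D) := Fintype.ofFinite _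
  have h1 : (fun κ : Fld D => coefL cls (lsymb κ u)) ∈ onShell (Shell D) :=
    mem_onShell_of_shifted (dH := tS) hD μ _
      ⟨fun i => coefL cls (lsymb (.inr (.antiT i)) b), fun κ => by
        rw [← coefL_cls_lsymb_dK, ← h, coefL_cls_lsymb_tD]
        rfl⟩
  obtain ⟨m, hm⟩ := hu.exists_of_onShell (fun _ => 0) (by simpa only [sub_zero] using h1)
  refine ⟨m, ?_⟩
  simpa only [map_zero, Finset.sum_const_zero, add_zero] using hm

/-- The same linearization argument for two directions. Here `lsubst` rebuilds `w` from the
linearized quotient, and it intertwines the linearized with the actual total derivative. -/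
theorem exists_of_tD_sub (hD : 4 < D) {μ ν : Fin D} (hμν : ν ≠ μ) {u u' : LForm D} (hu : IsField u)
    {b : LForm D} (h : tD ν u - tD μ u' = dK b) :
    ∃ w m, IsField w ∧ hat (cnt (fun _ => 1) 0) u = tD μ w + dK m := by
  have : Fintype (Fld D) := Fintype.ofFinite _
  obtain ⟨w, hw⟩ := exists_shifted (dH := tS) hD tS_comm hμν
    (fun κ : Fld D => coefL cls (lsymb κ u)) (fun κ : Fld D => coefL cls (lsymb κ u'))
      ⟨fun i => coefL cls (lsymb (.inr (.antiT i)) b), fun κ => by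
        rw [← coefL_cls_lsymb_dK, ← h, map_sub, map_sub, coefL_cls_lsymb_tD, coefL_cls_lsymb_tD]
        rfl⟩
  choose t ht using fun κ => coefL_cls_surjective (w κ)
  obtain ⟨m, hm⟩ := hu.exists_of_onShell
    (fun κ => (MvPolynomial.X μ : Poly D) • t κ + coefL (tD μ) (t κ)) (by
      convert hw using 1
      funext κ
      rw [map_sub, map_add, coefL_smul, coefL_cls_tD, ht]
      rfl)
  refine ⟨∑ κ : Fld D, lsubst κ (coefL (hat fieldPart) (t κ)), m, ?_, ?_⟩
  · rw [IsField, map_sum]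
    exact Finset.sum_eq_zero fun κ _ => isField_lsubst κ _
  · rw [hm, add_comm, map_sum]
    simp only [tD_lsubst, map_add, coefL_smul, coefL_fieldPart_tD]

theorem hat_invAll_tD (μ : Fin D) (u : LForm D) :
    hat invAll (tD μ u) = tD μ (hat invAll u) :=
  hat_tD (invAll_comm _ (cnt_tot _ _ μ)) u

theorem hat_invAll_dK (u : LForm D) : hat invAll (dK u) = dK (hat invAll u) :=
  hat_comm (invAll_comm _ (cnt_const_kos 1 1)) u

theorem hat_cntAll (u : LForm D) : hat cntAll u =
    hat (cnt (fun _ => 1) 0) u + hat (cnt (fun _ => 0) 1) u := by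
  rw [← LinearMap.add_apply, ← hat_add]
  congr 2
  refine LinearMap.ext fun a => ?_
  have h : IsDer (AlgHom.id ℝ (CForm D)) (AlgHom.id ℝ _)
      (cnt (fun _ => 1) 0 + cnt (fun _ => 0) 1 : CForm D →ₗ[ℝ] CForm D) :=
    (cnt_evenDer _ _).add (cnt_evenDer _ _)
  have := (cnt_evenDer (D := D) (fun _ => 1) 1).ext h fun z => by
    rw [LinearMap.add_apply, cnt_cgen, cnt_cgen, cnt_cgen, ← add_smul]
    rcases z with z | z | z <;> simp [wt]
  exact LinearMap.congr_fun this a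

theorem cnt_comm (w w' : Lab D → ℕ) (e e' : ℕ) (a : CForm D) :
    cnt w e (cnt w' e' a) = cnt w' e' (cnt w e a) := by
  have := ((cnt_evenDer w e).comm (cnt_evenDer w' e')).ext IsDer.zero fun z => by
    simp only [LinearMap.sub_apply, LinearMap.comp_apply, cnt_cgen, map_smul, LinearMap.zero_apply]
    rw [smul_comm, sub_self]
  exact sub_eq_zero.1 (LinearMap.congr_fun this a)

theorem IsField.map_invAll {u : LForm D} (hu : IsField u) : IsField (hat invAll u) := by
  rw [IsField, hat_comm fun a => (invAll_comm _ (cnt_comm _ _ _ _) a).symm, hu, map_zero]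

theorem IsField.decomp {u : LForm D} (hu : IsField u) :
    u = hat (cnt (fun _ => 1) 0) (hat invAll u) + pur (augL u) 1 := by
  have h := hat_cntAll_invAll u
  rw [hat_cntAll, hu.map_invAll.hat_formDeg, add_zero] at h
  rw [h, sub_add_cancel]

/-- Applying `exists_of_tD_eq` to the inverse of the counting operator removes that operator from
the conclusion; only the value at vanishing generators escapes. -/
theorem IsField.eq_of_tD (hD : 4 < D) (μ : Fin D) {u : LForm D} (hu : IsField u) {b : LForm D}
    (h : tD μ u = dK b) : ∃ m, u = dK m + pur (augL u) 1 := by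
  obtain ⟨m, hm⟩ := exists_of_tD_eq hD μ hu.map_invAll (b := hat invAll b) (by
    rw [← hat_invAll_tD, h, hat_invAll_dK])
  exact ⟨m, by rw [← hm]; exact hu.decomp⟩

/-- The Poincaré lemma for one-forms modulo the field equations. Two directions already produce a
primitive for one component. Any other component then differs from the derivative of that primitive
by something constant on shell along that direction, hence `δ`-exact once the purely `x`-dependent
parts agree. -/
theorem exists_primitive (hD : 4 < D) {u : Fin D → LForm D} (hu : ∀ μ, IsField (u μ))
    {b : Fin D → Fin D → LForm D} (h : ∀ μ ν, tD μ (u ν) - tD ν (u μ) = dK (b μ ν)) :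
    ∃ (w : LForm D) (k : Fin D → LForm D), IsField w ∧ ∀ μ, u μ = tD μ w + dK (k μ) := by
  obtain ⟨g, hg⟩ := exists_potential (fun μ => augL (u μ)) fun μ ν => by
    rw [← sub_eq_zero, ← augL_tD, ← augL_tD, ← map_sub, h, augL_dK]
  obtain ⟨α, β, hαβ⟩ : ∃ α β : Fin D, β ≠ α :=
    ⟨⟨0, by omega⟩, ⟨1, by omega⟩, by simp⟩
  obtain ⟨w, m, hw, hm⟩ := exists_of_tD_sub hD hαβ (hu α).map_invAll (u' := hat invAll (u β))
    (b := hat invAll (b β α)) (by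
      rw [← hat_invAll_tD, ← hat_invAll_tD, ← map_sub, h, hat_invAll_dK])
  -- The `x`-dependent part of the primitive is replaced by the potential `g` of the values at
  -- vanishing generators.
  obtain ⟨w', hw'⟩ : ∃ w', w' = w - pur (augL w) 1 + pur g 1 := ⟨_, rfl⟩
  have hf : IsField w' := by
    rw [hw', IsField, map_add, isField_pur_one g, add_zero]
    exact hw.sub (isField_pur_one _)
  have hone : ∀ f : Smooth D, augL (pur f 1) = f := fun f => by rw [augL_pur, map_one, one_smul]
  have haug : augL w' = g := by rw [hw', map_add, map_sub, hone, hone, sub_self, zero_add]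
  have hfield : ∀ μ, IsField (u μ - tD μ w') := fun μ => (hu μ).sub (hf.map_tD μ)
  have haug2 : ∀ μ, augL (u μ - tD μ w') = 0 := fun μ => by
    rw [map_sub, augL_tD, haug, hg, sub_self]
  obtain ⟨n, hn⟩ : ∃ n, u α - tD α w' = dK n := by
    have h1 : u α - tD α w' = dK m + pur (partialX α (augL w)) 1 := by
      conv_lhs => rw [(hu α).decomp, hm, hw', map_add, map_sub, tD_pur_one, tD_pur_one, ← hg]
      abel
    have h2 := haug2 α
    rw [h1, map_add, augL_dK, zero_add, hone] at h2
    rw [h2, map_zero, LinearMap.zero_apply, add_zero] at h1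
    exact ⟨m, h1⟩
  have : ∀ μ, ∃ k, u μ - tD μ w' = dK k := fun μ => by
    obtain ⟨k, hk⟩ := (hfield μ).eq_of_tD hD α (b := b α μ + tD μ n) (by
      rw [map_add, dK_tD, ← hn, ← h, map_sub, map_sub, tD_comm α μ w']
      abel)
    rw [haug2, map_zero, LinearMap.zero_apply, add_zero] at hk
    exact ⟨k, hk⟩
  choose k hk using this
  exact ⟨w', k, hf, fun μ => by rw [← hk, add_sub_cancel]⟩

/-! ### Polynomials in commuting operators -/

/-- The operators generate a commutative subalgebra, into which polynomials can be evaluated. -/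
theorem exists_aeval_of_comm {V : Type*} [AddCommGroup V] [Module ℝ V]
    (S : Fin D → Module.End ℝ V) (hS : ∀ μ ν, S μ * S ν = S ν * S μ) :
    ∃ φ : Poly D →ₐ[ℝ] Module.End ℝ V, ∀ μ, φ (MvPolynomial.X μ) = S μ := by
  have hc : ∀ a ∈ Set.range S, ∀ b ∈ Set.range S, a * b = b * a := by
    rintro _ ⟨μ, rfl⟩ _ ⟨ν, rfl⟩
    exact hS μ ν
  let := Algebra.adjoinCommRingOfComm ℝ hc
  let s : Fin D → Algebra.adjoin ℝ (Set.range S) := fun μ =>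
    ⟨S μ, Algebra.subset_adjoin ⟨μ, rfl⟩⟩
  refine ⟨(Algebra.adjoin ℝ (Set.range S)).val.comp (MvPolynomial.aeval s), fun μ => ?_⟩
  rw [AlgHom.comp_apply, MvPolynomial.aeval_X]
  rfl

theorem exists_adjoint_action : ∃ φ : Poly D →ₐ[ℝ] Module.End ℝ (LForm D),
    ∀ μ, φ (MvPolynomial.X μ) = -tD μ :=
  exists_aeval_of_comm (fun μ => -tD μ) fun μ ν => LinearMap.ext fun a => by
    simp only [Module.End.mul_apply, LinearMap.neg_apply, map_neg, tD_comm μ ν]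

/-- The polynomials in the momenta act on forms, the momenta as minus the total derivatives. -/
instance : Module (Poly D) (LForm D) :=
  Module.compHom (LForm D) (exists_adjoint_action (D := D)).choose.toRingHom

theorem poly_smul_def (q : Poly D) (a : LForm D) :
    q • a = (exists_adjoint_action (D := D)).choose q a := rfl

instance : IsScalarTower ℝ (Poly D) (LForm D) where
  smul_assoc r q a := by rw [poly_smul_def, map_smul]; rfl

theorem X_smul_form (μ : Fin D) (a : LForm D) : (MvPolynomial.X μ : Poly D) • a = -tD μ a := by
  rw [poly_smul_def, (exists_adjoint_action (D := D)).choose_spec μ]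
  rfl

theorem poly_smul_mem {U : Submodule ℝ (LForm D)} (hU : ∀ μ, ∀ a ∈ U, tD μ a ∈ U) (q : Poly D)
    {a : LForm D} (ha : a ∈ U) : q • a ∈ U := by
  induction q using MvPolynomial.induction_on generalizing a with
  | C r =>
    have : (MvPolynomial.C r : Poly D) • a = r • a := by
      rw [← MvPolynomial.algebraMap_eq, algebraMap_smul]
    rw [this]
    exact U.smul_mem r ha
  | add p q hp hq => rw [add_smul]; exact add_mem (hp ha) (hq ha)
  | mul_X p μ hp =>
    rw [mul_smul, X_smul_form]
    exact hp (neg_mem (hU μ a ha))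

theorem poly_smul_comm {L : LForm D →ₗ[ℝ] LForm D} (hL : ∀ μ a, L (tD μ a) = tD μ (L a))
    (q : Poly D) (a : LForm D) : L (q • a) = q • L a := by
  induction q using MvPolynomial.induction_on generalizing a with
  | C r => rw [← MvPolynomial.algebraMap_eq, algebraMap_smul, algebraMap_smul, map_smul]
  | add p q hp hq => rw [add_smul, add_smul, map_add, hp, hq]
  | mul_X p μ hp => rw [mul_smul, hp, X_smul_form, map_neg, hL, mul_smul, X_smul_form]

/-! ### Euler-Lagrange derivatives -/

/-- The action of the polynomials on the coefficients. -/
def evP : PLForm D →ₗ[ℝ] LForm D :=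
  TensorProduct.lift (LinearMap.mk₂ ℝ (fun (q : Poly D) a => q • a) (fun _ _ _ => add_smul _ _ _)
    (fun _ _ _ => smul_assoc _ _ _) (fun _ _ _ => smul_add _ _ _) fun _ _ _ => smul_comm _ _ _)

theorem evP_tmul (q : Poly D) (a : LForm D) : evP (q ⊗ₜ a) = q • a := rfl

theorem evP_smul (q : Poly D) (u : PLForm D) : evP (q • u) = q • evP u := by
  induction u using TensorProduct.induction_on with
  | zero => simp
  | add u w hu hw => simp only [smul_add, map_add, hu, hw]
  | tmul p a => rw [TensorProduct.smul_tmul', evP_tmul, evP_tmul, smul_eq_mul, mul_smul]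

theorem evP_coefL {L : LForm D →ₗ[ℝ] LForm D} (hL : ∀ μ a, L (tD μ a) = tD μ (L a))
    (u : PLForm D) : evP (coefL L u) = L (evP u) := by
  induction u using TensorProduct.induction_on with
  | zero => simp
  | add u w hu hw => simp only [map_add, hu, hw]
  | tmul p a => rw [coefL_tmul, evP_tmul, evP_tmul, poly_smul_comm hL]

/-- The Euler-Lagrange derivative with respect to a variable. -/
def euler (κ : Lab D) : LForm D →ₗ[ℝ] LForm D := evP ∘ₗ lsymb κ

theorem euler_apply (κ : Lab D) (a : LForm D) : euler κ a = evP (lsymb κ a) := rfl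

/-- Linearization produces `X_μ` plus the derivative of the coefficients; since the momenta act as
minus the total derivatives, the two cancel. -/
theorem euler_tD (κ : Lab D) (μ : Fin D) (a : LForm D) : euler κ (tD μ a) = 0 := by
  rw [euler_apply, lsymb_tD, map_add, evP_smul, evP_coefL (tD_comm μ), X_smul_form, neg_add_cancel]

/-- The Koszul-Tate differential on Euler-Lagrange derivatives. -/
def eulerD (b : Lab D → LForm D) (κ : Lab D) : LForm D :=
  ∑ κ', ktMat κ κ' • b κ' + par κ • dK (b κ)

theorem euler_dK (κ : Lab D) (a : LForm D) : euler κ (dK a) = eulerD (fun κ => euler κ a) κ := by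
  rw [euler_apply, lsymb_dK, map_add, map_sum, map_smul, evP_coefL fun μ a => dK_tD μ a]
  simp only [evP_smul]
  rfl

theorem euler_cnt (w : Lab D → ℕ) (e : ℕ) (κ : Lab D) (a : LForm D) :
    euler κ (hat (cnt w e) a) = (w κ : ℝ) • euler κ a + hat (cnt w e) (euler κ a) := by
  rw [euler_apply, lsymb_cnt, map_add, map_smul, evP_coefL fun μ a => hat_tD (cnt_tot w e μ) a]
  rfl

/-! ### Forms modulo total divergences -/

/-- The total divergence. -/
def dvg : (Fin D → LForm D) →ₗ[ℝ] LForm D := ∑ μ, tD μ ∘ₗ LinearMap.proj μ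

theorem dvg_apply (n : Fin D → LForm D) : dvg n = ∑ μ, tD μ (n μ) := by
  simp [dvg]

/-- The class of a form modulo total divergences. -/
def mdv : LForm D →ₗ[ℝ] LForm D ⧸ LinearMap.range (dvg (D := D)) := Submodule.mkQ _

theorem mdv_eq_zero {a : LForm D} : mdv a = 0 ↔ ∃ n, dvg n = a := by
  rw [mdv, Submodule.mkQ_apply, Submodule.Quotient.mk_eq_zero, LinearMap.mem_range]

theorem mdv_tD (μ : Fin D) (a : LForm D) : mdv (tD μ a) = 0 :=
  mdv_eq_zero.2 ⟨Pi.single μ a, by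
    rw [dvg_apply, Finset.sum_eq_single μ]
    · rw [Pi.single_eq_same]
    · intro ν _ h
      rw [Pi.single_eq_of_ne h, map_zero]
    · simp⟩

/-- Integration by parts: modulo divergences a differential operator on the variable becomes its
formal adjoint on the other factor. -/
theorem mdv_cmul_lin (κ : Lab D) (p q : Poly D) (a : LForm D) :
    mdv (cmul (lin κ (p * q)) a) = mdv (cmul (lin κ q) (p • a)) := by
  induction p using MvPolynomial.induction_on generalizing q with
  | C r =>
    rw [← MvPolynomial.algebraMap_eq, algebraMap_smul, ← Algebra.smul_def, map_smul, cmul_smul,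
      map_smul, map_smul, map_smul]
  | add p p' hp hp' =>
    rw [add_mul, map_add, cmul_add, map_add, hp, hp', add_smul, map_add, map_add]
  | mul_X p μ hp =>
    rw [mul_assoc, hp, ← tot_lin, mul_comm p, mul_smul, X_smul_form, map_neg, map_neg,
      eq_neg_iff_add_eq_zero, ← map_add, ← tD_cmul, mdv_tD]

theorem mdv_lsubst (κ : Lab D) (u : PLForm D) : mdv (lsubst κ u) = mdv (cmul (lin κ 1) (evP u)) := by
  induction u using TensorProduct.induction_on with
  | zero => simp
  | add u w hu hw => simp only [map_add, hu, hw]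
  | tmul p a => rw [lsubst_tmul, evP_tmul, ← mdv_cmul_lin, mul_one]

/-- The pairing of the variables with a family of forms. -/
def pairing (b : Lab D → LForm D) : LForm D := ∑ κ, cmul (lin κ 1) (b κ)

/-- The first variational formula. -/
theorem mdv_cnt (a : LForm D) :
    mdv (hat (cnt (fun _ => 1) 0) a) = mdv (pairing fun κ => euler κ a) := by
  rw [← sum_lsubst_lsymb, pairing, map_sum, map_sum]
  exact Finset.sum_congr rfl fun κ _ => mdv_lsubst κ _

/-- `eulerD` is what integration by parts makes of `δ` acting on the pairing: the matrix moves from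
the variable to the family, and `dK (b κ)` acquires the sign of passing `δ` through the variable. -/
theorem mdv_pairing_eulerD (b : Lab D → LForm D) :
    mdv (pairing (eulerD b)) = mdv (dK (pairing b)) := by
  have h : ∀ κ, mdv (dK (cmul (lin κ 1) (b κ))) =
      ∑ κ', mdv (cmul (lin κ' 1) (ktMat κ' κ • b κ)) +
        mdv (cmul (lin κ 1) (par κ • dK (b κ))) := fun κ => by
    rw [dK_cmul, kos_lin, cmul_sum, gradeInv_lin, cmul_smul, map_add, map_sum, map_smul (cmul _)]
    simp only [mdv_cmul_lin]
  simp only [pairing, eulerD, map_sum, map_add, h, Finset.sum_add_distrib]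
  rw [Finset.sum_comm]

/-! ### Acyclicity of the Koszul-Tate differential in positive antifield number -/

theorem Diag.eq_zero_of_neg {V : Type*} [AddCommGroup V] [Module ℝ V] {L : V →ₗ[ℝ] V} (hL : Diag L)
    {r : ℝ} (hr : 0 < r) {x : V} (hx : L x = -r • x) : x = 0 := by
  have h := hL.ext (f := calc' L (fun n => (r + n)⁻¹) ∘ₗ (r • LinearMap.id + L))
    (f' := LinearMap.id) (fun n x hx => by
      rw [LinearMap.comp_apply, LinearMap.add_apply, LinearMap.smul_apply, hx, LinearMap.id_apply,
        ← add_smul, map_smul, hL.calc'_apply _ hx, smul_smul, mul_inv_cancel₀ (by positivity),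
        one_smul]) x
  rw [LinearMap.comp_apply, LinearMap.add_apply, LinearMap.smul_apply, hx, LinearMap.id_apply,
    neg_smul, add_neg_cancel, map_zero] at h
  exact h.symm

theorem diag_cntL (w : Lab D → ℕ) (e : ℕ) : Diag (hat (cnt (D := D) w e)) := (cnt_diag w e).hat

theorem cntL_dK (e : ℕ) (a : LForm D) :
    hat (cnt af e) (dK a) = dK (hat (cnt af e) a) - dK a := by
  have h : cnt af e ∘ₗ (kos : CForm D →ₗ[ℝ] CForm D) =
      kos ∘ₗ (cnt af e + (-1 : ℝ) • LinearMap.id) := LinearMap.ext fun a => by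
    simp only [LinearMap.comp_apply, LinearMap.add_apply, LinearMap.smul_apply, LinearMap.id_apply,
      map_add, map_smul, cnt_af_kos]
    module
  rw [dK, ← LinearMap.comp_apply, ← hat_comp, h, hat_comp, hat_add, hat_smul, hat_id,
    LinearMap.comp_apply, LinearMap.add_apply, map_add, LinearMap.smul_apply, map_smul,
    LinearMap.id_apply, neg_one_smul, sub_eq_add_neg]

/-- The component of a given antifield number. -/
def afPart (n : ℕ) : LForm D →ₗ[ℝ] LForm D :=
  calc' (hat (cnt af 0)) fun m => if m = n then 1 else 0

theorem afPart_eq {n : ℕ} {a : LForm D} (h : hat (cnt af 0) a = (n : ℝ) • a) : afPart n a = a := by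
  rw [afPart, (diag_cntL af 0).calc'_apply _ h, if_pos rfl, one_smul]

theorem afPart_eq_zero {m n : ℕ} (hmn : m ≠ n) {a : LForm D}
    (h : hat (cnt af 0) a = (m : ℝ) • a) : afPart n a = 0 := by
  rw [afPart, (diag_cntL af 0).calc'_apply _ h, if_neg hmn, zero_smul]

theorem cnt_afPart (n : ℕ) (a : LForm D) :
    hat (cnt af 0) (afPart n a) = (n : ℝ) • afPart n a := by
  refine (diag_cntL af 0).ext (f := hat (cnt af 0) ∘ₗ afPart n) (f' := (n : ℝ) • afPart n)
    (fun m x hx => ?_) a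
  rw [LinearMap.comp_apply, LinearMap.smul_apply]
  by_cases h : m = n
  · subst h
    rw [afPart_eq hx, hx]
  · rw [afPart_eq_zero h hx, map_zero, smul_zero]

theorem afPart_dK (n : ℕ) (a : LForm D) : afPart n (dK a) = dK (afPart (n + 1) a) := by
  refine (diag_cntL af 0).calc'_comm (diag_cntL af 0) _ _ dK (fun m x hx => ?_) a
  have h : hat (cnt af 0) (dK x) = ((m : ℝ) - 1) • dK x := by
    rw [cntL_dK, hx, map_smul, sub_smul, one_smul]
  cases m with
  | zero =>
    refine .inl ((diag_cntL af 0).eq_zero_of_neg one_pos ?_)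
    rw [h, Nat.cast_zero, zero_sub]
  | succ m =>
    refine .inr ⟨m, ?_, by simp⟩
    rw [h, Nat.cast_add, Nat.cast_one, add_sub_cancel_right]

/-- Apply the homotopy to a closed form. Its remainder has antifield number zero, so the component
of number `n ≠ 0` is exact. -/
theorem exists_dK_eq (hD : 4 < D) {n : ℕ} (hn : n ≠ 0) {a : LForm D}
    (ha : hat (cnt af 0) a = (n : ℝ) • a) (h : dK a = 0) :
    ∃ b, hat (cnt af 0) b = ((n + 1 : ℕ) : ℝ) • b ∧ a = dK b := by
  obtain ⟨p, q, hp, hpq⟩ := exists_homotopy hD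
  have h1 : LinearMap.id = p + (kos ∘ₗ q + q ∘ₗ kos) := LinearMap.ext hpq
  have h2 := LinearMap.congr_fun (congrArg hat h1) a
  rw [hat_id, hat_add, hat_add, hat_comp, hat_comp] at h2
  simp only [LinearMap.add_apply, LinearMap.comp_apply, LinearMap.id_apply] at h2
  change a = hat p a + (dK (hat q a) + hat q (dK a)) at h2
  rw [h, map_zero, add_zero] at h2
  have h3 : hat (cnt af 0) (hat p a) = ((0 : ℕ) : ℝ) • hat p a := by
    rw [← LinearMap.comp_apply, ← hat_comp,
      show cnt af 0 ∘ₗ p = 0 from LinearMap.ext hp, hat_zero, LinearMap.zero_apply, Nat.cast_zero,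
      zero_smul]
  have h4 := congrArg (afPart n) h2
  rw [afPart_eq ha, map_add, afPart_eq_zero hn.symm h3, zero_add, afPart_dK] at h4
  exact ⟨afPart (n + 1) (hat q a), cnt_afPart _ _, h4⟩

theorem cntL_af_one (u : LForm D) :
    hat (cnt af 1) u = hat (cnt af 0) u + hat (cnt (fun _ => 0) 1) u := by
  have h : cnt (D := D) af 1 = cnt af 0 + cnt (fun _ => 0) 1 :=
    (cnt_evenDer af 1).ext ((cnt_evenDer af 0).add (cnt_evenDer _ _)) fun z => by
      rw [LinearMap.add_apply, cnt_cgen, cnt_cgen, cnt_cgen, ← add_smul]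
      rcases z with z | z | z <;> simp [wt]
  rw [h, hat_add, LinearMap.add_apply]

theorem IsField.hat_af {u : LForm D} (hu : IsField u) : hat (cnt af 0) u = 0 := by
  have h := cntL_af_one u
  rw [hu.hat_formDeg, add_zero] at h
  exact h.symm.trans hu

theorem IsField.dK_eq_zero {u : LForm D} (hu : IsField u) : dK u = 0 :=
  (diag_cntL af 1).eq_zero_of_neg one_pos (by rw [cntL_dK, hu, map_zero, zero_sub, neg_one_smul])

/-! ### Gauge parameters with gauge transformations vanishing on shell -/

/-- A totally antisymmetric tensor has no hook part. -/
theorem hookCoef_eq_zero_of_antisymmetric {M : Type*} [AddCommGroup M] [Module ℝ M]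
    {Y : Fin D → Fin D → Fin D → M} (h1 : ∀ α β γ, Y β α γ = -Y α β γ)
    (h2 : ∀ α β γ, Y β γ α = Y α β γ) (i : HookIdx D) : hookCoef Y i = 0 := by
  have h : hookProj Y = 0 := by
    funext α β γ
    simp only [hookProj, Pi.zero_apply]
    rw [← h2 γ α β, h2 α β γ, h1 α β γ, ← h2 α γ β, h1 β γ α, h2 α β γ]
    module
  rw [← hookCoef_hookProj, h]
  simp [hookCoef]

/-- The curl in the first index. -/
def curl (Z : Fin D → Fin D → LForm D) (γ α β : Fin D) : LForm D := tD γ (Z α β) - tD α (Z γ β)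

section Curl

variable {Z : Fin D → Fin D → LForm D} {X : HookIdx D → LForm D}

theorem hookCoef_cls_tD
    (h : ∀ i, ∑ α, ∑ β, gaugeMat MvPolynomial.X i α β • Z α β = dK (X i)) (i : HookIdx D) :
    hookCoef (fun γ α β => tS γ (cls (Z α β))) i = 0 := by
  have h1 := h i
  rw [sum_gaugeMat (M := LForm D) MvPolynomial.X i Z] at h1
  have h2 := congrArg cls h1
  rw [cls_dK, map_smul] at h2
  have h3 := (smul_eq_zero.1 h2).resolve_left (by norm_num)
  simp only [hookCoef, map_sum, map_smul, X_smul_form, map_neg, smul_neg, Finset.sum_neg_distrib,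
    neg_eq_zero] at h3
  exact h3

/-- On shell the hook part of the derivative of `Z` vanishes, and `curl_aux` reads this as cyclic
symmetry of the curl. -/
theorem cls_curl_cyclic
    (h : ∀ i, ∑ α, ∑ β, gaugeMat MvPolynomial.X i α β • Z α β = dK (X i)) (α β γ : Fin D) :
    cls (curl Z γ α β) = cls (curl Z α β γ) := by
  have h1 := hookProj_eq_zero (hookCoef_cls_tD h)
  have e1 := h1 γ α β
  have e2 := h1 α β γ
  simp only [hookProj] at e1 e2
  simp only [curl, map_sub, ← tS_cls]
  exact curl_aux _ _ _ _ _ _ e1 e2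

theorem cls_tD_curl
    (h : ∀ i, ∑ α, ∑ β, gaugeMat MvPolynomial.X i α β • Z α β = dK (X i)) (α β γ δ : Fin D) :
    cls (tD δ (curl Z γ α β)) = 0 := by
  have := map_curl_eq_zero (p := tS) tS_comm (Z := fun α β => cls (Z α β)) (fun α β γ => by
    have := cls_curl_cyclic h α β γ
    simpa only [curl, map_sub, ← tS_cls] using this) α β γ δ
  simpa only [curl, map_sub, ← tS_cls] using this

theorem augL_eq_of_cls {a b : LForm D} (h : cls a = cls b) : augL a = augL b := by
  rw [← sub_eq_zero, ← map_sub] at h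
  obtain ⟨c, hc⟩ := cls_eq_zero.1 h
  rw [← sub_eq_zero, ← map_sub, ← hc, augL_dK]

theorem smul_one_injective {r s : ℝ} (h : r • (1 : Smooth D) = s • (1 : Smooth D)) : r = s := by
  have := congrFun (congrArg Subtype.val h) 0
  change r * 1 = s * 1 at this
  rwa [mul_one, mul_one] at this

theorem partialX_coord (μ ν : Fin D) :
    partialX μ (coord ν) = (if μ = ν then (1 : ℝ) else 0) • (1 : Smooth D) := by
  apply Subtype.ext
  funext x
  change fderiv ℝ (fun x : Fin D → ℝ => x ν) x (Pi.single μ 1) =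
    (if μ = ν then (1 : ℝ) else 0) * 1
  rw [show (fun x : Fin D → ℝ => x ν) = ContinuousLinearMap.proj (R := ℝ) (φ := fun _ => ℝ) ν
    from rfl, ContinuousLinearMap.fderiv, mul_one]
  simp [Pi.single_apply, eq_comm]

theorem tD_pur_coord (γ : Fin D) (t : Fin D → ℝ) :
    tD γ (∑ ρ, pur (t ρ • coord ρ) 1) = t γ • pur 1 1 := by
  simp only [map_sum, tD_pur_one, map_smul, partialX_coord, LinearMap.smul_apply, ite_smul,
    one_smul, zero_smul, apply_ite (pur (D := D)), map_zero]
  rw [Finset.sum_eq_single γ]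
  · simp
  · intro ρ _ h
    simp [h.symm]
  · simp

/-- The derivatives of the curl are `δ`-exact, so by `IsField.eq_of_tD` the curl is a function of
`x` up to `δ`-exact terms. That function is its value at vanishing generators; all its derivatives
vanish, hence it is a number `s`. -/
theorem exists_curl_eq (hD : 4 < D) (hZ : ∀ α β, IsField (Z α β))
    (h : ∀ i, ∑ α, ∑ β, gaugeMat MvPolynomial.X i α β • Z α β = dK (X i)) :
    ∃ s : Fin D → Fin D → Fin D → ℝ, (∀ γ α β, s α γ β = -s γ α β) ∧
      (∀ γ α β, s γ α β = s α β γ) ∧ (∀ γ α β, augL (curl Z γ α β) = s γ α β • (1 : Smooth D)) ∧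
      ∀ γ α β, ∃ m, curl Z γ α β = dK m + s γ α β • pur 1 1 := by
  have hf : ∀ γ α β, IsField (curl Z γ α β) := fun γ α β =>
    ((hZ α β).map_tD γ).sub ((hZ γ β).map_tD α)
  have hc : ∀ γ α β, ∃ r : ℝ, augL (curl Z γ α β) = r • (1 : Smooth D) := fun γ α β =>
    exists_eq_const _ fun δ => by
      obtain ⟨b, hb⟩ := cls_eq_zero.1 (cls_tD_curl h α β γ δ)
      rw [← augL_tD, ← hb, augL_dK]
  choose s hs using hc
  refine ⟨s, fun γ α β => smul_one_injective (D := D) ?_,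
    fun γ α β => smul_one_injective (D := D) ?_, hs, fun γ α β => ?_⟩
  · rw [neg_smul, ← hs, ← hs, ← map_neg, curl, curl, neg_sub]
  · rw [← hs, ← hs]
    exact augL_eq_of_cls (cls_curl_cyclic h α β γ)
  · obtain ⟨b, hb⟩ := cls_eq_zero.1 (cls_tD_curl h α β γ α)
    obtain ⟨m, hm⟩ := (hf γ α β).eq_of_tD hD α hb.symm
    rw [hs, map_smul, LinearMap.smul_apply] at hm
    exact ⟨m, hm⟩

/-- Subtract from `Z` the solution linear in `x` that has the same numerical curl. For each fixed
second index the rest is a closed one-form on shell, and `exists_primitive` supplies `ξ` and `W`. -/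
theorem exists_gauge_parameter (hD : 4 < D) (hZ : ∀ α β, IsField (Z α β))
    (h : ∀ i, ∑ α, ∑ β, gaugeMat MvPolynomial.X i α β • Z α β = dK (X i)) :
    ∃ (t : Fin D → Fin D → Fin D → ℝ) (ξ : Fin D → LForm D) (W : Fin D → Fin D → LForm D),
      TotallyAntisymmetric t ∧ (∀ β, dK (ξ β) = 0) ∧
      (∀ α β, hat (cnt af 0) (W α β) = ((1 : ℕ) : ℝ) • W α β) ∧
      (∀ α β, Z α β = ∑ ρ, pur (t α β ρ • coord ρ) 1 + tD α (ξ β) + dK (W α β)) ∧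
      ((∀ α β, ∃ r : ℝ, augL (Z α β) = r • (1 : Smooth D)) → t = 0) := by
  obtain ⟨s, hs1, hs2, hs3, hs4⟩ := exists_curl_eq hD hZ h
  choose m hm using hs4
  have hone : ∀ f : Smooth D, IsField (pur f 1) := isField_pur_one
  -- The factor 1/2 is right because the curl of the linear term consists of two equal
  -- contributions.
  have hprim := fun β => exists_primitive hD
    (u := fun α => Z α β - ∑ ρ, pur (((1 / 2 : ℝ) * s ρ α β) • coord ρ) 1) (fun α =>
      (hZ α β).sub (by rw [IsField, map_sum]; exact Finset.sum_eq_zero fun ρ _ => hone _))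
    (b := fun γ α => m γ α β) fun γ α => by
      rw [map_sub, map_sub, tD_pur_coord, tD_pur_coord, ← sub_eq_zero]
      have := hm γ α β
      rw [curl] at this
      rw [hs1 γ α β]
      linear_combination (norm := module) this
  choose ξ W hξ hW using hprim
  refine ⟨fun α β ρ => (1 / 2 : ℝ) * s ρ α β, ξ, fun α β => afPart 1 (W β α),
    fun μ ν ρ => ⟨?_, ?_⟩, fun β => (hξ β).dK_eq_zero, fun α β => cnt_afPart 1 _,
    fun α β => ?_, fun hr => ?_⟩
  · linarith [hs2 ρ ν μ, hs1 μ ν ρ, hs2 ρ μ ν]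
  · linarith [hs2 ρ ν μ, hs1 μ ν ρ, hs2 ρ μ ν]
  · have h1 := hW β α
    have hf : IsField (Z α β - ∑ ρ, pur (((1 / 2 : ℝ) * s ρ α β) • coord ρ) 1 - tD α (ξ β)) :=
      ((hZ α β).sub (by
        rw [IsField, map_sum]; exact Finset.sum_eq_zero fun ρ _ => hone _)).sub ((hξ β).map_tD α)
    have h2 : Z α β - ∑ ρ, pur (((1 / 2 : ℝ) * s ρ α β) • coord ρ) 1 - tD α (ξ β) =
      dK (W β α) := by rw [h1, add_sub_cancel_left]
    have h3 := congrArg (afPart 0) h2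
    rw [afPart_eq (by rw [hf.hat_af, Nat.cast_zero, zero_smul]), afPart_dK] at h3
    rw [← h3]
    abel
  -- When the values of `Z` at vanishing generators are constants, so are not seen by derivatives,
  -- the numerical curl is zero.
  · funext α β ρ
    have h1 : s ρ α β • (1 : Smooth D) = (0 : ℝ) • (1 : Smooth D) := by
      obtain ⟨r, hr1⟩ := hr α β
      obtain ⟨r', hr2⟩ := hr ρ β
      have hp : ∀ μ : Fin D, partialX μ (1 : Smooth D) = 0 := fun μ => by
        apply Subtype.ext
        funext x
        change fderiv ℝ (fun _ => (1 : ℝ)) x _ = 0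
        simp
      rw [← hs3, curl, map_sub, augL_tD, augL_tD, hr1, hr2, map_smul, map_smul, hp, hp]
      simp
    change (1 / 2 : ℝ) * s ρ α β = 0
    rw [smul_one_injective h1, mul_zero]

end Curl

/-! ### Cocycles without one-forms -/

section EulerD

variable (b : Lab D → LForm D)

theorem eulerD_antiC (μ : Fin D) :
    eulerD b (.inr (.antiC μ)) = -dK (b (.inr (.antiC μ))) := by
  simp only [eulerD, ktMat, par, zero_smul, Finset.sum_const_zero, zero_add, neg_smul, one_smul]

theorem eulerD_antiC2 (α β : Fin D) : eulerD b (.inl (.antiC2 α β)) =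
    (-2 : ℝ) • tD α (b (.inr (.antiC β))) + dK (b (.inl (.antiC2 α β))) := by
  simp only [eulerD, Fintype.sum_sum_type, sum_oddVar, ktMat, par, zero_smul,
    Finset.sum_const_zero, zero_add, one_smul, ite_smul, Finset.sum_ite_eq,
    Finset.mem_univ, if_true, smul_assoc, X_smul_form, smul_neg, neg_smul]

theorem eulerD_antiT (i : HookIdx D) : eulerD b (.inr (.antiT i)) =
    ∑ α, ∑ β, gaugeMat MvPolynomial.X i α β • b (.inl (.antiC2 α β)) -
      dK (b (.inr (.antiT i))) := by
  simp only [eulerD, Fintype.sum_sum_type, sum_evenVar, ktMat, par, zero_smul,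
    Finset.sum_const_zero, add_zero, zero_add, one_smul, neg_smul, sub_eq_add_neg]

theorem eulerD_T (j : HookIdx D) : eulerD b (.inl (.T j)) =
    ∑ i, eomMat MvPolynomial.X i j • b (.inr (.antiT i)) + dK (b (.inl (.T j))) := by
  simp only [eulerD, Fintype.sum_sum_type, sum_oddVar, ktMat, par, zero_smul,
    Finset.sum_const_zero, add_zero, zero_add, one_smul]

theorem eulerD_ghost {κ : Lab D} (h : ∀ κ', ktMat κ κ' = 0) : eulerD b κ = par κ • dK (b κ) := by
  simp only [eulerD, h, zero_smul, Finset.sum_const_zero, zero_add]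

end EulerD

/-- The form `C^{*μν} t_{μνρ} x^ρ`. -/
def repr (t : Fin D → Fin D → Fin D → ℝ) : LForm D :=
  ∑ μ, ∑ ν, ∑ ρ, pur (t μ ν ρ • coord ρ) (cgen (.inl (0, .antiC2 μ ν)))

/-- The Euler-Lagrange derivatives of `repr t`. -/
def reprE (t : Fin D → Fin D → Fin D → ℝ) : Lab D → LForm D
  | .inl (.antiC2 α β) => ∑ ρ, pur (t α β ρ • coord ρ) 1
  | _ => 0

theorem lin_one (κ : Lab D) : lin κ 1 = cgen (jet 0 κ) := lin_monomial κ 0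

theorem pairing_reprE (t : Fin D → Fin D → Fin D → ℝ) : pairing (reprE t) = repr t := by
  simp only [pairing, Fintype.sum_sum_type, sum_evenVar, reprE, map_zero,
    Finset.sum_const_zero, add_zero, zero_add, map_sum, cmul_pur, mul_one, lin_one]
  rfl

theorem pairing_add (b b' : Lab D → LForm D) : pairing (b + b') = pairing b + pairing b' := by
  simp only [pairing, Pi.add_apply, map_add, Finset.sum_add_distrib]

theorem hat_invAll_repr (t : Fin D → Fin D → Fin D → ℝ) : hat invAll (repr t) = repr t := by
  have h : ∀ z : Gen D, invAll (cgen z) = cgen z := fun z => by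
    have h1 : cntAll (cgen z) = ((1 : ℕ) : ℝ) • cgen z := by
      rw [cnt_cgen]
      rcases z with z | z | z <;> rfl
    rw [invAll, (cnt_diag _ _).calc'_apply _ h1, Nat.cast_one, inv_one, one_smul]
  simp only [repr, map_sum, hat_pur, h]

/-- Forms with constant coefficients are stable under total derivatives, hence under the polynomial
action in the Euler-Lagrange derivative. -/
theorem euler_pur_one (κ : Lab D) (c : CForm D) : ∃ c', euler κ (pur 1 c) = pur 1 c' := by
  have hR : ∀ μ, ∀ a ∈ LinearMap.range (pur (D := D) 1), tD μ a ∈ LinearMap.range (pur 1) := by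
    rintro μ _ ⟨c, rfl⟩
    have h : partialX μ (1 : Smooth D) = 0 := by
      apply Subtype.ext
      funext x
      change fderiv ℝ (fun _ => (1 : ℝ)) x _ = 0
      simp
    exact ⟨tot μ c, by rw [tD_pur, h, map_zero, LinearMap.zero_apply, zero_add]⟩
  have key : ∀ u : PForm D, evP (purP 1 u) ∈ LinearMap.range (pur (D := D) 1) := fun u => by
    induction u using TensorProduct.induction_on with
    | zero => rw [map_zero, map_zero]; exact zero_mem _
    | add u w hu hw => rw [map_add, map_add]; exact add_mem hu hw
    | tmul p c => exact poly_smul_mem hR p ⟨c, rfl⟩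
  obtain ⟨c', hc'⟩ := key (symb κ c)
  exact ⟨c', by rw [euler_apply, lsymb_pur, hc']⟩

theorem sum_gaugeMat_tD (i : HookIdx D) (ξ : Fin D → LForm D) :
    ∑ α, ∑ β, gaugeMat MvPolynomial.X i α β • tD α (ξ β) = 0 := by
  rw [Finset.sum_comm]
  refine Finset.sum_eq_zero fun β _ => ?_
  have h : ∀ α, gaugeMat MvPolynomial.X i α β • tD α (ξ β) =
      -((gaugeMat MvPolynomial.X i α β * (MvPolynomial.X α : Poly D)) • ξ β) := fun α => by
    rw [mul_smul, X_smul_form, smul_neg, neg_neg]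
  simp only [h, Finset.sum_neg_distrib, ← Finset.sum_smul, sum_gaugeMat_X, zero_smul, neg_zero]

theorem sum_gaugeMat_coord (i : HookIdx D) {t : Fin D → Fin D → Fin D → ℝ}
    (ht : TotallyAntisymmetric t) : ∑ α, ∑ β, gaugeMat MvPolynomial.X i α β •
      (∑ ρ, pur (t α β ρ • coord ρ) 1 : LForm D) = 0 := by
  rw [sum_gaugeMat (M := LForm D), hookCoef_eq_zero_of_antisymmetric (fun α β γ => ?_)
    fun α β γ => ?_, smul_zero]
  · have e : t α γ β = -t β γ α := by linarith [(ht γ α β).1, (ht γ β α).2, (ht β γ α).1]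
    rw [X_smul_form, X_smul_form, tD_pur_coord, tD_pur_coord, e, neg_smul]
  · have e : t γ α β = t β γ α := by linarith [(ht γ β α).2, (ht β γ α).1]
    rw [X_smul_form, X_smul_form, tD_pur_coord, tD_pur_coord, e]

theorem sum_eomMat_sum_gaugeMat (j : HookIdx D) (W : Fin D → Fin D → LForm D) :
    ∑ i, eomMat MvPolynomial.X i j • ∑ α, ∑ β, gaugeMat MvPolynomial.X i α β • W α β = 0 := by
  simp only [Finset.smul_sum, smul_smul]
  rw [Finset.sum_comm]
  refine Finset.sum_eq_zero fun α _ => ?_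
  rw [Finset.sum_comm]
  refine Finset.sum_eq_zero fun β _ => ?_
  rw [← Finset.sum_smul, sum_eomMat_gaugeMat, zero_smul]

theorem dK_smul_poly (q : Poly D) (a : LForm D) : dK (q • a) = q • dK a :=
  poly_smul_comm dK_tD q a

/-- Families of forms annihilated by the Koszul-Tate differential. -/
theorem exists_eq_eulerD (hD : 4 < D) {a : Lab D → LForm D} (h : ∀ κ, eulerD a κ = 0)
    (haf : ∀ κ, hat (cnt af 0) (a κ) = ((2 : ℝ) - af κ) • a κ)
    (hfd : ∀ κ, hat (cnt (fun _ => 0) 1) (a κ) = 0) :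
    ∃ t b, TotallyAntisymmetric t ∧ a = reprE t + eulerD b ∧
      ((∀ κ, ∃ c, a κ = pur 1 c) → t = 0) := by
  have hT := fun i => (sub_eq_zero.1 ((eulerD_antiT a i).symm.trans (h _)))
  obtain ⟨t, ξ, W, ht, hξ, hW, hZ, ht0⟩ := exists_gauge_parameter hD
    (Z := fun α β => a (.inl (.antiC2 α β))) (X := fun i => a (.inr (.antiT i)))
    (fun α β => by
      rw [IsField, cntL_af_one, haf, hfd, add_zero]
      norm_num [af]) hT
  -- With `Z` known, subtracting the gauge transformation of `W` from the component along `T^*`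
  -- leaves a closed form of antifield number one. The parts of `Z` coming from `t` and `ξ` drop
  -- out, by antisymmetry and by reducibility.
  have hV : ∀ i, ∃ V, hat (cnt af 0) V = ((1 + 1 : ℕ) : ℝ) • V ∧ a (.inr (.antiT i)) -
      ∑ α, ∑ β, gaugeMat MvPolynomial.X i α β • W α β = dK V := fun i => by
    refine exists_dK_eq hD one_ne_zero ?_ ?_
    · rw [map_sub, haf, map_sum, smul_sub, Finset.smul_sum]
      congr 1
      · norm_num [af]
      · refine Finset.sum_congr rfl fun α _ => ?_
        rw [map_sum, Finset.smul_sum]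
        refine Finset.sum_congr rfl fun β _ => ?_
        rw [poly_smul_comm fun μ a => hat_tD (cnt_tot af 0 μ) a, hW, smul_comm]
    · rw [map_sub, ← hT i]
      simp only [hZ, map_sum, dK_smul_poly, smul_add, Finset.sum_add_distrib, sum_gaugeMat_tD]
      have := sum_gaugeMat_coord i ht
      simp only [Finset.smul_sum] at this ⊢
      rw [this]
      abel
  choose V hV1 hV2 using hV
  -- Likewise along `T`: gauge invariance of the equations removes `W`, and the corrected component
  -- is closed of antifield number two.
  have hU : ∀ j, ∃ U, a (.inl (.T j)) + ∑ i, eomMat MvPolynomial.X i j • V i = dK U := fun j => by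
    obtain ⟨U, -, hU⟩ := exists_dK_eq hD (n := 2) two_ne_zero
      (a := a (.inl (.T j)) + ∑ i, eomMat MvPolynomial.X i j • V i) (by
      rw [map_add, haf, map_sum, smul_add, Finset.smul_sum]
      congr 1
      · norm_num [af]
      · refine Finset.sum_congr rfl fun i _ => ?_
        rw [poly_smul_comm fun μ a => hat_tD (cnt_tot af 0 μ) a, hV1, smul_comm]) (by
      have h1 := h (.inl (.T j))
      rw [eulerD_T] at h1
      rw [map_add, map_sum]
      simp only [dK_smul_poly, ← hV2, smul_sub, Finset.sum_sub_distrib, sum_eomMat_sum_gaugeMat,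
        sub_zero]
      rw [add_comm, h1])
    exact ⟨U, hU⟩
  choose U hU using hU
  have hG : ∀ κ : Lab D, (∀ κ', ktMat κ κ' = 0) → af κ = 0 → ∃ G, a κ = par κ • dK G :=
    fun κ hκ h0 => by
      have h1 := h κ
      rw [eulerD_ghost a hκ] at h1
      have h2 : dK (a κ) = 0 := by
        rw [← one_smul ℝ (dK (a κ)), ← par_mul_par κ, mul_smul, h1, smul_zero]
      obtain ⟨G, -, hG⟩ := exists_dK_eq hD (n := 2) two_ne_zero (a := a κ)
        (by rw [haf, h0]; norm_num) h2
      exact ⟨par κ • G, by rw [map_smul, smul_smul, par_mul_par, one_smul, hG]⟩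
  -- This component would have antifield number -1.
  have hC : ∀ μ, a (.inr (.antiC μ)) = 0 := fun μ =>
    (diag_cntL af 0).eq_zero_of_neg one_pos (by rw [haf]; norm_num [af])
  choose G1 hG1 using fun α : Fin D => hG (.inl (.ghostC α)) (fun _ => rfl) rfl
  choose G2 hG2 using fun i => hG (.inr (.ghostS i) : Lab D) (fun _ => rfl) rfl
  choose G3 hG3 using fun i => hG (.inr (.ghostA i) : Lab D) (fun _ => rfl) rfl
  -- The minus sign at `T^*` and the factor -1/2 at `C^*` undo the sign of `eulerD_antiT` and the
  -- factor -2 of `eulerD_antiC2`.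
  let b : Lab D → LForm D := fun κ => match κ with
    | .inl (.T j) => U j
    | .inl (.ghostC α) => G1 α
    | .inl (.antiC2 α β) => W α β
    | .inr (.ghostS i) => G2 i
    | .inr (.ghostA i) => G3 i
    | .inr (.antiT i) => -V i
    | .inr (.antiC μ) => (-1 / 2 : ℝ) • ξ μ
  refine ⟨t, b, ht, funext fun κ => ?_, fun hc => ht0 fun α β => ?_⟩
  · rw [Pi.add_apply]
    rcases κ with (j | α | ⟨α, β⟩) | (i | i | i | μ)
    · rw [eulerD_T]
      simp only [reprE, b, zero_add, smul_neg, Finset.sum_neg_distrib]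
      rw [← hU]
      abel
    · rw [eulerD_ghost _ fun _ => rfl, hG1]
      simp only [reprE, b, zero_add]
    · rw [eulerD_antiC2, hZ]
      simp only [reprE, b, map_smul, smul_smul]
      norm_num
      abel
    · rw [eulerD_ghost _ fun _ => rfl, hG2]
      simp only [reprE, b, zero_add]
    · rw [eulerD_ghost _ fun _ => rfl, hG3]
      simp only [reprE, b, zero_add]
    · rw [eulerD_antiT]
      simp only [reprE, b, zero_add, map_neg, sub_neg_eq_add]
      rw [← hV2]
      abel
    · rw [eulerD_antiC, hC]
      simp only [reprE, b, zero_add, map_smul, hξ, smul_zero, neg_zero]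
  · obtain ⟨c, hc⟩ := hc (.inl (.antiC2 α β))
    exact ⟨aug c, by rw [hc, augL_pur]⟩

/-- The Euler-Lagrange derivatives of `f` solve the system, so they equal `reprE t + eulerD b`. The
variational formula gives the claim for the counting operator applied to `f`; its inverse commutes
with `δ` and total derivatives, and fixes `repr t`, which is linear in the generators. -/
theorem exists_of_cocycle (hD : 4 < D) {f : LForm D} (haf : hat (cnt af 0) f = (2 : ℝ) • f)
    (hfd : hat (cnt (fun _ => 0) 1) f = 0) {g : Fin D → LForm D} (h : dK f + dvg g = 0) :
    ∃ t M n, TotallyAntisymmetric t ∧ f = repr t + dK M + dvg n ∧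
      ((∃ c, f = pur 1 c) → t = 0) := by
  have h0 : ∀ κ, euler κ (dvg g) = 0 := fun κ => by
    rw [dvg_apply, map_sum]
    exact Finset.sum_eq_zero fun μ _ => euler_tD κ μ _
  obtain ⟨t, b, ht, hb, ht0⟩ := exists_eq_eulerD hD (a := fun κ => euler κ f)
    (fun κ => by
      rw [← euler_dK]
      have := congrArg (euler κ) h
      rwa [map_add, h0, add_zero, map_zero] at this)
    (fun κ => by
      have := euler_cnt af 0 κ f
      rw [haf, map_smul] at this
      rw [sub_smul, this, add_sub_cancel_left])
    (fun κ => by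
      have := euler_cnt (fun _ => 0) 1 κ f
      rw [hfd, map_zero, Nat.cast_zero, zero_smul, zero_add] at this
      exact this.symm)
  have h1 : mdv (hat cntAll f - (repr t + dK (pairing b))) = 0 := by
    rw [hat_cntAll, hfd, add_zero, map_sub, mdv_cnt, hb, pairing_add, map_add, mdv_pairing_eulerD,
      pairing_reprE, map_add, sub_self]
  obtain ⟨n, hn⟩ := mdv_eq_zero.1 h1
  -- Positive antifield number leaves no term without generators, so the counting operator can be
  -- inverted on `f`.
  have haug : augL f = 0 := by
    have := augL_cnt af 0 f
    rw [haf, map_smul] at this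
    exact (smul_eq_zero.1 this).resolve_left two_ne_zero
  have hf : hat invAll (hat cntAll f) = f := by
    rw [hat_comm (fun a => (invAll_comm cntAll (fun _ => rfl) a)), hat_cntAll_invAll, haug, map_zero,
      LinearMap.zero_apply, sub_zero]
  refine ⟨t, hat invAll (pairing b), fun μ => hat invAll (n μ), ht, ?_, ?_⟩
  · have h2 := congrArg (hat invAll) hn
    rw [map_sub, map_add, hf, hat_invAll_repr, hat_invAll_dK, dvg_apply, map_sum] at h2
    simp only [hat_invAll_tD] at h2
    rw [dvg_apply, h2]
    abel
  · rintro ⟨c, rfl⟩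
    exact ht0 fun κ => euler_pur_one κ c

/-! ### Contractions and forms of top degree -/

/-- The one-form `dx^μ`. -/
def dxc (μ : Fin D) : CForm D := cgen (.inr (.inr μ))

/-- The contraction with a coordinate vector field. -/
def iota (μ : Fin D) : CForm D →ₗ[ℝ] CForm D := pd (.inr (.inr μ))

theorem iota_oddDer (μ : Fin D) : OddDer (iota μ) := pd_inr_mul _

theorem iota_cgen [DecidableEq (Gen D)] (μ : Fin D) (z : Gen D) :
    iota μ (cgen z) = if z = .inr (.inr μ) then 1 else 0 := pd_cgen _ _

theorem iota_jet (μ : Fin D) (I : MultiIdx D) (κ : Lab D) : iota μ (cgen (jet I κ)) = 0 := by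
  classical
  rw [iota_cgen, if_neg]
  rcases κ with κ | κ <;> simp [jet]

theorem iota_dx (μ ν : Fin D) : iota μ (dxc ν) = if ν = μ then 1 else 0 := by
  classical
  rw [dxc, iota_cgen]
  simp

theorem iota_one (μ : Fin D) : iota μ 1 = 0 := by simpa using iota_oddDer μ 1 1

theorem iota_gradeInv (μ : Fin D) (a : CForm D) : iota μ (gradeInv a) = -gradeInv (iota μ a) := by
  classical
  rw [iota, pd_eq_der]
  refine ParityReversing.der_gradeInv ⟨fun e => ?_, fun o => ?_⟩ a
  · rw [Pi.single_eq_of_ne (by simp)]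
    exact zero_mem _
  · by_cases h : o = .inr μ
    · rw [h, Pi.single_eq_same]
      exact one_mem_evenPart
    · rw [Pi.single_eq_of_ne (by simpa using h)]
      exact zero_mem _

theorem iota_comm (μ ν : Fin D) (a : CForm D) : iota μ (iota ν a) = -iota ν (iota μ a) := by
  have h := ((iota_oddDer μ).anticomm (iota_oddDer ν) (iota_gradeInv μ) (iota_gradeInv ν)).ext
    IsDer.zero (gen_cases (fun I κ => by
      simp only [LinearMap.add_apply, LinearMap.comp_apply, iota_jet, map_zero, add_zero,
        LinearMap.zero_apply]) fun ρ => by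
      have h (α β : Fin D) : iota α (iota β (dxc ρ)) = 0 := by
        rw [iota_dx]
        split_ifs
        · exact iota_one α
        · exact map_zero _
      exact (congrArg₂ (· + ·) (h μ ν) (h ν μ)).trans (add_zero _))
  exact eq_neg_of_add_eq_zero_left (LinearMap.congr_fun h a)

theorem cnt_one (w : Lab D → ℕ) (e : ℕ) : cnt w e (1 : CForm D) = 0 := by
  simpa using cnt_evenDer w e (1 : CForm D) 1

theorem tot_one (μ : Fin D) : tot μ (1 : CForm D) = 0 := by
  simpa using tot_evenDer μ (1 : CForm D) 1

theorem cnt_iota (w : Lab D → ℕ) (e : ℕ) (μ : Fin D) (a : CForm D) :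
    cnt w e (iota μ a) = iota μ (cnt w e a) - (e : ℝ) • iota μ a := by
  have h := (((cnt_evenDer w e).comm_odd (iota_oddDer μ) (cnt_gradeInv w e)).add
    ((iota_oddDer μ).smul (e : ℝ))).ext IsDer.zero (gen_cases (fun I κ => by
      simp only [LinearMap.add_apply, LinearMap.sub_apply, LinearMap.smul_apply,
        LinearMap.comp_apply, iota_jet, cnt_cgen, map_smul, map_zero, smul_zero, sub_zero, add_zero,
        LinearMap.zero_apply]) fun ρ => by
      have h1 : cnt w e (iota μ (dxc ρ)) = 0 := by
        rw [iota_dx]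
        split_ifs
        · exact cnt_one w e
        · exact map_zero _
      change cnt w e (iota μ (dxc ρ)) - iota μ (cnt w e (cgen _)) + (e : ℝ) • iota μ (dxc ρ) = 0
      rw [h1, cnt_cgen, map_smul]
      exact (congrArg (· + _) (zero_sub _)).trans (neg_add_cancel _))
  have h2 := LinearMap.congr_fun h a
  simp only [LinearMap.add_apply, LinearMap.sub_apply, LinearMap.smul_apply,
    LinearMap.comp_apply, LinearMap.zero_apply] at h2
  linear_combination (norm := module) h2

theorem tot_iota (ν μ : Fin D) (a : CForm D) : tot ν (iota μ a) = iota μ (tot ν a) := by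
  have h := ((tot_evenDer ν).comm_odd (iota_oddDer μ) (tot_gradeInv ν)).ext IsDer.zero
    (gen_cases (fun I κ => by
      simp only [LinearMap.sub_apply, LinearMap.comp_apply, iota_jet, tot_jet, map_zero, sub_zero,
        LinearMap.zero_apply]) fun ρ => by
      have h1 : tot ν (iota μ (dxc ρ)) = 0 := by
        rw [iota_dx]
        split_ifs
        · exact tot_one ν
        · exact map_zero _
      change tot ν (iota μ (dxc ρ)) - iota μ (tot ν (cgen _)) = 0
      rw [h1, tot_dx, map_zero, sub_zero])
  exact sub_eq_zero.1 (LinearMap.congr_fun h a)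

theorem dxc_mul_dxc (μ ν : Fin D) : dxc μ * dxc ν = -(dxc ν * dxc μ) := cgen_inr_mul_cgen_inr _ _

theorem dxc_mul_self (μ : Fin D) : dxc μ * dxc μ = 0 := by
  have h : (2 : ℝ) • (dxc μ * dxc μ) = 0 := by
    rw [two_smul]
    nth_rw 1 [dxc_mul_dxc]
    exact neg_add_cancel _
  exact (smul_eq_zero.1 h).resolve_left two_ne_zero

theorem gradeInv_dxc (μ : Fin D) : gradeInv (dxc μ) = -dxc μ := gradeInv_inr _

theorem iota_dxc_mul (μ ν : Fin D) (a : CForm D) :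
    iota μ (dxc ν * a) = (if ν = μ then a else 0) - dxc ν * iota μ a := by
  rw [iota_oddDer μ _ _, iota_dx, gradeInv_dxc, neg_mul, ← sub_eq_add_neg, AlgHom.id_apply, ite_mul,
    one_mul, zero_mul]

/-- The operator counting one of the `dx^μ`. -/
def num (μ : Fin D) : CForm D →ₗ[ℝ] CForm D := LinearMap.mulLeft ℝ (dxc μ) ∘ₗ iota μ

theorem num_apply (μ : Fin D) (a : CForm D) : num μ a = dxc μ * iota μ a := rfl

theorem num_evenDer (μ : Fin D) : EvenDer (num μ) := fun a b => by
  have hx : ∀ c, dxc μ * c = gradeInv c * dxc μ := (mem_oddPart.1 (cgen_inr_mem _)).2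
  rw [num_apply, iota_oddDer μ a b, mul_add, ← mul_assoc, ← mul_assoc, hx (gradeInv a),
    gradeInv_gradeInv, mul_assoc a]
  rfl

theorem num_num (μ : Fin D) (a : CForm D) : num μ (num μ a) = num μ a := by
  rw [num_apply, num_apply, iota_dxc_mul, if_pos rfl, mul_sub, ← mul_assoc, dxc_mul_self, zero_mul,
    sub_zero]

theorem num_iota {μ ν : Fin D} (h : ν ≠ μ) (a : CForm D) : num ν (iota μ a) = iota μ (num ν a) := by
  rw [num_apply, num_apply, iota_dxc_mul, if_neg h, zero_sub, iota_comm ν μ, mul_neg]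

theorem sum_num (a : CForm D) : ∑ μ, num μ a = cnt (fun _ => 0) 1 a := by
  have h := (IsDer.sum Finset.univ fun μ _ => num_evenDer (D := D) μ).ext
    (cnt_evenDer (fun _ => 0) 1) (gen_cases (fun I κ => by
      rw [LinearMap.sum_apply, cnt_cgen, wt_jet, Nat.cast_zero, zero_smul]
      exact Finset.sum_eq_zero fun μ _ => by rw [num_apply, iota_jet, mul_zero]) fun ρ => by
      rw [LinearMap.sum_apply, cnt_cgen]
      change ∑ μ, dxc μ * iota μ (dxc ρ) = ((1 : ℕ) : ℝ) • dxc ρ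
      simp only [iota_dx, mul_ite, mul_one, mul_zero, Finset.sum_ite_eq, Finset.mem_univ, if_true,
        Nat.cast_one, one_smul])
  rw [← h, LinearMap.sum_apply]

theorem exists_num_prod (l : List (Gen D)) :
    ∃ m : Fin D → ℕ, ∑ μ, m μ = (l.map (wt (fun _ => 0) 1)).sum ∧
      ∀ μ, num μ (l.map cgen).prod = (m μ : ℝ) • (l.map cgen).prod := by
  induction l with
  | nil => exact ⟨0, by simp, fun μ => by simp [num_apply, iota_one]⟩
  | cons z l ih =>
    obtain ⟨m, hm, hl⟩ := ih
    have hz : ∃ n : Fin D → ℕ, ∑ μ, n μ = wt (fun _ => 0) 1 z ∧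
        ∀ μ, num μ (cgen z) = (n μ : ℝ) • cgen z := by
      induction z using gen_cases with
      | hj I κ =>
        exact ⟨0, by rw [wt_jet]; simp, fun μ => by
          rw [num_apply, iota_jet, mul_zero, Pi.zero_apply, Nat.cast_zero, zero_smul]⟩
      | hx ν =>
        refine ⟨Pi.single ν 1, by rw [Finset.sum_pi_single']; simp [wt], fun μ => ?_⟩
        change dxc μ * iota μ (dxc ν) = _ • dxc ν
        rw [iota_dx]
        by_cases h : ν = μ
        · subst h; simp
        · rw [if_neg h, mul_zero, Pi.single_eq_of_ne (Ne.symm h), Nat.cast_zero, zero_smul]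
    obtain ⟨n, hn, hz⟩ := hz
    refine ⟨n + m, ?_, fun μ => ?_⟩
    · rw [List.map_cons, List.sum_cons, ← hn, ← hm, ← Finset.sum_add_distrib]
      rfl
    · rw [List.map_cons, List.prod_cons, num_evenDer μ _ _, hz, hl, AlgHom.id_apply,
        AlgHom.id_apply, smul_mul_assoc, mul_smul_comm, ← add_smul, Pi.add_apply, Nat.cast_add]

/-- The component of a given form degree. -/
def fdC (n : ℕ) : CForm D →ₗ[ℝ] CForm D :=
  calc' (cnt (fun _ => 0) 1) fun m => if m = n then 1 else 0

/-- A nonzero product contains each `dx^μ` at most once, because `num` is idempotent; total degree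
`D` then forces each to occur exactly once. -/
theorem num_fdC (μ : Fin D) (a : CForm D) : num μ (fdC D a) = fdC D a := by
  have key : Submodule.span ℝ (Set.range fun l : List (Gen D) => (l.map cgen).prod) ≤
      LinearMap.eqLocus (num μ ∘ₗ fdC D) (fdC D) := by
    refine Submodule.span_le.2 ?_
    rintro _ ⟨l, rfl⟩
    change num μ (fdC D (l.map cgen).prod) = fdC D (l.map cgen).prod
    obtain ⟨m, hm, hl⟩ := exists_num_prod l
    have h1 := cnt_prod (fun _ => 0) 1 l
    rw [fdC, (cnt_diag _ _).calc'_apply _ h1, map_smul]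
    split_ifs with h
    · by_cases h0 : (l.map cgen).prod = 0
      · rw [h0, map_zero]
      · have hle : ∀ ν ∈ Finset.univ, m ν ≤ 1 := fun ν _ => by
          have h2 := num_num ν (l.map cgen).prod
          rw [hl, map_smul, hl, smul_smul] at h2
          have h3 := smul_left_injective ℝ h0 h2
          have h4 : m ν * m ν = m ν := by exact_mod_cast h3
          by_contra h5
          nlinarith
        have h6 := (Finset.sum_eq_sum_iff_of_le hle).1 (by rw [hm, h]; simp) μ (Finset.mem_univ μ)
        rw [hl, h6, Nat.cast_one, one_smul]
    · rw [zero_smul, zero_smul]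
  exact key (span_cgen_prod (D := D) ▸ Submodule.mem_top)

/-- The product of the `dx^μ` in a list. -/
def dxProd (l : List (Fin D)) : CForm D := (l.map dxc).prod

theorem dxProd_cons (μ : Fin D) (l : List (Fin D)) : dxProd (μ :: l) = dxc μ * dxProd l := by
  rw [dxProd, List.map_cons, List.prod_cons]
  rfl

/-- The iterated contraction. -/
def ctr : List (Fin D) → CForm D →ₗ[ℝ] CForm D
  | [] => LinearMap.id
  | μ :: l => ctr l ∘ₗ iota μ

theorem eq_dxProd_mul_ctr {l : List (Fin D)} (hl : l.Nodup) {a : CForm D}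
    (h : ∀ μ ∈ l, num μ a = a) : a = dxProd l * ctr l a := by
  induction l generalizing a with
  | nil => exact (one_mul a).symm
  | cons μ l ih =>
    rw [List.nodup_cons] at hl
    rw [dxProd_cons, mul_assoc]
    have h1 := ih hl.2 (a := iota μ a) fun ν hν => by
      rw [num_iota (by rintro rfl; exact hl.1 hν), h ν (List.mem_cons_of_mem _ hν)]
    exact (h μ List.mem_cons_self).symm.trans (congrArg (dxc μ * ·) h1)

theorem iota_dxProd_mul {μ : Fin D} {l : List (Fin D)} (hl : μ ∉ l) {a : CForm D}
    (h : iota μ a = 0) : iota μ (dxProd l * a) = 0 := by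
  induction l with
  | nil => exact (congrArg (iota μ) (one_mul a)).trans h
  | cons ν l ih =>
    rw [List.mem_cons, not_or] at hl
    rw [dxProd_cons, mul_assoc, iota_dxc_mul, if_neg (Ne.symm hl.1), ih hl.2, mul_zero, sub_zero]

theorem ctr_dxProd_mul {l : List (Fin D)} (hl : l.Nodup) {a : CForm D}
    (h : ∀ μ ∈ l, iota μ a = 0) : ctr l (dxProd l * a) = a := by
  induction l with
  | nil => exact one_mul a
  | cons μ l ih =>
    rw [List.nodup_cons] at hl
    rw [ctr, LinearMap.comp_apply, dxProd_cons, mul_assoc, iota_dxc_mul, if_pos rfl,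
      iota_dxProd_mul hl.1 (h μ List.mem_cons_self), mul_zero, sub_zero,
      ih hl.2 fun ν hν => h ν (List.mem_cons_of_mem _ hν)]

theorem cnt_ctr (w : Lab D → ℕ) (e : ℕ) (l : List (Fin D)) (a : CForm D) :
    cnt w e (ctr l a) = ctr l (cnt w e a) - ((l.length * e : ℕ) : ℝ) • ctr l a := by
  induction l generalizing a with
  | nil => simp [ctr]
  | cons μ l ih =>
    rw [ctr, LinearMap.comp_apply, LinearMap.comp_apply, ih, cnt_iota, map_sub, map_smul,
      List.length_cons]
    push_cast
    module

theorem iota_eq_zero {a : CForm D} (h : cnt (fun _ => 0) 1 a = 0) (μ : Fin D) : iota μ a = 0 :=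
  (cnt_diag (fun _ => 0) 1).eq_zero_of_neg one_pos (by
    rw [cnt_iota, h, map_zero, zero_sub, Nat.cast_one, neg_smul])

theorem cnt_dxProd (w : Lab D → ℕ) (e : ℕ) (l : List (Fin D)) :
    cnt w e (dxProd l) = ((l.length * e : ℕ) : ℝ) • dxProd l := by
  induction l with
  | nil => simpa [dxProd] using cnt_one w e
  | cons μ l ih =>
    rw [dxProd_cons, cnt_evenDer w e _ _, ih, dxc, cnt_cgen, AlgHom.id_apply, AlgHom.id_apply,
      smul_mul_assoc, mul_smul_comm, ← add_smul, List.length_cons, ← Nat.cast_add]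
    congr 2
    simp only [wt]
    ring

theorem kos_dxProd (l : List (Fin D)) : kos (dxProd l) = 0 := by
  induction l with
  | nil => simpa [dxProd] using kos_oddDer (D := D) 1 1
  | cons μ l ih =>
    rw [dxProd_cons, kos_oddDer _ _, ih, dxc, kos_dx, zero_mul, mul_zero, add_zero]

theorem tot_dxProd (μ : Fin D) (l : List (Fin D)) : tot μ (dxProd l) = 0 := by
  induction l with
  | nil => exact tot_one μ
  | cons ν l ih =>
    rw [dxProd_cons, tot_evenDer μ _ _, ih, dxc, tot_dx, zero_mul, mul_zero, add_zero]

theorem gradeInv_dxProd (l : List (Fin D)) :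
    gradeInv (dxProd l) = ((-1 : ℝ) ^ l.length) • dxProd l := by
  induction l with
  | nil => simp [dxProd]
  | cons μ l ih =>
    rw [dxProd_cons, map_mul, ih, gradeInv_dxc, List.length_cons, pow_succ, mul_neg_one, neg_smul,
      mul_smul_comm, neg_mul, smul_neg]

theorem dxc_mul_dxProd {μ : Fin D} {l : List (Fin D)} (h : μ ∈ l) : dxc μ * dxProd l = 0 := by
  induction l with
  | nil => simp at h
  | cons ν l ih =>
    rw [dxProd_cons, ← mul_assoc]
    rcases List.mem_cons.1 h with rfl | h
    · rw [dxc_mul_self, zero_mul]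
    · rw [dxc_mul_dxc, neg_mul, mul_assoc, ih h, mul_zero, neg_zero]

/-! ### Degree components of local forms -/

/-- The component in the eigenspace of an integer. -/
def degPart {V : Type*} [AddCommGroup V] [Module ℝ V] (L : V →ₗ[ℝ] V) (n : ℕ) : V →ₗ[ℝ] V :=
  calc' L fun m => if m = n then 1 else 0

theorem Diag.degPart_eq {V : Type*} [AddCommGroup V] [Module ℝ V] {L : V →ₗ[ℝ] V} (h : Diag L)
    {n : ℕ} {x : V} (hx : L x = (n : ℝ) • x) : degPart L n x = x := by
  rw [degPart, h.calc'_apply _ hx, if_pos rfl, one_smul]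

theorem Diag.apply_degPart {V : Type*} [AddCommGroup V] [Module ℝ V] {L : V →ₗ[ℝ] V} (h : Diag L)
    (n : ℕ) (x : V) : L (degPart L n x) = (n : ℝ) • degPart L n x := by
  refine h.ext (f := L ∘ₗ degPart L n) (f' := (n : ℝ) • degPart L n) (fun m x hx => ?_) x
  rw [LinearMap.comp_apply, LinearMap.smul_apply]
  by_cases hmn : m = n
  · subst hmn
    rw [h.degPart_eq hx, hx]
  · rw [degPart, h.calc'_apply _ hx, if_neg hmn, zero_smul, map_zero, smul_zero]

theorem hat_degPart {L : CForm D →ₗ[ℝ] CForm D} (h : Diag L) (n : ℕ) :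
    hat (degPart L n) = degPart (hat L) n := lform_ext fun f c =>
  h.ext (f := hat (degPart L n) ∘ₗ pur f) (f' := degPart (hat L) n ∘ₗ pur f) (fun m x hx => by
    have h1 : hat L (pur f x) = (m : ℝ) • pur f x := by rw [hat_pur, hx, map_smul]
    rw [LinearMap.comp_apply, LinearMap.comp_apply, hat_pur, degPart, degPart, h.calc'_apply _ hx,
      h.hat.calc'_apply _ h1, map_smul]) c

/-- The operator measuring the form degree. -/
abbrev cntF : CForm D →ₗ[ℝ] CForm D := cnt (fun _ => 0) 1

/-- The component of a given form degree. -/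
abbrev fdPart (n : ℕ) : LForm D →ₗ[ℝ] LForm D := degPart (hat cntF) n

theorem hat_fdC {n : ℕ} {a : LForm D} (h : hat cntF a = (n : ℝ) • a) : hat (fdC n) a = a := by
  have h1 : fdC (D := D) n = degPart cntF n := rfl
  rw [h1, hat_degPart (cnt_diag _ _), (diag_cntL _ _).degPart_eq h]

theorem hat_cntF_dK (a : LForm D) : hat cntF (dK a) = dK (hat cntF a) :=
  hat_comm (cnt_const_kos 0 1) a

theorem fdPart_dK (n : ℕ) (a : LForm D) : fdPart n (dK a) = dK (fdPart n a) :=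
  (diag_cntL _ _).calc'_comm_of_comm _ dK hat_cntF_dK a

/-! ### Forms of top degree -/

/-- The volume form. -/
def volC (D : ℕ) : CForm D := dxProd (List.finRange D)

/-- The coefficient of the volume form. -/
def red : CForm D →ₗ[ℝ] CForm D := ctr (List.finRange D)

theorem eq_cmul_volC {a : LForm D} (h : hat cntF a = (D : ℝ) • a) :
    a = cmul (volC D) (hat red a) := by
  have h1 : (fdC D : CForm D →ₗ[ℝ] CForm D) =
      (LinearMap.mulLeft ℝ (volC D) ∘ₗ red) ∘ₗ fdC D := LinearMap.ext fun c =>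
    eq_dxProd_mul_ctr (List.nodup_finRange D) fun μ _ => num_fdC μ c
  have h2 := LinearMap.congr_fun (congrArg hat h1) a
  rw [hat_comp, hat_comp] at h2
  rwa [LinearMap.comp_apply, LinearMap.comp_apply, hat_fdC h] at h2

theorem cntF_fdC_zero (c : CForm D) : cntF (fdC 0 c) = 0 := by
  have h : cntF (fdC 0 c) = ((0 : ℕ) : ℝ) • fdC 0 c := (cnt_diag _ _).apply_degPart 0 c
  rw [h, Nat.cast_zero, zero_smul]

theorem hat_fdC_zero {a : LForm D} (h : hat cntF a = 0) : hat (fdC 0) a = a :=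
  hat_fdC (by rw [h, Nat.cast_zero, zero_smul])

theorem hat_red_cmul_volC {a : LForm D} (h : hat cntF a = 0) : hat red (cmul (volC D) a) = a := by
  have h1 : (red ∘ₗ LinearMap.mulLeft ℝ (volC D)) ∘ₗ fdC 0 = fdC 0 := LinearMap.ext fun c =>
    ctr_dxProd_mul (List.nodup_finRange D) fun μ _ => iota_eq_zero (cntF_fdC_zero c) μ
  have h2 := LinearMap.congr_fun (congrArg hat h1) a
  rw [hat_comp, hat_comp] at h2
  rwa [LinearMap.comp_apply, LinearMap.comp_apply, hat_fdC_zero h] at h2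

theorem hat_iota_eq_zero {a : LForm D} (h : hat cntF a = 0) (μ : Fin D) : hat (iota μ) a = 0 := by
  have h1 : iota μ ∘ₗ fdC 0 = 0 := LinearMap.ext fun c => iota_eq_zero (cntF_fdC_zero c) μ
  have h2 := LinearMap.congr_fun (congrArg hat h1) a
  rw [hat_comp, hat_zero] at h2
  rwa [LinearMap.comp_apply, hat_fdC_zero h] at h2

theorem hat_cnt_red (w : Lab D → ℕ) (e : ℕ) (a : LForm D) :
    hat (cnt w e) (hat red a) = hat red (hat (cnt w e) a) - ((D * e : ℕ) : ℝ) • hat red a := by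
  have h1 : cnt w e ∘ₗ red = red ∘ₗ cnt w e + (-((D * e : ℕ) : ℝ)) • red := LinearMap.ext fun c => by
    have h := cnt_ctr w e (List.finRange D) c
    rw [List.length_finRange] at h
    rw [LinearMap.add_apply, LinearMap.smul_apply, neg_smul, ← sub_eq_add_neg]
    exact h
  have h2 := LinearMap.congr_fun (congrArg hat h1) a
  rwa [hat_comp, hat_add, hat_comp, hat_smul, LinearMap.add_apply, LinearMap.smul_apply, neg_smul,
    ← sub_eq_add_neg] at h2

theorem hat_cntF_red {a : LForm D} (h : hat cntF a = (D : ℝ) • a) : hat cntF (hat red a) = 0 := by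
  rw [hat_cnt_red, h, map_smul, mul_one, sub_self]

theorem hat_iota_cmul (μ : Fin D) (c : CForm D) (a : LForm D) :
    hat (iota μ) (cmul c a) = cmul (iota μ c) a + cmul (gradeInv c) (hat (iota μ) a) := by
  have : hat (iota μ) ∘ₗ cmul c = cmul (iota μ c) + cmul (gradeInv c) ∘ₗ hat (iota μ) :=
    lform_ext fun f b => by
      simp only [LinearMap.comp_apply, LinearMap.add_apply, hat_pur, cmul_pur, ← map_add]
      exact congrArg (pur f) (iota_oddDer μ c b)
  exact LinearMap.congr_fun this a

theorem dK_cmul_volC (a : LForm D) :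
    dK (cmul (volC D) a) = (-1 : ℝ) ^ D • cmul (volC D) (dK a) := by
  rw [dK_cmul, volC, kos_dxProd, cmul_zero, zero_add, gradeInv_dxProd, List.length_finRange,
    cmul_smul]

theorem hat_cnt_cmul_volC (w : Lab D → ℕ) (e : ℕ) (a : LForm D) : hat (cnt w e) (cmul (volC D) a) =
    ((D * e : ℕ) : ℝ) • cmul (volC D) a + cmul (volC D) (hat (cnt w e) a) := by
  rw [hat_cnt_cmul, volC, cnt_dxProd, List.length_finRange, cmul_smul]

/-! ### The exterior differential -/

/-- The exterior differential. -/
def dT : LForm D →ₗ[ℝ] LForm D := ∑ μ, cmul (dxc μ) ∘ₗ tD μ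

theorem dT_apply (a : LForm D) : dT a = ∑ μ, cmul (dxc μ) (tD μ a) := by
  simp [dT]

theorem dK_dT (a : LForm D) : dK (dT a) = -dT (dK a) := by
  rw [dT_apply, dT_apply, map_sum, ← Finset.sum_neg_distrib]
  refine Finset.sum_congr rfl fun μ _ => ?_
  have h : kos (dxc μ) = 0 := kos_dx μ
  rw [dK_cmul, h, cmul_zero, zero_add, gradeInv_dxc, dK_tD, ← neg_one_smul ℝ (dxc μ), cmul_smul,
    neg_one_smul]

theorem hat_cnt_dT (w : Lab D → ℕ) (e : ℕ) (a : LForm D) :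
    hat (cnt w e) (dT a) = (e : ℝ) • dT a + dT (hat (cnt w e) a) := by
  rw [dT_apply, dT_apply, map_sum, Finset.smul_sum, ← Finset.sum_add_distrib]
  refine Finset.sum_congr rfl fun μ _ => ?_
  have h : cnt w e (dxc μ) = (e : ℝ) • dxc μ := cnt_cgen w e _
  rw [hat_cnt_cmul, h, cmul_smul, hat_tD (cnt_tot w e μ)]

theorem fdPart_dT (n : ℕ) (a : LForm D) : fdPart (n + 1) (dT a) = dT (fdPart n a) :=
  (diag_cntL _ _).calc'_comm (diag_cntL _ _) _ _ dT (fun m x hx => .inr ⟨m + 1, by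
    rw [hat_cnt_dT, hx, map_smul, ← add_smul, Nat.cast_add, add_comm], by simp⟩) a

theorem afPart_dT (n : ℕ) (a : LForm D) : afPart n (dT a) = dT (afPart n a) :=
  (diag_cntL _ _).calc'_comm_of_comm _ dT (fun a => by
    rw [hat_cnt_dT, Nat.cast_zero, zero_smul, zero_add]) a

/-- Contracting the identity `dx^ν ∧ vol = 0` shows that `dx^ν` times the contracted volume form is
the volume form for `ν = μ` and zero otherwise. -/
theorem dT_cmul_iota_volC (μ : Fin D) (a : LForm D) :
    dT (cmul (iota μ (volC D)) a) = cmul (volC D) (tD μ a) := by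
  have h : ∀ ν, dxc ν * iota μ (volC D) = if ν = μ then volC D else 0 := fun ν => by
    have h1 := iota_dxc_mul μ ν (volC D)
    rw [volC, dxc_mul_dxProd (List.mem_finRange ν), map_zero] at h1
    exact (sub_eq_zero.1 h1.symm).symm
  have h0 : ∀ ν, tot ν (iota μ (volC D)) = 0 := fun ν => by
    rw [tot_iota, volC, tot_dxProd, map_zero]
  simp only [dT_apply, tD_cmul, h0, cmul_zero, zero_add, ← cmul_mul, h]
  rw [Finset.sum_eq_single μ]
  · rw [if_pos rfl]
  · intro ν _ hν
    rw [if_neg hν, cmul_zero]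
  · exact fun h => absurd (Finset.mem_univ μ) h

/-- The form of codegree one with given components. -/
def coone (g : Fin D → LForm D) : LForm D := ∑ μ, cmul (iota μ (volC D)) (g μ)

theorem dT_coone (g : Fin D → LForm D) : dT (coone g) = cmul (volC D) (dvg g) := by
  rw [coone, map_sum, dvg_apply, map_sum]
  exact Finset.sum_congr rfl fun μ _ => dT_cmul_iota_volC μ _

/-- The components are the coefficients of `dx^μ ∧ b`. Contracting these top forms gives `b` minus
its part containing `dx^μ`, and summing over `μ` leaves `D - (D - 1)` copies of `b`. -/
theorem exists_eq_coone (hD : D ≠ 0) {b : LForm D} (h : hat cntF b = ((D - 1 : ℕ) : ℝ) • b) :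
    ∃ g, (∀ μ, hat cntF (g μ) = 0) ∧ b = coone g := by
  have hD1 : ((D - 1 : ℕ) : ℝ) = (D : ℝ) - 1 := by
    rw [Nat.cast_sub (Nat.one_le_iff_ne_zero.2 hD), Nat.cast_one]
  have h1 : ∀ μ, hat cntF (cmul (dxc μ) b) = (D : ℝ) • cmul (dxc μ) b := fun μ => by
    have h : cntF (dxc μ) = ((1 : ℕ) : ℝ) • dxc μ := cnt_cgen _ _ _
    rw [hat_cnt_cmul, h, cmul_smul, ‹hat cntF b = _›, map_smul, hD1, ← add_smul, Nat.cast_one,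
      add_sub_cancel]
  refine ⟨fun μ => hat red (cmul (dxc μ) b), fun μ => hat_cntF_red (h1 μ), ?_⟩
  have h2 : ∀ μ, cmul (iota μ (volC D)) (hat red (cmul (dxc μ) b)) =
      b - hat (num μ) b := fun μ => by
    have h3 := hat_iota_cmul μ (volC D) (hat red (cmul (dxc μ) b))
    rw [hat_iota_eq_zero (hat_cntF_red (h1 μ)), map_zero, add_zero, ← eq_cmul_volC (h1 μ),
      hat_iota_cmul, iota_dx, if_pos rfl, cmul_one, gradeInv_dxc, ← neg_one_smul ℝ (dxc μ),
      cmul_smul, neg_one_smul, ← sub_eq_add_neg] at h3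
    rw [← h3, num, hat_comp]
    rfl
  have h4 : ∑ μ, hat (num μ) b = hat cntF b := by
    have h5 : (∑ μ, num μ : CForm D →ₗ[ℝ] CForm D) = cntF := LinearMap.ext fun a => by
      rw [LinearMap.sum_apply, sum_num]
    have h6 : hat (∑ μ, num μ : CForm D →ₗ[ℝ] CForm D) = ∑ μ, hat (num μ) :=
      lform_ext fun f c => by
        rw [hat_pur, LinearMap.sum_apply, LinearMap.sum_apply, map_sum]
        exact Finset.sum_congr rfl fun μ _ => (hat_pur _ _ _).symm
    rw [← h5, h6, LinearMap.sum_apply]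
  rw [coone, Finset.sum_congr rfl fun μ _ => h2 μ, Finset.sum_sub_distrib, h4, h, hD1,
    Finset.sum_const, Finset.card_univ, Fintype.card_fin, ← Nat.cast_smul_eq_nsmul ℝ, sub_smul,
    one_smul, sub_sub_cancel]

/-! ### Cocycles of top degree -/

/-- Local forms of a given form degree and antifield number. -/
def IsBi (p k : ℕ) (a : LForm D) : Prop :=
  hat cntF a = (p : ℝ) • a ∧ hat (cnt af 0) a = (k : ℝ) • a

theorem cnt_af_cntF (c : CForm D) : cnt af 0 (cntF c) = cntF (cnt af 0 c) := cnt_comm _ _ _ _ c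

theorem isBi_afPart_fdPart (p k : ℕ) (a : LForm D) : IsBi p k (afPart k (fdPart p a)) := by
  refine ⟨?_, cnt_afPart k _⟩
  have h : hat cntF (afPart k (fdPart p a)) = afPart k (hat cntF (fdPart p a)) :=
    ((diag_cntL _ _).calc'_comm_of_comm _ (hat cntF) (hat_comm cnt_af_cntF) _).symm
  rw [h, (diag_cntL _ _).apply_degPart, map_smul]

theorem IsBi.afPart_fdPart {p k : ℕ} {a : LForm D} (h : IsBi p k a) :
    afPart k (fdPart p a) = a := by
  rw [(diag_cntL _ _).degPart_eq h.1, afPart_eq h.2]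

/-- Both differentials shift the bidegree by a fixed amount, so any decomposition can be projected
to the right degrees. -/
theorem IsBi.exists_of_eq {k : ℕ} {a m n : LForm D} (hD : D ≠ 0) (ha : IsBi D k a)
    (h : a = dK m + dT n) :
    ∃ m' n', IsBi D (k + 1) m' ∧ IsBi (D - 1) k n' ∧ a = dK m' + dT n' := by
  refine ⟨_, _, isBi_afPart_fdPart D (k + 1) m, isBi_afPart_fdPart (D - 1) k n, ?_⟩
  have h1 : fdPart D (dT n) = dT (fdPart (D - 1) n) := by
    have := fdPart_dT (D - 1) n
    rwa [Nat.sub_add_cancel (Nat.one_le_iff_ne_zero.2 hD)] at this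
  have h2 := ha.afPart_fdPart
  rw [h, map_add, map_add, fdPart_dK, h1, afPart_dK, afPart_dT] at h2
  rw [h2, h]

theorem IsBi.exists_of_cocycle {k : ℕ} {a b : LForm D} (hD : D ≠ 0) (ha : IsBi D (k + 1) a)
    (h : dK a + dT b = 0) : ∃ b', IsBi (D - 1) k b' ∧ dK a + dT b' = 0 := by
  refine ⟨_, isBi_afPart_fdPart (D - 1) k b, ?_⟩
  have h1 : fdPart D (dT b) = dT (fdPart (D - 1) b) := by
    have := fdPart_dT (D - 1) b
    rwa [Nat.sub_add_cancel (Nat.one_le_iff_ne_zero.2 hD)] at this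
  have h2 := congrArg (fun x => afPart k (fdPart D x)) h
  simp only [map_add, map_zero, fdPart_dK, h1, afPart_dK, afPart_dT, ha.afPart_fdPart] at h2
  exact h2

theorem sign_mul_sign (n : ℕ) : ((-1 : ℝ) ^ n) * (-1) ^ n = 1 := by
  rw [← mul_pow, neg_one_mul, neg_neg, one_pow]

/-- Cocycles of top degree and antifield number two. -/
theorem exists_of_top_cocycle (hD : 4 < D) {a b : LForm D} (ha : IsBi D 2 a)
    (hb : IsBi (D - 1) 1 b) (h : dK a + dT b = 0) :
    ∃ t m n, TotallyAntisymmetric t ∧ a = cmul (volC D) (repr t) + (dK m + dT n) ∧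
      ((∃ c, a = pur 1 c) → t = 0) := by
  have hD0 : D ≠ 0 := by omega
  obtain ⟨g, hg, rfl⟩ := exists_eq_coone hD0 hb.1
  have ha' := eq_cmul_volC ha.1
  have hf0 := hat_cntF_red ha.1
  have hf2 : hat (cnt af 0) (hat red a) = (2 : ℝ) • hat red a := by
    rw [hat_cnt_red, ha.2, map_smul, mul_zero, Nat.cast_zero, zero_smul, sub_zero]
    norm_num
  have h1 : (-1 : ℝ) ^ D • dK (hat red a) + dvg g = 0 := by
    rw [ha', dK_cmul_volC, dT_coone, ← map_smul, ← map_add] at h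
    have h2 := congrArg (hat red) h
    rw [map_zero, hat_red_cmul_volC] at h2
    · exact h2
    · rw [map_add, map_smul, hat_cntF_dK, hf0, map_zero, smul_zero, zero_add, dvg_apply, map_sum]
      exact Finset.sum_eq_zero fun μ _ => by
        rw [hat_tD (cnt_tot _ _ μ), hg, map_zero]
  -- The sign `(-1)^D` from passing `δ` through the volume form is moved onto the divergence.
  obtain ⟨t, M, n, ht, hf, h0⟩ := exists_of_cocycle hD hf2 hf0
    (g := (-1 : ℝ) ^ D • g) (by
      have h2 := congrArg (fun x => (-1 : ℝ) ^ D • x) h1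
      simp only [smul_add, smul_smul, sign_mul_sign, one_smul, smul_zero] at h2
      rwa [map_smul])
  refine ⟨t, (-1 : ℝ) ^ D • cmul (volC D) M, coone n, ht, ?_, ?_⟩
  · rw [map_smul, dK_cmul_volC, smul_smul, sign_mul_sign, one_smul, dT_coone, ← map_add, ← map_add,
      ← add_assoc, ← hf]
    exact ha'
  · rintro ⟨c, rfl⟩
    exact h0 ⟨red c, hat_pur _ _ _⟩

/-- Modulo divergences `δ` of the pairing is the pairing with `eulerD (reprE t)`, which vanishes.
The only equation with content is the one along `T^*`, and it holds because `t` is totally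
antisymmetric. -/
theorem exists_dvg_repr {t : Fin D → Fin D → Fin D → ℝ} (ht : TotallyAntisymmetric t) :
    ∃ g, dvg g = dK (repr t) := by
  rw [← mdv_eq_zero, ← pairing_reprE, ← mdv_pairing_eulerD]
  have h1 : ∀ f : Smooth D, dK (pur f 1) = 0 := fun f => by
    have : kos (1 : CForm D) = 0 := by simpa using kos_oddDer (D := D) 1 1
    rw [dK_pur, this, map_zero]
  have h : eulerD (reprE t) = 0 := funext fun κ => by
    rcases κ with (j | α | ⟨α, β⟩) | (i | i | i | μ)
    · rw [eulerD_T]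
      simp only [reprE, map_zero, smul_zero, Finset.sum_const_zero, add_zero, Pi.zero_apply]
    · rw [eulerD_ghost _ fun _ => rfl]
      simp only [reprE, map_zero, smul_zero, Pi.zero_apply]
    · rw [eulerD_antiC2]
      simp only [reprE, map_zero, smul_zero, zero_add, map_sum, h1, Finset.sum_const_zero,
        Pi.zero_apply]
    · rw [eulerD_ghost _ fun _ => rfl]
      simp only [reprE, map_zero, smul_zero, Pi.zero_apply]
    · rw [eulerD_ghost _ fun _ => rfl]
      simp only [reprE, map_zero, smul_zero, Pi.zero_apply]
    · rw [eulerD_antiT]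
      simp only [reprE, map_zero, sub_zero, Pi.zero_apply]
      exact sum_gaugeMat_coord i ht
    · rw [eulerD_antiC]
      simp only [reprE, map_zero, neg_zero, Pi.zero_apply]
  rw [h]
  simp [pairing]

theorem isBi_repr (t : Fin D → Fin D → Fin D → ℝ) : IsBi D 2 (cmul (volC D) (repr t)) := by
  have h : ∀ (w : Lab D → ℕ) e (n : ℕ), (∀ μ ν, w (.inl (.antiC2 μ ν)) = n) →
      hat (cnt w e) (repr t) = (n : ℝ) • repr t := fun w e n hw => by
    simp only [repr, map_sum, map_smul, LinearMap.smul_apply, hat_pur, cnt_cgen, wt, hw,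
      Finset.smul_sum, smul_comm (n : ℝ)]
  constructor
  · rw [hat_cnt_cmul_volC, h _ 1 0 fun _ _ => rfl, mul_one, Nat.cast_zero, zero_smul, map_zero,
      add_zero]
  · rw [hat_cnt_cmul_volC, h _ 0 2 fun _ _ => rfl, mul_zero, Nat.cast_zero, zero_smul, zero_add,
      map_smul]

theorem exists_dT_repr {t : Fin D → Fin D → Fin D → ℝ} (ht : TotallyAntisymmetric t) :
    ∃ b, dK (cmul (volC D) (repr t)) + dT b = 0 := by
  obtain ⟨g, hg⟩ := exists_dvg_repr ht
  refine ⟨coone (-((-1 : ℝ) ^ D • g)), ?_⟩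
  rw [dK_cmul_volC, dT_coone, map_neg, map_neg, map_smul, map_smul, hg, add_neg_cancel]

/-! ### The passage to the sealed copy of the algebra of local forms -/

/-- The passage to the sealed copy of the algebra. -/
def toL : Forms D →ₗ[ℝ] LForm D where
  toFun a := a
  map_add' _ _ := rfl
  map_smul' _ _ := rfl

/-- The passage from the sealed copy of the algebra. -/
def ofL : LForm D →ₗ[ℝ] Forms D where
  toFun a := a
  map_add' _ _ := rfl
  map_smul' _ _ := rfl

/-- The passage from the sealed copy of the algebra. -/
def ofC : CForm D →ₗ[ℝ] ConstForms D where
  toFun a := a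
  map_add' _ _ := rfl
  map_smul' _ _ := rfl

theorem toL_ofL (a : LForm D) : toL (ofL a) = a := rfl

theorem toL_injective : Function.Injective (toL (D := D)) := fun _ _ h => h

theorem toL_tmul (f : Smooth D) (c : ConstForms D) : toL (f ⊗ₜ c) = pur f (toC c) := rfl

theorem ofL_pur (f : Smooth D) (c : CForm D) : ofL (pur f c) = f ⊗ₜ ofC c := rfl

theorem toC_mul (a b : ConstForms D) : toC (a * b) = toC a * toC b := rfl

theorem toC_prod (l : List (ConstForms D)) : toC l.prod = (l.map toC).prod := by
  induction l with
  | nil => rfl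
  | cons a l ih => rw [List.prod_cons, List.map_cons, List.prod_cons, toC_mul, ih]

theorem toC_prod_gen (l : List (Gen D)) : toC (l.map gen).prod = (l.map cgen).prod := by
  rw [toC_prod, List.map_map]
  rfl

theorem toL_delta (a : Forms D) : toL (delta a) = dK (toL a) := by
  induction a using TensorProduct.induction_on with
  | zero => simp
  | add a b ha hb => simp only [map_add, ha, hb]
  | tmul f c =>
    rw [toL_tmul, dK_pur]
    rfl

theorem toL_d (a : Forms D) : toL (d a) = dT (toL a) := by
  induction a using TensorProduct.induction_on with
  | zero => simp
  | add a b ha hb => simp only [map_add, ha, hb]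
  | tmul f c =>
    rw [toL_tmul, dT_apply, d, LinearMap.sum_apply, map_sum]
    refine Finset.sum_congr rfl fun μ _ => ?_
    rw [LinearMap.comp_apply, LinearMap.mulLeft_apply, totalDeriv, LinearMap.add_apply,
      LinearMap.rTensor_tmul, LinearMap.lTensor_tmul, mul_add, Algebra.TensorProduct.tmul_mul_tmul,
      Algebra.TensorProduct.tmul_mul_tmul, one_mul, one_mul, map_add, toL_tmul, toL_tmul, tD_pur,
      map_add, cmul_pur, cmul_pur]
    rfl

theorem toC_vol : toC (vol D) = volC D := by
  rw [vol, toC_prod, List.map_map]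
  rfl

theorem toL_representative (t : Fin D → Fin D → Fin D → ℝ) :
    toL (representative t) = cmul (volC D) (repr t) := by
  simp only [representative, repr, map_sum, toL_tmul, cmul_pur, toC_mul, toC_vol]
  have h : ∀ μ ν, toC (antiC2 0 μ ν) * volC D = volC D * cgen (.inl (0, .antiC2 μ ν)) :=
    fun μ ν => ((mem_evenPart.1 (cgen_inl_mem _)).2 (volC D))
  simp only [h]

/-! ### Degrees of local forms -/

theorem isBi_toL {p k : ℕ} {a : Forms D} (h : a ∈ cochains D p k) : IsBi p k (toL a) := by
  have h1 : ∀ c ∈ constCochains D p k, cntF (toC c) = (p : ℝ) • toC c ∧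
      cnt af 0 (toC c) = (k : ℝ) • toC c := fun c hc => by
    induction hc using Submodule.span_induction with
    | mem c hc =>
      obtain ⟨l, hp, hk, rfl⟩ := hc
      rw [toC_prod_gen, cnt_prod, cnt_prod, funext wt_af, funext wt_formDeg, hp, hk]
      exact ⟨rfl, rfl⟩
    | zero => simp
    | add a b _ _ ha hb =>
      simp only [map_add, smul_add, ha.1, hb.1, ha.2, hb.2, and_self]
    | smul r a _ ha =>
      simp only [map_smul, ha.1, ha.2, smul_comm r, and_self]
  have h2 : ∀ y : Smooth D ⊗[ℝ] constCochains D p k,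
      IsBi p k (toL (LinearMap.lTensor (Smooth D) (constCochains D p k).subtype y)) := fun y => by
    induction y using TensorProduct.induction_on with
    | zero => simp [IsBi]
    | add a b ha hb =>
      simp only [IsBi, map_add, smul_add] at ha hb ⊢
      exact ⟨congrArg₂ _ ha.1 hb.1, congrArg₂ _ ha.2 hb.2⟩
    | tmul f c =>
      obtain ⟨e1, e2⟩ := h1 c c.2
      rw [LinearMap.lTensor_tmul, toL_tmul]
      exact ⟨by rw [hat_pur, Submodule.subtype_apply, e1, map_smul],
        by rw [hat_pur, Submodule.subtype_apply, e2, map_smul]⟩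
  obtain ⟨y, rfl⟩ := h
  exact h2 y

/-- The degree projections multiply a product of generators by 0 or 1, and products span. So being
an eigenvector of the counting operators agrees with membership in the spanned cochains. -/
theorem ofC_degPart_mem (p k : ℕ) (c : CForm D) :
    ofC (degPart (cnt af 0) k (degPart cntF p c)) ∈ constCochains D p k := by
  have key : Submodule.span ℝ (Set.range fun l : List (Gen D) => (l.map cgen).prod) ≤
      (constCochains D p k).comap (ofC ∘ₗ degPart (cnt af 0) k ∘ₗ degPart cntF p) := by
    refine Submodule.span_le.2 ?_
    rintro _ ⟨l, rfl⟩
    change ofC (degPart (cnt af 0) k (degPart cntF p (l.map cgen).prod)) ∈ constCochains D p k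
    rw [degPart, degPart, (cnt_diag _ _).calc'_apply _ (cnt_prod (fun _ => 0) 1 l), map_smul,
      (cnt_diag _ _).calc'_apply _ (cnt_prod af 0 l), map_smul, map_smul]
    split_ifs with h1 h2
    · rw [one_smul, one_smul]
      refine Submodule.subset_span ⟨l, ?_, ?_, (toC_prod_gen l).symm⟩
      · rw [← h1, funext wt_formDeg]
      · rw [← h2, funext wt_af]
    · rw [zero_smul, smul_zero]
      exact zero_mem _
    · rw [zero_smul]
      exact zero_mem _
    · rw [zero_smul]
      exact zero_mem _
  exact key (span_cgen_prod (D := D) ▸ Submodule.mem_top)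

theorem ofL_hat_degPart_mem (p k : ℕ) (a : LForm D) :
    ofL (hat (degPart (cnt af 0) k) (hat (degPart cntF p) a)) ∈ cochains D p k := by
  induction a using LForm.induction with
  | h0 => simp
  | ha a b ha hb =>
    rw [map_add, map_add, map_add]
    exact add_mem ha hb
  | hp f c =>
    rw [hat_pur, hat_pur, ofL_pur]
    exact Submodule.tmul_mem_baseChange_of_mem f (ofC_degPart_mem p k c)

theorem IsBi.ofL_mem {p k : ℕ} {a : LForm D} (h : IsBi p k a) : ofL a ∈ cochains D p k := by
  have h1 := ofL_hat_degPart_mem p k a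
  rw [hat_degPart (cnt_diag _ _), hat_degPart (cnt_diag _ _)] at h1
  have h2 := h.afPart_fdPart
  rw [afPart] at h2
  rwa [degPart, h2] at h1

theorem isTrivial_iff {a : Forms D} (hD : D ≠ 0) (ha : IsBi D 2 (toL a)) :
    IsTrivial D a ↔ ∃ m n, toL a = dK m + dT n := by
  constructor
  · rintro ⟨m, -, n, -, rfl⟩
    exact ⟨toL m, toL n, by rw [map_add, toL_delta, toL_d]⟩
  · rintro ⟨m, n, h⟩
    obtain ⟨m, n, hm, hn, h⟩ := ha.exists_of_eq hD h
    refine ⟨ofL m, hm.ofL_mem, ofL n, hn.ofL_mem, toL_injective ?_⟩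
    rw [map_add, toL_delta, toL_d, h, toL_ofL, toL_ofL]

theorem isCocycle_iff {a : Forms D} :
    IsCocycle D a ↔ IsBi D 2 (toL a) ∧ ∃ b, IsBi (D - 1) 1 b ∧ dK (toL a) + dT b = 0 := by
  constructor
  · rintro ⟨ha, b, hb, h⟩
    exact ⟨isBi_toL ha, toL b, isBi_toL hb, by rw [← toL_delta, ← toL_d, ← map_add, h, map_zero]⟩
  · rintro ⟨ha, b, hb, h⟩
    exact ⟨ha.ofL_mem, ofL b, hb.ofL_mem, toL_injective (by
      rw [map_add, toL_delta, toL_d, toL_ofL, h, map_zero])⟩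

theorem IsBi.add {p k : ℕ} {a b : LForm D} (ha : IsBi p k a) (hb : IsBi p k b) :
    IsBi p k (a + b) := by
  simp only [IsBi, map_add, smul_add] at ha hb ⊢
  exact ⟨congrArg₂ _ ha.1 hb.1, congrArg₂ _ ha.2 hb.2⟩

theorem IsBi.sub {p k : ℕ} {a b : LForm D} (ha : IsBi p k a) (hb : IsBi p k b) :
    IsBi p k (a - b) := by
  simp only [IsBi, map_sub, smul_sub] at ha hb ⊢
  exact ⟨congrArg₂ _ ha.1 hb.1, congrArg₂ _ ha.2 hb.2⟩

theorem IsBi.dK_add_dT {k : ℕ} {m n : LForm D} (hD : D ≠ 0) (hm : IsBi D (k + 1) m)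
    (hn : IsBi (D - 1) k n) : IsBi D k (dK m + dT n) := by
  refine IsBi.add ⟨?_, ?_⟩ ⟨?_, ?_⟩
  · rw [hat_cntF_dK, hm.1, map_smul]
  · rw [cntL_dK, hm.2, map_smul, Nat.cast_add, Nat.cast_one, add_smul, one_smul,
      add_sub_cancel_right]
  · rw [hat_cnt_dT, hn.1, map_smul, ← add_smul, ← Nat.cast_add,
      Nat.add_sub_cancel' (Nat.one_le_iff_ne_zero.2 hD)]
  · rw [hat_cnt_dT, hn.2, map_smul, Nat.cast_zero, zero_smul, zero_add]

theorem repr_zero : repr (0 : Fin D → Fin D → Fin D → ℝ) = 0 := by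
  simp [repr]

theorem isCocycle_iff_exists (hD : 4 < D) (a : Forms D) : IsCocycle D a ↔
    ∃ t : Fin D → Fin D → Fin D → ℝ, TotallyAntisymmetric t ∧
      ∃ c : Forms D, IsTrivial D c ∧ a = representative t + c := by
  have hD0 : D ≠ 0 := by omega
  rw [isCocycle_iff]
  constructor
  · rintro ⟨ha, b, hb, h⟩
    obtain ⟨t, m, n, ht, h1, -⟩ := exists_of_top_cocycle hD ha hb h
    refine ⟨t, ht, ofL (dK m + dT n), ?_, toL_injective ?_⟩
    · refine (isTrivial_iff hD0 ?_).2 ⟨m, n, rfl⟩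
      have := ha.sub (isBi_repr t)
      rwa [h1, add_sub_cancel_left] at this
    · rw [map_add, toL_representative, h1, toL_ofL]
  · rintro ⟨t, ht, _, ⟨m, hm, n, hn, rfl⟩, rfl⟩
    have h1 := (isBi_repr t).add (IsBi.dK_add_dT hD0 (isBi_toL hm) (isBi_toL hn))
    rw [map_add, map_add, toL_representative, toL_delta, toL_d]
    refine ⟨h1, ?_⟩
    obtain ⟨b, hb⟩ := exists_dT_repr ht
    -- For the trivial part, `δ d n = -d δ n` is compensated by `δ n`.
    refine h1.exists_of_cocycle hD0 (b := b + dK (toL n)) ?_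
    rw [map_add, map_add, map_add, dK_dK, dK_dT, zero_add, add_add_add_comm, hb, neg_add_cancel,
      add_zero]

theorem isTrivial_of_const (hD : 4 < D) {f : ConstForms D}
    (h : IsCocycle D ((1 : Smooth D) ⊗ₜ[ℝ] f)) : IsTrivial D ((1 : Smooth D) ⊗ₜ[ℝ] f) := by
  have hD0 : D ≠ 0 := by omega
  obtain ⟨ha, b, hb, h⟩ := (isCocycle_iff).1 h
  obtain ⟨t, m, n, -, h1, h0⟩ := exists_of_top_cocycle hD ha hb h
  refine (isTrivial_iff hD0 ha).2 ⟨m, n, ?_⟩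
  rw [h1, h0 ⟨toC f, rfl⟩, repr_zero, map_zero, zero_add]

end DualGravity

end

theorem mainTheorem6 (D : ℕ) (hD : 4 < D) :
    (∀ a : DualGravity.Forms D, DualGravity.IsCocycle D a ↔
      ∃ t : Fin D → Fin D → Fin D → ℝ, DualGravity.TotallyAntisymmetric t ∧
        ∃ c : DualGravity.Forms D, DualGravity.IsTrivial D c ∧
          a = DualGravity.representative t + c) ∧
    (∀ f ∈ DualGravity.constCochains D D 2,
      DualGravity.IsCocycle D ((1 : DualGravity.Smooth D) ⊗ₜ[ℝ] f) →
        DualGravity.IsTrivial D ((1 : DualGravity.Smooth D) ⊗ₜ[ℝ] f)) := by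
  exact ⟨DualGravity.isCocycle_iff_exists hD, fun _ _ h => DualGravity.isTrivial_of_const hD h⟩
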